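/- Let $P\subset\mathbb R^2$ be a finite set of points, no three of which are collinear. All graphs have vertex set $P$ and straight-line edges. A PSLG is such a graph whose edges meet only in common endpoints. Fix $\gamma>0$ and an integer $i$, and a square grid of side length $\gamma 3^{i-1}$ with half-open cells. For a point $v$ let $N(v)$ consist of the cell of $v$ and the eight cells around it, and let $\mathcal G_i$ be the graph of all pairs $uv$ of points of $P$ with $u\in N(v)$. Let $\mathcal A_i$ be a maximal PSLG with respect to $\mathcal G_i$ (a PSLG with edges in $\mathcal G_i$ to which no edge of $\mathcal G_i$ can be added). A face of a graph is a connected component of the complement of its drawing (the unbounded one included); it is non-triangulated if it is not the interior of a triangle with vertices in $P$. Let $\hat{\mathcal A}_i$ be obtained from $\mathcal A_i$ by Phase 1, which treats every non-triangulated face $f$ of $\mathcal A_i$ and every boundary vertex sequence $\sigma=\langle v_0,\dots,v_{m-1}\rangle$ of $f$ (a closed walk along a component of the boundary of $f$ with $f$ on the right, indices mod $m$) as follows. A vertex of $\sigma$ is convex if the angle of $f$ there is less than $\pi$, and reflex otherwise. The forward convex vertex of $v_k$ is the first convex vertex after $v_k$, and the vertex following it is the forward support vertex of $v_k$. The backward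 convex vertex of a reflex vertex $v_k$ is the last convex vertex before $v_k$, and the vertex preceding it is the backward support vertex of $v_k$. Two vertices of $\sigma$ are visible to each other if the open segment between them lies in $f$ and leaves both of them inside the corners of $f$ belonging to these two positions of $\sigma$; visibility of a support vertex includes that it is seen from the side on which its edge to the corresponding convex vertex bounds $f$. The start vertex $v_0$ is a backward support vertex (an arbitrary vertex if there is none). Beginning with $v_0$, a vertex $v_k$ is processed as follows. Step 1. Suppose that the forward convex vertex $v_{l-1}$ of $v_k$ lies in $N(v_k)$ and the forward support vertex $v_l$ is visible to $v_k$. (a) If $v_{l-1}$ has not been visited yet, $v_{l+1}$ is reflex, its backward convex vertex $v_{q+1}$ lies in $N(v_{l+1})$ and its backward support vertex $v_q$ is visible to $v_{l+1}$, then the chain of $v_k$ is $v_k,\dots,v_s$, where $v_s$ is the last vertex of the run of reflex vertices beginning with $v_{l+1}$ such that $v_s\in N(v_{q+1})$ and $v_q$ is visible to $v_s$. (b) If $v_{l-1}$ has not been visited yet and (a) does not apply, the chain of $v_k$ is $v_k,\dots,v_l$. (c) If $v_{l-1}$ has already been visited, that is, if the walk passes $v_0$ on its way from $v_k$ to $v_{l-1}$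 or $v_{l-1}=v_0$, then the chain of $v_k$ runs from $v_k$ via $v_0$ to the last vertex of the chain of $v_0$. In each case (a)–(c), the segment joining the endpoints of the chain is added, together with the diagonals of a triangulation of the region enclosed by this segment and the chain (in case (c), a triangulation that extends the edges already added for the chain of $v_0$). Step 2. Otherwise no edge is added, and the chain of $v_k$ is $v_k,v_{k+1}$. The next vertex processed is the last vertex of the chain, until the walk is back at $v_0$ or case (c) has occurred. Let $\mathcal T^*$ be a minimum weight triangulation of $P$ (a triangulation of $P$ with the least total Euclidean edge length), and let $\mathcal T^*_i$ consist of its edges of length at most $\gamma 3^{i-1}/\sqrt2$. Then the following hold. 1. For every non-triangulated face $f'$ of $\hat{\mathcal A}_i$ and every edge $uv$ of $\mathcal T^*_i$: if the segment $uv$ intersects two boundary edges $e_1$ and $e_2$ of $f'$, then $e_1$ and $e_2$ belong to the same connected component of $\hat{\mathcal A}_i$. 2. No edge of $\mathcal T^*_i$ joins two points that lie in distinct connected components of $\hat{\mathcal A}_i$. -/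

import Mathlib

open Set Filter Topology

noncomputable section

namespace GridMWT

/-! The plane is `ℂ`; `P : Finset ℂ` is the set of input points, and all graphs are simple graphs
on the vertex set `P`, drawn with straight edges. -/

/-- No three distinct points of `P` are collinear. -/
def GeneralPosition (P : Finset ℂ) : Prop :=
  ∀ a ∈ P, ∀ b ∈ P, ∀ c ∈ P, a ≠ b → a ≠ c → b ≠ c → ¬ Collinear ℝ ({a, b, c} : Set ℂ)

variable {P : Finset ℂ}

/-- The closed segment spanned by an (unordered) pair of input points. -/
def seg (e : Sym2 P) : Set ℂ :=
  Sym2.lift ⟨fun u v : P => segment ℝ (u : ℂ) (v : ℂ), fun _ _ => segment_symm ℝ _ _⟩ e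

/-- The open segment spanned by an (unordered) pair of input points. -/
def openSeg (e : Sym2 P) : Set ℂ :=
  Sym2.lift ⟨fun u v : P => openSegment ℝ (u : ℂ) (v : ℂ), fun _ _ => openSegment_symm ℝ _ _⟩ e

/-- The Euclidean length of a pair of input points. -/
def len (e : Sym2 P) : ℝ :=
  Sym2.lift ⟨fun u v : P => dist (u : ℂ) (v : ℂ), fun _ _ => dist_comm _ _⟩ e

/-- Planar straight-line graph: edges meet only in common endpoints, and no edge passes through
an input point. -/
def IsPSLG (A : SimpleGraph P) : Prop :=
  (∀ e ∈ A.edgeSet, ∀ e' ∈ A.edgeSet, e ≠ e' → Disjoint (openSeg e) (openSeg e')) ∧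
  (∀ e ∈ A.edgeSet, ∀ p : P, (p : ℂ) ∉ openSeg e)

/-- A maximal PSLG with respect to the graph `G`: a PSLG with edges in `G` to which no further
edge of `G` can be added. -/
def IsMaximalPSLG (G A : SimpleGraph P) : Prop :=
  Maximal (fun B : SimpleGraph P => IsPSLG B ∧ B ≤ G) A

/-! ### Minimum weight triangulation and its short edges -/

/-- The total edge length. -/
def weight (T : SimpleGraph P) : ℝ := ∑ᶠ e ∈ T.edgeSet, len e

/-- A triangulation of `P`: an inclusion-maximal PSLG on `P`. -/
def IsTriangulation (T : SimpleGraph P) : Prop := Maximal IsPSLG T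

/-- A minimum weight triangulation of `P`. -/
def IsMWT (T : SimpleGraph P) : Prop :=
  IsTriangulation T ∧ ∀ T' : SimpleGraph P, IsTriangulation T' → weight T ≤ weight T'

/-- The subgraph of `T` formed by the edges of length at most `δ`. -/
def shortEdges (T : SimpleGraph P) (δ : ℝ) : SimpleGraph P where
  Adj u v := T.Adj u v ∧ dist (u : ℂ) (v : ℂ) ≤ δ
  symm := ⟨fun u v h => ⟨h.1.symm, by rw [dist_comm]; exact h.2⟩⟩
  loopless := ⟨fun u h => T.loopless.irrefl u h.1⟩

/-! ### The grid -/

/-- The side length of the cells of the `i`-th grid. -/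
def side (γ : ℝ) (i : ℤ) : ℝ := γ * 3 ^ (i - 1)

/-- The (half-open) cell of the square grid with a corner at `o` and side length `s` that contains
`z`, given by its column and row. -/
def cell (o : ℂ) (s : ℝ) (z : ℂ) : ℤ × ℤ := (⌊(z.re - o.re) / s⌋, ⌊(z.im - o.im) / s⌋)

/-- `u ∈ N(v)`: the cell of `u` is the cell of `v` or one of the eight cells around it. -/
def Near (o : ℂ) (s : ℝ) (u v : ℂ) : Prop :=
  |(cell o s u).1 - (cell o s v).1| ≤ 1 ∧ |(cell o s u).2 - (cell o s v).2| ≤ 1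

/-- The adjacency graph of the grid: all pairs of points lying in equal or neighbouring cells. -/
def adjGraph (P : Finset ℂ) (o : ℂ) (s : ℝ) : SimpleGraph P where
  Adj u v := u ≠ v ∧ Near o s (u : ℂ) (v : ℂ)
  symm := ⟨fun u v h => ⟨h.1.symm, by
    refine ⟨?_, ?_⟩
    · rw [abs_sub_comm]; exact h.2.1
    · rw [abs_sub_comm]; exact h.2.2⟩⟩
  loopless := ⟨fun u h => h.1 rfl⟩

/-! ### Faces -/

/-- The points of the plane that lie on the drawing of `A`. -/
def drawing (A : SimpleGraph P) : Set ℂ := (P : Set ℂ) ∪ ⋃ e ∈ A.edgeSet, seg e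

/-- The faces of `A`: the connected components of the complement of the drawing (the unbounded
one included). -/
def IsFace (A : SimpleGraph P) (f : Set ℂ) : Prop :=
  ∃ z ∈ (drawing A)ᶜ, f = connectedComponentIn (drawing A)ᶜ z

/-- A face is triangulated if it is the interior of a triangle spanned by input points. -/
def Triangulated (P : Finset ℂ) (f : Set ℂ) : Prop :=
  ∃ a ∈ P, ∃ b ∈ P, ∃ c ∈ P, f = interior (convexHull ℝ ({a, b, c} : Set ℂ))

/-- A non-triangulated face of `A`. -/
def IsNonTriangulatedFace (A : SimpleGraph P) (f : Set ℂ) : Prop :=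
  IsFace A f ∧ ¬ Triangulated P f

/-- `e` is an edge of `A` on the boundary of `f`. -/
def IsBoundaryEdge (A : SimpleGraph P) (f : Set ℂ) (e : Sym2 P) : Prop :=
  e ∈ A.edgeSet ∧ seg e ⊆ frontier f

/-- The region `f` lies immediately to the right of the directed segment from `u` to `v`. -/
def OnRight (f : Set ℂ) (u v : ℂ) : Prop :=
  ∀ᶠ ε : ℝ in 𝓝[>] 0, (u + v) / 2 - (ε : ℂ) * Complex.I * (v - u) ∈ f

/-! ### Boundary vertex sequences -/

/-- The angle in `(0, 2π]` of the counterclockwise rotation about `v` that takes the direction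
of `u` to the direction of `w`. -/
def turn (u v w : ℂ) : ℝ :=
  if 0 < Complex.arg ((w - v) / (u - v)) then Complex.arg ((w - v) / (u - v))
  else Complex.arg ((w - v) / (u - v)) + 2 * Real.pi

/-- `w` is the first neighbour of `v` met when rotating counterclockwise about `v`, starting from
(and excluding, unless it is met again after a full turn) the direction of `u`. -/
def IsNext (A : SimpleGraph P) (u v w : P) : Prop :=
  A.Adj v w ∧ ∀ x : P, A.Adj v x → turn (u : ℂ) v w ≤ turn (u : ℂ) v x

/-- `σ` is a boundary vertex sequence `⟨v₀, …, v_{m-1}⟩` of the face `f`, read cyclically: a closed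
walk along the boundary of `f` that keeps `f` on its right. A face has one such sequence, up to
rotation, for each component of its boundary that contains an edge. -/
def IsBoundaryWalk (A : SimpleGraph P) (f : Set ℂ) (σ : ℤ → P) : Prop :=
  ∀ k : ℤ, A.Adj (σ k) (σ (k + 1)) ∧ OnRight f (σ k : ℂ) (σ (k + 1) : ℂ) ∧
    IsNext A (σ k) (σ (k + 1)) (σ (k + 2))

/-- The length `m` of the boundary vertex sequence `σ`. -/
def IsPeriod (σ : ℤ → P) (m : ℤ) : Prop :=
  IsLeast {m : ℤ | 0 < m ∧ ∀ k, σ (k + m) = σ k} m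

/-- The vertex `v_k` is convex in the sequence: the angle of the face at `v_k` is less than `π`.
Otherwise it is reflex. -/
def ConvexAt (σ : ℤ → P) (k : ℤ) : Prop :=
  turn (σ (k - 1) : ℂ) (σ k : ℂ) (σ (k + 1) : ℂ) < Real.pi

/-- `v_c` is the forward convex vertex of `v_k`: the first convex vertex after `v_k`. The forward
support vertex of `v_k` is then `v_{c+1}`. -/
def ForwardConvex (σ : ℤ → P) (k c : ℤ) : Prop :=
  k < c ∧ ConvexAt σ c ∧ ∀ x, k < x → x < c → ¬ ConvexAt σ x

/-- `v_b` is the backward convex vertex of the reflex vertex `v_k`: the last convex vertex before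
`v_k`. The backward support vertex of `v_k` is then `v_{b-1}`. -/
def BackwardConvex (σ : ℤ → P) (k b : ℤ) : Prop :=
  ¬ ConvexAt σ k ∧ b < k ∧ ConvexAt σ b ∧ ∀ x, b < x → x < k → ¬ ConvexAt σ x

/-- `v_k` and `v_l` are visible to each other in the sequence `σ`: the open segment between them
lies in the face, and it leaves either endpoint into the corner of the face that belongs to the
given occurrence of this endpoint in `σ` (a point may occur several times in `σ`). -/
def Visible (A : SimpleGraph P) (f : Set ℂ) (σ : ℤ → P) (k l : ℤ) : Prop :=
  openSegment ℝ (σ k : ℂ) (σ l : ℂ) ⊆ f ∧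
    IsNext A (σ l) (σ k) (σ (k + 1)) ∧ IsNext A (σ k) (σ l) (σ (l + 1))

/-! ### Triangulating the region of a chain -/

/-- The closed curve formed by the chain `v_a, v_{a+1}, …, v_b` and the segment `v_a v_b`. -/
def chainCurve (σ : ℤ → P) (a b : ℤ) : Set ℂ :=
  segment ℝ (σ a : ℂ) (σ b : ℂ) ∪ ⋃ k ∈ Set.Ico a b, segment ℝ (σ k : ℂ) (σ (k + 1) : ℂ)

/-- The region enclosed by the chain `v_a, …, v_b` and the segment `v_a v_b`. -/
def chainRegion (σ : ℤ → P) (a b : ℤ) : Set ℂ :=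
  {z | z ∉ chainCurve σ a b ∧
    Bornology.IsBounded (connectedComponentIn (chainCurve σ a b)ᶜ z)}

/-- `D` consists of the pairs in `D₀` and of segments between vertices of the chain
`v_a, …, v_b` that run inside its region and cross no segment of `D`. -/
def IsPartialTriangulation (σ : ℤ → P) (a b : ℤ) (D₀ D : Set (Sym2 P)) : Prop :=
  D₀ ⊆ D ∧ ∀ e ∈ D, e ∉ D₀ →
    (∃ p q : ℤ, a ≤ p ∧ p < q ∧ q ≤ b ∧ e = s(σ p, σ q)) ∧
    openSeg e ⊆ chainRegion σ a b ∧
    ∀ e' ∈ D, e' ≠ e → Disjoint (openSeg e) (openSeg e')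

/-- `D` consists of the segment `v_a v_b` and of the diagonals of a triangulation of the region
of the chain `v_a, …, v_b`, chosen so as to extend the set `D₀` of segments already added there. -/
def IsChainTriangulation (σ : ℤ → P) (a b : ℤ) (D₀ D : Set (Sym2 P)) : Prop :=
  Maximal (IsPartialTriangulation σ a b (insert s(σ a, σ b) D₀)) D

/-! ### Phase 1

`near` is the relation `· ∈ N(·)` of the grid. The sequence `σ` is indexed so that the start vertex
is `v₀`; `m` is its length. -/

variable (near : ℂ → ℂ → Prop) (A : SimpleGraph P) (f : Set ℂ) (σ : ℤ → P)

/-- The start vertex `v₀` is the backward support vertex of some reflex vertex, unless there is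
no backward support vertex at all. -/
def IsStart : Prop :=
  (∃ p, BackwardConvex σ p 1) ∨ ¬ ∃ p b, BackwardConvex σ p b

/-- The precondition of step 1 at `v_k`: the forward convex vertex `v_c` of `v_k` satisfies
`v_c ∈ N(v_k)` and the forward support vertex `v_{c+1}` is visible to `v_k` from the side on which
the edge `v_c v_{c+1}` bounds the face (so that this edge is visible, too, near `v_{c+1}`). -/
def StepOne (k c : ℤ) : Prop :=
  ForwardConvex σ k c ∧ near (σ c : ℂ) (σ k : ℂ) ∧ Visible A f σ k (c + 1) ∧
    turn (σ c : ℂ) (σ (c + 1) : ℂ) (σ k : ℂ) < Real.pi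

/-- `v_s` lies on the run of reflex vertices that starts with `v_{l+1}`, it is in `N(v_b)`, and
`v_{b-1}` is visible to it from the side on which the edge `v_{b-1} v_b` bounds the face. -/
def Extends (l b s : ℤ) : Prop :=
  l < s ∧ (∀ x, l < x → x ≤ s → ¬ ConvexAt σ x) ∧ near (σ s : ℂ) (σ b : ℂ) ∧
    Visible A f σ (b - 1) s ∧ turn (σ s : ℂ) (σ (b - 1) : ℂ) (σ b : ℂ) < Real.pi

/-- The chain generated at `v_k` is extended beyond the forward support vertex `v_l`: the vertex
`v_{l+1}` is reflex with backward convex vertex `v_b ∈ N(v_{l+1})`, and its backward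
support vertex `v_{b-1}` is visible to it. -/
def CanExtend (l b : ℤ) : Prop :=
  BackwardConvex σ (l + 1) b ∧ Extends near A f σ l b (l + 1)

/-- The last vertex `v_e` of the chain generated by step 1 at `v_k`, when the forward convex vertex
`v_c` of `v_k` has not been visited yet (`c < m`): with `l = c + 1`, either the last reflex
vertex up to which the chain can be extended, or else `v_l`. -/
def StepOneEnd (m k e : ℤ) : Prop :=
  ∃ c, c < m ∧ StepOne near A f σ k c ∧
    ((∃ b, CanExtend near A f σ (c + 1) b ∧
        IsGreatest {s | Extends near A f σ (c + 1) b s} e) ∨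
      ((¬ ∃ b, CanExtend near A f σ (c + 1) b) ∧ e = c + 1))

/-- Step 1 is executed at `v_k` and the forward convex vertex of `v_k` has already been visited. The
chain then ends at the last vertex of the chain of the start vertex. -/
def Closing (m k : ℤ) : Prop := ∃ c, m ≤ c ∧ StepOne near A f σ k c

/-- Step 2 is executed at `v_k`: the trivial chain `v_k, v_{k+1}` is generated. -/
def StepTwo (k : ℤ) : Prop := ¬ ∃ c, StepOne near A f σ k c

/-- The last vertex of the chain generated at `v_k`, in the cases without `Closing`. -/
def ChainEnd (m k e : ℤ) : Prop :=
  StepOneEnd near A f σ m k e ∨ (StepTwo near A f σ k ∧ e = k + 1)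

/-- The vertices visited as starting vertices of chains: `v₀`, the last vertex of the chain of
`v₀`, and so on, until the walk is back at `v₀`. -/
inductive Processed (m : ℤ) : ℤ → Prop
  | start : Processed m 0
  | next {k e : ℤ} : Processed m k → ChainEnd near A f σ m k e → e < m → Processed m e

/-- `D` is the set of edges added by a run of Phase 1 on the boundary vertex sequence `σ` of the
face `f`; `T k` is the set of edges of the triangulated chain generated at `v_k`. -/
def IsRun (D : Set (Sym2 P)) : Prop :=
  IsStart σ ∧ ∃ (m j : ℤ) (T : ℤ → Set (Sym2 P)),
    IsPeriod σ m ∧ ChainEnd near A f σ m 0 j ∧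
    (∀ k, Processed near A f σ m k →
      (∀ e, StepOneEnd near A f σ m k e → IsChainTriangulation σ k e ∅ (T k)) ∧
      (Closing near A f σ m k → IsChainTriangulation σ k (m + j) (T 0) (T k)) ∧
      (StepTwo near A f σ k → T k = ∅)) ∧
    D = ⋃ k ∈ {k | Processed near A f σ m k}, T k

/-- `B` is an outcome of Phase 1 on the graph `A`: Phase 1 is run once on each boundary vertex
sequence of each non-triangulated face of `A` (`W` is the collection of these sequences, each
rotated so that it begins with its start vertex), and the edges obtained are added to `A`. -/
def IsPhaseOne (B : SimpleGraph P) : Prop :=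
  ∃ (W : Set (ℤ → P)) (D : (ℤ → P) → Set (Sym2 P)),
    (∀ σ ∈ W, ∃ f, IsNonTriangulatedFace A f ∧ IsBoundaryWalk A f σ ∧
      IsRun near A f σ (D σ)) ∧
    (∀ f, IsNonTriangulatedFace A f → ∀ u v : P, A.Adj u v → OnRight f (u : ℂ) (v : ℂ) →
      ∃! σ, σ ∈ W ∧ ∃ k : ℤ, σ k = u ∧ σ (k + 1) = v) ∧
    ∀ u v : P, B.Adj u v ↔ A.Adj u v ∨ (u ≠ v ∧ ∃ σ ∈ W, s(u, v) ∈ D σ)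

end GridMWT

end

/-!
Write `s` for the side length of the grid and call a segment between two points of `P` short if
its length is at most `s / √2`. The result follows from a statement about `A` alone and one about
the chains of Phase 1.

*Short segments stay in one component of `A`.* A short segment from `u` to `v` touches only edges
of `A` that belong to the component of `u`, and it ends in this component (`reach_of_touch`).
Consider the first edge outside the component of `u` that the segment touches, and the last edge
of this component touched before. Between the two the segment meets no edge, and as it is short,
the edges have ends `l` and `r` whose cells are adjacent to each other and to the cells of both
meeting points (`exists_near_ends`). Then `l` and `r` are connected (`reach_of_clear`): among the
points of `P` in the triangle of `l` and the two meeting points, there is one in the component of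
`l` that is seen from the second meeting point (`exists_seen_vertex`); all pairs of points in such
triangles lie in adjacent cells, so whenever two of them see each other, they are joined by an
edge of `A` by maximality. As `A` is contained in `Ahat`, the second claim follows.

*Edges added by Phase 1.* Every added edge is enclosed by a chain and by the segment between its
ends. It suffices that this region lies in a star-shaped set that is missed by every segment
between two points of `P` that misses the chain (`Covered`): then a short segment touching an
added edge touches an edge of the chain, the vertices of the chain are connected in `A`, and the
added edge joins two of them (`IsChainTriangulation.good`). So every edge of `Ahat` touched by a
short segment from `u` to `v` lies in the component of `u`, which is the first claim.

*The chains are covered.* If the forward convex vertex, the apex of the chain, is close to the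
vertex `v_k` and the support vertex is visible from `v_k`, then by the maximality of `A` the ray
from the apex through its predecessor on the walk reaches the base, the segment between the ends
of the chain, and cuts off an empty triangle at the support vertex (`LeftChain.exists_frame`).
From there the reflex vertices of the chain are met in angular order, the triangles spanned by the
support vertex and the edges of the chain form a fan that contains no further vertices, and this
fan is the star-shaped set (`LeftChain.covered`). A chain that is extended beyond the support
vertex consists of two such chains whose bases cross in a point `X`, and the fan is centred at `X`
(`Crossing.covered`); it remains to show that the triangle of `X` and the two ends of the chain,
the gap, contains no vertices. A vertex in the gap yields an edge of `A` from an end of the chain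
to an extremal vertex of the gap, by arithmetic of grid cells and maximality
(`Crossing.near_right_of_eq`, `Crossing.edge_of_succ`). At the last vertex of the chain, which is
reflex, such an edge does not exist. At `v_k`, the edge forces the walk to arrive at `v_k` from
the gap, in such a way that the convex vertex `v_k` can be cut off by the segment between its
neighbours (`Crossing.shortcut`). But then step 1 applies to the reflex predecessor of `v_k`, with
`v_k` as forward convex vertex, so the chain before would not have ended in `v_k`
(`Processed.not_stepOne`). The same argument, with the choice of the start vertex, handles the
chain that closes the walk (`Closing.covered`).
-/

namespace GridMWT

/-! ### Orientation, segments and triangles -/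

/-- Twice the signed area of the triangle `a b c`; positive iff it is oriented counterclockwise. -/
def orient (a b c : ℂ) : ℝ :=
  (b.re - a.re) * (c.im - a.im) - (b.im - a.im) * (c.re - a.re)

/-- Real affine functionals on the plane. -/
def Aff (h : ℂ → ℝ) : Prop := ∃ α β γ : ℝ, ∀ z, h z = α * z.re + β * z.im + γ

/-- The closed, possibly degenerate, triangle with vertices `a`, `b`, `c`. -/
def Tri (a b c : ℂ) : Set ℂ :=
  {z | ∃ x y w : ℝ, 0 ≤ x ∧ 0 ≤ y ∧ 0 ≤ w ∧ x + y + w = 1 ∧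
    z = (x : ℂ) * a + (y : ℂ) * b + (w : ℂ) * c}

lemma orient_rot (a b c : ℂ) : orient b c a = orient a b c := by unfold orient; ring
lemma orient_rot' (a b c : ℂ) : orient c a b = orient a b c := by unfold orient; ring
lemma orient_swap (a b c : ℂ) : orient b a c = -orient a b c := by unfold orient; ring
lemma orient_swap' (a b c : ℂ) : orient a c b = -orient a b c := by unfold orient; ring
lemma orient_swap'' (a b c : ℂ) : orient c b a = -orient a b c := by unfold orient; ring
@[simp] lemma orient_self_left (a c : ℂ) : orient a a c = 0 := by unfold orient; ring
@[simp] lemma orient_self_right (a c : ℂ) : orient a c c = 0 := by unfold orient; ring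
@[simp] lemma orient_self_out (a c : ℂ) : orient a c a = 0 := by unfold orient; ring

lemma Aff.orient_right (a b : ℂ) : Aff (fun z => orient a b z) :=
  ⟨-(b.im - a.im), b.re - a.re, -(b.re - a.re) * a.im + (b.im - a.im) * a.re, fun z => by
    simp only [orient]; ring⟩
lemma Aff.orient_mid (a b : ℂ) : Aff (fun z => orient a z b) := by
  obtain ⟨α, β, γ, h⟩ := Aff.orient_right b a
  exact ⟨α, β, γ, fun z => by rw [← h]; unfold orient; ring⟩
lemma Aff.neg {h : ℂ → ℝ} (hh : Aff h) : Aff (fun z => -h z) := by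
  obtain ⟨α, β, γ, h'⟩ := hh
  exact ⟨-α, -β, -γ, fun z => by simp only [h']; ring⟩
lemma Aff.mul_const {h : ℂ → ℝ} (hh : Aff h) (c : ℝ) : Aff (fun z => c * h z) := by
  obtain ⟨α, β, γ, h'⟩ := hh
  exact ⟨c * α, c * β, c * γ, fun z => by simp only [h']; ring⟩
lemma Aff.add_const {h : ℂ → ℝ} (hh : Aff h) (c : ℝ) : Aff (fun z => h z + c) := by
  obtain ⟨α, β, γ, h'⟩ := hh
  exact ⟨α, β, γ + c, fun z => by simp only [h']; ring⟩
lemma Aff.add {h g : ℂ → ℝ} (hh : Aff h) (hg : Aff g) : Aff (fun z => h z + g z) := by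
  obtain ⟨α, β, γ, h'⟩ := hh
  obtain ⟨α', β', γ', g'⟩ := hg
  exact ⟨α + α', β + β', γ + γ', fun z => by simp only [h', g']; ring⟩

lemma Aff.comb3 {h : ℂ → ℝ} (hh : Aff h) (a b c : ℂ) {x y w : ℝ} (e : x + y + w = 1) :
    h ((x : ℂ) * a + (y : ℂ) * b + (w : ℂ) * c) = x * h a + y * h b + w * h c := by
  obtain ⟨α, β, γ, h'⟩ := hh
  simp only [h', Complex.add_re, Complex.add_im, Complex.mul_re, Complex.mul_im,
    Complex.ofReal_re, Complex.ofReal_im]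
  linear_combination (-γ) * e

/-- The point at parameter `t` on the line through `a` and `b`. -/
noncomputable def pt (a b : ℂ) (t : ℝ) : ℂ := a + t • (b - a)

lemma pt_re (a b : ℂ) (t : ℝ) : (pt a b t).re = a.re + t * (b.re - a.re) := by simp [pt]
lemma pt_im (a b : ℂ) (t : ℝ) : (pt a b t).im = a.im + t * (b.im - a.im) := by simp [pt]
@[simp] lemma pt_zero (a b : ℂ) : pt a b 0 = a := by simp [pt]
@[simp] lemma pt_one (a b : ℂ) : pt a b 1 = b := by simp [pt]

lemma Aff.pt {h : ℂ → ℝ} (hh : Aff h) (a b : ℂ) (t : ℝ) :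
    h (pt a b t) = h a + t * (h b - h a) := by
  obtain ⟨α, β, γ, h'⟩ := hh
  simp only [h', pt_re, pt_im]; ring

lemma mem_seg {a b z : ℂ} : z ∈ segment ℝ a b ↔ ∃ t, 0 ≤ t ∧ t ≤ 1 ∧ z = pt a b t := by
  rw [segment_eq_image']
  constructor
  · rintro ⟨t, ⟨h0, h1⟩, rfl⟩; exact ⟨t, h0, h1, rfl⟩
  · rintro ⟨t, h0, h1, rfl⟩; exact ⟨t, ⟨h0, h1⟩, rfl⟩
lemma mem_open {a b z : ℂ} : z ∈ openSegment ℝ a b ↔ ∃ t, 0 < t ∧ t < 1 ∧ z = pt a b t := by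
  rw [openSegment_eq_image']
  constructor
  · rintro ⟨t, ⟨h0, h1⟩, rfl⟩; exact ⟨t, h0, h1, rfl⟩
  · rintro ⟨t, h0, h1, rfl⟩; exact ⟨t, ⟨h0, h1⟩, rfl⟩

lemma open_comm {a b z : ℂ} (h : z ∈ openSegment ℝ a b) : z ∈ openSegment ℝ b a := by
  rwa [openSegment_symm]
lemma seg_comm {a b z : ℂ} (h : z ∈ segment ℝ a b) : z ∈ segment ℝ b a := by
  rwa [segment_symm]

lemma open_of_seg {a b z : ℂ} (h : z ∈ segment ℝ a b) (ha : z ≠ a) (hb : z ≠ b) :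
    z ∈ openSegment ℝ a b := mem_openSegment_of_ne_left_right ha.symm hb.symm h

lemma ne_of_open {a b z : ℂ} (h : z ∈ openSegment ℝ a b) (hab : a ≠ b) : z ≠ a ∧ z ≠ b := by
  obtain ⟨t, h0, h1, rfl⟩ := mem_open.1 h
  have : b - a ≠ 0 := sub_ne_zero.2 hab.symm
  constructor
  · intro e
    have : (t : ℝ) • (b - a) = 0 := by simpa [pt] using e
    rcases smul_eq_zero.1 this with h | h
    · exact h0.ne' h
    · exact ‹b - a ≠ 0› h
  · intro e
    have : (1 - t : ℝ) • (b - a) = 0 := by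
      have : b - pt a b t = 0 := by rw [e]; simp
      rw [← this, pt, sub_smul, one_smul]; ring
    rcases smul_eq_zero.1 this with h | h
    · linarith
    · exact ‹b - a ≠ 0› h

lemma orient_open {a b z : ℂ} (h : z ∈ segment ℝ a b) : orient a b z = 0 := by
  obtain ⟨t, h0, h1, rfl⟩ := mem_seg.1 h
  unfold orient; rw [pt_re, pt_im]; ring

lemma open_sub_seg {a b z : ℂ} (h : z ∈ openSegment ℝ a b) : z ∈ segment ℝ a b :=
  openSegment_subset_segment ℝ a b h

lemma Aff.pos_open {h : ℂ → ℝ} (hh : Aff h) {a b z : ℂ} (hz : z ∈ openSegment ℝ a b)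
    (ha : 0 ≤ h a) (hb : 0 ≤ h b) (hne : h a ≠ 0 ∨ h b ≠ 0) : 0 < h z := by
  obtain ⟨t, h0, h1, rfl⟩ := mem_open.1 hz
  rw [hh.pt]
  rcases hne with h | h
  · have := lt_of_le_of_ne ha h.symm
    nlinarith [mul_nonneg h0.le hb, mul_pos (sub_pos.2 h1) this]
  · have := lt_of_le_of_ne hb h.symm
    nlinarith [mul_pos h0 this, mul_nonneg (sub_pos.2 h1).le ha]

lemma Aff.nonneg_seg {h : ℂ → ℝ} (hh : Aff h) {a b z : ℂ} (hz : z ∈ segment ℝ a b)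
    (ha : 0 ≤ h a) (hb : 0 ≤ h b) : 0 ≤ h z := by
  obtain ⟨t, h0, h1, rfl⟩ := mem_seg.1 hz
  rw [hh.pt]
  nlinarith [mul_nonneg h0 hb, mul_nonneg (sub_nonneg.2 h1) ha]

lemma Aff.zero_seg {h : ℂ → ℝ} (hh : Aff h) {a b z : ℂ} (hz : z ∈ segment ℝ a b)
    (ha : h a = 0) (hb : h b = 0) : h z = 0 := by
  obtain ⟨t, h0, h1, rfl⟩ := mem_seg.1 hz
  rw [hh.pt, ha, hb]; ring

lemma Aff.nonneg_tri {h : ℂ → ℝ} (hh : Aff h) {a b c z : ℂ} (hz : z ∈ Tri a b c)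
    (ha : 0 ≤ h a) (hb : 0 ≤ h b) (hc : 0 ≤ h c) : 0 ≤ h z := by
  obtain ⟨x, y, w, hx, hy, hw, e, rfl⟩ := hz
  rw [hh.comb3 _ _ _ e]
  positivity

lemma left_mem_Tri (a b c : ℂ) : a ∈ Tri a b c := ⟨1, 0, 0, by simp⟩
lemma mid_mem_Tri (a b c : ℂ) : b ∈ Tri a b c := ⟨0, 1, 0, by simp⟩
lemma right_mem_Tri (a b c : ℂ) : c ∈ Tri a b c := ⟨0, 0, 1, by simp⟩

lemma Tri_rot {a b c z : ℂ} (h : z ∈ Tri a b c) : z ∈ Tri b c a := by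
  obtain ⟨x, y, w, hx, hy, hw, e, rfl⟩ := h
  exact ⟨y, w, x, hy, hw, hx, by linarith, by ring⟩
lemma Tri_swap {a b c z : ℂ} (h : z ∈ Tri a b c) : z ∈ Tri b a c := by
  obtain ⟨x, y, w, hx, hy, hw, e, rfl⟩ := h
  exact ⟨y, x, w, hy, hx, hw, by linarith, by ring⟩
lemma Tri_swap' {a b c z : ℂ} (h : z ∈ Tri a b c) : z ∈ Tri a c b := by
  obtain ⟨x, y, w, hx, hy, hw, e, rfl⟩ := h
  exact ⟨x, w, y, hx, hw, hy, by linarith, by ring⟩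

lemma Tri_convex (a b c : ℂ) : Convex ℝ (Tri a b c) := by
  rintro _ ⟨x, y, w, hx, hy, hw, e, rfl⟩ _ ⟨x', y', w', hx', hy', hw', e', rfl⟩ s t hs ht hst
  refine ⟨s * x + t * x', s * y + t * y', s * w + t * w', by positivity, by positivity,
    by positivity, by linear_combination s * e + t * e' + hst, ?_⟩
  simp only [Complex.real_smul]; push_cast; ring

lemma Tri_subset {a b c x y z : ℂ} (hx : x ∈ Tri a b c) (hy : y ∈ Tri a b c)
    (hz : z ∈ Tri a b c) : Tri x y z ⊆ Tri a b c := by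
  rintro _ ⟨s, t, r, hs, ht, hr, e, rfl⟩
  have := (Tri_convex a b c).sum_mem (t := Finset.univ) (w := ![s, t, r]) (z := ![x, y, z])
    (by intro i _; fin_cases i <;> simpa) (by simp [Fin.sum_univ_three, e])
    (by intro i _; fin_cases i <;> simpa)
  simpa [Fin.sum_univ_three] using this

lemma seg_sub_Tri {a b c x y z : ℂ} (hx : x ∈ Tri a b c) (hy : y ∈ Tri a b c)
    (hz : z ∈ segment ℝ x y) : z ∈ Tri a b c := (Tri_convex a b c).segment_subset hx hy hz

lemma orient_bary (a b c z : ℂ) :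
    orient b c z + orient c a z + orient a b z = orient a b c := by unfold orient; ring

lemma mem_Tri_of {a b c z : ℂ} (h : 0 < orient a b c) (h1 : 0 ≤ orient a b z)
    (h2 : 0 ≤ orient b c z) (h3 : 0 ≤ orient c a z) : z ∈ Tri a b c := by
  refine ⟨orient b c z / orient a b c, orient c a z / orient a b c, orient a b z / orient a b c,
    by positivity, by positivity, by positivity, ?_, ?_⟩
  · rw [← add_div, ← add_div, orient_bary, div_self h.ne']
  · have hne : orient a b c ≠ 0 := h.ne'
    apply Complex.ext <;>
    · simp only [Complex.add_re, Complex.add_im, Complex.mul_re, Complex.mul_im,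
        Complex.ofReal_re, Complex.ofReal_im]
      field_simp
      unfold orient; ring

lemma mem_Tri_iff {a b c z : ℂ} (h : 0 < orient a b c) :
    z ∈ Tri a b c ↔ 0 ≤ orient a b z ∧ 0 ≤ orient b c z ∧ 0 ≤ orient c a z := by
  refine ⟨fun hz => ⟨?_, ?_, ?_⟩, fun hz => mem_Tri_of h hz.1 hz.2.1 hz.2.2⟩
  · exact (Aff.orient_right a b).nonneg_tri hz (by simp) (by simp) h.le
  · exact (Aff.orient_right b c).nonneg_tri hz (by rw [orient_rot]; exact h.le) (by simp) (by simp)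
  · exact (Aff.orient_right c a).nonneg_tri hz (by simp) (by rw [orient_rot']; exact h.le) (by simp)

/-- Two affine functionals that are positive at `z`, one of them negative at `g`: on the way from
`z` to `g` there is a first point where one of them vanishes. -/
lemma exists_first_zero {h k : ℂ → ℝ} (hh : Aff h) (hk : Aff k) {z g : ℂ} (hz : 0 < h z)
    (kz : 0 < k z) (hg : h g < 0 ∨ k g < 0) :
    ∃ w ∈ openSegment ℝ z g, 0 ≤ h w ∧ 0 ≤ k w ∧ (h w = 0 ∨ k w = 0) := by
  have key : ∀ {h k : ℂ → ℝ}, Aff h → Aff k → 0 < h z → 0 < k z → h g < 0 →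
      h z / (h z - h g) * (k z - k g) ≤ k z → 
      ∃ w ∈ openSegment ℝ z g, 0 ≤ h w ∧ 0 ≤ k w ∧ (h w = 0 ∨ k w = 0) := by
    intro h k hh hk hz kz hg hle
    have hd : 0 < h z - h g := by linarith
    refine ⟨pt z g (h z / (h z - h g)), mem_open.2 ⟨_, div_pos hz hd,
      by rw [div_lt_one hd]; linarith, rfl⟩, ?_, ?_, ?_⟩
    · rw [hh.pt]; apply le_of_eq; field_simp; ring
    · rw [hk.pt]; nlinarith
    · left; rw [hh.pt]; field_simp; ring
  -- move to the zero of the functional that vanishes first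
  by_cases hg' : h g < 0
  · by_cases c : h z / (h z - h g) * (k z - k g) ≤ k z
    · exact key hh hk hz kz hg' c
    · have hd : 0 < h z - h g := by linarith
      rw [not_le, div_mul_eq_mul_div, lt_div_iff₀ hd] at c
      have kg : k g < 0 := by
        by_contra hc
        nlinarith [mul_nonneg hz.le (not_lt.1 hc), mul_pos kz (neg_pos.2 hg')]
      obtain ⟨w, hw, h1, h2, h3⟩ := key hk hh kz hz kg (by
        rw [div_mul_eq_mul_div, div_le_iff₀ (by linarith)]; nlinarith)
      exact ⟨w, hw, h2, h1, h3.symm⟩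
  · have kg : k g < 0 := hg.resolve_left hg'
    obtain ⟨w, hw, h1, h2, h3⟩ := key hk hh kz hz kg (by
      rw [div_mul_eq_mul_div, div_le_iff₀ (by linarith)]
      nlinarith [mul_nonneg kz.le (not_lt.1 hg'), mul_pos hz (neg_pos.2 kg)])
    exact ⟨w, hw, h2, h1, h3.symm⟩

/-- In a nondegenerate triangle, a point on a side line lies on the side. -/
lemma mem_seg_of_Tri {a b c z : ℂ} (h : orient a b c ≠ 0) (hz : z ∈ Tri a b c)
    (h0 : orient a b z = 0) : z ∈ segment ℝ a b := by
  obtain ⟨x, y, w, hx, hy, hw, e, rfl⟩ := hz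
  have := (Aff.orient_right a b).comb3 a b c e
  simp only [orient_self_right, orient_self_out, mul_zero, zero_add] at this
  have hw0 : w = 0 := by
    rw [h0] at this
    rcases mul_eq_zero.1 this.symm with h | h
    · exact h
    · exact absurd h ‹orient a b c ≠ 0›
  subst hw0
  refine ⟨x, y, hx, hy, by linarith, ?_⟩
  simp

/-- A segment that enters a triangle through an inner point `z` of the side `a b` ends in the
triangle or leaves it through one of the two other sides. -/
lemma triExit {a b c z g : ℂ} (h : orient a b c ≠ 0) (hz : z ∈ openSegment ℝ a b)
    (hg : 0 < orient a b g * orient a b c) :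
    g ∈ Tri a b c ∨ ∃ w ∈ openSegment ℝ z g, w ∈ segment ℝ a c ∨ w ∈ segment ℝ c b := by
  have main : ∀ a b : ℂ, 0 < orient a b c → z ∈ openSegment ℝ a b → 0 < orient a b g →
      g ∈ Tri a b c ∨ ∃ w ∈ openSegment ℝ z g, w ∈ segment ℝ a c ∨ w ∈ segment ℝ c b := by
    intro a b h hz hg
    by_cases hT : 0 ≤ orient b c g ∧ 0 ≤ orient c a g
    · exact .inl (mem_Tri_of h hg.le hT.1 hT.2)
    right
    have hT' : orient b c g < 0 ∨ orient c a g < 0 := by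
      by_contra hc; push Not at hc; exact hT hc
    have hB : 0 < orient b c z := (Aff.orient_right b c).pos_open hz
      (by rw [orient_rot]; exact h.le) (by simp) (.inl (by rw [orient_rot]; exact h.ne'))
    have hC : 0 < orient c a z := (Aff.orient_right c a).pos_open hz
      (by simp) (by rw [orient_rot']; exact h.le) (.inr (by rw [orient_rot']; exact h.ne'))
    obtain ⟨w, hw, h1, h2, h3⟩ := exists_first_zero (Aff.orient_right b c)
      (Aff.orient_right c a) hB hC hT'
    have h4 : 0 ≤ orient a b w := (Aff.orient_right a b).nonneg_seg (open_sub_seg hw)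
      (orient_open (open_sub_seg hz)).ge hg.le
    have hw' := mem_Tri_of h h4 h1 h2
    refine ⟨w, hw, ?_⟩
    rcases h3 with h3 | h3
    · right
      exact seg_comm (mem_seg_of_Tri (c := a) (by rw [orient_rot]; exact h.ne') (Tri_rot hw') h3)
    · left
      exact seg_comm (mem_seg_of_Tri (c := b) (by rw [orient_rot']; exact h.ne')
        (Tri_rot (Tri_rot hw')) h3)
  rcases lt_or_gt_of_ne h with h' | h'
  · have := main b a (by rw [orient_swap]; linarith) (open_comm hz)
      (by rw [orient_swap]; nlinarith)
    rcases this with h | ⟨w, hw, h⟩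
    · exact .inl (Tri_swap h)
    · exact .inr ⟨w, hw, h.symm.imp seg_comm seg_comm⟩
  · exact main a b h' hz (by nlinarith)

/-- Among finitely many points of the triangle `l x y` other than `y`, take one that is met first
by a ray from `y` turning from `x` towards `l`. -/
lemma exists_first_ray {l x y : ℂ} {S : Set ℂ} (hS : S.Finite)
    (hl : l ∈ S) (hST : S ⊆ Tri l x y) (hy : y ∉ S) :
    ∃ p ∈ S, ∃ w ∈ segment ℝ x l, p ∈ segment ℝ w y ∧
      ∀ v ∈ S, orient l x y * orient y p v ≤ 0 := by
  set D := orient l x y with hD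
  have hc : ∀ v ∈ S, ∃ α β γ : ℝ, 0 ≤ α ∧ 0 ≤ β ∧ 0 ≤ γ ∧ 0 < α + β ∧ α + β + γ = 1 ∧
      v = (α : ℂ) * l + (β : ℂ) * x + (γ : ℂ) * y := by
    intro v hv
    obtain ⟨α, β, γ, hα, hβ, hγ, e, rfl⟩ := hST hv
    refine ⟨α, β, γ, hα, hβ, hγ, ?_, e, rfl⟩
    rcases (add_nonneg hα hβ).lt_or_eq with h | h
    · exact h
    · exfalso
      have h1 : α = 0 := by linarith
      have h2 : β = 0 := by linarith
      have h3 : γ = 1 := by linarith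
      subst h1 h2 h3
      apply hy; simpa using hv
  -- barycentric coordinates of the points with respect to `l`, `x`, `y`
  choose! α β γ hα hβ hγ hpos hsum hv using hc
  -- the ray from `y` through `v` hits `l x` at a parameter given by `β v / (α v + β v)`
  obtain ⟨p, hp, hmax⟩ := hS.exists_maximalFor (fun v => β v / (α v + β v)) S ⟨l, hl⟩
  have hmax' : ∀ v ∈ S, β v * (α p + β p) ≤ β p * (α v + β v) := by
    intro v hv
    by_contra hc
    have : β p / (α p + β p) < β v / (α v + β v) := by
      rw [div_lt_div_iff₀ (hpos p hp) (hpos v hv)]; linarith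
    exact absurd (hmax hv this.le) (not_le.2 this)
  refine ⟨p, hp, ((β p / (α p + β p) : ℝ) : ℂ) * x + ((α p / (α p + β p) : ℝ) : ℂ) * l, ?_, ?_, ?_⟩
  · refine ⟨β p / (α p + β p), α p / (α p + β p), div_nonneg (hβ p hp) (hpos p hp).le,
      div_nonneg (hα p hp) (hpos p hp).le, ?_, by simp⟩
    have := (hpos p hp).ne'
    field_simp; ring
  · refine ⟨α p + β p, γ p, (hpos p hp).le, hγ p hp, hsum p hp, ?_⟩
    have : ((α p + β p : ℝ) : ℂ) ≠ 0 := by exact_mod_cast (hpos p hp).ne'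
    conv_rhs => rw [hv p hp]
    simp only [Complex.real_smul]
    push_cast at this ⊢
    field_simp
    ring
  · intro v hv'
    have h1 := (Aff.orient_right y p).comb3 l x y (hsum v hv')
    rw [← hv v hv'] at h1
    have h2 := (Aff.orient_mid y l).comb3 l x y (hsum p hp)
    have h3 := (Aff.orient_mid y x).comb3 l x y (hsum p hp)
    rw [← hv p hp] at h2 h3
    simp only [orient_self_right, orient_self_left, orient_self_out] at h1 h2 h3
    have e1 : orient y l x = D := by rw [hD, orient_rot']
    have e2 : orient y x l = -D := by rw [orient_swap', e1]
    rw [e1] at h3; rw [e2] at h2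
    rw [h1, h2, h3]
    have := hmax' v hv'
    nlinarith [sq_nonneg D, mul_le_mul_of_nonneg_left this (sq_nonneg D)]

/-! ### Cells of the grid -/

lemma Aff.pos_tri {h : ℂ → ℝ} (hh : Aff h) {a b c z : ℂ} (hz : z ∈ Tri a b c)
    (ha : 0 < h a) (hb : 0 < h b) (hc : 0 < h c) : 0 < h z := by
  have hm : 0 < min (h a) (min (h b) (h c)) := by simp [ha, hb, hc]
  have := (hh.add_const (-min (h a) (min (h b) (h c)))).nonneg_tri hz
    (by simp) (by simp) (by simp)
  linarith

lemma Aff.floor_ge_tri {X : ℂ → ℝ} (hX : Aff X) {a b c z : ℂ} (hz : z ∈ Tri a b c) {n : ℤ}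
    (ha : n ≤ ⌊X a⌋) (hb : n ≤ ⌊X b⌋) (hc : n ≤ ⌊X c⌋) : n ≤ ⌊X z⌋ := by
  rw [Int.le_floor] at *
  have := (hX.add_const (-n)).nonneg_tri hz (by linarith) (by linarith) (by linarith)
  linarith

lemma Aff.floor_le_tri {X : ℂ → ℝ} (hX : Aff X) {a b c z : ℂ} (hz : z ∈ Tri a b c) {n : ℤ}
    (ha : ⌊X a⌋ ≤ n) (hb : ⌊X b⌋ ≤ n) (hc : ⌊X c⌋ ≤ n) : ⌊X z⌋ ≤ n := by
  rw [← Int.lt_add_one_iff, Int.floor_lt] at *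
  have := (hX.neg.add_const ((n + 1 : ℤ) : ℝ)).pos_tri hz (by linarith) (by linarith) (by linarith)
  linarith

lemma Tri_of_seg {a b z : ℂ} (c : ℂ) (hz : z ∈ segment ℝ a b) : z ∈ Tri a b c :=
  seg_sub_Tri (left_mem_Tri a b c) (mid_mem_Tri a b c) hz

lemma Aff.floor_ge_seg {X : ℂ → ℝ} (hX : Aff X) {a b z : ℂ} (hz : z ∈ segment ℝ a b) {n : ℤ}
    (ha : n ≤ ⌊X a⌋) (hb : n ≤ ⌊X b⌋) : n ≤ ⌊X z⌋ :=
  hX.floor_ge_tri (Tri_of_seg a hz) ha hb ha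

lemma Aff.floor_le_seg {X : ℂ → ℝ} (hX : Aff X) {a b z : ℂ} (hz : z ∈ segment ℝ a b) {n : ℤ}
    (ha : ⌊X a⌋ ≤ n) (hb : ⌊X b⌋ ≤ n) : ⌊X z⌋ ≤ n :=
  hX.floor_le_tri (Tri_of_seg a hz) ha hb ha

/-- Normalized horizontal coordinate: `⌊gx o s z⌋` is the column of `z`. -/
noncomputable def gx (o : ℂ) (s : ℝ) (z : ℂ) : ℝ := (z.re - o.re) / s

/-- Normalized vertical coordinate: `⌊gy o s z⌋` is the row of `z`. -/
noncomputable def gy (o : ℂ) (s : ℝ) (z : ℂ) : ℝ := (z.im - o.im) / s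

lemma Aff.gx (o : ℂ) (s : ℝ) : Aff (gx o s) :=
  ⟨s⁻¹, 0, -(o.re / s), fun z => by unfold GridMWT.gx; ring⟩
lemma Aff.gy (o : ℂ) (s : ℝ) : Aff (gy o s) :=
  ⟨0, s⁻¹, -(o.im / s), fun z => by unfold GridMWT.gy; ring⟩

variable {o : ℂ} {s : ℝ}

lemma near_iff {a b : ℂ} : Near o s a b ↔ |⌊gx o s a⌋ - ⌊gx o s b⌋| ≤ 1 ∧
    |⌊gy o s a⌋ - ⌊gy o s b⌋| ≤ 1 := Iff.rfl

lemma Near.symm {a b : ℂ} (h : Near o s a b) : Near o s b a := by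
  rw [near_iff] at *; rwa [abs_sub_comm, abs_sub_comm ⌊gy o s b⌋]

lemma near_refl (a : ℂ) : Near o s a a := by rw [near_iff]; simp

lemma Aff.floor_near_hull {X : ℂ → ℝ} (hX : Aff X) {a b c z w : ℂ} (hz : z ∈ Tri a b c)
    (hw : w ∈ Tri a b c) (h1 : |⌊X a⌋ - ⌊X b⌋| ≤ 1) (h2 : |⌊X b⌋ - ⌊X c⌋| ≤ 1)
    (h3 : |⌊X c⌋ - ⌊X a⌋| ≤ 1) : |⌊X z⌋ - ⌊X w⌋| ≤ 1 := by
  rw [abs_le] at *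
  obtain ⟨n, hn⟩ : ∃ n, n ≤ ⌊X a⌋ ∧ n ≤ ⌊X b⌋ ∧ n ≤ ⌊X c⌋ ∧
      ⌊X a⌋ ≤ n + 1 ∧ ⌊X b⌋ ≤ n + 1 ∧ ⌊X c⌋ ≤ n + 1 :=
    ⟨min ⌊X a⌋ (min ⌊X b⌋ ⌊X c⌋), by omega, by omega, by omega, by omega, by omega, by omega⟩
  have a1 := hX.floor_ge_tri hz hn.1 hn.2.1 hn.2.2.1
  have a2 := hX.floor_le_tri hz hn.2.2.2.1 hn.2.2.2.2.1 hn.2.2.2.2.2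
  have a3 := hX.floor_ge_tri hw hn.1 hn.2.1 hn.2.2.1
  have a4 := hX.floor_le_tri hw hn.2.2.2.1 hn.2.2.2.2.1 hn.2.2.2.2.2
  omega

lemma near_hull {a b c z w : ℂ} (hz : z ∈ Tri a b c) (hw : w ∈ Tri a b c)
    (h1 : Near o s a b) (h2 : Near o s b c) (h3 : Near o s c a) : Near o s z w :=
  ⟨(Aff.gx o s).floor_near_hull hz hw h1.1 h2.1 h3.1,
    (Aff.gy o s).floor_near_hull hz hw h1.2 h2.2 h3.2⟩

lemma Aff.floor_near_tri {X : ℂ → ℝ} (hX : Aff X) {m a b c z : ℂ} (hz : z ∈ Tri a b c)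
    (h1 : |⌊X m⌋ - ⌊X a⌋| ≤ 1) (h2 : |⌊X m⌋ - ⌊X b⌋| ≤ 1)
    (h3 : |⌊X m⌋ - ⌊X c⌋| ≤ 1) : |⌊X m⌋ - ⌊X z⌋| ≤ 1 := by
  rw [abs_le] at *
  have a1 := hX.floor_ge_tri (n := ⌊X m⌋ - 1) hz (by omega) (by omega) (by omega)
  have a2 := hX.floor_le_tri (n := ⌊X m⌋ + 1) hz (by omega) (by omega) (by omega)
  omega

/-- The neighbourhood of a point is convex. -/
lemma near_tri {m a b c z : ℂ} (hz : z ∈ Tri a b c)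
    (h1 : Near o s m a) (h2 : Near o s m b) (h3 : Near o s m c) : Near o s m z :=
  ⟨(Aff.gx o s).floor_near_tri hz h1.1 h2.1 h3.1, (Aff.gy o s).floor_near_tri hz h1.2 h2.2 h3.2⟩

lemma near_seg {m a b z : ℂ} (hz : z ∈ segment ℝ a b)
    (h1 : Near o s m a) (h2 : Near o s m b) : Near o s m z :=
  near_tri (Tri_of_seg a hz) h1 h2 h1

/-! ### Planar configurations -/

/-- An abstract maximal plane graph: the adjacency relation `E` on the finite set `V` of points in
general position consists of pairs of points in equal or neighbouring cells, its segments do not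
cross, and every such pair that crosses no segment belongs to `E`. -/
structure Cfg (o : ℂ) (s : ℝ) (V : Finset ℂ) (E : ℂ → ℂ → Prop) : Prop where
  hs : 0 < s
  gp : ∀ a ∈ V, ∀ b ∈ V, ∀ c ∈ V, a ≠ b → a ≠ c → b ≠ c → orient a b c ≠ 0
  symm : ∀ {a b}, E a b → E b a
  mem : ∀ {a b}, E a b → a ∈ V
  ne : ∀ {a b}, E a b → a ≠ b
  near : ∀ {a b}, E a b → Near o s a b
  planar : ∀ {a b c d z}, E a b → E c d → z ∈ openSegment ℝ a b → z ∈ openSegment ℝ c d →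
    (a = c ∧ b = d) ∨ (a = d ∧ b = c)
  maxl : ∀ {a b}, a ∈ V → b ∈ V → a ≠ b → Near o s a b →
    (∀ c d, E c d → ∀ z ∈ openSegment ℝ a b, z ∉ openSegment ℝ c d) → E a b

/-- No edge crosses the open segment `x y` transversally. -/
def Clear (E : ℂ → ℂ → Prop) (x y : ℂ) : Prop :=
  ∀ c d, E c d → ∀ z ∈ openSegment ℝ x y, z ∈ openSegment ℝ c d → orient x y c = 0

/-- Membership in the same connected component. -/
abbrev Reach (E : ℂ → ℂ → Prop) (a b : ℂ) : Prop := Relation.ReflTransGen E a b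

section

variable {V : Finset ℂ} {E : ℂ → ℂ → Prop}

namespace Cfg

lemma mem' (H : Cfg o s V E) {a b : ℂ} (h : E a b) : b ∈ V := H.mem (H.symm h)

lemma reach_symm (H : Cfg o s V E) {a b : ℂ} (h : Reach E a b) : Reach E b a :=
  by
  induction h with
  | refl => exact .refl
  | tail _ h ih => exact .head (H.symm h) ih

/-- A vertex on the line through two vertices is one of them. -/
lemma eq_of_orient (H : Cfg o s V E) {a b c : ℂ} (ha : a ∈ V) (hb : b ∈ V) (hc : c ∈ V)
    (hab : a ≠ b) (h : orient a b c = 0) : c = a ∨ c = b := by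
  by_contra hne; push Not at hne
  exact H.gp a ha b hb c hc hab hne.1.symm hne.2.symm h

lemma not_mem_open (H : Cfg o s V E) {a b c : ℂ} (h : E a b) (hc : c ∈ V) :
    c ∉ openSegment ℝ a b := by
  intro hco
  have h1 := ne_of_open hco (H.ne h)
  rcases H.eq_of_orient (H.mem h) (H.mem' h) hc (H.ne h) (orient_open (open_sub_seg hco)) with e | e
  · exact h1.1 e
  · exact h1.2 e

lemma edge_of_clear (H : Cfg o s V E) {x y : ℂ} (hx : x ∈ V) (hy : y ∈ V) (hxy : x ≠ y)
    (hn : Near o s x y) (hc : Clear E x y) : E x y := by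
  by_contra hE
  refine hE (H.maxl hx hy hxy hn fun c d hcd z hz hz' => ?_)
  have h1 := hc c d hcd z hz hz'
  have h2 := hc d c (H.symm hcd) z hz (open_comm hz')
  rcases H.eq_of_orient hx hy (H.mem hcd) hxy h1 with rfl | rfl <;>
  rcases H.eq_of_orient hx hy (H.mem' hcd) hxy h2 with rfl | rfl
  · exact H.ne hcd rfl
  · exact hE hcd
  · exact hE (H.symm hcd)
  · exact H.ne hcd rfl

lemma clear_symm {x y : ℂ} (h : Clear E x y) : Clear E y x := by
  intro c d hcd z hz hz'
  rw [orient_swap, h c d hcd z (open_comm hz) hz', neg_zero]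

lemma clear_edge (H : Cfg o s V E) {a b : ℂ} (h : E a b) : Clear E a b := by
  intro c d hcd z hz hz'
  rcases H.planar h hcd hz hz' with ⟨rfl, rfl⟩ | ⟨rfl, rfl⟩ <;> simp

end Cfg

lemma Clear.symm {x y : ℂ} (h : Clear E x y) : Clear E y x := Cfg.clear_symm h

/-- Subsegments of clear segments are clear. -/
lemma Clear.sub {x y x' y' : ℂ} (h : Clear E x y) (hx : x' ∈ segment ℝ x y)
    (hy : y' ∈ segment ℝ x y) : Clear E x' y' := by
  intro c d hcd z hz hz'
  by_cases hxy : x = y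
  · subst hxy
    rw [segment_same] at hx hy
    rw [hx, hy]; simp
  by_cases hxy' : x' = y'
  · rw [hxy']; simp
  have hzo : z ∈ openSegment ℝ x y := by
    obtain ⟨t, t0, t1, rfl⟩ := mem_seg.1 hx
    obtain ⟨r, r0, r1, rfl⟩ := mem_seg.1 hy
    obtain ⟨q, q0, q1, rfl⟩ := mem_open.1 hz
    have htr : t ≠ r := by rintro rfl; exact hxy' rfl
    refine mem_open.2 ⟨t + q * (r - t), ?_, ?_, ?_⟩
    · rcases t0.lt_or_eq with h | h
      · nlinarith [mul_nonneg q0.le r0, mul_pos (sub_pos.2 q1) h]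
      · have : 0 < r := lt_of_le_of_ne r0 (by rw [h]; exact htr)
        nlinarith [mul_pos q0 this]
    · rcases t1.lt_or_eq with h | h
      · nlinarith [mul_nonneg q0.le (sub_nonneg.2 r1), mul_pos (sub_pos.2 q1) (sub_pos.2 h)]
      · have : r < 1 := lt_of_le_of_ne r1 (by rw [← h]; exact htr.symm)
        nlinarith [mul_pos q0 (sub_pos.2 this)]
    · apply Complex.ext <;> simp only [pt_re, pt_im] <;> ring
  have h1 := h c d hcd z hzo hz'
  obtain ⟨t, t0, t1, rfl⟩ := mem_seg.1 hx
  obtain ⟨r, r0, r1, rfl⟩ := mem_seg.1 hy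
  have : orient (pt x y t) (pt x y r) c = (r - t) * orient x y c := by
    unfold orient; simp only [pt_re, pt_im]; ring
  rw [this, h1, mul_zero]

/-- A side of a triangle without inner vertices is clear if the two other sides are. -/
lemma clear_of_empty (H : Cfg o s V E) {a b c : ℂ} (h : orient a b c ≠ 0) (hac : Clear E a c)
    (hcb : Clear E c b) (hV : ∀ v ∈ V, v ∈ Tri a b c → v = c ∨ orient a b v = 0)
    (hc : ∀ g k, E g k → c ∈ segment ℝ g k → ∀ z ∈ openSegment ℝ a b, z ∉ openSegment ℝ g k) :
    Clear E a b := by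
  -- an edge that crosses `a b` towards the side of `c` would have to end in the triangle or to
  -- leave it through another side
  have key : ∀ g k, E g k → ∀ z ∈ openSegment ℝ a b, z ∈ openSegment ℝ g k →
      0 < orient a b g * orient a b c → False := by
    intro g k hgk z hz hz' hpos
    have hab : a ≠ b := by rintro rfl; simp at h
    rcases triExit h hz hpos with hg | ⟨w, hw, hw'⟩
    · rcases hV g (H.mem hgk) hg with rfl | h0
      · exact hc _ k hgk (left_mem_segment ℝ _ _) z hz hz'
      · rw [h0] at hpos; simp at hpos
    · have hwo : w ∈ openSegment ℝ g k := by
        have hz1 : z ∈ openSegment ℝ g k := hz'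
        obtain ⟨t, t0, t1, rfl⟩ := mem_open.1 hz'
        obtain ⟨r, r0, r1, rfl⟩ := mem_open.1 hw
        refine mem_open.2 ⟨t * (1 - r), by have := sub_pos.2 r1; positivity, by nlinarith, ?_⟩
        apply Complex.ext <;> simp only [pt_re, pt_im] <;> ring
      have hwp : 0 < orient a b w * orient a b c := by
        have := ((Aff.orient_right a b).mul_const (orient a b c)).pos_open hw
          (by simp [orient_open (open_sub_seg hz)]) (by linarith) (.inr (by
            rw [mul_comm]; exact hpos.ne'))
        linarith
      have hwc : w ≠ c := by
        rintro rfl; exact hc g k hgk (open_sub_seg hwo) z hz hz'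
      have hwa : w ≠ a := by rintro rfl; simp at hwp
      have hwb : w ≠ b := by rintro rfl; simp at hwp
      -- the edge cannot cross a clear side transversally, and it does not run along it since it
      -- contains `z`
      have sub : ∀ x y : ℂ, Clear E x y → w ∈ openSegment ℝ x y → orient x y z ≠ 0 → False := by
        intro x y hxy hwxy hne
        have h1 := hxy g k hgk w hwxy hwo
        have h2 := hxy k g (H.symm hgk) w hwxy (open_comm hwo)
        exact hne ((Aff.orient_right x y).zero_seg (open_sub_seg hz') h1 h2)
      rcases hw' with hw' | hw'
      · refine sub a c hac (open_of_seg hw' hwa hwc) ?_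
        obtain ⟨t, t0, t1, rfl⟩ := mem_open.1 hz
        rw [(Aff.orient_right a c).pt]
        simp only [orient_self_out, zero_add, sub_zero]
        rw [orient_swap']; exact mul_ne_zero t0.ne' (neg_ne_zero.2 h)
      · refine sub c b hcb (open_of_seg hw' hwc hwb) ?_
        obtain ⟨t, t0, t1, rfl⟩ := mem_open.1 hz
        rw [(Aff.orient_right c b).pt]
        simp only [orient_self_right, zero_sub]
        rw [orient_swap'']
        have := sub_pos.2 t1
        have : -orient a b c + t * - -orient a b c = -(1 - t) * orient a b c := by ring
        rw [this]; exact mul_ne_zero (by linarith) h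
  intro g k hgk z hz hz'
  by_contra hne
  rcases lt_or_gt_of_ne (mul_ne_zero hne h) with hlt | hgt
  · refine key k g (H.symm hgk) z hz (open_comm hz') ?_
    by_contra hle
    have := ((Aff.orient_right a b).mul_const (orient a b c)).neg.pos_open hz'
      (by nlinarith) (by nlinarith) (.inl (by
        rw [mul_comm, neg_ne_zero]; exact hlt.ne))
    rw [orient_open (open_sub_seg hz)] at this
    simp at this
  · exact key g k hgk z hz hz' hgt

/-- The position of an inner point `z` of `l y` relative to a third point `x` of the same line. -/
lemma open_trans_collinear {l x y z : ℂ} (hlx : x ≠ l) (h : orient l x y = 0)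
    (hz : z ∈ openSegment ℝ l y) (hy : y ≠ l) :
    z ∈ openSegment ℝ l x ∨ z = x ∨ z ∈ openSegment ℝ x y := by
  obtain ⟨r, rfl⟩ : ∃ r : ℝ, y = pt l x r := by
    by_cases h0 : x.re - l.re = 0
    · have h1 : x.im - l.im ≠ 0 := by
        intro h1; apply hlx; apply Complex.ext <;> linarith
      refine ⟨(y.im - l.im) / (x.im - l.im), ?_⟩
      apply Complex.ext
      · rw [pt_re, h0, mul_zero]
        unfold orient at h; rw [h0, zero_mul, zero_sub, neg_eq_zero] at h
        rcases mul_eq_zero.1 h with h | h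
        · exact absurd h h1
        · linarith
      · rw [pt_im]; field_simp; ring
    · refine ⟨(y.re - l.re) / (x.re - l.re), ?_⟩
      apply Complex.ext
      · rw [pt_re]; field_simp; ring
      · rw [pt_im]; field_simp; unfold orient at h; linarith
  obtain ⟨t, t0, t1, rfl⟩ := mem_open.1 hz
  have e : pt l (pt l x r) t = pt l x (t * r) := by
    apply Complex.ext <;> simp only [pt_re, pt_im] <;> ring
  have e2 : ∀ q, r ≠ 1 → pt l x q = pt x (pt l x r) ((q - 1) / (r - 1)) := by
    intro q hr
    have : r - 1 ≠ 0 := sub_ne_zero.2 hr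
    apply Complex.ext <;> simp only [pt_re, pt_im] <;> field_simp <;> ring
  rw [e]
  rcases lt_trichotomy r 0 with hr | hr | hr
  · right; right
    rw [e2 (t * r) (by linarith)]
    have : r - 1 < 0 := by linarith
    refine mem_open.2 ⟨_, div_pos_of_neg_of_neg (by nlinarith) this, ?_, rfl⟩
    rw [div_lt_one_of_neg this]; nlinarith
  · subst hr; simp at hy
  · rcases lt_trichotomy (t * r) 1 with h1 | h1 | h1
    · left; exact mem_open.2 ⟨_, by positivity, h1, rfl⟩
    · right; left; rw [h1]; simp
    · right; right
      have : 1 < r := by nlinarith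
      rw [e2 (t * r) this.ne']
      refine mem_open.2 ⟨_, div_pos (by linarith) (by linarith), ?_, rfl⟩
      rw [div_lt_one (by linarith)]; nlinarith

/-- If `l` is a vertex and `x` is `l` or a point inside an edge at `l`, then from a point `y` that
sees `x` one also sees a vertex of the component of `l` in the triangle `l x y`, provided that
this triangle has small diameter. -/
lemma exists_seen_vertex (H : Cfg o s V E) {l x y : ℂ} (hl : l ∈ V)
    (hx : x = l ∨ ∃ l', E l l' ∧ x ∈ openSegment ℝ l l') (hxy : Clear E x y)
    (n1 : Near o s l x) (n2 : Near o s x y) (n3 : Near o s y l) :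
    ∃ p ∈ V, p ∈ Tri l x y ∧ Reach E l p ∧ Clear E p y := by
  classical
  obtain ⟨n, hn⟩ : ∃ n, n = (V.filter (fun v => v ∈ Tri l x y ∧ v ≠ y)).card := ⟨_, rfl⟩
  -- induction on the number of vertices in the triangle
  induction n using Nat.strong_induction_on generalizing x y with
  | _ n ih =>
  by_cases hxl : x = l
  · subst hxl; exact ⟨x, hl, left_mem_Tri _ _ _, .refl, hxy⟩
  obtain ⟨l', hE, hxo⟩ := hx.resolve_left hxl
  by_cases hdeg : orient l x y = 0
  -- a degenerate triangle: the view from `l` to `y` runs along the edge of `l` and the segment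
  -- `x y`
  · refine ⟨l, hl, left_mem_Tri _ _ _, .refl, ?_⟩
    by_cases hyl : y = l
    · rw [hyl]; intro c d _ z _ _; simp
    have hxl' : x ∈ segment ℝ l l' := open_sub_seg hxo
    intro c d hcd z hz hz'
    have lin : ∀ v, orient l l' v = 0 → orient l y v = 0 := by
      intro v hv
      obtain ⟨t, t0, t1, rfl⟩ := mem_open.1 hxo
      have e1 : orient l (pt l l' t) y = t * orient l l' y := by
        unfold orient; simp only [pt_re, pt_im]; ring
      have hy' : orient l l' y = 0 := by
        rw [e1] at hdeg; exact (mul_eq_zero.1 hdeg).resolve_left t0.ne'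
      have hll := H.ne hE
      have f1 : (l'.re - l.re) * orient l y v = (y.re - l.re) * orient l l' v -
        (v.re - l.re) * orient l l' y := by unfold orient; ring
      have f2 : (l'.im - l.im) * orient l y v = (y.im - l.im) * orient l l' v -
        (v.im - l.im) * orient l l' y := by unfold orient; ring
      rw [hv, hy'] at f1 f2
      simp only [mul_zero, sub_zero, mul_eq_zero] at f1 f2
      rcases f1 with f1 | f1
      · rcases f2 with f2 | f2
        · exact absurd (Complex.ext (by linarith) (by linarith)) hll
        · exact f2
      · exact f1
    rcases open_trans_collinear hxl hdeg hz hyl with h1 | h1 | h1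
    · have : z ∈ openSegment ℝ l l' := by
        obtain ⟨t, t0, t1, rfl⟩ := mem_open.1 hxo
        obtain ⟨r, r0, r1, rfl⟩ := mem_open.1 h1
        refine mem_open.2 ⟨r * t, by positivity, by nlinarith, ?_⟩
        apply Complex.ext <;> simp only [pt_re, pt_im] <;> ring
      exact lin _ (H.clear_edge hE c d hcd z this hz')
    · rw [h1] at hz'; exact lin _ (H.clear_edge hE c d hcd x hxo hz')
    · have h2 := hxy c d hcd z h1 hz'
      have h3 := hxy d c (H.symm hcd) z h1 (open_comm hz')
      by_contra hne
      -- both ends of `c d` lie on the line through `x` and `y`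
      have hxy0 : x ≠ y := by
        rintro rfl
        rw [openSegment_same] at h1
        rw [h1] at hz'
        rcases H.planar hE hcd hxo hz' with ⟨rfl, rfl⟩ | ⟨rfl, rfl⟩
        · simp at hne
        · exact hne (lin _ (by simp))
      have f1 : (y.re - x.re) * orient l y c = (y.re - l.re) * orient x y c +
          (c.re - y.re) * orient l x y := by unfold orient; ring
      have f2 : (y.im - x.im) * orient l y c = (y.im - l.im) * orient x y c +
          (c.im - y.im) * orient l x y := by unfold orient; ring
      rw [h2, hdeg] at f1 f2
      simp only [mul_zero, add_zero, mul_eq_zero, hne, or_false] at f1 f2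
      exact hxy0 (Complex.ext (by linarith) (by linarith))
  · have hyl : l ≠ y := by rintro rfl; simp at hdeg
    -- rotate the ray from `y` through `x` towards `l` until it meets a vertex `p`; no vertices are
    -- left behind, so the segment from `y` to the point `w` of the ray on `l x` stays clear
    set S : Set ℂ := {v | v ∈ V ∧ v ∈ Tri l x y ∧ v ≠ y} with hS
    have hSf : S.Finite := (V.finite_toSet).subset fun v hv => hv.1
    obtain ⟨p, hp, w, hw, hpw, hmax⟩ := exists_first_ray hSf
      (show l ∈ S from ⟨hl, left_mem_Tri _ _ _, hyl⟩) (fun v hv => hv.2.1) (fun h => h.2.2 rfl)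
    have hwT : w ∈ Tri l x y := seg_sub_Tri (mid_mem_Tri _ _ _) (left_mem_Tri _ _ _) hw
    have hxV : x ∉ V := fun h => H.not_mem_open hE h hxo
    have hwE : w = l ∨ w ∈ openSegment ℝ l l' := by
      by_cases hwl : w = l
      · exact .inl hwl
      right
      obtain ⟨t, t0, t1, rfl⟩ := mem_open.1 hxo
      obtain ⟨r, r0, r1, rfl⟩ := mem_seg.1 hw
      refine mem_open.2 ⟨t * (1 - r), ?_, ?_, ?_⟩
      · have : r ≠ 1 := by rintro rfl; simp at hwl
        have := sub_pos.2 (lt_of_le_of_ne r1 this)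
        positivity
      · nlinarith
      · apply Complex.ext <;> simp only [pt_re, pt_im] <;> ring
    have hwy : Clear E w y := by
      by_cases hwx : w = x
      · rw [hwx]; exact hxy
      obtain ⟨r, r0, r1, rfl⟩ := mem_seg.1 hw
      have hr0 : r ≠ 0 := by rintro rfl; simp at hwx
      have e1 : orient (pt x l r) y x = -(r * orient l x y) := by
        unfold orient; simp only [pt_re, pt_im]; ring
      have e1' : orient (pt x l r) y x ≠ 0 := by
        rw [e1]; simp [hr0, hdeg]
      -- the segment `w y` leaves the line through `l` and `l'` at `w`
      have onl : ∀ z ∈ openSegment ℝ (pt x l r) y, z ∉ segment ℝ l l' := by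
        intro z hz hzl
        have h1 := orient_open hzl
        obtain ⟨t, t0, t1, rfl⟩ := mem_open.1 hxo
        obtain ⟨q, q0, q1, rfl⟩ := mem_open.1 hz
        have : orient l l' (pt (pt (pt l l' t) l r) y q) = q * orient l l' y := by
          unfold orient; simp only [pt_re, pt_im]; ring
        rw [this] at h1
        have h2 := (mul_eq_zero.1 h1).resolve_left q0.ne'
        apply hdeg
        have : orient l (pt l l' t) y = t * orient l l' y := by
          unfold orient; simp only [pt_re, pt_im]; ring
        rw [this, h2, mul_zero]
      refine clear_of_empty H e1' ?_ hxy ?_ ?_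
      · refine (H.clear_edge hE).sub ?_ (open_sub_seg hxo)
        rcases hwE with e | e
        · rw [e]; exact left_mem_segment _ _ _
        · exact open_sub_seg e
      · intro v hv hvT
        right
        by_cases hvy : v = y
        · rw [hvy]; simp
        have hvS : v ∈ S := ⟨hv, Tri_subset hwT (right_mem_Tri _ _ _) (mid_mem_Tri _ _ _) hvT, hvy⟩
        have h1 := hmax v hvS
        have hpy : p ≠ y := hp.2.2
        obtain ⟨q, q0, q1, rfl⟩ := mem_seg.1 hpw
        have hq1 : q < 1 := lt_of_le_of_ne q1 (by rintro rfl; simp at hpy)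
        have e2 : orient y (pt (pt x l r) y q) v = -((1 - q) * orient (pt x l r) y v) := by
          unfold orient; simp only [pt_re, pt_im]; ring
        rw [e2] at h1
        have h2 := ((Aff.orient_right (pt x l r) y).mul_const
          (-orient l x y)).nonneg_tri hvT (by simp) (by simp) (by
            rw [e1]; nlinarith [mul_nonneg r0 (sq_nonneg (orient l x y))])
        have h3 : 0 < 1 - q := by linarith
        have h4 : 0 ≤ orient l x y * orient (pt x l r) y v := by
          by_contra hc
          push Not at hc
          nlinarith [mul_pos h3 (neg_pos.2 hc)]
        exact (mul_eq_zero.1 (le_antisymm (by linarith) h4)).resolve_left hdeg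
      · intro g k hgk hxg z hz hz'
        have hxo' : x ∈ openSegment ℝ g k := open_of_seg hxg
          (by rintro rfl; exact hxV (H.mem hgk)) (by rintro rfl; exact hxV (H.mem' hgk))
        rcases H.planar hE hgk hxo hxo' with ⟨rfl, rfl⟩ | ⟨rfl, rfl⟩
        · exact onl z hz (open_sub_seg hz')
        · exact onl z hz (seg_comm (open_sub_seg hz'))
    have hpy : Clear E p y := hwy.sub hpw (right_mem_segment _ _ _)
    have hwp : Clear E w p := hwy.sub (left_mem_segment _ _ _) hpw
    have hpT : p ∈ Tri l x y := hp.2.1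
    have hlT := left_mem_Tri l x y
    have hsub : Tri l w p ⊆ Tri l x y := Tri_subset hlT hwT hpT
    -- by induction `p` sees a vertex `p₂` of the component of `l` in the smaller triangle `l w p`,
    -- and `p` is joined to it by maximality
    obtain ⟨p₂, hp₂, hp₂T, hr, hcl⟩ := ih _ (by
        rw [hn]
        apply Finset.card_lt_card
        rw [Finset.ssubset_iff_of_subset (fun v hv => by
          simp only [Finset.mem_filter] at hv ⊢
          refine ⟨hv.1, hsub hv.2.1, ?_⟩
          rintro rfl
          -- `y` is an extreme point of the triangle
          have hD : ∀ u, u ∈ Tri l x v → u ≠ v → orient l x u * orient l x v < orient l x v ^ 2 := by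
            rintro _ ⟨α, β, γ, hα, hβ, hγ, e, rfl⟩ hne
            have := (Aff.orient_right l x).comb3 l x v e
            simp only [orient_self_right, orient_self_out, mul_zero, zero_add] at this
            rw [this]
            have hγ1 : γ < 1 := by
              rcases (show γ ≤ 1 by linarith).lt_or_eq with h | h
              · exact h
              · exfalso; apply hne
                have h1 : α = 0 := by linarith
                have h2 : β = 0 := by linarith
                subst h1 h2 h; simp
            have : 0 < orient l x v ^ 2 := by positivity
            nlinarith
          have hwv : w ≠ v := by
            rintro rfl
            have h9 := orient_open (seg_comm hw)
            exact hdeg h9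
          have h1 := hD l (left_mem_Tri _ _ _) hyl
          have h2 := hD w hwT hwv
          have h3 := hD p hpT hp.2.2
          have := (((Aff.orient_right l x).mul_const (-orient l x v)).add_const
            (orient l x v ^ 2)).pos_tri hv.2.1 (by linarith) (by linarith)
              (by linarith)
          nlinarith)]
        exact ⟨p, by simp [hp.1, hpT, hp.2.2], by simp⟩)
      (hwE.imp id fun h => ⟨l', hE, h⟩) hwp (near_hull hlT hwT n1 n2 n3)
      (near_hull hwT hpT n1 n2 n3) (near_hull hpT hlT n1 n2 n3) rfl
    refine ⟨p, hp.1, hpT, ?_, hpy⟩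
    by_cases hpp : p₂ = p
    · rw [← hpp]; exact hr
    · exact hr.tail (H.edge_of_clear hp₂ hp.1 hpp (near_hull (hsub hp₂T) hpT n1 n2 n3) hcl)

/-- Two edges (or vertices) that see each other at short distance lie in the same component. -/
lemma reach_of_clear (H : Cfg o s V E) {l x y r : ℂ} (hl : l ∈ V) (hr : r ∈ V)
    (hx : x = l ∨ ∃ l', E l l' ∧ x ∈ openSegment ℝ l l')
    (hy : y = r ∨ ∃ r', E r r' ∧ y ∈ openSegment ℝ r r') (hxy : Clear E x y)
    (n1 : Near o s l x) (n2 : Near o s x y) (n3 : Near o s y l)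
    (n4 : Near o s r l) (n5 : Near o s r x) (n6 : Near o s r y) : Reach E l r := by
  -- `y` sees a vertex `p` of the component of `l`, and then `p` sees one of the component of `r`
  obtain ⟨p, hp, hpT, h1, h2⟩ := exists_seen_vertex H hl hx hxy n1 n2 n3
  have hrp : Near o s r p := near_tri hpT n4 n5 n6
  have hyp : Near o s y p := near_hull (right_mem_Tri _ _ _) hpT n1 n2 n3
  obtain ⟨p₃, hp₃, hp₃T, h3, h4⟩ := exists_seen_vertex H hr hy h2.symm n6 hyp hrp.symm
  refine h1.trans (H.reach_symm ?_)
  by_cases hpp : p₃ = p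
  · rw [← hpp]; exact h3
  · exact h3.tail (H.edge_of_clear hp₃ hp hpp
      (near_hull hp₃T (right_mem_Tri _ _ _) n6 hyp hrp.symm) h4)

end

/-! ### Short segments -/

/-- The cells `(l, l')` and `(r, r')` are equal or neighbouring, `(l, l')` also to `(y, y')` and
`(r, r')` also to `(x, x')`. -/
def CellsClose (x x' y y' l l' r r' : ℤ) : Prop :=
  ((-1 ≤ l - y ∧ l - y ≤ 1) ∧ (-1 ≤ l' - y' ∧ l' - y' ≤ 1)) ∧
  ((-1 ≤ r - x ∧ r - x ≤ 1) ∧ (-1 ≤ r' - x' ∧ r' - x' ≤ 1)) ∧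
  ((-1 ≤ r - l ∧ r - l ≤ 1) ∧ (-1 ≤ r' - l' ∧ r' - l' ≤ 1))

section
variable {a a' b b' x x' y y' c c' d d' : ℤ}

/-- Choice of ends `l` of `a b` and `r` of `c d` for `x` and `y` in the same cell. Here and in the
following lemmas the unprimed letters denote columns and the primed letters rows of cells. -/
lemma cellsClose_same (hx : min a b ≤ x ∧ x ≤ max a b) (hx' : min a' b' ≤ x' ∧ x' ≤ max a' b')
    (hy : min c d ≤ x ∧ x ≤ max c d) (hy' : min c' d' ≤ x' ∧ x' ≤ max c' d')
    (hab : -1 ≤ a - b ∧ a - b ≤ 1) (hab' : -1 ≤ a' - b' ∧ a' - b' ≤ 1)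
    (hcd : -1 ≤ c - d ∧ c - d ≤ 1) (hcd' : -1 ≤ c' - d' ∧ c' - d' ≤ 1) :
    CellsClose x x' x x' a a' c c' ∨ CellsClose x x' x x' b b' c c' ∨
      CellsClose x x' x x' a a' d d' ∨ CellsClose x x' x x' b b' d d' := by
  have zx : a = x ∨ b = x := by omega
  have zy' : c' = x' ∨ d' = x' := by omega
  unfold CellsClose
  rcases zx with h | h <;> rcases zy' with h' | h'
  · left; omega
  · right; right; left; omega
  · right; left; omega
  · right; right; right; omega

/-- Choice of ends for `y` in the column to the right of `x`. -/
lemma cellsClose_side (hx : min a b ≤ x ∧ x ≤ max a b) (hx' : min a' b' ≤ x' ∧ x' ≤ max a' b')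
    (hy : min c d ≤ x + 1 ∧ x + 1 ≤ max c d) (hy' : min c' d' ≤ x' ∧ x' ≤ max c' d')
    (hab : -1 ≤ a - b ∧ a - b ≤ 1) (hab' : -1 ≤ a' - b' ∧ a' - b' ≤ 1)
    (hcd : -1 ≤ c - d ∧ c - d ≤ 1) (hcd' : -1 ≤ c' - d' ∧ c' - d' ≤ 1)
    (h1 : min (c + c') (d + d') < max (a + a') (b + b') + 3)
    (h3 : min (c - c') (d - d') < max (a - a') (b - b') + 3) :
    CellsClose x x' (x + 1) x' a a' c c' ∨ CellsClose x x' (x + 1) x' b b' c c' ∨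
      CellsClose x x' (x + 1) x' a a' d d' ∨ CellsClose x x' (x + 1) x' b b' d d' := by
  have zx : a = x ∨ b = x := by clear * - hx hab; omega
  have zy : c = x + 1 ∨ d = x + 1 := by clear * - hy hcd; omega
  have zx' : a' = x' ∨ b' = x' := by clear * - hx' hab'; omega
  have zy' : c' = x' ∨ d' = x' := by clear * - hy' hcd'; omega
  have ra : (x - 1 ≤ a ∧ a ≤ x + 1) ∧ (x - 1 ≤ b ∧ b ≤ x + 1) := by clear * - hx hab; omega
  have rc : (x ≤ c ∧ c ≤ x + 2) ∧ (x ≤ d ∧ d ≤ x + 2) := by clear * - hy hcd; omega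
  have ra' : (x' - 1 ≤ a' ∧ a' ≤ x' + 1) ∧ (x' - 1 ≤ b' ∧ b' ≤ x' + 1) := by
    clear * - hx' hab'; omega
  have rc' : (x' - 1 ≤ c' ∧ c' ≤ x' + 1) ∧ (x' - 1 ≤ d' ∧ d' ≤ x' + 1) := by
    clear * - hy' hcd'; omega
  clear hx hx' hy hy'
  unfold CellsClose
  by_cases p1 : c' = x' ∧ c ≤ x + 1
  · rcases zx with h | h
    · left; (clear h1 h3; omega)
    · right; left; (clear h1 h3; omega)
  by_cases p2 : d' = x' ∧ d ≤ x + 1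
  · rcases zx with h | h
    · right; right; left; (clear h1 h3; omega)
    · right; right; right; (clear h1 h3; omega)
  by_cases p3 : a' = x' ∧ x ≤ a
  · rcases zy with h | h
    · left; (clear h1 h3; omega)
    · right; right; left; (clear h1 h3; omega)
  by_cases p4 : b' = x' ∧ x ≤ b
  · rcases zy with h | h
    · right; left; (clear h1 h3; omega)
    · right; right; right; (clear h1 h3; omega)
  -- the remaining configurations are excluded by the bounds on the sum and the difference of
  -- column and row
  rcases zx' with h | h <;> rcases zy' with h' | h'
  · right; right; right
    have : a = x - 1 ∧ b = x ∧ c = x + 2 ∧ d = x + 1 := by clear h1 h3; omega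
    obtain ⟨rfl, rfl, rfl, rfl⟩ := this
    subst h h'; omega
  · right; left
    have : a = x - 1 ∧ b = x ∧ d = x + 2 ∧ c = x + 1 := by clear h1 h3; omega
    obtain ⟨rfl, rfl, rfl, rfl⟩ := this
    subst h h'; omega
  · right; right; left
    have : b = x - 1 ∧ a = x ∧ c = x + 2 ∧ d = x + 1 := by clear h1 h3; omega
    obtain ⟨rfl, rfl, rfl, rfl⟩ := this
    subst h h'; omega
  · left
    have : b = x - 1 ∧ a = x ∧ d = x + 2 ∧ c = x + 1 := by clear h1 h3; omega
    obtain ⟨rfl, rfl, rfl, rfl⟩ := this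
    subst h h'; omega

/-- Choice of ends for `y` in the cell diagonally above and to the right of `x`. -/
lemma cellsClose_diag (hx : min a b ≤ x ∧ x ≤ max a b) (hx' : min a' b' ≤ x' ∧ x' ≤ max a' b')
    (hy : min c d ≤ x + 1 ∧ x + 1 ≤ max c d) (hy' : min c' d' ≤ x' + 1 ∧ x' + 1 ≤ max c' d')
    (hab : -1 ≤ a - b ∧ a - b ≤ 1) (hab' : -1 ≤ a' - b' ∧ a' - b' ≤ 1)
    (hcd : -1 ≤ c - d ∧ c - d ≤ 1) (hcd' : -1 ≤ c' - d' ∧ c' - d' ≤ 1)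
    (h1 : max (x + x' + 2) (min (c + c') (d + d')) < min (x + x') (max (a + a') (b + b')) + 3) :
    CellsClose x x' (x + 1) (x' + 1) a a' c c' ∨ CellsClose x x' (x + 1) (x' + 1) b b' c c' ∨
      CellsClose x x' (x + 1) (x' + 1) a a' d d' ∨
      CellsClose x x' (x + 1) (x' + 1) b b' d d' := by
  have k : (x ≤ a ∧ x' ≤ a') ∨ (x ≤ b ∧ x' ≤ b') := by
    have : x + x' ≤ max (a + a') (b + b') := by omega
    clear hy hy' hcd hcd' h1; omega
  have k' : (c ≤ x + 1 ∧ c' ≤ x' + 1) ∨ (d ≤ x + 1 ∧ d' ≤ x' + 1) := by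
    have : min (c + c') (d + d') ≤ x + x' + 2 := by omega
    clear hx hx' hab hab' h1 k; omega
  unfold CellsClose
  clear h1
  rcases k with h | h <;> rcases k' with h' | h'
  · left; omega
  · right; right; left; omega
  · right; left; omega
  · right; right; right; omega

lemma CellsClose.swap {l l' r r' : ℤ} (h : CellsClose x x' y y' l l' r r') :
    CellsClose x' x y' y l' l r' r := by unfold CellsClose at *; omega
lemma CellsClose.flip {l l' r r' : ℤ} (h : CellsClose x x' y y' l l' r r') :
    CellsClose y y' x x' r r' l l' := by unfold CellsClose at *; omega
lemma CellsClose.neg {l l' r r' : ℤ} (h : CellsClose x (-x') y (-y') l (-l') r (-r')) :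
    CellsClose x x' y y' l l' r r' := by unfold CellsClose at *; omega

/-- For points `x` of `a b` and `y` of `c d` in neighbouring cells, ends `l` and `r` can be chosen
that satisfy `CellsClose`. The last four hypotheses are the integer form of the bound on the
distance of `x` and `y` along the two diagonal directions. -/
lemma cellsClose_of (hx : min a b ≤ x ∧ x ≤ max a b) (hx' : min a' b' ≤ x' ∧ x' ≤ max a' b')
    (hy : min c d ≤ y ∧ y ≤ max c d) (hy' : min c' d' ≤ y' ∧ y' ≤ max c' d')
    (hab : -1 ≤ a - b ∧ a - b ≤ 1) (hab' : -1 ≤ a' - b' ∧ a' - b' ≤ 1)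
    (hcd : -1 ≤ c - d ∧ c - d ≤ 1) (hcd' : -1 ≤ c' - d' ∧ c' - d' ≤ 1)
    (hxy : -1 ≤ x - y ∧ x - y ≤ 1) (hxy' : -1 ≤ x' - y' ∧ x' - y' ≤ 1)
    (h1 : max (y + y') (min (c + c') (d + d')) < min (x + x') (max (a + a') (b + b')) + 3)
    (h2 : max (x + x') (min (a + a') (b + b')) < min (y + y') (max (c + c') (d + d')) + 3)
    (h3 : max (y - y') (min (c - c') (d - d')) < min (x - x') (max (a - a') (b - b')) + 3)
    (h4 : max (x - x') (min (a - a') (b - b')) < min (y - y') (max (c - c') (d - d')) + 3) :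
    CellsClose x x' y y' a a' c c' ∨ CellsClose x x' y y' b b' c c' ∨
      CellsClose x x' y y' a a' d d' ∨ CellsClose x x' y y' b b' d d' := by
  have e : y = x ∨ y = x + 1 ∨ x = y + 1 := by clear * - hxy; omega
  have e' : y' = x' ∨ y' = x' + 1 ∨ x' = y' + 1 := by clear * - hxy'; omega
  rcases e with rfl | rfl | rfl <;> rcases e' with rfl | rfl | rfl
  · exact cellsClose_same hx hx' hy hy' hab hab' hcd hcd'
  · exact (cellsClose_side hx' hx hy' hy hab' hab hcd' hcd (by clear * - h1; omega)
      (by clear * - h4; omega)).imp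
      CellsClose.swap (Or.imp CellsClose.swap (Or.imp CellsClose.swap CellsClose.swap))
  · rcases cellsClose_side hy' hy hx' hx hcd' hcd hab' hab (by clear * - h2; omega)
      (by clear * - h3; omega) with h | h | h | h
    · exact .inl h.flip.swap
    · exact .inr (.inr (.inl h.flip.swap))
    · exact .inr (.inl h.flip.swap)
    · exact .inr (.inr (.inr h.flip.swap))
  · exact cellsClose_side hx hx' hy hy' hab hab' hcd hcd' (by clear * - h1; omega)
      (by clear * - h3; omega)
  · exact cellsClose_diag hx hx' hy hy' hab hab' hcd hcd' (by clear * - h1; omega)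
  · have := cellsClose_diag (a' := -a') (b' := -b') (c' := -c') (d' := -d') (x' := -(y' + 1))
      hx (by clear * - hx'; omega) hy (by clear * - hy'; omega) hab (by clear * - hab'; omega)
      hcd (by clear * - hcd'; omega) (by clear * - h3; omega)
    rw [show -(y' + 1) + 1 = -y' by ring] at this
    exact this.imp
      CellsClose.neg (Or.imp CellsClose.neg (Or.imp CellsClose.neg CellsClose.neg))
  · rcases cellsClose_side hy hy' hx hx' hcd hcd' hab hab' (by clear * - h2; omega)
      (by clear * - h4; omega) with h | h | h | h
    · exact .inl h.flip
    · exact .inr (.inr (.inl h.flip))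
    · exact .inr (.inl h.flip)
    · exact .inr (.inr (.inr h.flip))
  · have := cellsClose_diag (a' := -c') (b' := -d') (c' := -a') (d' := -b') (x' := -(x' + 1))
      hy (by clear * - hy'; omega) hx (by clear * - hx'; omega) hcd (by clear * - hcd'; omega)
      hab (by clear * - hab'; omega) (by clear * - h4; omega)
    rw [show -(x' + 1) + 1 = -x' by ring] at this
    rcases this with h | h | h | h
    · exact .inl h.neg.flip
    · exact .inr (.inr (.inl h.neg.flip))
    · exact .inr (.inl h.neg.flip)
    · exact .inr (.inr (.inr h.neg.flip))
  · rcases cellsClose_diag hy hy' hx hx' hcd hcd' hab hab' (by clear * - h2; omega) with h | h | h | h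
    · exact .inl h.flip
    · exact .inr (.inr (.inl h.flip))
    · exact .inr (.inl h.flip)
    · exact .inr (.inr (.inr h.flip))
end

variable {o : ℂ} {s : ℝ}

lemma Aff.le_max_seg {h : ℂ → ℝ} (hh : Aff h) {a b z : ℂ} (hz : z ∈ segment ℝ a b) :
    h z ≤ max (h a) (h b) := by
  have := (hh.neg.add_const (max (h a) (h b))).nonneg_seg hz (by simp) (by simp)
  linarith

lemma Aff.min_le_seg {h : ℂ → ℝ} (hh : Aff h) {a b z : ℂ} (hz : z ∈ segment ℝ a b) :
    min (h a) (h b) ≤ h z := by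
  have := (hh.add_const (-min (h a) (h b))).nonneg_seg hz (by simp) (by simp)
  linarith

/-- Integer form of the estimate `h y - h x ≤ 1` for a functional `h` that is tied to the
integer-valued function `n` by `n ≤ h + e < n + 2`. -/
lemma floor_bound {h : ℂ → ℝ} (hh : Aff h) {n : ℂ → ℤ} {e : ℝ} (hn : ∀ z, (n z : ℝ) ≤ h z + e)
    (hn' : ∀ z, h z + e < n z + 2) {a b c d x y : ℂ} (hx : x ∈ segment ℝ a b)
    (hy : y ∈ segment ℝ c d) (hxy : h y - h x ≤ 1) :
    max (n y) (min (n c) (n d)) < min (n x) (max (n a) (n b)) + 3 := by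
  have h1 := hh.le_max_seg hx
  have h2 := hh.min_le_seg hy
  have k1 : h x + e < min (n x : ℝ) (max (n a) (n b)) + 2 := by
    rcases le_total (h a) (h b) with hab | hab
    · rw [max_eq_right hab] at h1
      have : (n b : ℝ) ≤ max (n a : ℝ) (n b) := le_max_right _ _
      have e1 := hn' x
      have e2 := hn' b
      have : h x + e - 2 < min (n x : ℝ) (max (n a) (n b)) := lt_min (by linarith) (by linarith)
      linarith
    · rw [max_eq_left hab] at h1
      have : (n a : ℝ) ≤ max (n a : ℝ) (n b) := le_max_left _ _
      have e1 := hn' x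
      have e2 := hn' a
      have : h x + e - 2 < min (n x : ℝ) (max (n a) (n b)) := lt_min (by linarith) (by linarith)
      linarith
  have k2 : (max (n y) (min (n c) (n d)) : ℝ) ≤ h y + e := by
    refine max_le (hn y) ?_
    rcases le_total (h c) (h d) with hcd | hcd
    · rw [min_eq_left hcd] at h2
      exact (min_le_left _ _).trans ((hn c).trans (by linarith))
    · rw [min_eq_right hcd] at h2
      exact (min_le_right _ _).trans ((hn d).trans (by linarith))
  have : ((max (n y) (min (n c) (n d)) : ℤ) : ℝ) < ((min (n x) (max (n a) (n b)) + 3 : ℤ) : ℝ) := by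
    push_cast; linarith
  exact_mod_cast this

/-- Length at most `s / √2` means taxicab length at most one grid unit; this is where the constant
`√2` is needed. -/
lemma gx_sub_gy_bound (hs : 0 < s) {x y : ℂ} (h : dist x y ≤ s / √2) :
    |gx o s y - gx o s x| + |gy o s y - gy o s x| ≤ 1 := by
  have h2 : dist x y ^ 2 ≤ s ^ 2 / 2 := by
    calc dist x y ^ 2 ≤ (s / √2) ^ 2 := by gcongr
      _ = s ^ 2 / 2 := by rw [div_pow, Real.sq_sqrt (by norm_num)]
  rw [Complex.dist_eq, Complex.sq_norm, Complex.normSq_apply] at h2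
  simp only [Complex.sub_re, Complex.sub_im] at h2
  have e1 : gx o s y - gx o s x = (y.re - x.re) / s := by unfold gx; ring
  have e2 : gy o s y - gy o s x = (y.im - x.im) / s := by unfold gy; ring
  rw [e1, e2, abs_div, abs_div, abs_of_pos hs, ← add_div, div_le_one hs]
  apply abs_le_of_sq_le_sq' _ hs.le |>.2
  have e3 := sq_abs (y.re - x.re)
  have e4 := sq_abs (y.im - x.im)
  nlinarith [sq_nonneg (|y.re - x.re| - |y.im - x.im|)]

/-- Two grid edges met by a segment of length at most `s / √2`: some of their ends are
close to each other and to both meeting points. -/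
lemma exists_near_ends (hs : 0 < s) {a b c d x y : ℂ} (hab : Near o s a b) (hcd : Near o s c d)
    (hx : x ∈ segment ℝ a b) (hy : y ∈ segment ℝ c d) (hxy : dist x y ≤ s / √2) :
    Near o s x y ∧ ∃ l r, (l = a ∨ l = b) ∧ (r = c ∨ r = d) ∧ Near o s l x ∧ Near o s l y ∧
      Near o s r l ∧ Near o s r x ∧ Near o s r y := by
  have hb := gx_sub_gy_bound (o := o) hs hxy
  have X := Aff.gx o s
  have Y := Aff.gy o s
  have fx := fun z => Int.floor_le (gx o s z)
  have fx' := fun z => Int.lt_floor_add_one (gx o s z)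
  have fy := fun z => Int.floor_le (gy o s z)
  have fy' := fun z => Int.lt_floor_add_one (gy o s z)
  have b1 := abs_le.1 (show |gx o s y - gx o s x| ≤ 1 by linarith [abs_nonneg (gy o s y - gy o s x)])
  have b2 := abs_le.1 (show |gy o s y - gy o s x| ≤ 1 by linarith [abs_nonneg (gx o s y - gx o s x)])
  have p1 := le_abs_self (gx o s y - gx o s x)
  have p2 := neg_abs_le (gx o s y - gx o s x)
  have p3 := le_abs_self (gy o s y - gy o s x)
  have p4 := neg_abs_le (gy o s y - gy o s x)
  have near1 : ∀ u v : ℝ, -1 ≤ v - u → v - u ≤ 1 → -1 ≤ ⌊u⌋ - ⌊v⌋ ∧ ⌊u⌋ - ⌊v⌋ ≤ 1 := by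
    intro u v h1 h2
    have g1 : ⌊u⌋ ≤ ⌊v + 1⌋ := Int.floor_le_floor (by linarith)
    have g2 : ⌊v⌋ ≤ ⌊u + 1⌋ := Int.floor_le_floor (by linarith)
    rw [Int.floor_add_one] at g1 g2
    omega
  have nx := near1 _ _ b1.1 b1.2
  have ny := near1 _ _ b2.1 b2.2
  have segx : ∀ {X : ℂ → ℝ}, Aff X → ∀ {a b z : ℂ}, z ∈ segment ℝ a b →
      min ⌊X a⌋ ⌊X b⌋ ≤ ⌊X z⌋ ∧ ⌊X z⌋ ≤ max ⌊X a⌋ ⌊X b⌋ := fun hX a b z hz =>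
    ⟨hX.floor_ge_seg hz (min_le_left _ _) (min_le_right _ _),
      hX.floor_le_seg hz (le_max_left _ _) (le_max_right _ _)⟩
  -- the diagonal bounds for the sum and, with offset `1`, the difference of the two floors
  have key := cellsClose_of (segx X hx) (segx Y hx) (segx X hy) (segx Y hy)
    (abs_le.1 hab.1) (abs_le.1 hab.2) (abs_le.1 hcd.1) (abs_le.1 hcd.2) nx ny
    (floor_bound (X.add Y) (n := fun z => ⌊gx o s z⌋ + ⌊gy o s z⌋) (e := 0)
      (fun z => by push_cast; linarith [fx z, fy z])
      (fun z => by push_cast; linarith [fx' z, fy' z]) hx hy (by linarith))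
    (floor_bound (X.add Y) (n := fun z => ⌊gx o s z⌋ + ⌊gy o s z⌋) (e := 0)
      (fun z => by push_cast; linarith [fx z, fy z])
      (fun z => by push_cast; linarith [fx' z, fy' z]) hy hx (by linarith))
    (floor_bound (X.add Y.neg) (n := fun z => ⌊gx o s z⌋ - ⌊gy o s z⌋) (e := 1)
      (fun z => by push_cast; linarith [fx z, fy' z])
      (fun z => by push_cast; linarith [fx' z, fy z]) hx hy (by linarith))
    (floor_bound (X.add Y.neg) (n := fun z => ⌊gx o s z⌋ - ⌊gy o s z⌋) (e := 1)
      (fun z => by push_cast; linarith [fx z, fy' z])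
      (fun z => by push_cast; linarith [fx' z, fy z]) hy hx (by linarith))
  refine ⟨⟨abs_le.2 nx, abs_le.2 ny⟩, ?_⟩
  have conv : ∀ l r, (l = a ∨ l = b) → (r = c ∨ r = d) →
      CellsClose ⌊gx o s x⌋ ⌊gy o s x⌋ ⌊gx o s y⌋ ⌊gy o s y⌋ ⌊gx o s l⌋ ⌊gy o s l⌋ ⌊gx o s r⌋
        ⌊gy o s r⌋ → ∃ l r, (l = a ∨ l = b) ∧ (r = c ∨ r = d) ∧ Near o s l x ∧ Near o s l y ∧
      Near o s r l ∧ Near o s r x ∧ Near o s r y := by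
    intro l r hl hr h
    refine ⟨l, r, hl, hr, ?_, ⟨abs_le.2 h.1.1, abs_le.2 h.1.2⟩, ⟨abs_le.2 h.2.2.1, abs_le.2 h.2.2.2⟩,
      ⟨abs_le.2 h.2.1.1, abs_le.2 h.2.1.2⟩, ?_⟩
    · rcases hl with rfl | rfl
      · exact near_seg hx (near_refl _) hab
      · exact near_seg hx hab.symm (near_refl _)
    · rcases hr with rfl | rfl
      · exact near_seg hy (near_refl _) hcd
      · exact near_seg hy hcd.symm (near_refl _)
  rcases key with h | h | h | h
  · exact conv a c (.inl rfl) (.inl rfl) h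
  · exact conv b c (.inr rfl) (.inl rfl) h
  · exact conv a d (.inl rfl) (.inr rfl) h
  · exact conv b d (.inr rfl) (.inr rfl) h

section
variable {V : Finset ℂ} {E : ℂ → ℂ → Prop}

/-- Two edges (or vertices) that see each other along a segment of length at most `s / √2` lie in
the same component. -/
lemma reach_of_short (H : Cfg o s V E) {a b c d x y : ℂ} (ha : a ∈ V) (hb : b ∈ V) (hc : c ∈ V)
    (hd : d ∈ V) (hab : a = b ∨ E a b) (hcd : c = d ∨ E c d)
    (hx : x ∈ segment ℝ a b) (hy : y ∈ segment ℝ c d) (hxy : dist x y ≤ s / √2)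
    (hcl : Clear E x y) : Reach E a c := by
  -- replace an edge by its end if it is met there
  obtain ⟨a', b', ha', hb', hab', hx', hra⟩ : ∃ a' b', a' ∈ V ∧ b' ∈ V ∧
      ((a' = b' ∧ x = a') ∨ (E a' b' ∧ x ∈ openSegment ℝ a' b')) ∧ x ∈ segment ℝ a' b' ∧
      Reach E a a' := by
    by_cases h1 : x = a
    · exact ⟨a, a, ha, ha, .inl ⟨rfl, h1⟩, by simp [h1], .refl⟩
    by_cases h2 : x = b
    · refine ⟨b, b, hb, hb, .inl ⟨rfl, h2⟩, by simp [h2], ?_⟩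
      rcases hab with rfl | h
      · exact .refl
      · exact .single h
    · refine ⟨a, b, ha, hb, .inr ⟨hab.resolve_left ?_, open_of_seg hx h1 h2⟩, hx, .refl⟩
      rintro rfl; simp at hx; exact h1 hx
  obtain ⟨c', d', hc', hd', hcd', hy', hrc⟩ : ∃ a' b', a' ∈ V ∧ b' ∈ V ∧
      ((a' = b' ∧ y = a') ∨ (E a' b' ∧ y ∈ openSegment ℝ a' b')) ∧ y ∈ segment ℝ a' b' ∧
      Reach E c a' := by
    by_cases h1 : y = c
    · exact ⟨c, c, hc, hc, .inl ⟨rfl, h1⟩, by simp [h1], .refl⟩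
    by_cases h2 : y = d
    · refine ⟨d, d, hd, hd, .inl ⟨rfl, h2⟩, by simp [h2], ?_⟩
      rcases hcd with rfl | h
      · exact .refl
      · exact .single h
    · refine ⟨c, d, hc, hd, .inr ⟨hcd.resolve_left ?_, open_of_seg hy h1 h2⟩, hy, .refl⟩
      rintro rfl; simp at hy; exact h1 hy
  have edge : ∀ {a b x : ℂ}, ((a = b ∧ x = a) ∨ (E a b ∧ x ∈ openSegment ℝ a b)) → Near o s a b := by
    intro a b x h
    rcases h with ⟨rfl, -⟩ | ⟨h, -⟩
    · exact near_refl _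
    · exact H.near h
  have pick : ∀ {a b x : ℂ}, a ∈ V → b ∈ V → ((a = b ∧ x = a) ∨ (E a b ∧ x ∈ openSegment ℝ a b)) →
      ∀ l, (l = a ∨ l = b) → l ∈ V ∧ (x = l ∨ ∃ l', E l l' ∧ x ∈ openSegment ℝ l l') ∧
        Reach E a l := by
    intro a b x ha hb h l hl
    rcases h with ⟨rfl, rfl⟩ | ⟨h, hx⟩
    · have : l = x := by tauto
      subst this; exact ⟨ha, .inl rfl, .refl⟩
    · rcases hl with rfl | rfl
      · exact ⟨ha, .inr ⟨b, h, hx⟩, .refl⟩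
      · exact ⟨hb, .inr ⟨a, H.symm h, open_comm hx⟩, .single h⟩
  obtain ⟨nxy, l, r, hl, hr, n1, n2, n3, n4, n5⟩ :=
    exists_near_ends H.hs (edge hab') (edge hcd') hx' hy' hxy
  obtain ⟨hlV, hlx, hlr⟩ := pick ha' hb' hab' l hl
  obtain ⟨hrV, hry, hrr⟩ := pick hc' hd' hcd' r hr
  have := reach_of_clear H hlV hrV hlx hry hcl n1 nxy n2.symm n3 n4 n5
  exact hra.trans (hlr.trans (this.trans ((H.reach_symm hrr).trans (H.reach_symm hrc))))

/-- Two edges (or vertices) of a plane graph that meet lie in the same component. -/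
lemma reach_of_meet (H : Cfg o s V E) {a b c d x : ℂ} (ha : a ∈ V) (hb : b ∈ V) (hc : c ∈ V)
    (hd : d ∈ V) (hab : a = b ∨ E a b) (hcd : c = d ∨ E c d)
    (hx : x ∈ segment ℝ a b) (hy : x ∈ segment ℝ c d) : Reach E a c :=
  reach_of_short H ha hb hc hd hab hcd hx hy
    (by rw [dist_self]; have := H.hs; positivity) (fun c d _ z _ _ => by simp)

/-- A segment of length at most `s / √2` between two vertices stays in one component: its ends and
all the edges it touches belong to the same component. -/
lemma reach_of_touch (H : Cfg o s V E) {u v : ℂ} (hu : u ∈ V)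
    (huv : dist u v ≤ s / √2) {a b z : ℂ} (ha : a ∈ V) (hb : b ∈ V) (hab : a = b ∨ E a b)
    (hz : z ∈ segment ℝ a b) (hz' : z ∈ segment ℝ u v) : Reach E u a := by
  classical
  by_contra hbad
  let item : ℂ × ℂ → Prop := fun p => p.1 = p.2 ∨ E p.1 p.2
  let hit : ℂ × ℂ → Set ℝ := fun p => {t | pt u v t ∈ segment ℝ p.1 p.2}
  have hcont : Continuous (pt u v) := by unfold pt; fun_prop
  have hclosed : ∀ p, IsClosed (hit p) := fun p =>
    (show IsClosed (segment ℝ p.1 p.2) by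
      rw [segment_eq_image]
      exact (isCompact_Icc.image (by fun_prop)).isClosed).preimage hcont
  -- the first parameter at which an item outside the component of `u` is touched
  let Bad : Set ℝ := Icc 0 1 ∩ ⋃ p ∈ (V ×ˢ V).filter (fun p => item p ∧ ¬ Reach E u p.1), hit p
  have hBc : IsCompact Bad := by
    refine isCompact_Icc.inter_right ?_
    exact (Finset.finite_toSet _).isClosed_biUnion fun p _ => hclosed p
  obtain ⟨t₀, h0, h1, rfl⟩ := mem_seg.1 hz'
  have hBn : Bad.Nonempty := ⟨t₀, ⟨h0, h1⟩, mem_iUnion₂.2 ⟨(a, b), by simp [ha, hb, item, hab, hbad],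
    hz⟩⟩
  obtain ⟨t, ⟨⟨ht0, ht1⟩, htB⟩, htmin⟩ := hBc.exists_isLeast hBn
  -- the last parameter before it at which an item of the component is touched
  let Good : Set ℝ := Icc 0 t ∩ ⋃ p ∈ (V ×ˢ V).filter (fun p => item p ∧ Reach E u p.1), hit p
  have hGc : IsCompact Good := by
    refine isCompact_Icc.inter_right ?_
    exact (Finset.finite_toSet _).isClosed_biUnion fun p _ => hclosed p
  have hGn : Good.Nonempty := ⟨0, ⟨le_rfl, ht0⟩, mem_iUnion₂.2 ⟨(u, u), by
    simp [hu, item, Relation.ReflTransGen.refl], by simp [hit]⟩⟩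
  obtain ⟨r, ⟨⟨hr0, hrt⟩, hrG⟩, hrmax⟩ := hGc.exists_isGreatest hGn
  obtain ⟨⟨c, d⟩, hcd, hct⟩ := mem_iUnion₂.1 htB
  obtain ⟨⟨e, f⟩, hef, her⟩ := mem_iUnion₂.1 hrG
  simp only [Finset.mem_filter, Finset.mem_product, item] at hcd hef
  -- between the two nothing is touched, so the two items see each other
  refine hcd.2.2 (hef.2.2.trans (reach_of_short H hef.1.1 hef.1.2 hcd.1.1 hcd.1.2 hef.2.1 hcd.2.1
    her hct ?_ ?_))
  · refine le_trans ?_ huv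
    rw [dist_eq_norm, dist_comm, dist_eq_norm]
    have : pt u v r - pt u v t = (r - t) • (v - u) := by unfold pt; module
    rw [this, norm_smul]
    have : ‖r - t‖ ≤ 1 := by rw [Real.norm_eq_abs, abs_le]; constructor <;> linarith
    nlinarith [norm_nonneg (v - u)]
  · intro g k hgk w hw hw'
    exfalso
    obtain ⟨q, q0, q1, rfl⟩ := mem_open.1 hw
    have hq : pt (pt u v r) (pt u v t) q = pt u v (r + q * (t - r)) := by
      apply Complex.ext <;> simp only [pt_re, pt_im] <;> ring
    rw [hq] at hw'
    have hrt' : r < t := by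
      refine lt_of_le_of_ne hrt ?_
      rintro rfl
      exact hcd.2.2 (hef.2.2.trans (reach_of_meet H hef.1.1 hef.1.2 hcd.1.1 hcd.1.2 hef.2.1 hcd.2.1
        her hct))
    have l1 : r < r + q * (t - r) := by nlinarith
    have l2 : r + q * (t - r) < t := by nlinarith
    by_cases hg : Reach E u g
    · refine absurd (hrmax (a := r + q * (t - r)) ⟨⟨by linarith, l2.le⟩, mem_iUnion₂.2 ⟨(g, k), ?_,
        open_sub_seg hw'⟩⟩) (not_le.2 l1)
      simp [item, H.mem hgk, H.mem' hgk, hgk, hg]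
    · refine absurd (htmin (a := r + q * (t - r)) ⟨⟨by linarith, by linarith⟩, mem_iUnion₂.2
        ⟨(g, k), ?_, open_sub_seg hw'⟩⟩) (not_le.2 l2)
      simp [item, H.mem hgk, H.mem' hgk, hgk, hg]

end

/-! ### Corners and walks -/

variable {o : ℂ} {s : ℝ}

/-- The neighbour `w` of `v` is the first one that is met when rotating counterclockwise about `v`
from the direction of `u`, expressed by orientations: a neighbour `x` that lies strictly between
the directions of `u` and `w` does not exist. -/
def Corner (E : ℂ → ℂ → Prop) (u v w : ℂ) : Prop :=
  ∀ x, E v x → (0 < orient v u x → 0 < orient v u w ∧ orient v x w ≤ 0) ∧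
    (0 < orient v x w → 0 < orient v u w ∧ orient v u x ≤ 0)

/-- A bi-infinite walk along a face boundary, with the face on the right. -/
structure IsWalk (E : ℂ → ℂ → Prop) (τ : ℤ → ℂ) : Prop where
  adj : ∀ i, E (τ i) (τ (i + 1))
  corner : ∀ i, Corner E (τ i) (τ (i + 1)) (τ (i + 2))

/-- The open segment `p q` is disjoint from the drawing. -/
def Free (V : Finset ℂ) (E : ℂ → ℂ → Prop) (p q : ℂ) : Prop :=
  (∀ v ∈ V, v ∉ openSegment ℝ p q) ∧
    ∀ a b, E a b → ∀ z ∈ openSegment ℝ p q, z ∉ segment ℝ a b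

section
variable {V : Finset ℂ} {E : ℂ → ℂ → Prop}

/-- The Plücker relation for directions about `v`, the source of all comparisons of three or more
directions below. -/
lemma plucker (v a b c d : ℂ) : orient v a b * orient v c d - orient v a c * orient v b d +
    orient v a d * orient v b c = 0 := by unfold orient; ring

lemma wedge_exit {c a b u : ℂ} (h : 0 < orient c a b) (h1 : 0 < orient c a u)
    (h2 : 0 < orient c u b) :
    u ∈ Tri c a b ∨ ∃ z ∈ openSegment ℝ c u, z ∈ openSegment ℝ a b := by
  by_cases hu : 0 ≤ orient a b u
  · exact .inl (mem_Tri_of h h1.le hu (by rw [← orient_rot]; exact h2.le))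
  right
  push Not at hu
  have hc : 0 < orient a b c := by rw [orient_rot]; exact h
  set t := orient a b c / (orient a b c - orient a b u) with ht
  have hd : 0 < orient a b c - orient a b u := by linarith
  have t0 : 0 < t := div_pos hc hd
  have t1 : t < 1 := by rw [ht, div_lt_one hd]; linarith
  have hz : orient a b (pt c u t) = 0 := by
    rw [(Aff.orient_right a b).pt, ht]; field_simp; ring
  have hz1 : orient c a (pt c u t) = t * orient c a u := by
    rw [(Aff.orient_right c a).pt]; simp
  have hz2 : orient c (pt c u t) b = t * orient c u b := by
    rw [(Aff.orient_mid c b).pt]; simp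
  have hzT : pt c u t ∈ Tri c a b := mem_Tri_of h (by rw [hz1]; positivity) hz.ge
    (by rw [← orient_rot, hz2]; positivity)
  refine ⟨_, mem_open.2 ⟨t, t0, t1, rfl⟩, open_of_seg (mem_seg_of_Tri hc.ne' (Tri_rot hzT) hz) ?_ ?_⟩
  · intro e; rw [e] at hz1; simp at hz1
    rcases hz1 with h | h <;> linarith
  · intro e; rw [e] at hz2; simp at hz2
    rcases hz2 with h | h <;> linarith

lemma IsWalk.adj' {τ : ℤ → ℂ} (W : IsWalk E τ) (i : ℤ) : E (τ (i - 1)) (τ i) := by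
  have := W.adj (i - 1); rwa [sub_add_cancel] at this
lemma IsWalk.corner' {τ : ℤ → ℂ} (W : IsWalk E τ) (i : ℤ) :
    Corner E (τ (i - 1)) (τ i) (τ (i + 1)) := by
  have := W.corner (i - 1)
  rwa [sub_add_cancel, show i - 1 + 2 = i + 1 by ring] at this

/-- At a reflex corner no neighbour lies to the left of either side. -/
lemma Corner.of_reflex {u v w : ℂ} (h : Corner E u v w) (hr : orient v u w ≤ 0) {x : ℂ}
    (hx : E v x) : orient v u x ≤ 0 ∧ orient v x w ≤ 0 := by
  constructor
  · by_contra hc; have := ((h x hx).1 (not_le.1 hc)).1; linarith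
  · by_contra hc; have := ((h x hx).2 (not_le.1 hc)).1; linarith

lemma Corner.unique (H : Cfg o s V E) {u v w w' : ℂ} (hw : E v w) (hw' : E v w')
    (h : Corner E u v w) (h' : Corner E u v w') : w = w' := by
  have h0 : orient v w' w = 0 := by
    apply le_antisymm
    · by_contra hc; push Not at hc
      have h1 := (h w' hw').2 hc
      have h2 := (h' w hw).1 h1.1
      linarith
    · by_contra hc; push Not at hc
      have hc' : 0 < orient v w w' := by rw [orient_swap']; linarith
      have h1 := (h' w hw).2 hc'
      have h2 := (h w' hw').1 h1.1
      linarith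
  rcases H.eq_of_orient (H.mem hw) (H.mem' hw') (H.mem' hw) (H.ne hw') h0 with e | e
  · exact absurd e.symm (H.ne hw)
  · exact e

/-- A walk is determined by two consecutive vertices. -/
lemma IsWalk.shift (H : Cfg o s V E) {τ : ℤ → ℂ} (W : IsWalk E τ) {i j : ℤ} (h0 : τ i = τ j)
    (h1 : τ (i + 1) = τ (j + 1)) (n : ℕ) : τ (i + n) = τ (j + n) := by
  have : ∀ n : ℕ, τ (i + n) = τ (j + n) ∧ τ (i + n + 1) = τ (j + n + 1) := by
    intro n
    induction n with
    | zero => simpa using ⟨h0, h1⟩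
    | succ n ih =>
      push_cast
      refine ⟨by rw [← add_assoc, ← add_assoc]; exact ih.2, ?_⟩
      have c1 := W.corner (i + n)
      have c2 := W.corner (j + n)
      have a1 := W.adj (i + n + 1)
      have a2 := W.adj (j + n + 1)
      rw [show i + (n : ℤ) + 1 + 1 = i + n + 2 by ring] at a1
      rw [show j + (n : ℤ) + 1 + 1 = j + n + 2 by ring] at a2
      rw [show i + ((n : ℤ) + 1) + 1 = i + n + 2 by ring,
        show j + ((n : ℤ) + 1) + 1 = j + n + 2 by ring]
      rw [← ih.1, ← ih.2] at c2
      rw [← ih.2] at a2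
      exact c1.unique H a1 a2 c2
  exact (this n).1

lemma Free.symm {p q : ℂ} (h : Free V E p q) : Free V E q p :=
  ⟨fun v hv hz => h.1 v hv (open_comm hz), fun a b hE z hz => h.2 a b hE z (open_comm hz)⟩

lemma Free.clear {p q : ℂ} (h : Free V E p q) : Clear E p q := fun c d hcd z hz hz' =>
  absurd (open_sub_seg hz') (h.2 c d hcd z hz)

lemma pt_mem_open {p q : ℂ} {t : ℝ} (h0 : 0 < t) (h1 : t < 1) : pt p q t ∈ openSegment ℝ p q :=
  mem_open.2 ⟨t, h0, h1, rfl⟩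
lemma pt_mem_seg {p q : ℂ} {t : ℝ} (h0 : 0 ≤ t) (h1 : t ≤ 1) : pt p q t ∈ segment ℝ p q :=
  mem_seg.2 ⟨t, h0, h1, rfl⟩

end

/-! ### Cell arithmetic for points of a triangle -/

lemma cell_tri {a b c z : ℂ} (hz : z ∈ Tri a b c) :
    (min (min ⌊gx o s a⌋ ⌊gx o s b⌋) ⌊gx o s c⌋ ≤ ⌊gx o s z⌋ ∧
      ⌊gx o s z⌋ ≤ max (max ⌊gx o s a⌋ ⌊gx o s b⌋) ⌊gx o s c⌋) ∧
    (min (min ⌊gy o s a⌋ ⌊gy o s b⌋) ⌊gy o s c⌋ ≤ ⌊gy o s z⌋ ∧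
      ⌊gy o s z⌋ ≤ max (max ⌊gy o s a⌋ ⌊gy o s b⌋) ⌊gy o s c⌋) :=
  ⟨⟨(Aff.gx o s).floor_ge_tri hz (by simp) (by simp) (by simp),
    (Aff.gx o s).floor_le_tri hz (by simp) (by simp) (by simp)⟩,
  ⟨(Aff.gy o s).floor_ge_tri hz (by simp) (by simp) (by simp),
    (Aff.gy o s).floor_le_tri hz (by simp) (by simp) (by simp)⟩⟩

/-- The sum and the difference of column and row are convex up to an error of one. -/
lemma cell_tri_diag {a b c z : ℂ} (hz : z ∈ Tri a b c) :
    (min (min (⌊gx o s a⌋ + ⌊gy o s a⌋) (⌊gx o s b⌋ + ⌊gy o s b⌋)) (⌊gx o s c⌋ + ⌊gy o s c⌋) ≤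
        ⌊gx o s z⌋ + ⌊gy o s z⌋ + 1 ∧ ⌊gx o s z⌋ + ⌊gy o s z⌋ ≤
      max (max (⌊gx o s a⌋ + ⌊gy o s a⌋) (⌊gx o s b⌋ + ⌊gy o s b⌋)) (⌊gx o s c⌋ + ⌊gy o s c⌋) + 1) ∧
    (min (min (⌊gx o s a⌋ - ⌊gy o s a⌋) (⌊gx o s b⌋ - ⌊gy o s b⌋)) (⌊gx o s c⌋ - ⌊gy o s c⌋) ≤
        ⌊gx o s z⌋ - ⌊gy o s z⌋ + 1 ∧ ⌊gx o s z⌋ - ⌊gy o s z⌋ ≤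
      max (max (⌊gx o s a⌋ - ⌊gy o s a⌋) (⌊gx o s b⌋ - ⌊gy o s b⌋)) (⌊gx o s c⌋ - ⌊gy o s c⌋) + 1)
    := by
  have fx := fun z => Int.floor_le (gx o s z)
  have fx' := fun z => Int.lt_floor_add_one (gx o s z)
  have fy := fun z => Int.floor_le (gy o s z)
  have fy' := fun z => Int.lt_floor_add_one (gy o s z)
  -- a functional with values in a strip of width two about the integer-valued function `n`
  have key : ∀ {h : ℂ → ℝ} {n : ℂ → ℤ} {e : ℝ}, Aff h → (∀ z, (n z : ℝ) ≤ h z + e) →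
      (∀ z, h z + e < n z + 2) → min (min (n a) (n b)) (n c) ≤ n z + 1 ∧
        n z ≤ max (max (n a) (n b)) (n c) + 1 := by
    intro h n e hh h1 h2
    obtain ⟨m, hm⟩ : ∃ m, m = min (min (n a) (n b)) (n c) := ⟨_, rfl⟩
    obtain ⟨M, hM⟩ : ∃ M, M = max (max (n a) (n b)) (n c) := ⟨_, rfl⟩
    rw [← hm, ← hM]
    have ha : (m : ℝ) ≤ n a := by exact_mod_cast (by omega : m ≤ n a)
    have hb : (m : ℝ) ≤ n b := by exact_mod_cast (by omega : m ≤ n b)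
    have hc : (m : ℝ) ≤ n c := by exact_mod_cast (by omega : m ≤ n c)
    have ha' : (n a : ℝ) ≤ M := by exact_mod_cast (by omega : n a ≤ M)
    have hb' : (n b : ℝ) ≤ M := by exact_mod_cast (by omega : n b ≤ M)
    have hc' : (n c : ℝ) ≤ M := by exact_mod_cast (by omega : n c ≤ M)
    have k1 := (hh.add_const (e - m)).nonneg_tri hz (by linarith [h1 a]) (by linarith [h1 b])
      (by linarith [h1 c])
    have k2 := (hh.neg.add_const (M + 2 - e)).pos_tri hz (by linarith [h2 a]) (by linarith [h2 b])
      (by linarith [h2 c])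
    constructor
    · have : (m : ℝ) < ((n z + 2 : ℤ) : ℝ) := by push_cast; linarith [h2 z]
      have := Int.cast_lt.1 this; omega
    · have : ((n z : ℤ) : ℝ) < ((M + 2 : ℤ) : ℝ) := by push_cast; linarith [h1 z]
      have := Int.cast_lt.1 this; omega
  exact ⟨key (n := fun z => ⌊gx o s z⌋ + ⌊gy o s z⌋) (e := 0) ((Aff.gx o s).add (Aff.gy o s))
      (fun z => by push_cast; linarith [fx z, fy z])
      (fun z => by push_cast; linarith [fx' z, fy' z]),
    key (n := fun z => ⌊gx o s z⌋ - ⌊gy o s z⌋) (e := 1) ((Aff.gx o s).add (Aff.gy o s).neg)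
      (fun z => by push_cast; linarith [fx z, fy' z])
      (fun z => by push_cast; linarith [fx' z, fy z])⟩

lemma not_near_iff {a b : ℂ} : ¬ Near o s a b ↔
    (⌊gx o s a⌋ + 1 < ⌊gx o s b⌋ ∨ ⌊gx o s b⌋ + 1 < ⌊gx o s a⌋) ∨
    (⌊gy o s a⌋ + 1 < ⌊gy o s b⌋ ∨ ⌊gy o s b⌋ + 1 < ⌊gy o s a⌋) := by
  rw [near_iff, abs_le, abs_le]; omega

lemma near_int {a b : ℂ} : Near o s a b ↔
    (⌊gx o s a⌋ ≤ ⌊gx o s b⌋ + 1 ∧ ⌊gx o s b⌋ ≤ ⌊gx o s a⌋ + 1) ∧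
    (⌊gy o s a⌋ ≤ ⌊gy o s b⌋ + 1 ∧ ⌊gy o s b⌋ ≤ ⌊gy o s a⌋ + 1) := by
  rw [near_iff, abs_le, abs_le]; omega

/-- If two vertices of a triangle are close to the third one, then every point of the triangle is
close to one of the two. -/
lemma near_or_near {c p q w : ℂ} (hp : Near o s c p) (hq : Near o s c q) (hw : w ∈ Tri p c q) :
    Near o s w p ∨ Near o s w q := by
  have h1 := cell_tri (o := o) (s := s) hw
  have h2 := cell_tri_diag (o := o) (s := s) hw
  by_contra hc
  push Not at hc
  rw [near_int] at hp hq
  have hc1 := not_near_iff.1 hc.1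
  have hc2 := not_near_iff.1 hc.2
  generalize ⌊gx o s c⌋ = cx at *
  generalize ⌊gx o s p⌋ = px at *
  generalize ⌊gx o s q⌋ = qx at *
  generalize ⌊gx o s w⌋ = wx at *
  generalize ⌊gy o s c⌋ = cy at *
  generalize ⌊gy o s p⌋ = py at *
  generalize ⌊gy o s q⌋ = qy at *
  generalize ⌊gy o s w⌋ = wy at *
  obtain ⟨h1x, h1y⟩ := h1
  -- a coordinate in which `w` is far from `p` takes its extreme values at `p` and `q`
  have far : ∀ {px cx qx wx : ℤ}, min (min px cx) qx ≤ wx ∧ wx ≤ max (max px cx) qx →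
      cx ≤ px + 1 ∧ px ≤ cx + 1 → cx ≤ qx + 1 ∧ qx ≤ cx + 1 →
      (wx + 1 < px ∨ px + 1 < wx) → (px = cx + 1 ∧ qx = cx - 1 ∧ wx = cx - 1) ∨
        (px = cx - 1 ∧ qx = cx + 1 ∧ wx = cx + 1) := by intros; omega
  have far' : ∀ {px cx qx wx : ℤ}, min (min px cx) qx ≤ wx ∧ wx ≤ max (max px cx) qx →
      cx ≤ px + 1 ∧ px ≤ cx + 1 → cx ≤ qx + 1 ∧ qx ≤ cx + 1 →
      (wx + 1 < qx ∨ qx + 1 < wx) → (qx = cx + 1 ∧ px = cx - 1 ∧ wx = cx - 1) ∨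
        (qx = cx - 1 ∧ px = cx + 1 ∧ wx = cx + 1) := by intros; omega
  -- far in the same coordinate from both ends is impossible, and the mixed cases contradict the
  -- convexity of the diagonal coordinates
  rcases hc1 with h | h
  · rcases hc2 with h' | h'
    · have a1 := far h1x hp.1 hq.1 h
      clear * - a1 h'; omega
    · have a1 := far h1x hp.1 hq.1 h
      have a2 := far' h1y hp.2 hq.2 h'
      clear * - a1 a2 h2
      rcases a1 with ⟨rfl, rfl, rfl⟩ | ⟨rfl, rfl, rfl⟩ <;>
      rcases a2 with ⟨rfl, rfl, rfl⟩ | ⟨rfl, rfl, rfl⟩ <;> omega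
  · rcases hc2 with h' | h'
    · have a1 := far h1y hp.2 hq.2 h
      have a2 := far' h1x hp.1 hq.1 h'
      clear * - a1 a2 h2
      rcases a1 with ⟨rfl, rfl, rfl⟩ | ⟨rfl, rfl, rfl⟩ <;>
      rcases a2 with ⟨rfl, rfl, rfl⟩ | ⟨rfl, rfl, rfl⟩ <;> omega
    · have a1 := far h1y hp.2 hq.2 h
      clear * - a1 h'; omega

/-- Suppose that `p` and `q` are close to `c`, that the point `r` lies between `c` and a point
`w` of the segment `p q`, and that `r` is far from `q`. Then the triangle `p w r` is small. -/
lemma near_corner {c p q w r : ℂ} (hp : Near o s c p) (hq : Near o s c q)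
    (hw : w ∈ segment ℝ p q) (hr : r ∈ segment ℝ w c) (hrq : ¬ Near o s r q) :
    Near o s p w ∧ Near o s w r ∧ Near o s r p := by
  have w1 := cell_tri (o := o) (s := s) (Tri_of_seg p hw)
  have w2 := cell_tri_diag (o := o) (s := s) (Tri_of_seg p hw)
  have r1 := cell_tri (o := o) (s := s) (Tri_of_seg w hr)
  rw [not_near_iff] at hrq
  simp only [near_int] at *
  generalize ⌊gx o s c⌋ = cx at *
  generalize ⌊gx o s p⌋ = px at *
  generalize ⌊gx o s q⌋ = qx at *
  generalize ⌊gx o s w⌋ = wx at *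
  generalize ⌊gx o s r⌋ = rx at *
  generalize ⌊gy o s c⌋ = cy at *
  generalize ⌊gy o s p⌋ = py at *
  generalize ⌊gy o s q⌋ = qy at *
  generalize ⌊gy o s w⌋ = wy at *
  generalize ⌊gy o s r⌋ = ry at *
  obtain ⟨w1x, w1y⟩ := w1
  obtain ⟨r1x, r1y⟩ := r1
  -- a coordinate in which `r` is far from `q` is determined completely
  have far : ∀ {px cx qx wx rx : ℤ}, min (min px qx) px ≤ wx ∧ wx ≤ max (max px qx) px →
      min (min wx cx) wx ≤ rx ∧ rx ≤ max (max wx cx) wx →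
      cx ≤ px + 1 ∧ px ≤ cx + 1 → cx ≤ qx + 1 ∧ qx ≤ cx + 1 →
      (rx + 1 < qx ∨ qx + 1 < rx) → (qx = cx + 1 ∧ px = cx - 1 ∧ wx = cx - 1 ∧ rx = cx - 1) ∨
        (qx = cx - 1 ∧ px = cx + 1 ∧ wx = cx + 1 ∧ rx = cx + 1) := by intros; omega
  -- the other coordinate is harmless, unless it changes by two between `p` and `q`
  have other : ∀ {px cx qx wx rx : ℤ}, min (min px qx) px ≤ wx ∧ wx ≤ max (max px qx) px →
      min (min wx cx) wx ≤ rx ∧ rx ≤ max (max wx cx) wx →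
      cx ≤ px + 1 ∧ px ≤ cx + 1 → cx ≤ qx + 1 ∧ qx ≤ cx + 1 →
      ((px ≤ wx + 1 ∧ wx ≤ px + 1) ∧ (wx ≤ rx + 1 ∧ rx ≤ wx + 1) ∧ (rx ≤ px + 1 ∧ px ≤ rx + 1)) ∨
      (px = cx + 1 ∧ qx = cx - 1 ∧ wx = cx - 1) ∨ (px = cx - 1 ∧ qx = cx + 1 ∧ wx = cx + 1) := by
    intros; omega
  rcases hrq with h | h
  · have a1 := far w1x r1x hp.1 hq.1 h
    have a2 := other w1y r1y hp.2 hq.2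
    clear * - a1 a2 w2
    rcases a1 with ⟨rfl, rfl, rfl, rfl⟩ | ⟨rfl, rfl, rfl, rfl⟩ <;>
    rcases a2 with h | ⟨rfl, rfl, rfl⟩ | ⟨rfl, rfl, rfl⟩ <;>
    first | (clear w2; omega) | omega
  · have a1 := far w1y r1y hp.2 hq.2 h
    have a2 := other w1x r1x hp.1 hq.1
    clear * - a1 a2 w2
    rcases a1 with ⟨rfl, rfl, rfl, rfl⟩ | ⟨rfl, rfl, rfl, rfl⟩ <;>
    rcases a2 with h | ⟨rfl, rfl, rfl⟩ | ⟨rfl, rfl, rfl⟩ <;>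
    first | (clear w2; omega) | omega

/-! ### The fan of a chain -/

/-- A chain `τ k, …, τ c, τ (c + 1)` along a face with the face on its right: all vertices strictly
between `τ k` and `τ c` are reflex, `τ c` is convex and close to `τ k`, and the two ends
`τ k`, `τ (c + 1)` see each other inside the face, on the right hand side of the chain. -/
structure LeftChain (o : ℂ) (s : ℝ) (V : Finset ℂ) (E : ℂ → ℂ → Prop) (τ : ℤ → ℂ) (k c : ℤ) :
    Prop where
  cfg : Cfg o s V E
  walk : IsWalk E τ
  lt : k < c
  conv : 0 < orient (τ c) (τ (c - 1)) (τ (c + 1))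
  refl : ∀ i, k < i → i < c → orient (τ i) (τ (i - 1)) (τ (i + 1)) ≤ 0
  pos : 0 < orient (τ k) (τ (c + 1)) (τ c)
  near : Near o s (τ c) (τ k)
  free : Free V E (τ k) (τ (c + 1))
  left : Corner E (τ (c + 1)) (τ k) (τ (k + 1))
  right : Corner E (τ k) (τ (c + 1)) (τ (c + 2))

section
variable {o : ℂ} {s : ℝ} {V : Finset ℂ} {E : ℂ → ℂ → Prop} {τ : ℤ → ℂ} {k c : ℤ}

lemma IsWalk.mem (H : Cfg o s V E) (W : IsWalk E τ) (i : ℤ) : τ i ∈ V := H.mem (W.adj i)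

namespace LeftChain

/-- No edge at the last vertex enters the triangle spanned by the base and the convex vertex. -/
lemma wedge_right (L : LeftChain o s V E τ k c) {x : ℂ} (hx : E (τ (c + 1)) x)
    (h1 : 0 < orient (τ (c + 1)) (τ c) x) (h2 : 0 < orient (τ (c + 1)) x (τ k)) : False := by
  have hc := L.walk.corner c x hx
  have hE : E (τ (c + 1)) (τ c) := L.cfg.symm (L.walk.adj c)
  have hr := L.right (τ c) hE
  have a1 := hc.1 h1
  have a2 := hr.2 a1.1
  have pos : 0 < orient (τ (c + 1)) (τ c) (τ k) := by rw [orient_rot]; exact L.pos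
  have := plucker (τ (c + 1)) (τ c) x (τ k) (τ (c + 2))
  nlinarith [mul_pos h1 a2.1, mul_pos a1.1 h2]

lemma base_ne (L : LeftChain o s V E τ k c) : τ k ≠ τ (c + 1) := by
  intro h; have := L.pos; rw [h] at this; simp at this
lemma apex_ne (L : LeftChain o s V E τ k c) : τ k ≠ τ c := by
  intro h; have := L.pos; rw [h] at this; simp at this

/-- The first ray from the apex `c`, turning from the side `c q` into the triangle, that meets a
vertex: it meets the predecessor of `c` on the walk and ends on the base. -/
lemma exists_frame (L : LeftChain o s V E τ k c) : ∃ t ρ : ℝ, 0 ≤ t ∧ t < 1 ∧ 0 ≤ ρ ∧ ρ < 1 ∧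
    τ (c - 1) = pt (pt (τ k) (τ (c + 1)) t) (τ c) ρ ∧
    (∀ v ∈ V, v ∈ Tri (τ (c + 1)) (pt (τ k) (τ (c + 1)) t) (τ c) →
      v = τ (c + 1) ∨ v = τ c ∨ v = τ (c - 1)) ∧
    Clear E (pt (τ k) (τ (c + 1)) t) (τ c) := by
  have H := L.cfg
  have W := L.walk
  set p := τ k with hp
  set q := τ (c + 1) with hq
  set a := τ c with ha
  have hpV : p ∈ V := W.mem H k
  have hqV : q ∈ V := W.mem H (c + 1)
  have haV : a ∈ V := W.mem H c
  have pos : 0 < orient p q a := L.pos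
  have hcq : E a q := W.adj c
  set S : Set ℂ := {v | v ∈ V ∧ v ∈ Tri p q a ∧ v ≠ a ∧ v ≠ q} with hS
  have hSf : S.Finite := (V.finite_toSet).subset fun v hv => hv.1
  -- `r` is the first vertex met by the turning ray, and `w` is the point where the ray meets the
  -- base
  obtain ⟨r, hr, w, hw, hrw, hmax⟩ := exists_first_ray (l := p) (x := q) (y := a) hSf
    ⟨hpV, left_mem_Tri _ _ _, L.apex_ne, L.base_ne⟩ (fun v hv => hv.2.1) (fun h => h.2.2.1 rfl)
  have hmax' : ∀ v ∈ S, orient a r v ≤ 0 := fun v hv => by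
    have := hmax v hv; by_contra hc; push Not at hc; nlinarith
  obtain ⟨t, t0, t1, rfl⟩ := mem_seg.1 (seg_comm hw)
  obtain ⟨ρ, ρ0, ρ1, hrρ⟩ := mem_seg.1 hrw
  have hρ1 : ρ < 1 := lt_of_le_of_ne ρ1 (by rintro rfl; rw [pt_one] at hrρ; exact hr.2.2.1 hrρ)
  have ht1 : t < 1 := by
    refine lt_of_le_of_ne t1 ?_
    rintro rfl
    rw [pt_one] at hrw
    rcases H.eq_of_orient hqV haV hr.1 (H.ne hcq).symm (orient_open hrw) with h | h
    · exact hr.2.2.2 h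
    · exact hr.2.2.1 h
  set w := pt p q t with hwdef
  have e1 : orient w a q = -((1 - t) * orient p q a) := by
    rw [hwdef]; unfold orient; simp only [pt_re, pt_im]; ring
  have e1' : orient w a q < 0 := by rw [e1]; nlinarith
  have e2 : ∀ v, orient a r v = -((1 - ρ) * orient w a v) := by
    intro v; rw [hrρ]; unfold orient; simp only [pt_re, pt_im]; ring
  have hwT : w ∈ Tri p q a := seg_sub_Tri (mid_mem_Tri _ _ _) (left_mem_Tri _ _ _) hw
  -- up to `q`, the swept triangle contains only vertices on its last side
  have line : ∀ v ∈ V, v ∈ Tri w a q → v = q ∨ orient w a v = 0 := by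
    intro v hv hvT
    by_cases hvq : v = q
    · exact .inl hvq
    by_cases hva : v = a
    · right; rw [hva]; simp
    right
    have hvS : v ∈ S := ⟨hv, Tri_subset hwT (right_mem_Tri _ _ _) (mid_mem_Tri _ _ _) hvT, hva, hvq⟩
    have h1 := hmax' v hvS
    rw [e2] at h1
    have h2 := (Aff.orient_right w a).neg.nonneg_tri hvT (by simp) (by simp) (by linarith)
    have : 0 < 1 - ρ := by linarith
    nlinarith
  have hqo : ∀ z ∈ openSegment ℝ w a, 0 < orient q a z ∧ 0 < orient q z p := by
    intro z hz
    constructor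
    · refine (Aff.orient_right q a).pos_open hz ?_ (by simp) (.inl ?_)
      · rw [orient_swap'' w a q]; linarith
      · rw [orient_swap'' w a q]; linarith
    · have e3 : orient q w p = 0 := by
        rw [hwdef]; unfold orient; simp only [pt_re, pt_im]; ring
      have e4 : orient q a p = orient p q a := by unfold orient; ring
      refine (Aff.orient_mid q p).pos_open hz e3.ge (by rw [e4]; exact pos.le)
        (.inr (by rw [e4]; exact pos.ne'))
  have hclear : Clear E w a := by
    refine clear_of_empty H e1'.ne (L.free.clear.sub (pt_mem_seg t0 t1) (right_mem_segment _ _ _))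
      (H.clear_edge (H.symm hcq)) line ?_
    intro g k' hgk hqg z hz hz'
    have hzq := hqo z hz
    have key : ∀ k', E q k' → z ∈ openSegment ℝ q k' → False := by
      intro k' hk hz'
      obtain ⟨r', r0, r1, rfl⟩ := mem_open.1 hz'
      have f1 : orient q a (pt q k' r') = r' * orient q a k' := by
        unfold orient; simp only [pt_re, pt_im]; ring
      have f2 : orient q (pt q k' r') p = r' * orient q k' p := by
        unfold orient; simp only [pt_re, pt_im]; ring
      rw [f1, f2] at hzq
      exact L.wedge_right hk (by by_contra hc; nlinarith) (by by_contra hc; nlinarith)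
    by_cases hg : q = g
    · subst hg; exact key k' hgk hz'
    by_cases hk : q = k'
    · subst hk; exact key g (H.symm hgk) (open_comm hz')
    exact H.not_mem_open hgk hqV (open_of_seg hqg hg hk)
  have hrT : r ∈ Tri p q a := hr.2.1
  have hnr : Near o s a r := near_tri hrT L.near (H.near hcq) (near_refl _)
  have hra : r ≠ a := hr.2.2.1
  -- `r` is close to `a` and seen by it, hence joined to it by maximality
  have hrE : E a r := H.edge_of_clear haV hr.1 hra.symm hnr
    ((hclear.sub hrw (right_mem_segment _ _ _)).symm)
  -- the corner at `a` identifies `r` as the predecessor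
  have huE : E a (τ (c - 1)) := H.symm (W.adj' c)
  have hcor := W.corner' c r hrE
  have hrq : 0 < orient a r q := by rw [e2]; nlinarith
  have h1 := (hcor.2 hrq).2
  have hur : τ (c - 1) = r := by
    have h0 : orient a r (τ (c - 1)) = 0 := by
      refine le_antisymm ?_ (by rw [orient_swap']; linarith)
      by_contra hc
      push Not at hc
      have hwu : 0 < orient a w (τ (c - 1)) := by
        have := e2 (τ (c - 1)); rw [orient_swap]
        have : 0 < 1 - ρ := by linarith
        by_contra hcon; nlinarith
      rcases wedge_exit (c := a) (a := w) (b := q) (by rw [orient_swap]; linarith) hwu L.conv with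
        h | ⟨z, hz, hz'⟩
      · rcases line _ (W.mem H _) (Tri_swap h) with h | h
        · have := L.conv; rw [h, ← hq] at this; simp at this
        · rw [orient_swap, h] at hwu; linarith
      -- an edge from `a` leaving the triangle across the base contradicts the visibility of its
      -- ends
      · refine L.free.2 _ _ huE z ?_ (open_sub_seg hz)
        obtain ⟨r', r0, r1, rfl⟩ := mem_open.1 hz'
        refine mem_open.2 ⟨t + r' * (1 - t), by nlinarith, by nlinarith, ?_⟩
        apply Complex.ext <;> simp only [hwdef, pt_re, pt_im] <;> ring
    rcases H.eq_of_orient haV hr.1 (W.mem H (c - 1)) hra.symm h0 with h | h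
    · exact absurd h.symm (H.ne huE)
    · exact h
  refine ⟨t, ρ, t0, ht1, ρ0, hρ1, by rw [hur, hrρ], ?_, hclear⟩
  intro v hv hvT
  rcases line v hv (Tri_rot hvT) with h | h
  · exact .inl h
  · right
    have : orient a r v = 0 := by rw [e2, h]; ring
    rw [hur]
    exact H.eq_of_orient haV hr.1 hv hra.symm this

end LeftChain

/-- The data of `LeftChain.exists_frame`: the point `w` of the base at parameter `t` lies on the ray
from the apex through its predecessor. -/
structure Frame (o : ℂ) (s : ℝ) (V : Finset ℂ) (E : ℂ → ℂ → Prop) (τ : ℤ → ℂ) (k c : ℤ)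
    (t ρ : ℝ) : Prop extends LeftChain o s V E τ k c where
  t0 : 0 ≤ t
  t1 : t < 1
  ρ0 : 0 ≤ ρ
  ρ1 : ρ < 1
  pred : τ (c - 1) = pt (pt (τ k) (τ (c + 1)) t) (τ c) ρ
  empty : ∀ v ∈ V, v ∈ Tri (τ (c + 1)) (pt (τ k) (τ (c + 1)) t) (τ c) →
      v = τ (c + 1) ∨ v = τ c ∨ v = τ (c - 1)
  clear : Clear E (pt (τ k) (τ (c + 1)) t) (τ c)

namespace Frame

variable {t ρ : ℝ}

/-- If the frame degenerates then the predecessor of the apex is the start of the chain. -/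
lemma pred_eq_of (F : Frame o s V E τ k c t ρ) (ht : t = 0) : τ (c - 1) = τ k := by
  have H := F.cfg
  have W := F.walk
  have h := F.pred
  rw [ht, pt_zero] at h
  have h0 : orient (τ k) (τ c) (τ (c - 1)) = 0 := by
    rw [h]; unfold orient; simp only [pt_re, pt_im]; ring
  rcases H.eq_of_orient (W.mem H _) (W.mem H _) (W.mem H _) F.apex_ne h0 with h | h
  · exact h
  · exact absurd h (H.ne (W.adj' c))

lemma t_pos (F : Frame o s V E τ k c t ρ) (h : τ (c - 1) ≠ τ k) : 0 < t :=
  lt_of_le_of_ne F.t0 fun e => h (F.pred_eq_of e.symm)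

lemma pred_ne_right (F : Frame o s V E τ k c t ρ) : τ (c - 1) ≠ τ (c + 1) := by
  intro h; have := F.conv; rw [h] at this; simp at this

lemma orient_pred (F : Frame o s V E τ k c t ρ) : 0 < orient (τ (c + 1)) (τ c) (τ (c - 1)) := by
  rw [orient_rot']; exact F.conv

lemma pred_mem (F : Frame o s V E τ k c t ρ) :
    τ (c - 1) ∈ Tri (τ (c + 1)) (pt (τ k) (τ (c + 1)) t) (τ c) := by
  rw [F.pred]
  exact seg_sub_Tri (mid_mem_Tri _ _ _) (right_mem_Tri _ _ _) (pt_mem_seg F.ρ0 F.ρ1.le)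

lemma clear_right (F : Frame o s V E τ k c t ρ) : Clear E (τ (c + 1)) (τ (c - 1)) := by
  have H := F.cfg
  have W := F.walk
  have hrT := F.pred_mem
  refine clear_of_empty H (c := τ c) (by
    rw [orient_swap']; linarith [F.orient_pred])
    (H.clear_edge (H.symm (W.adj c))) (H.clear_edge (H.symm (W.adj' c))) ?_ ?_
  · intro v hv hvT
    rcases F.empty v hv (Tri_subset (left_mem_Tri _ _ _) hrT (right_mem_Tri _ _ _) hvT) with
      h | h | h
    · right; rw [h]; simp
    · left; exact h
    · right; rw [h]; simp
  · intro g k' hgk hqg z hz hz'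
    -- no edge at the apex leaves into its convex corner
    have key : ∀ k', E (τ c) k' → z ∈ openSegment ℝ (τ c) k' → False := by
      intro k' hk hz'
      obtain ⟨r', r0, r1, rfl⟩ := mem_open.1 hz'
      have f1 := (Aff.orient_right (τ c) (τ (c - 1))).pos_open hz F.conv.le (by simp)
        (.inl F.conv.ne')
      have f2 := (Aff.orient_mid (τ c) (τ (c + 1))).pos_open hz (by simp) F.conv.le
        (.inr F.conv.ne')
      have f3 : orient (τ c) (pt (τ c) k' r') (τ (c + 1)) = r' * orient (τ c) k' (τ (c + 1)) := by
        unfold orient; simp only [pt_re, pt_im]; ring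
      have f4 : orient (τ c) (τ (c - 1)) (pt (τ c) k' r') = r' * orient (τ c) (τ (c - 1)) k' := by
        unfold orient; simp only [pt_re, pt_im]; ring
      rw [f3] at f2; rw [f4] at f1
      have := ((W.corner' c k' hk).2 (by by_contra hc; nlinarith)).2
      nlinarith
    by_cases hg : τ c = g
    · subst hg; exact key k' hgk hz'
    by_cases hk : τ c = k'
    · subst hk; exact key g (H.symm hgk) (open_comm hz')
    exact H.not_mem_open hgk (W.mem H c) (open_of_seg hqg hg hk)

/-- If the predecessor of the apex is not the start of the chain, then it is not joined to the end
of the chain. -/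
lemma pred_not_edge (F : Frame o s V E τ k c t ρ) (h : τ (c - 1) ≠ τ k) :
    ¬ E (τ (c + 1)) (τ (c - 1)) := by
  intro hE
  have ht := F.t_pos h
  have pos := F.pos
  refine F.wedge_right hE F.orient_pred ?_
  have e2 : orient (τ (c + 1)) (τ (c - 1)) (τ k) = ρ * orient (τ k) (τ (c + 1)) (τ c) := by
    rw [F.pred]; unfold orient; simp only [pt_re, pt_im]; ring
  rw [e2]
  have : ρ ≠ 0 := by
    intro h0
    have hp := F.pred
    rw [h0, pt_zero] at hp
    exact F.free.1 _ (F.walk.mem F.cfg (c - 1)) (by rw [hp]; exact pt_mem_open ht F.t1)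
  have := lt_of_le_of_ne F.ρ0 this.symm
  positivity

/-- If the predecessor of the apex is not the start of the chain, then it is far from the end of the
chain, so that the triangle below the chain is small. -/
lemma not_near (F : Frame o s V E τ k c t ρ) (h : τ (c - 1) ≠ τ k) :
    ¬ Near o s (τ (c - 1)) (τ (c + 1)) := fun hn =>
  F.pred_not_edge h (F.cfg.edge_of_clear (F.walk.mem F.cfg _) (F.walk.mem F.cfg _)
    F.pred_ne_right.symm hn.symm F.clear_right)

/-- The triangle spanned by the start of the chain, the point of the frame on the base and the
predecessor of the apex is contained in the neighbourhood of each of its points. -/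
lemma small (F : Frame o s V E τ k c t ρ) :
    Near o s (τ k) (pt (τ k) (τ (c + 1)) t) ∧ Near o s (pt (τ k) (τ (c + 1)) t) (τ (c - 1)) ∧
      Near o s (τ (c - 1)) (τ k) := by
  have H := F.cfg
  have W := F.walk
  by_cases h : τ (c - 1) = τ k
  · have ht : t = 0 := by
      by_contra ht
      have ht := lt_of_le_of_ne F.t0 (Ne.symm ht)
      have pos := F.pos
      have ρ0 := F.ρ0; have ρ1 := F.ρ1; have t1 := F.t1
      have e1 := F.pred
      have e2 : orient (τ k) (τ (c + 1)) (τ (c - 1)) = ρ * orient (τ k) (τ (c + 1)) (τ c) := by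
        rw [F.pred]; unfold orient; simp only [pt_re, pt_im]; ring
      have e3 : orient (τ k) (τ c) (τ (c - 1)) =
          -((1 - ρ) * (t * orient (τ k) (τ (c + 1)) (τ c))) := by
        rw [F.pred]; unfold orient; simp only [pt_re, pt_im]; ring
      rw [h] at e3
      simp only [orient_self_out] at e3
      have : 0 < (1 - ρ) * (t * orient (τ k) (τ (c + 1)) (τ c)) := by
        have := sub_pos.2 ρ1; positivity
      linarith
    rw [ht, h, pt_zero]; exact ⟨near_refl _, near_refl _, near_refl _⟩
  · exact near_corner F.near (H.near (W.adj c)) (pt_mem_seg F.t0 F.t1.le)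
      (by rw [F.pred]; exact pt_mem_seg F.ρ0 F.ρ1.le) (F.not_near h)

end Frame

/-- The triangle with apex `O` over the edge `τ i, τ (i + 1)` of the chain contains no other
vertices except possibly the end `τ (c + 1)` of the base, and its sides at `O` cross no edges.
Moreover, `τ i` lies in the triangle of `Frame.small`. -/
structure FanAt (V : Finset ℂ) (E : ℂ → ℂ → Prop) (τ : ℤ → ℂ) (k c : ℤ) (t : ℝ) (O : ℂ) (i : ℤ) :
    Prop where
  mem : τ i ∈ Tri (τ k) (pt (τ k) (τ (c + 1)) t) (τ (c - 1))
  clear' : Clear E O (τ (i + 1))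
  clear : Clear E O (τ i)
  pos : 0 < orient O (τ (i + 1)) (τ i)
  empty : ∀ v ∈ V, v ∈ Tri O (τ (i + 1)) (τ i) → v = τ (c + 1) ∨ v = τ (i + 1) ∨ v = τ i

namespace Frame

variable {t ρ : ℝ}

/-- The point of the base at parameter `r` is a vertex only if it is the end of the base. -/
lemma center_vertex (F : Frame o s V E τ k c t ρ) {r : ℝ} (hr : t < r) (hr1 : r ≤ 1)
    {v : ℂ} (hv : v ∈ V) (h : v = pt (τ k) (τ (c + 1)) r) : r = 1 := by
  by_contra hne
  have t0 := F.t0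
  exact F.free.1 v hv (h ▸ pt_mem_open (by linarith) (lt_of_le_of_ne hr1 hne))

/-- Edges through the centre of a fan do not enter its triangles. -/
lemma center_edge (F : Frame o s V E τ k c t ρ) {r : ℝ} (hr : t < r) (hr1 : r ≤ 1) {g h z : ℂ}
    (hgh : E g h) (hO : pt (τ k) (τ (c + 1)) r ∈ segment ℝ g h)
    (hz : z ∈ openSegment ℝ g h) (h1 : 0 < orient (τ (c + 1)) (τ c) z)
    (h2 : 0 < orient (τ (c + 1)) z (τ k)) : False := by
  have H := F.cfg
  have t0 := F.t0
  -- the base is free, so that an edge can touch the centre only at the end of the base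
  have hr' : r = 1 := by
    by_contra hne
    exact F.free.2 g h hgh _ (pt_mem_open (by linarith) (lt_of_le_of_ne hr1 hne)) hO
  rw [hr', pt_one] at hO
  have key : ∀ k', E (τ (c + 1)) k' → z ∈ openSegment ℝ (τ (c + 1)) k' → False := by
    intro k' hk hz'
    obtain ⟨r', r0, r1, rfl⟩ := mem_open.1 hz'
    have f1 : orient (τ (c + 1)) (τ c) (pt (τ (c + 1)) k' r') = r' * orient (τ (c + 1)) (τ c) k' := by
      unfold orient; simp only [pt_re, pt_im]; ring
    have f2 : orient (τ (c + 1)) (pt (τ (c + 1)) k' r') (τ k) =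
        r' * orient (τ (c + 1)) k' (τ k) := by
      unfold orient; simp only [pt_re, pt_im]; ring
    rw [f1] at h1; rw [f2] at h2
    exact F.wedge_right hk (by by_contra hc; nlinarith) (by by_contra hc; nlinarith)
  by_cases hg : τ (c + 1) = g
  · subst hg; exact key h hgh hz
  by_cases hk : τ (c + 1) = h
  · subst hk; exact key g (H.symm hgh) (open_comm hz)
  exact H.not_mem_open hgh (F.walk.mem H _) (open_of_seg hO hg hk)

lemma center_clear (F : Frame o s V E τ k c t ρ) {r r' : ℝ} (hr : 0 ≤ r) (hr1 : r ≤ 1)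
    (hr' : 0 ≤ r') (hr1' : r' ≤ 1) :
    Clear E (pt (τ k) (τ (c + 1)) r) (pt (τ k) (τ (c + 1)) r') :=
  F.free.clear.sub (pt_mem_seg hr hr1) (pt_mem_seg hr' hr1')

/-- The fan starts at the predecessor of the apex. -/
lemma fan_start (F : Frame o s V E τ k c t ρ) {r : ℝ} (hr : t < r) (hr1 : r ≤ 1)
    (hO : Clear E (pt (τ k) (τ (c + 1)) r) (τ c)) :
    FanAt V E τ k c t (pt (τ k) (τ (c + 1)) r) (c - 1) := by
  have H := F.cfg
  have W := F.walk
  have t0 := F.t0; have t1 := F.t1; have ρ0 := F.ρ0; have ρ1 := F.ρ1; have pos := F.pos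
  set O := pt (τ k) (τ (c + 1)) r with hOdef
  set w := pt (τ k) (τ (c + 1)) t with hw
  have hrV := W.mem H (c - 1)
  have hOT : O ∈ Tri (τ (c + 1)) w (τ c) := by
    refine seg_sub_Tri (left_mem_Tri _ _ _) (mid_mem_Tri _ _ _) (mem_seg.2 ⟨(1 - r) / (1 - t),
      div_nonneg (by linarith) (by linarith), by rw [div_le_one] <;> linarith, ?_⟩)
    have : 1 - t ≠ 0 := by linarith
    apply Complex.ext <;> simp only [hOdef, hw, pt_re, pt_im] <;> field_simp <;> ring
  have hrT : τ (c - 1) ∈ Tri (τ (c + 1)) w (τ c) := by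
    rw [F.pred]; exact seg_sub_Tri (mid_mem_Tri _ _ _) (right_mem_Tri _ _ _) (pt_mem_seg ρ0 ρ1.le)
  have epos : orient O (τ c) (τ (c - 1)) =
      (1 - ρ) * ((r - t) * orient (τ k) (τ (c + 1)) (τ c)) := by
    rw [F.pred, hOdef]; unfold orient; simp only [pt_re, pt_im]; ring
  refine ⟨right_mem_Tri _ _ _, by rw [sub_add_cancel]; exact hO, ?_, ?_, ?_⟩
  · by_cases h : τ (c - 1) = τ k
    · rw [h]; simpa using F.center_clear (r := r) (r' := 0) (by linarith) hr1 le_rfl zero_le_one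
    have ht := F.t_pos h
    have hρ : 0 < ρ := by
      refine lt_of_le_of_ne ρ0 fun h0 => ?_
      have hp := F.pred
      rw [← h0, pt_zero] at hp
      exact F.free.1 _ hrV (by rw [hp]; exact pt_mem_open ht t1)
    have e : orient O (τ (c - 1)) w = ρ * ((r - t) * orient (τ k) (τ (c + 1)) (τ c)) := by
      rw [F.pred, hOdef, hw]; unfold orient; simp only [pt_re, pt_im]; ring
    have e' : 0 < orient O (τ (c - 1)) w := by
      rw [e]; have := sub_pos.2 hr; positivity
    -- the spoke is the third side of the triangle `O`, `w`, `τ (c - 1)` without inner vertices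
    refine clear_of_empty H (c := w) e'.ne' (F.center_clear (by linarith) hr1 t0 t1.le)
      (F.clear.sub (left_mem_segment _ _ _) (by rw [F.pred]; exact pt_mem_seg ρ0 ρ1.le)) ?_ ?_
    · intro v hv hvT
      rcases F.empty v hv (Tri_subset hOT hrT (mid_mem_Tri _ _ _) hvT) with h | h | h
      · right
        -- the end of the base lies in the triangle only if it is the centre
        have h1 := ((Aff.orient_right O (τ (c - 1))).nonneg_tri hvT (by simp) (by simp) e'.le)
        have e3 : orient O (τ (c - 1)) (τ (c + 1)) =
            -(ρ * ((1 - r) * orient (τ k) (τ (c + 1)) (τ c))) := by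
          rw [F.pred, hOdef]; unfold orient; simp only [pt_re, pt_im]; ring
        rw [h, e3] at h1 ⊢
        have : 0 ≤ ρ * ((1 - r) * orient (τ k) (τ (c + 1)) (τ c)) := by
          have := sub_nonneg.2 hr1; positivity
        linarith
      · exfalso
        have h2 := (Aff.orient_right (τ k) (τ (c + 1))).neg.add_const
          (ρ * orient (τ k) (τ (c + 1)) (τ c))
        have f1 : orient (τ k) (τ (c + 1)) O = 0 := by
          rw [hOdef]; unfold orient; simp only [pt_re, pt_im]; ring
        have f2 : orient (τ k) (τ (c + 1)) w = 0 := by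
          rw [hw]; unfold orient; simp only [pt_re, pt_im]; ring
        have f3 : orient (τ k) (τ (c + 1)) (τ (c - 1)) = ρ * orient (τ k) (τ (c + 1)) (τ c) := by
          rw [F.pred]; unfold orient; simp only [pt_re, pt_im]; ring
        have h3 := h2.nonneg_tri hvT (by rw [f1]; simp; positivity) (by rw [f3]; simp)
          (by rw [f2]; simp; positivity)
        rw [h] at h3
        nlinarith
      · right; rw [h]; simp
    · intro g k' hgk hwg z _ _
      exact F.free.2 g k' hgk w (pt_mem_open ht t1) hwg
  · rw [sub_add_cancel, epos]; have := sub_pos.2 hr; have := sub_pos.2 ρ1; positivity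
  · intro v hv hvT
    rw [sub_add_cancel] at hvT ⊢
    exact F.empty v hv (Tri_subset hOT (right_mem_Tri _ _ _) hrT hvT)

end Frame
end

section
variable {o : ℂ} {s : ℝ} {V : Finset ℂ} {E : ℂ → ℂ → Prop} {τ : ℤ → ℂ} {k c : ℤ}
namespace Frame

variable {t ρ : ℝ}

lemma ρ_pos (F : Frame o s V E τ k c t ρ) (h : τ (c - 1) ≠ τ k) : 0 < ρ := by
  refine lt_of_le_of_ne F.ρ0 fun h0 => ?_
  have hp := F.pred
  rw [← h0, pt_zero] at hp
  exact F.free.1 _ (F.walk.mem F.cfg _) (by rw [hp]; exact pt_mem_open (F.t_pos h) F.t1)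

/-- Points below the chain are on the inner side of the ray through the apex and the end of the
chain. -/
lemma orient_below (F : Frame o s V E τ k c t ρ) {v : ℂ}
    (hv : v ∈ Tri (τ k) (pt (τ k) (τ (c + 1)) t) (τ (c - 1))) :
    0 ≤ orient (τ k) (τ (c + 1)) v ∧ 0 < orient (τ (c + 1)) (τ c) v ∧
      0 ≤ orient (pt (τ k) (τ (c + 1)) t) (τ c) v ∧ 0 ≤ orient (τ (c - 1)) (τ k) v := by
  have t0 := F.t0; have t1 := F.t1; have ρ0 := F.ρ0; have ρ1 := F.ρ1; have pos := F.pos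
  have t1' := sub_pos.2 t1; have ρ1' := sub_pos.2 ρ1
  refine ⟨(Aff.orient_right _ _).nonneg_tri hv (by simp) ?_ ?_,
    (Aff.orient_right _ _).pos_tri hv ?_ ?_ ?_, (Aff.orient_right _ _).nonneg_tri hv ?_ (by simp) ?_,
    (Aff.orient_right _ _).nonneg_tri hv (by simp) ?_ (by simp)⟩
  · apply le_of_eq; unfold orient; simp only [pt_re, pt_im]; ring
  · have : orient (τ k) (τ (c + 1)) (τ (c - 1)) = ρ * orient (τ k) (τ (c + 1)) (τ c) := by
      rw [F.pred]; unfold orient; simp only [pt_re, pt_im]; ring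
    rw [this]; positivity
  · rw [orient_rot]; exact pos
  · have : orient (τ (c + 1)) (τ c) (pt (τ k) (τ (c + 1)) t) =
        (1 - t) * orient (τ k) (τ (c + 1)) (τ c) := by
      unfold orient; simp only [pt_re, pt_im]; ring
    rw [this]; positivity
  · have : orient (τ (c + 1)) (τ c) (τ (c - 1)) =
        (1 - ρ) * ((1 - t) * orient (τ k) (τ (c + 1)) (τ c)) := by
      rw [F.pred]; unfold orient; simp only [pt_re, pt_im]; ring
    rw [this]; positivity
  · have : orient (pt (τ k) (τ (c + 1)) t) (τ c) (τ k) = t * orient (τ k) (τ (c + 1)) (τ c) := by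
      unfold orient; simp only [pt_re, pt_im]; ring
    rw [this]; positivity
  · apply le_of_eq; rw [F.pred]; unfold orient; simp only [pt_re, pt_im]; ring
  · have : orient (τ (c - 1)) (τ k) (pt (τ k) (τ (c + 1)) t) =
        t * (ρ * orient (τ k) (τ (c + 1)) (τ c)) := by
      rw [F.pred]; unfold orient; simp only [pt_re, pt_im]; ring
    rw [this]; positivity

set_option maxHeartbeats 1000000 in
/-- The fan continues along the chain: the next vertex of the chain is the first one that is met by
a ray from the current vertex turning away from the centre. -/
lemma fan_step (F : Frame o s V E τ k c t ρ) {r : ℝ} (hr : t < r) (hr1 : r ≤ 1) {i : ℤ}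
    (hki : k < i) (hic : i ≤ c - 1) (hne : τ i ≠ τ k)
    (hi : FanAt V E τ k c t (pt (τ k) (τ (c + 1)) r) i) :
    FanAt V E τ k c t (pt (τ k) (τ (c + 1)) r) (i - 1) := by
  have H := F.cfg
  have W := F.walk
  have t0 := F.t0; have t1 := F.t1; have ρ0 := F.ρ0; have ρ1 := F.ρ1; have pos := F.pos
  have t1' := sub_pos.2 t1; have ρ1' := sub_pos.2 ρ1
  have small := F.small
  obtain ⟨b1, b2, b3, b4⟩ := F.orient_below hi.mem
  -- otherwise the triangle of `Frame.small` is a point and the chain has no further vertices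
  have hpr : τ (c - 1) ≠ τ k := by
    intro h
    have hm := hi.mem
    have ht : t = 0 := by
      by_contra ht
      have ht := lt_of_le_of_ne F.t0 (Ne.symm ht)
      have e3 : orient (τ k) (τ c) (τ (c - 1)) =
          -((1 - ρ) * (t * orient (τ k) (τ (c + 1)) (τ c))) := by
        rw [F.pred]; unfold orient; simp only [pt_re, pt_im]; ring
      rw [h] at e3
      simp only [orient_self_out] at e3
      have : 0 < (1 - ρ) * (t * orient (τ k) (τ (c + 1)) (τ c)) := by positivity
      linarith
    rw [h, ht, pt_zero] at hm
    obtain ⟨x, y, w, hx, hy, hw, e, e'⟩ := hm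
    apply hne
    rw [e']
    have : (x : ℂ) + y + w = 1 := by exact_mod_cast e
    linear_combination (τ k) * this
  have ht := F.t_pos hpr
  have hρ := F.ρ_pos hpr
  have hc' := hi.clear'
  have hcl := hi.clear
  have hpos := hi.pos
  have hem := hi.empty
  have hmem := hi.mem
  have hrefl := F.refl i hki (by omega)
  have hcor := W.corner' i
  have huE : E (τ i) (τ (i - 1)) := H.symm (W.adj' i)
  have hvV := W.mem H i
  have huV := W.mem H (i - 1)
  set O := pt (τ k) (τ (c + 1)) r with hOdef
  set w := pt (τ k) (τ (c + 1)) t with hw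
  set v := τ i with hv
  have b1' : 0 < orient (τ k) (τ (c + 1)) v := by
    refine lt_of_le_of_ne b1 fun h0 => ?_
    rcases H.eq_of_orient (W.mem H k) (W.mem H (c + 1)) hvV F.base_ne h0.symm with h | h
    · exact hne h
    · rw [h] at b2; simp at b2
  have eO : ∀ z, orient (τ k) O z = r * orient (τ k) (τ (c + 1)) z := by
    intro z; rw [hOdef]; unfold orient; simp only [pt_re, pt_im]; ring
  have hpOv : 0 < orient (τ k) O v := by rw [eO]; have : 0 < r := by linarith
                                         positivity
  set S : Set ℂ := {z | z ∈ V ∧ z ∈ Tri (τ k) O v ∧ z ≠ v ∧ z ≠ O} with hS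
  have hSf : S.Finite := (V.finite_toSet).subset fun v hv => hv.1
  have hpS : τ k ∈ S := ⟨W.mem H k, left_mem_Tri _ _ _, hne.symm, by
    intro h; rw [← h] at hpOv; simp at hpOv⟩
  -- turning from `O` towards the start of the chain, the ray from `v` first meets the vertex `q`,
  -- and the base in `w'`
  obtain ⟨q, hq, w', hw', hqw, hmax⟩ := exists_first_ray (l := τ k) (x := O) (y := v) hSf
    hpS (fun v hv => hv.2.1) (fun h => h.2.2.1 rfl)
  have hmax' : ∀ z ∈ S, orient v q z ≤ 0 := fun z hz => by
    have := hmax z hz; by_contra hc; push Not at hc; nlinarith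
  obtain ⟨ω, ω0, ω1, hwω⟩ := mem_seg.1 hw'
  obtain ⟨κ, κ0, κ1, hqκ⟩ := mem_seg.1 hqw
  have hκ1 : κ < 1 := lt_of_le_of_ne κ1 (by rintro rfl; rw [pt_one] at hqκ; exact hq.2.2.1 hqκ)
  have hqT : q ∈ Tri (τ k) O v := hq.2.1
  -- `q` is not the end of the chain
  have bO : orient (τ (c + 1)) (τ c) O = (1 - r) * orient (τ k) (τ (c + 1)) (τ c) := by
    rw [hOdef]; unfold orient; simp only [pt_re, pt_im]; ring
  have bk : orient (τ (c + 1)) (τ c) (τ k) = orient (τ k) (τ (c + 1)) (τ c) := by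
    rw [orient_rot]
  have hqq : q ≠ τ (c + 1) := by
    intro h
    rcases hr1.lt_or_eq with h1 | h1
    · have := (Aff.orient_right (τ (c + 1)) (τ c)).pos_tri hqT (by rw [bk]; exact pos)
        (by rw [bO]; have := sub_pos.2 h1; positivity) b2
      rw [h] at this; simp at this
    · apply hq.2.2.2; rw [h, hOdef, h1, pt_one]
  -- `q` does not lie on the spoke `O v`, by the emptiness of the previous triangle of the fan
  have hω : 0 < ω := by
    refine lt_of_le_of_ne ω0 fun h0 => ?_
    rw [← h0, pt_zero] at hwω
    rw [hwω] at hqw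
    rcases hem q hq.1 (seg_sub_Tri (left_mem_Tri _ _ _) (right_mem_Tri _ _ _) hqw) with h | h | h
    · exact hqq h
    · have := orient_open hqw
      rw [h, orient_swap'] at this
      linarith
    · exact hq.2.2.1 h
  -- `q` lies below the ray of the frame, since the triangle above it is empty
  have hqw1 : 0 ≤ orient w (τ c) q := by
    by_contra hneg
    push Not at hneg
    have hqT' : q ∈ Tri (τ (c + 1)) w (τ c) := by
      refine Tri_swap (mem_Tri_of (a := w) (b := τ (c + 1)) (c := τ c) ?_ ?_ ?_ ?_)
      · have : orient w (τ (c + 1)) (τ c) = (1 - t) * orient (τ k) (τ (c + 1)) (τ c) := by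
          rw [hw]; unfold orient; simp only [pt_re, pt_im]; ring
        rw [this]; positivity
      · have : orient w (τ (c + 1)) q = (1 - t) * orient (τ k) (τ (c + 1)) q := by
          rw [hw]; unfold orient; simp only [pt_re, pt_im]; ring
        rw [this]
        refine mul_nonneg t1'.le ((Aff.orient_right _ _).nonneg_tri hqT (by simp) ?_ b1)
        rw [hOdef]; apply le_of_eq; unfold orient; simp only [pt_re, pt_im]; ring
      · exact (Aff.orient_right _ _).nonneg_tri hqT (by rw [bk]; exact pos.le)
          (by rw [bO]; have := sub_nonneg.2 hr1; positivity) b2.le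
      · rw [orient_swap]; linarith
    rcases F.empty q hq.1 hqT' with h | h | h
    · exact hqq h
    · rw [h] at hneg; simp at hneg
    · have : orient w (τ c) (τ (c - 1)) = 0 := by
        rw [F.pred, ← hw]; unfold orient; simp only [pt_re, pt_im]; ring
      rw [h] at hneg; linarith
  -- consequently `q` lies in the triangle of `Frame.small` and is close to `v`
  have hqB : q ∈ Tri (τ k) w (τ (c - 1)) := by
    refine mem_Tri_of ?_ ?_ ?_ ?_
    · have : orient (τ k) w (τ (c - 1)) = t * (ρ * orient (τ k) (τ (c + 1)) (τ c)) := by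
        rw [F.pred, hw]; unfold orient; simp only [pt_re, pt_im]; ring
      rw [this]; positivity
    · have : orient (τ k) w q = t * orient (τ k) (τ (c + 1)) q := by
        rw [hw]; unfold orient; simp only [pt_re, pt_im]; ring
      rw [this]
      refine mul_nonneg t0 ((Aff.orient_right _ _).nonneg_tri hqT (by simp) ?_ b1)
      rw [hOdef]; apply le_of_eq; unfold orient; simp only [pt_re, pt_im]; ring
    · have : orient w (τ (c - 1)) q = ρ * orient w (τ c) q := by
        rw [F.pred, hw]; unfold orient; simp only [pt_re, pt_im]; ring
      rw [this]; positivity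
    · refine (Aff.orient_right _ _).nonneg_tri hqT (by simp) ?_ b4
      have : orient (τ (c - 1)) (τ k) O = r * (ρ * orient (τ k) (τ (c + 1)) (τ c)) := by
        rw [F.pred, hOdef]; unfold orient; simp only [pt_re, pt_im]; ring
      rw [this]; have : 0 < r := by linarith
      positivity
  have e2 : ∀ z, orient v q z = -((1 - κ) * orient w' v z) := by
    intro z; rw [hqκ]; unfold orient; simp only [pt_re, pt_im]; ring
  have κ1' := sub_pos.2 hκ1
  have e3 : orient w' v O = -(ω * orient (τ k) O v) := by
    rw [hwω]; unfold orient; simp only [pt_re, pt_im]; ring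
  have e3' : orient w' v O < 0 := by rw [e3]; have := mul_pos hω hpOv; linarith
  have hw'T : w' ∈ Tri (τ k) O v := seg_sub_Tri (mid_mem_Tri _ _ _) (left_mem_Tri _ _ _) hw'
  -- the swept triangle contains only vertices on its last side
  have line : ∀ z ∈ V, z ∈ Tri w' v O → z = O ∨ orient w' v z = 0 := by
    intro z hz hzT
    by_cases hzO : z = O
    · exact .inl hzO
    by_cases hzv : z = v
    · right; rw [hzv]; simp
    right
    have hzS : z ∈ S := ⟨hz, Tri_subset hw'T (right_mem_Tri _ _ _) (mid_mem_Tri _ _ _) hzT, hzv, hzO⟩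
    have h1 := hmax' z hzS
    rw [e2] at h1
    have h2 := (Aff.orient_right w' v).neg.nonneg_tri hzT (by simp) (by simp) (by linarith)
    nlinarith
  have hw'r : w' = pt (τ k) (τ (c + 1)) (r * (1 - ω)) := by
    rw [hwω, hOdef]; apply Complex.ext <;> simp only [pt_re, pt_im] <;> ring
  have r0 : 0 < r := by linarith
  have hω1 : 0 ≤ 1 - ω := by linarith
  have hw'v : Clear E w' v := by
    refine clear_of_empty H e3'.ne ?_ hcl line ?_
    · rw [hw'r]
      exact F.center_clear (by positivity) (by nlinarith) (by linarith) hr1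
    · intro g h hgh hOg z hz hz'
      refine F.center_edge hr hr1 hgh hOg hz' ?_ ?_
      · have : orient (τ (c + 1)) (τ c) w' =
            (1 - r * (1 - ω)) * orient (τ k) (τ (c + 1)) (τ c) := by
          rw [hw'r]; unfold orient; simp only [pt_re, pt_im]; ring
        exact (Aff.orient_right _ _).pos_open hz (by
          rw [this]; exact mul_nonneg (by nlinarith) pos.le) b2.le (.inr b2.ne')
      · have : orient (τ (c + 1)) v (τ k) = orient (τ k) (τ (c + 1)) v := by
          unfold orient; ring
        refine (Aff.orient_mid _ _).pos_open hz ?_ (by rw [this]; exact b1) (.inr (by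
          rw [this]; exact b1'.ne'))
        rw [hw'r]; apply le_of_eq; unfold orient; simp only [pt_re, pt_im]; ring
  have hqv : q ≠ v := hq.2.2.1
  have hqE : E v q := H.edge_of_clear hvV hq.1 hqv.symm
    (near_hull hmem hqB small.1 small.2.1 small.2.2)
    (hw'v.sub hqw (right_mem_segment _ _ _)).symm
  have hqO : 0 < orient v q O := by
    rw [e2]; have := mul_pos κ1' (neg_pos.2 e3'); linarith
  have hOprev : 0 < orient v O (τ (i + 1)) := by rw [orient_rot']; exact hpos
  have g1 := hcor.of_reflex hrefl hqE
  -- the reflex corner at `v` leaves no room between `q` and the predecessor of `v`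
  have huq : τ (i - 1) = q := by
    have h0 : orient v q (τ (i - 1)) = 0 := by
      refine le_antisymm ?_ (by rw [orient_swap']; linarith [g1.1])
      by_contra hc
      push Not at hc
      have huO : 0 < orient v (τ (i - 1)) O := by
        have pl := plucker v q O (τ (i - 1)) (τ (i + 1))
        have k1 := mul_pos hc hOprev
        have k2 := mul_nonneg hqO.le (neg_nonneg.2 hrefl)
        rw [orient_swap']
        by_contra hcon
        have k3 := mul_nonneg (neg_nonneg.2 g1.2) (show 0 ≤ orient v O (τ (i - 1)) by linarith)
        linarith
      have hwu : 0 < orient v w' (τ (i - 1)) := by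
        have k1 := e2 (τ (i - 1)); rw [orient_swap]
        by_contra hcon
        have k2 := mul_nonneg κ1'.le (show 0 ≤ orient w' v (τ (i - 1)) by linarith)
        linarith
      rcases wedge_exit (c := v) (a := w') (b := O) (by rw [orient_swap]; linarith) hwu huO with
        h | ⟨z, hz, hz'⟩
      · rcases line _ huV (Tri_swap h) with h | h
        · rw [h] at huO; simp at huO
        · rw [orient_swap, h] at hwu; linarith
      -- the edge to the predecessor would cross the free base
      · refine F.free.2 _ _ huE z ?_ (open_sub_seg hz)
        obtain ⟨r', r0', r1', rfl⟩ := mem_open.1 hz'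
        refine mem_open.2 ⟨r * (1 - ω) + r' * (r - r * (1 - ω)), ?_, ?_, ?_⟩
        · have : r * (1 - ω) + r' * (r - r * (1 - ω)) = r * ((1 - ω) + r' * ω) := by ring
          rw [this]; positivity
        · have : r * (1 - ω) + r' * (r - r * (1 - ω)) = r * (1 - ω * (1 - r')) := by ring
          rw [this]
          have : 0 < ω * (1 - r') := mul_pos hω (by linarith)
          nlinarith
        · rw [hw'r, hOdef]
          apply Complex.ext <;> simp only [pt_re, pt_im] <;> ring
    rcases H.eq_of_orient hvV hq.1 huV hqv.symm h0 with h | h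
    · exact absurd h.symm (H.ne huE)
    · exact h
  have hqT2 : q ∈ Tri w' v O := seg_sub_Tri (left_mem_Tri _ _ _) (mid_mem_Tri _ _ _) hqw
  -- the last triangle of the sweep contains the next triangle of the fan
  refine ⟨by rw [huq]; exact hqB, by rw [sub_add_cancel]; exact hcl, ?_, ?_, ?_⟩
  · rw [huq]
    refine clear_of_empty H (c := v) (by
      intro h; linarith [orient_rot' v q O, orient_swap' O v q])
      hcl (H.clear_edge hqE) ?_ ?_
    · intro z hz hzT
      rcases line z hz (Tri_subset (right_mem_Tri _ _ _) hqT2 (mid_mem_Tri _ _ _) hzT) with h | h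
      · right; rw [h]; simp
      · have h0 : orient v q z = 0 := by rw [e2, h]; ring
        rcases H.eq_of_orient hvV hq.1 hz hqv.symm h0 with h | h
        · exact .inl h
        · right; rw [h]; simp
    · intro g h hgh hvg z hz hz'
      have hz1 : 0 < orient v q z :=
        (Aff.orient_right v q).pos_open hz hqO.le (by simp) (.inl hqO.ne')
      have key : ∀ k', E v k' → z ∈ openSegment ℝ v k' → False := by
        intro k' hk hz'
        obtain ⟨r', r0, r1, rfl⟩ := mem_open.1 hz'
        have f1 : orient v q (pt v k' r') = r' * orient v q k' := by
          unfold orient; simp only [pt_re, pt_im]; ring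
        have := (hcor.of_reflex hrefl hk).1
        rw [huq] at this
        rw [f1] at hz1
        nlinarith
      by_cases hg : v = g
      · rw [← hg] at hgh hz'; exact key h hgh hz'
      by_cases hk : v = h
      · rw [← hk] at hgh hz'; exact key g (H.symm hgh) (open_comm hz')
      exact H.not_mem_open hgh hvV (open_of_seg hvg hg hk)
  · rw [huq, sub_add_cancel, ← hv]
    linarith [orient_rot O v q]
  · intro z hz hzT
    rw [sub_add_cancel] at hzT ⊢
    rw [huq] at hzT ⊢
    rcases line z hz (Tri_subset (right_mem_Tri _ _ _) (mid_mem_Tri _ _ _) hqT2 hzT) with h | h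
    · left
      have := F.center_vertex hr hr1 hz (h.trans hOdef)
      rw [h, hOdef, this, pt_one]
    · right
      have h0 : orient v q z = 0 := by rw [e2, h]; ring
      exact H.eq_of_orient hvV hq.1 hz hqv.symm h0

/-- The fan does not pass through the start of the chain before the chain does. -/
lemma fan_ne (F : Frame o s V E τ k c t ρ) {r : ℝ} (hr : t < r) {i : ℤ}
    (hki : k < i) (hic : i ≤ c - 1)
    (hi : FanAt V E τ k c t (pt (τ k) (τ (c + 1)) r) i) : τ i ≠ τ k := by
  intro hip
  have H := F.cfg
  have W := F.walk
  have t0 := F.t0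
  have r0 : 0 < r := by linarith
  have hc' := hi.clear'
  have hpos := hi.pos
  have hem := hi.empty
  rw [hip] at hpos hem
  set O := pt (τ k) (τ (c + 1)) r with hOdef
  have eO : ∀ z, orient (τ k) O z = r * orient (τ k) (τ (c + 1)) z := by
    intro z; rw [hOdef]; unfold orient; simp only [pt_re, pt_im]; ring
  have hpos' : 0 < orient (τ k) O (τ (i + 1)) := by rw [orient_rot']; exact hpos
  -- no edge at the start of the chain runs between the base and the edge to `τ (i + 1)`
  have none : ∀ x, E (τ k) x → 0 < orient (τ k) (τ (c + 1)) x →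
      0 < orient (τ k) x (τ (i + 1)) → False := by
    intro x hx h1 h2
    have h1' : 0 < orient (τ k) O x := by rw [eO]; positivity
    rcases wedge_exit hpos' h1' h2 with h | ⟨z, hz, hz'⟩
    · rcases hem x (H.mem' hx) (Tri_rot h) with h | h | h
      · rw [h] at h1; simp at h1
      · rw [h] at h2; simp at h2
      · exact H.ne hx h.symm
    · have := hc' _ _ hx z hz' hz
      linarith
  have hE : E (τ k) (τ (i + 1)) := by rw [← hip]; exact W.adj i
  have hq : 0 < orient (τ k) (τ (c + 1)) (τ (i + 1)) := by
    rw [eO] at hpos'; by_contra hc; nlinarith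
  have h1 := (F.left _ hE).1 hq
  have h0 : orient (τ k) (τ (i + 1)) (τ (k + 1)) = 0 := by
    refine le_antisymm h1.2 ?_
    by_contra hc; push Not at hc
    exact none _ (W.adj k) h1.1 (by rw [orient_swap']; linarith)
  have h2 : τ (k + 1) = τ (i + 1) := by
    rcases H.eq_of_orient (W.mem H k) (W.mem H (i + 1)) (W.mem H (k + 1)) (H.ne hE) h0 with h | h
    · exact absurd h.symm (H.ne (W.adj k))
    · exact h
  -- the walk repeats itself from `τ k` on, so the apex would also occur among the reflex vertices
  have sh := W.shift H hip.symm h2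
  obtain ⟨n, hn⟩ := Int.eq_ofNat_of_zero_le (show 0 ≤ c - 1 - i by omega)
  have s0 := sh n
  have s1 := sh (n + 1)
  have s2 := sh (n + 2)
  push_cast at s1 s2
  rw [show i + (n : ℤ) = c - 1 by omega] at s0
  rw [show i + ((n : ℤ) + 1) = c by omega] at s1
  rw [show i + ((n : ℤ) + 2) = c + 1 by omega] at s2
  have := F.refl (k + (n + 1)) (by omega) (by omega)
  rw [show k + ((n : ℤ) + 1) - 1 = k + n by ring, show k + ((n : ℤ) + 1) + 1 = k + (n + 2) by ring,
    s0, s1, s2] at this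
  exact absurd F.conv (not_lt.2 this)

/-- The triangles spanned by a point `O` of the base right of the frame and the edges of the chain
contain no other vertices. -/
lemma fan (F : Frame o s V E τ k c t ρ) {r : ℝ} (hr : t < r) (hr1 : r ≤ 1)
    (hO : Clear E (pt (τ k) (τ (c + 1)) r) (τ c)) {i : ℤ} (hki : k ≤ i) (hic : i < c) :
    FanAt V E τ k c t (pt (τ k) (τ (c + 1)) r) i := by
  have : ∀ n : ℕ, k ≤ c - 1 - n → FanAt V E τ k c t (pt (τ k) (τ (c + 1)) r) (c - 1 - n) := by
    intro n
    induction n with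
    | zero => intro _; simpa using F.fan_start hr hr1 hO
    | succ n ih =>
      intro h
      push_cast at h ⊢
      have h1 := ih (by omega)
      have := F.fan_step hr hr1 (by omega) (by omega)
        (F.fan_ne hr (by omega) (by omega) h1) h1
      rwa [show c - 1 - ((n : ℤ) + 1) = c - 1 - n - 1 by ring]
  obtain ⟨n, hn⟩ := Int.eq_ofNat_of_zero_le (show 0 ≤ c - 1 - i by omega)
  have := this n (by omega)
  rwa [show c - 1 - (n : ℤ) = i by omega] at this

end Frame
end

/-! ### Segments and fans of triangles -/

/-- The union of the triangles with apex `O` over the edges of the polygonal path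
`τ a, …, τ b`. -/
def Fan (O : ℂ) (τ : ℤ → ℂ) (a b : ℤ) : Set ℂ :=
  {z | ∃ i, a ≤ i ∧ i < b ∧ z ∈ Tri O (τ (i + 1)) (τ i)}

lemma Aff.continuous {h : ℂ → ℝ} (hh : Aff h) : Continuous h := by
  obtain ⟨α, β, γ, h'⟩ := hh
  rw [show h = fun z => α * z.re + β * z.im + γ from funext h']
  fun_prop

lemma Tri_closed {a b c : ℂ} (h : 0 < orient a b c) : IsClosed (Tri a b c) := by
  have : Tri a b c = {z | 0 ≤ orient a b z} ∩ ({z | 0 ≤ orient b c z} ∩ {z | 0 ≤ orient c a z}) := by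
    ext z; exact mem_Tri_iff h
  rw [this]
  exact (isClosed_le continuous_const (Aff.orient_right _ _).continuous).inter
    ((isClosed_le continuous_const (Aff.orient_right _ _).continuous).inter
      (isClosed_le continuous_const (Aff.orient_right _ _).continuous))

lemma Fan_closed {O : ℂ} {τ : ℤ → ℂ} {a b : ℤ}
    (hpos : ∀ i, a ≤ i → i < b → 0 < orient O (τ (i + 1)) (τ i)) : IsClosed (Fan O τ a b) := by
  have : Fan O τ a b = ⋃ i ∈ Set.Ico a b, Tri O (τ (i + 1)) (τ i) := by
    ext z; simp [Fan, and_assoc]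
  rw [this]
  exact (Set.finite_Ico a b).isClosed_biUnion fun i hi => Tri_closed (hpos i hi.1 hi.2)

/-- An affine functional that is positive at `w`, or zero at `w` and nonnegative at `u`, is
nonnegative on a short piece of the segment from `w` to `u`. -/
lemma Aff.eventually_nonneg {h : ℂ → ℝ} (hh : Aff h) {w u : ℂ}
    (hw : 0 < h w ∨ (0 ≤ h w ∧ 0 ≤ h u)) :
    ∃ ε > 0, ∀ t : ℝ, 0 ≤ t → t ≤ ε → 0 ≤ h (GridMWT.pt w u t) := by
  rcases hw with hw | ⟨hw, hu⟩
  · refine ⟨h w / (|h u - h w| + 1), by positivity, fun t t0 t1 => ?_⟩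
    rw [hh.pt]
    have h1 : t * (|h u - h w| + 1) ≤ h w := by
      rwa [le_div_iff₀ (by positivity)] at t1
    have h2 := mul_le_mul_of_nonneg_left (neg_abs_le (h u - h w)) t0
    nlinarith
  · refine ⟨1, one_pos, fun t t0 t1 => ?_⟩
    exact hh.nonneg_seg (pt_mem_seg t0 t1) hw hu

/-- A point of a triangle moves inside the triangle for some time towards `u` if each side line
that contains it has `u` on the inner side. -/
lemma Tri_eventually {a b c w u : ℂ} (h : 0 < orient a b c)
    (h1 : 0 < orient a b w ∨ (0 ≤ orient a b w ∧ 0 ≤ orient a b u))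
    (h2 : 0 < orient b c w ∨ (0 ≤ orient b c w ∧ 0 ≤ orient b c u))
    (h3 : 0 < orient c a w ∨ (0 ≤ orient c a w ∧ 0 ≤ orient c a u)) :
    ∃ ε > 0, ∀ t : ℝ, 0 ≤ t → t ≤ ε → pt w u t ∈ Tri a b c := by
  obtain ⟨e1, p1, f1⟩ := (Aff.orient_right a b).eventually_nonneg h1
  obtain ⟨e2, p2, f2⟩ := (Aff.orient_right b c).eventually_nonneg h2
  obtain ⟨e3, p3, f3⟩ := (Aff.orient_right c a).eventually_nonneg h3
  refine ⟨min e1 (min e2 e3), by simp [p1, p2, p3], fun t t0 t1 => ?_⟩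
  simp only [le_min_iff] at t1
  exact mem_Tri_of h (f1 t t0 t1.1) (f2 t t0 t1.2.1) (f3 t t0 t1.2.2)

/-- A segment that starts in a fan and meets neither the path nor the two extreme spokes stays in
the fan. -/
lemma fan_exit {O : ℂ} {τ : ℤ → ℂ} {a b : ℤ}
    (hpos : ∀ i, a ≤ i → i < b → 0 < orient O (τ (i + 1)) (τ i)) {z u : ℂ}
    (hz : z ∈ Fan O τ a b)
    (hout : ∀ i, a ≤ i → i < b → ∀ x ∈ segment ℝ z u, x ∉ segment ℝ (τ i) (τ (i + 1)))
    (ha : ∀ x ∈ segment ℝ z u, x ∉ segment ℝ O (τ a))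
    (hb : ∀ x ∈ segment ℝ z u, x ∉ segment ℝ O (τ b)) : u ∈ Fan O τ a b := by
  have hcont : Continuous (pt z u) := by unfold pt; fun_prop
  have hcl : IsClosed ((pt z u ⁻¹' Fan O τ a b) ∩ Icc 0 1) :=
    ((Fan_closed hpos).preimage hcont).inter isClosed_Icc
  -- the closed set of parameters with values in the fan is open to the right
  have key := hcl.Icc_subset_of_forall_exists_gt (a := 0) (b := 1)
    (by simpa using hz) ?_
  · simpa using key (show (1 : ℝ) ∈ Icc 0 1 by simp)
  rintro x ⟨hx, hx0, hx1⟩ y hy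
  suffices h : ∃ j, a ≤ j ∧ j < b ∧ ∃ ε > 0, ∀ t : ℝ, 0 ≤ t → t ≤ ε →
      pt (pt z u x) u t ∈ Tri O (τ (j + 1)) (τ j) by
    obtain ⟨j, hj, hj', ε, hε, h⟩ := h
    have hyx : 0 < y - x := sub_pos.2 hy
    have hx1' : 0 < 1 - x := sub_pos.2 hx1
    set δ := min ε (y - x) with hδ
    have hδ0 : 0 < δ := lt_min hε hyx
    refine ⟨x + δ * (1 - x), ⟨j, hj, hj', ?_⟩, ?_, ?_⟩
    · have := h δ hδ0.le (min_le_left _ _)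
      have e : pt (pt z u x) u δ = pt z u (x + δ * (1 - x)) := by
        apply Complex.ext <;> simp only [pt_re, pt_im] <;> ring
      rwa [e] at this
    · nlinarith
    · have : δ ≤ y - x := min_le_right _ _
      nlinarith
  have hw := pt_mem_seg (p := z) (q := u) hx0 hx1.le
  obtain ⟨i, hai, hib, hT⟩ := hx
  set w := pt z u x with hwdef
  have hpi := hpos i hai hib
  obtain ⟨f1, f2, f3⟩ := (mem_Tri_iff hpi).1 hT
  have hO : w ≠ O := fun e => ha w hw (e ▸ left_mem_segment _ _ _)
  have f2' : 0 < orient (τ (i + 1)) (τ i) w := by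
    refine lt_of_le_of_ne f2 fun h0 => hout i hai hib w hw (seg_comm ?_)
    exact mem_seg_of_Tri (c := O) (by rw [orient_rot]; exact hpi.ne') (Tri_rot hT) h0.symm
  -- on a spoke, the segment stays in its triangle or moves on to the neighbouring one, depending
  -- on the side of `u`
  rcases f1.lt_or_eq with f1' | f1'
  · rcases f3.lt_or_eq with f3' | f3'
    · exact ⟨i, hai, hib, Tri_eventually hpi (.inl f1') (.inl f2') (.inl f3')⟩
    · by_cases hu : 0 ≤ orient (τ i) O u
      · exact ⟨i, hai, hib, Tri_eventually hpi (.inl f1') (.inl f2') (.inr ⟨f3, hu⟩)⟩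
      push Not at hu
      have hws : w ∈ segment ℝ (τ i) O :=
        mem_seg_of_Tri (c := τ (i + 1)) (by rw [orient_rot']; exact hpi.ne') (Tri_rot (Tri_rot hT))
          f3'.symm
      have hai' : a ≤ i - 1 := by
        rcases hai.lt_or_eq with h | h
        · omega
        · exact absurd (seg_comm hws) (h ▸ ha w hw)
      have hwo : w ∈ openSegment ℝ (τ i) O := open_of_seg hws (fun e => hout i hai hib w hw
        (e ▸ left_mem_segment _ _ _)) hO
      have hpj := hpos (i - 1) hai' (by omega)
      rw [sub_add_cancel] at hpj
      refine ⟨i - 1, hai', by omega, ?_⟩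
      rw [sub_add_cancel]
      refine Tri_eventually hpj (.inr ⟨?_, ?_⟩) (.inl ?_) (.inl ?_)
      · rw [orient_swap]; linarith
      · rw [orient_swap]; linarith
      · exact (Aff.orient_right _ _).pos_open hwo (by simp) (by rw [orient_rot]; exact hpj.le)
          (.inr (by rw [orient_rot]; exact hpj.ne'))
      · exact (Aff.orient_right _ _).pos_open hwo (by rw [orient_rot']; exact hpj.le) (by simp)
          (.inl (by rw [orient_rot']; exact hpj.ne'))
  · have hws : w ∈ segment ℝ O (τ (i + 1)) := mem_seg_of_Tri hpi.ne' hT f1'.symm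
    have hib' : i + 1 < b := by
      rcases (show i + 1 ≤ b by omega).lt_or_eq with h | h
      · exact h
      · exact absurd hws (h ▸ hb w hw)
    have hwo : w ∈ openSegment ℝ O (τ (i + 1)) := open_of_seg hws hO (fun e => hout i hai hib w hw
        (e ▸ right_mem_segment _ _ _))
    have f3' : 0 < orient (τ i) O w := (Aff.orient_right _ _).pos_open hwo (by simp)
      (by rw [orient_rot']; exact hpi.le) (.inr (by rw [orient_rot']; exact hpi.ne'))
    by_cases hu : 0 ≤ orient O (τ (i + 1)) u
    · exact ⟨i, hai, hib, Tri_eventually hpi (.inr ⟨f1, hu⟩) (.inl f2') (.inl f3')⟩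
    push Not at hu
    have hpj := hpos (i + 1) (by omega) hib'
    refine ⟨i + 1, by omega, hib', Tri_eventually hpj (.inl ?_) (.inl ?_) (.inr ⟨?_, ?_⟩)⟩
    · exact (Aff.orient_right _ _).pos_open hwo (by simp) hpj.le (.inr hpj.ne')
    · exact (Aff.orient_right _ _).pos_open hwo (by rw [orient_rot]; exact hpj.le) (by simp)
        (.inl (by rw [orient_rot]; exact hpj.ne'))
    · rw [orient_swap]; linarith
    · rw [orient_swap]; linarith

/-- A segment whose ends lie outside a fan and off the line through the extreme spoke `O (τ a)`, and
that meets neither the path nor the other extreme spoke, does not meet the fan at all: it could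
leave the fan only through the spoke `O (τ a)`, and that only once. -/
lemma fan_avoid {O : ℂ} {τ : ℤ → ℂ} {a b : ℤ} (hab : a < b)
    (hpos : ∀ i, a ≤ i → i < b → 0 < orient O (τ (i + 1)) (τ i)) {u v : ℂ}
    (hout : ∀ i, a ≤ i → i < b → ∀ x ∈ segment ℝ u v, x ∉ segment ℝ (τ i) (τ (i + 1)))
    (hb : ∀ x ∈ segment ℝ u v, x ∉ segment ℝ O (τ b))
    (hu : u ∉ Fan O τ a b) (hv : v ∉ Fan O τ a b)
    (hu' : orient (τ a) O u ≠ 0) (hv' : orient (τ a) O v ≠ 0) :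
    ∀ x ∈ segment ℝ u v, x ∉ Fan O τ a b ∧ x ∉ segment ℝ O (τ a) := by
  have sub : ∀ {u v x y : ℂ}, x ∈ segment ℝ u v → y ∈ segment ℝ x u → y ∈ segment ℝ u v :=
    fun hx hy => (convex_segment _ _).segment_subset hx (left_mem_segment _ _ _) hy
  have base : ∀ x ∈ segment ℝ u v, x ∉ segment ℝ O (τ a) := by
    intro z hz hzb
    have h0 : orient (τ a) O z = 0 := orient_open (seg_comm hzb)
    have main : ∀ u v : ℂ, z ∈ segment ℝ u v → u ∉ Fan O τ a b →
        (∀ i, a ≤ i → i < b → ∀ x ∈ segment ℝ u v, x ∉ segment ℝ (τ i) (τ (i + 1))) →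
        (∀ x ∈ segment ℝ u v, x ∉ segment ℝ O (τ b)) → 0 < orient (τ a) O u → False := by
      intro u v hz hu hout hb hpu
      have hpa := hpos a le_rfl hab
      have hzo : z ∈ openSegment ℝ O (τ a) := open_of_seg hzb
        (fun e => hb z hz (e ▸ left_mem_segment _ _ _))
        (fun e => hout a le_rfl hab z hz (e ▸ left_mem_segment _ _ _))
      -- beyond the spoke the segment enters the first triangle of the fan, and it does not meet
      -- the spoke again
      obtain ⟨ε, hε, h⟩ := Tri_eventually (w := z) (u := u) hpa
        (.inl ((Aff.orient_right _ _).pos_open hzo (by simp) hpa.le (.inr hpa.ne')))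
        (.inl ((Aff.orient_right _ _).pos_open hzo (by rw [orient_rot]; exact hpa.le) (by simp)
          (.inl (by rw [orient_rot]; exact hpa.ne'))))
        (.inr ⟨h0.ge, hpu.le⟩)
      have hδ : 0 < min ε 1 := lt_min hε one_pos
      have hT := h (min ε 1) hδ.le (min_le_left _ _)
      set y := pt z u (min ε 1) with hy
      have hyz : y ∈ segment ℝ z u := pt_mem_seg hδ.le (min_le_right _ _)
      have hyu : ∀ x ∈ segment ℝ y u, x ∈ segment ℝ u v := fun x hx => sub (sub hz hyz) hx
      have hyp : 0 < orient (τ a) O y := by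
        rw [hy, (Aff.orient_right _ _).pt, h0]; simp; positivity
      refine hu (fan_exit hpos ⟨a, le_rfl, hab, hT⟩ (fun i h1 h2 x hx => hout i h1 h2 x (hyu x hx))
        (fun x hx hxb => ?_) (fun x hx => hb x (hyu x hx)))
      have h2 := orient_open (seg_comm hxb)
      obtain ⟨r, r0, r1, rfl⟩ := mem_seg.1 hx
      rw [(Aff.orient_right _ _).pt] at h2
      nlinarith [mul_nonneg r0 hpu.le, mul_nonneg (sub_nonneg.2 r1) hyp.le, mul_pos hpu hyp]
    obtain ⟨r, r0, r1, hr⟩ := mem_seg.1 hz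
    rw [hr, (Aff.orient_right _ _).pt] at h0
    by_cases hup : 0 < orient (τ a) O u
    · exact main u v hz hu hout hb hup
    · refine main v u (seg_comm hz) hv (fun i h1 h2 x hx => hout i h1 h2 x (seg_comm hx))
        (fun x hx => hb x (seg_comm hx)) ?_
      have hup' : orient (τ a) O u < 0 := lt_of_le_of_ne (not_lt.1 hup) hu'
      by_contra hc
      have hvn : orient (τ a) O v < 0 := lt_of_le_of_ne (not_lt.1 hc) hv'
      nlinarith [mul_nonneg r0 (neg_pos.2 hvn).le, mul_nonneg (sub_nonneg.2 r1) (neg_pos.2 hup').le]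
  refine fun x hx => ⟨fun hxF => hu (fan_exit hpos hxF ?_ ?_ ?_), base x hx⟩
  · exact fun i h1 h2 y hy => hout i h1 h2 y (sub hx hy)
  · exact fun y hy => base y (sub hx hy)
  · exact fun y hy => hb y (sub hx hy)

lemma Fan_star {O : ℂ} {τ : ℤ → ℂ} {a b : ℤ} {z : ℂ} (hz : z ∈ Fan O τ a b) :
    segment ℝ O z ⊆ Fan O τ a b := by
  obtain ⟨i, h1, h2, h⟩ := hz
  exact fun x hx => ⟨i, h1, h2, seg_sub_Tri (left_mem_Tri _ _ _) h hx⟩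

/-- A set that is star-shaped about `O` and contains `K` contains the bounded components of the
complement of `K`. -/
lemma mem_of_bounded_component {K F : Set ℂ} {O z : ℂ} (hO : O ∈ F)
    (hstar : ∀ y ∈ F, segment ℝ O y ⊆ F) (hK : K ⊆ F)
    (hb : Bornology.IsBounded (connectedComponentIn Kᶜ z)) : z ∈ F := by
  by_contra hz
  have hzO : z - O ≠ 0 := fun h => hz (by rw [sub_eq_zero.1 h]; exact hO)
  have hcont : Continuous (pt O z) := by unfold pt; fun_prop
  -- the ray from `z` away from `O` misses `F`, hence `K`, and it is unbounded
  have hconn : IsPreconnected (pt O z '' Ici 1) :=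
    isPreconnected_Ici.image _ hcont.continuousOn
  have hsub : pt O z '' Ici 1 ⊆ Kᶜ := by
    rintro _ ⟨t, ht, rfl⟩ hmem
    have ht : 1 ≤ t := ht
    refine hz (hstar _ (hK hmem) (mem_seg.2 ⟨1 / t, by positivity,
      by rw [div_le_one (by linarith)]; exact ht, ?_⟩))
    have : t ≠ 0 := by linarith
    apply Complex.ext <;> simp only [pt_re, pt_im] <;> field_simp <;> ring
  have hsub' := hconn.subset_connectedComponentIn (x := z) ⟨1, by simp, by simp⟩ hsub
  obtain ⟨R, hR⟩ := (hb.subset hsub').exists_norm_le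
  have hn : 0 < ‖z - O‖ := norm_pos_iff.2 hzO
  have h1 := hR (pt O z (1 + (|R| + ‖O‖ + 1) / ‖z - O‖)) ⟨_, by
    simp only [mem_Ici, le_add_iff_nonneg_right]; positivity, rfl⟩
  have h2 : ‖(1 + (|R| + ‖O‖ + 1) / ‖z - O‖) • (z - O)‖ =
      ‖z - O‖ + (|R| + ‖O‖ + 1) := by
    rw [norm_smul, Real.norm_eq_abs, abs_of_pos (by positivity)]; field_simp
  have h3 : ‖(1 + (|R| + ‖O‖ + 1) / ‖z - O‖) • (z - O)‖ ≤
      ‖pt O z (1 + (|R| + ‖O‖ + 1) / ‖z - O‖)‖ + ‖O‖ := by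
    have := norm_sub_le (pt O z (1 + (|R| + ‖O‖ + 1) / ‖z - O‖)) O
    unfold pt at this ⊢
    rwa [add_sub_cancel_left] at this
  linarith [le_abs_self R]

section
variable {o : ℂ} {s : ℝ} {V : Finset ℂ} {E : ℂ → ℂ → Prop} {τ : ℤ → ℂ} {k c : ℤ}

/-- A segment between two vertices that misses the chain also misses its base and its fan. -/
lemma LeftChain.avoid (L : LeftChain o s V E τ k c) {u v : ℂ} (hu : u ∈ V) (hv : v ∈ V)
    (hout : ∀ i, k ≤ i → i ≤ c → ∀ x ∈ segment ℝ u v, x ∉ segment ℝ (τ i) (τ (i + 1))) :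
    ∀ x ∈ segment ℝ u v, x ∉ Fan (τ (c + 1)) τ k c ∧ x ∉ segment ℝ (τ (c + 1)) (τ k) := by
  have H := L.cfg
  have W := L.walk
  obtain ⟨t, ρ, h⟩ := L.exists_frame
  have F : Frame o s V E τ k c t ρ :=
    { L with t0 := h.1, t1 := h.2.1, ρ0 := h.2.2.1, ρ1 := h.2.2.2.1, pred := h.2.2.2.2.1,
             empty := h.2.2.2.2.2.1, clear := h.2.2.2.2.2.2 }
  have fan : ∀ i, k ≤ i → i < c → FanAt V E τ k c t (τ (c + 1)) i := fun i h1 h2 => by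
    have := F.fan (r := 1) F.t1 le_rfl (by rw [pt_one]; exact H.clear_edge (H.symm (W.adj c))) h1 h2
    rwa [pt_one] at this
  have nv : ∀ w ∈ segment ℝ u v, ∀ i, k ≤ i → i ≤ c + 1 → w ≠ τ i := by
    intro w hw i h1 h2 e
    rcases h2.lt_or_eq with h | h
    · exact hout i h1 (by omega) w hw (e ▸ left_mem_segment _ _ _)
    · refine hout c F.lt.le le_rfl w hw ?_
      rw [e, h]; exact right_mem_segment _ _ _
  have nF : ∀ w ∈ V, w ∈ segment ℝ u v → w ∉ Fan (τ (c + 1)) τ k c := by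
    rintro w hwV hw ⟨i, h1, h2, hT⟩
    rcases (fan i h1 h2).empty w hwV hT with h | h | h
    · exact nv w hw _ (by omega) (by omega) h
    · exact nv w hw _ (by omega) (by omega) h
    · exact nv w hw _ (by omega) (by omega) h
  have no : ∀ w ∈ V, w ∈ segment ℝ u v → orient (τ k) (τ (c + 1)) w ≠ 0 := by
    intro w hwV hw h0
    rcases H.eq_of_orient (W.mem H _) (W.mem H _) hwV L.base_ne h0 with h | h
    · exact nv w hw _ le_rfl (by have := L.lt; omega) h
    · exact nv w hw _ (by have := L.lt; omega) le_rfl h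
  exact fan_avoid L.lt (fun i h1 h2 => (fan i h1 h2).pos)
    (fun i h1 h2 => hout i h1 h2.le)
    (fun x hx h => hout c L.lt.le le_rfl x hx (seg_comm h))
    (nF u hu (left_mem_segment _ _ _)) (nF v hv (right_mem_segment _ _ _))
    (no u hu (left_mem_segment _ _ _)) (no v hv (right_mem_segment _ _ _))

end

/-! ### Mirror images -/

/-- The reflection in the diagonal; it exchanges the two coordinates and hence preserves the grid.
-/
def mir (z : ℂ) : ℂ := ⟨z.im, z.re⟩

@[simp] lemma mir_mir (z : ℂ) : mir (mir z) = z := rfl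
lemma mir_inj {a b : ℂ} : mir a = mir b ↔ a = b :=
  ⟨fun h => by have := congrArg mir h; simpa using this, fun h => h ▸ rfl⟩
lemma mir_pt (a b : ℂ) (t : ℝ) : mir (pt a b t) = pt (mir a) (mir b) t := by
  apply Complex.ext <;> simp [mir, pt_re, pt_im]
@[simp] lemma orient_mir (a b c : ℂ) : orient (mir a) (mir b) (mir c) = -orient a b c := by
  unfold orient mir; simp only; ring
lemma seg_mir {a b z : ℂ} : mir z ∈ segment ℝ (mir a) (mir b) ↔ z ∈ segment ℝ a b := by
  simp only [mem_seg, ← mir_pt, mir_inj]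
lemma open_mir {a b z : ℂ} : mir z ∈ openSegment ℝ (mir a) (mir b) ↔ z ∈ openSegment ℝ a b := by
  simp only [mem_open, ← mir_pt, mir_inj]
lemma Tri_mir {a b c z : ℂ} (h : z ∈ Tri a b c) : mir z ∈ Tri (mir a) (mir b) (mir c) := by
  obtain ⟨x, y, w, hx, hy, hw, e, rfl⟩ := h
  refine ⟨x, y, w, hx, hy, hw, e, ?_⟩
  apply Complex.ext <;> simp [mir]
lemma near_mir {o : ℂ} {s : ℝ} {a b : ℂ} : Near (mir o) s (mir a) (mir b) ↔ Near o s a b := by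
  rw [near_iff, near_iff]
  simp only [gx, gy, mir]
  exact and_comm

/-- The mirror image of a finite set. -/
noncomputable abbrev mV (V : Finset ℂ) : Finset ℂ := V.image mir
/-- The mirror image of a graph. -/
abbrev mE (E : ℂ → ℂ → Prop) : ℂ → ℂ → Prop := fun a b => E (mir a) (mir b)
/-- The mirror image of a walk, traversed backwards so that the face stays on the right. -/
abbrev mτ (τ : ℤ → ℂ) : ℤ → ℂ := fun i => mir (τ (-i))

section
variable {o : ℂ} {s : ℝ} {V : Finset ℂ} {E : ℂ → ℂ → Prop} {τ : ℤ → ℂ} {k c b e : ℤ}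

lemma mem_mV {v : ℂ} : v ∈ mV V ↔ mir v ∈ V := by
  simp only [mV, Finset.mem_image]
  exact ⟨by rintro ⟨w, hw, rfl⟩; exact hw, fun h => ⟨_, h, rfl⟩⟩

lemma open_mir' {a b z : ℂ} (h : z ∈ openSegment ℝ a b) :
    mir z ∈ openSegment ℝ (mir a) (mir b) := open_mir.2 h

lemma orient_mir' (a b c : ℂ) : orient a b c = -orient (mir a) (mir b) (mir c) := by simp

lemma Cfg.mir (H : Cfg o s V E) : Cfg (mir o) s (mV V) (mE E) where
  hs := H.hs
  gp a ha b hb c hc hab hac hbc := by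
    rw [orient_mir', neg_ne_zero]
    exact H.gp _ (mem_mV.1 ha) _ (mem_mV.1 hb) _ (mem_mV.1 hc) (mt mir_inj.1 hab) (mt mir_inj.1 hac)
      (mt mir_inj.1 hbc)
  symm h := H.symm h
  mem h := mem_mV.2 (H.mem h)
  ne h := fun e => H.ne h (e ▸ rfl)
  near h := by have := near_mir.2 (H.near h); simpa using this
  planar h h' hz hz' := by
    have := H.planar h h' (open_mir' hz) (open_mir' hz')
    simpa only [mir_inj] using this
  maxl ha hb hab hn h := by
    refine H.maxl (mem_mV.1 ha) (mem_mV.1 hb) (mt mir_inj.1 hab) (near_mir.1 (by simpa using hn))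
      fun c d hcd z hz hz' => h (GridMWT.mir c) (GridMWT.mir d) hcd
        (GridMWT.mir z) (by have := open_mir' hz; simpa using this)
        (by have := open_mir' hz'; simpa using this)

lemma Clear.mir {x y : ℂ} (h : Clear E x y) : Clear (mE E) (mir x) (mir y) := by
  intro c d hcd z hz hz'
  have := h _ _ hcd (GridMWT.mir z) (by have := open_mir' hz; simpa using this) (open_mir' hz')
  rw [orient_mir']; simpa using this

lemma Corner.mir {u v w : ℂ} (h : Corner E u v w) :
    Corner (mE E) (mir w) (mir v) (mir u) := by
  intro x hx
  have := h _ hx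
  have e1 : orient (GridMWT.mir v) (GridMWT.mir w) x = orient v (GridMWT.mir x) w := by
    unfold orient GridMWT.mir; simp only; ring
  have e2 : orient (GridMWT.mir v) x (GridMWT.mir u) = orient v u (GridMWT.mir x) := by
    unfold orient GridMWT.mir; simp only; ring
  have e3 : orient (GridMWT.mir v) (GridMWT.mir w) (GridMWT.mir u) = orient v u w := by
    unfold orient GridMWT.mir; simp only; ring
  rw [e1, e2, e3]
  exact ⟨this.2, this.1⟩

lemma Free.mir {p q : ℂ} (h : Free V E p q) : Free (mV V) (mE E) (mir p) (mir q) := by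
  refine ⟨fun v hv hz => h.1 _ (mem_mV.1 hv) (by have := open_mir' hz; simpa using this),
    fun a b hab z hz hz' => h.2 _ _ hab (GridMWT.mir z) (by have := open_mir' hz; simpa using this)
      (seg_mir.2 hz')⟩

lemma IsWalk.mir (W : IsWalk E τ) (H : Cfg o s V E) : IsWalk (mE E) (mτ τ) where
  adj i := by
    have := H.symm (W.adj' (-i))
    show E (GridMWT.mir (GridMWT.mir (τ (-i)))) (GridMWT.mir (GridMWT.mir (τ (-(i + 1)))))
    rw [show -(i + 1) = -i - 1 by ring]
    exact this
  corner i := by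
    have := (W.corner (-(i + 2))).mir
    rw [show -(i + 2) + 1 = -(i + 1) by ring, show -(i + 2) + 2 = -i by ring] at this
    exact this

/-- The mirror image of a `LeftChain`: a chain `τ (b - 1), τ b, …, τ e`, all of whose vertices
strictly between `τ b` and `τ e` are reflex, such that the convex vertex `τ b` is close to `τ e` and
`τ (b - 1)`, `τ e` see each other. -/
structure RightChain (o : ℂ) (s : ℝ) (V : Finset ℂ) (E : ℂ → ℂ → Prop) (τ : ℤ → ℂ) (b e : ℤ) :
    Prop where
  cfg : Cfg o s V E
  walk : IsWalk E τ
  lt : b < e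
  conv : 0 < orient (τ b) (τ (b - 1)) (τ (b + 1))
  refl : ∀ i, b < i → i < e → orient (τ i) (τ (i - 1)) (τ (i + 1)) ≤ 0
  pos : 0 < orient (τ (b - 1)) (τ e) (τ b)
  near : Near o s (τ b) (τ e)
  free : Free V E (τ (b - 1)) (τ e)
  right : Corner E (τ (e - 1)) (τ e) (τ (b - 1))
  left : Corner E (τ (b - 2)) (τ (b - 1)) (τ e)

lemma RightChain.mir (R : RightChain o s V E τ b e) :
    LeftChain (mir o) s (mV V) (mE E) (mτ τ) (-e) (-b) where
  cfg := R.cfg.mir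
  walk := R.walk.mir R.cfg
  lt := by have := R.lt; omega
  conv := by
    have := R.conv
    simp only [mτ, orient_mir, neg_neg, show -(-b - 1) = b + 1 by ring,
      show -(-b + 1) = b - 1 by ring]
    rw [orient_swap']; linarith
  refl i h1 h2 := by
    have := R.refl (-i) (by omega) (by omega)
    simp only [mτ, orient_mir, show -(i - 1) = -i + 1 by ring, show -(i + 1) = -i - 1 by ring]
    rw [orient_swap']; linarith
  pos := by
    have := R.pos
    simp only [mτ, orient_mir, neg_neg, show -(-b + 1) = b - 1 by ring]
    rw [orient_swap]; linarith
  near := by simpa [near_mir] using R.near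
  free := by
    have := R.free.symm.mir
    simpa only [mτ, neg_neg, show -(-b + 1) = b - 1 by ring] using this
  left := by
    have := R.right.mir
    simpa only [mτ, neg_neg, show -(-b + 1) = b - 1 by ring, show -(-e + 1) = e - 1 by ring]
      using this
  right := by
    have := R.left.mir
    simpa only [mτ, neg_neg, show -(-b + 1) = b - 1 by ring, show -(-b + 2) = b - 2 by ring]
      using this

lemma LeftChain.mir (L : LeftChain o s V E τ k c) :
    RightChain (mir o) s (mV V) (mE E) (mτ τ) (-c) (-k) where
  cfg := L.cfg.mir
  walk := L.walk.mir L.cfg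
  lt := by have := L.lt; omega
  conv := by
    have := L.conv
    simp only [mτ, orient_mir, neg_neg, show -(-c - 1) = c + 1 by ring,
      show -(-c + 1) = c - 1 by ring]
    rw [orient_swap']; linarith
  refl i h1 h2 := by
    have := L.refl (-i) (by omega) (by omega)
    simp only [mτ, orient_mir, show -(i - 1) = -i + 1 by ring, show -(i + 1) = -i - 1 by ring]
    rw [orient_swap']; linarith
  pos := by
    have := L.pos
    simp only [mτ, orient_mir, neg_neg, show -(-c - 1) = c + 1 by ring]
    rw [orient_swap]; linarith
  near := by simpa [near_mir] using L.near
  free := by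
    have := L.free.symm.mir
    simpa only [mτ, neg_neg, show -(-c - 1) = c + 1 by ring] using this
  right := by
    have := L.left.mir
    simpa only [mτ, neg_neg, show -(-c - 1) = c + 1 by ring, show -(-k - 1) = k + 1 by ring]
      using this
  left := by
    have := L.right.mir
    simpa only [mτ, neg_neg, show -(-c - 1) = c + 1 by ring, show -(-c - 2) = c + 2 by ring]
      using this

/-! ### Regions of chains -/

/-- The chain `τ k, …, τ e` and its base lie in a star-shaped set that is missed by every segment
between two vertices that misses the chain. -/
def Covered (V : Finset ℂ) (τ : ℤ → ℂ) (k e : ℤ) : Prop :=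
  ∃ O : ℂ, ∃ F : Set ℂ, O ∈ F ∧ (∀ y ∈ F, segment ℝ O y ⊆ F) ∧ segment ℝ (τ k) (τ e) ⊆ F ∧
    (∀ i, k ≤ i → i < e → segment ℝ (τ i) (τ (i + 1)) ⊆ F) ∧
    ∀ u ∈ V, ∀ v ∈ V,
      (∀ i, k ≤ i → i < e → ∀ x ∈ segment ℝ u v, x ∉ segment ℝ (τ i) (τ (i + 1))) →
      ∀ x ∈ segment ℝ u v, x ∉ F

lemma Covered.of_mir (h : Covered (mV V) (mτ τ) (-e) (-k)) : Covered V τ k e := by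
  obtain ⟨O, F, hO, hs, hb, hc, ha⟩ := h
  refine ⟨mir O, {z | mir z ∈ F}, by simpa using hO, fun y hy x hx => ?_, fun x hx => ?_,
    fun i h1 h2 x hx => ?_, fun u hu v hv hout x hx => ?_⟩
  · exact hs _ hy (by rw [← mir_mir O]; exact seg_mir.2 hx)
  · refine hb ?_
    simp only [mτ, neg_neg]
    exact seg_mir.2 (seg_comm hx)
  · refine hc (-i - 1) (by omega) (by omega) ?_
    simp only [mτ, show -(-i - 1) = i + 1 by ring, show -(-i - 1 + 1) = i by ring]
    exact seg_mir.2 (seg_comm hx)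
  · refine ha (mir u) (mem_mV.2 (by simpa using hu)) (mir v) (mem_mV.2 (by simpa using hv)) ?_ _
      (seg_mir.2 hx)
    intro i h1 h2 y hy hy'
    refine hout (-i - 1) (by omega) (by omega) (mir y) (by rw [← seg_mir]; simpa using hy) ?_
    rw [← seg_mir, mir_mir]
    have : -i - 1 + 1 = -i := by ring
    rw [this, show -i - 1 = -(i + 1) by ring]
    exact seg_comm hy'

lemma LeftChain.exists_frame' (L : LeftChain o s V E τ k c) : ∃ t ρ, Frame o s V E τ k c t ρ := by
  obtain ⟨t, ρ, h⟩ := L.exists_frame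
  exact ⟨t, ρ, { L with t0 := h.1, t1 := h.2.1, ρ0 := h.2.2.1, ρ1 := h.2.2.2.1,
                        pred := h.2.2.2.2.1, empty := h.2.2.2.2.2.1, clear := h.2.2.2.2.2.2 }⟩

/-- The path of a fan is contained in it. -/
lemma Fan_path {O : ℂ} {a b i : ℤ} (h1 : a ≤ i) (h2 : i < b) :
    segment ℝ (τ i) (τ (i + 1)) ⊆ Fan O τ a b := fun _ hx =>
  ⟨i, h1, h2, seg_sub_Tri (right_mem_Tri _ _ _) (mid_mem_Tri _ _ _) hx⟩

lemma LeftChain.covered (L : LeftChain o s V E τ k c) : Covered V τ k (c + 1) := by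
  have hlt := L.lt
  -- the fan of the chain is centred at the end of the base
  refine ⟨τ (c + 1), Fan (τ (c + 1)) τ k c, ⟨k, le_rfl, hlt, left_mem_Tri _ _ _⟩,
    fun y hy => Fan_star hy, ?_, ?_, ?_⟩
  · rw [segment_symm]; exact Fan_star ⟨k, le_rfl, hlt, right_mem_Tri _ _ _⟩
  · intro i h1 h2
    rcases (show i ≤ c by omega).lt_or_eq with h | rfl
    · exact Fan_path h1 h
    · rw [segment_symm]
      refine Fan_star ⟨i - 1, by omega, by omega, ?_⟩
      rw [sub_add_cancel]; exact mid_mem_Tri _ _ _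
  · intro u hu v hv hout x hx
    exact (L.avoid hu hv (fun i h1 h2 => hout i h1 (by omega)) x hx).1

lemma RightChain.covered (R : RightChain o s V E τ b e) : Covered V τ (b - 1) e := by
  apply Covered.of_mir
  have := R.mir.covered
  rwa [show -b + 1 = -(b - 1) by ring] at this

lemma RightChain.avoid (R : RightChain o s V E τ b e) {u v : ℂ} (hu : u ∈ V) (hv : v ∈ V)
    (hout : ∀ i, b - 1 ≤ i → i < e → ∀ x ∈ segment ℝ u v, x ∉ segment ℝ (τ i) (τ (i + 1))) :
    ∀ x ∈ segment ℝ u v, x ∉ segment ℝ (τ (b - 1)) (τ e) := by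
  intro x hx hx'
  refine (R.mir.avoid (u := GridMWT.mir u) (v := GridMWT.mir v) (mem_mV.2 (by simpa using hu))
    (mem_mV.2 (by simpa using hv)) ?_ (GridMWT.mir x) (seg_mir.2 hx)).2 ?_
  · intro i h1 h2 y hy hy'
    refine hout (-i - 1) (by omega) (by omega) (GridMWT.mir y) (by rw [← seg_mir]; simpa using hy) ?_
    rw [← seg_mir, mir_mir]
    rw [show -i - 1 + 1 = -i by ring, show -i - 1 = -(i + 1) by ring]
    exact seg_comm hy'
  · simp only [mτ, neg_neg, show -(-b + 1) = b - 1 by ring]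
    exact seg_mir.2 hx'

/-- The data of a chain `τ k, …, τ e` that is extended beyond the forward support vertex: a left
chain with apex `τ c` and a right chain with apex `τ b` whose bases cross in `X`. The frames are at
the parameters `t` and `t'` of the bases, and `X` lies at the parameters `r` and `r'`, beyond the
frames. -/
structure Crossing (o : ℂ) (s : ℝ) (V : Finset ℂ) (E : ℂ → ℂ → Prop) (τ : ℤ → ℂ) (k c b e : ℤ)
    (t ρ t' ρ' r r' : ℝ) (X : ℂ) : Prop where
  L : Frame o s V E τ k c t ρ
  R : RightChain o s V E τ b e
  R' : Frame (mir o) s (mV V) (mE E) (mτ τ) (-e) (-b) t' ρ'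
  hbc : b = c ∨ b = c + 1
  hkb : k < b - 1
  hce : c + 1 < e
  tr : t < r
  r1 : r < 1
  tr' : t' < r'
  r1' : r' < 1
  hX : X = pt (τ k) (τ (c + 1)) r
  hX' : X = pt (τ e) (τ (b - 1)) r'
  clear : Clear E X (τ c)
  clear' : Clear E X (τ b)

namespace Crossing
variable {t ρ t' ρ' r r' : ℝ} {X : ℂ}

lemma mir (C : Crossing o s V E τ k c b e t ρ t' ρ' r r' X) :
    Crossing (mir o) s (mV V) (mE E) (mτ τ) (-e) (-b) (-c) (-k) t' ρ' t ρ r' r (mir X) where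
  L := C.R'
  R := C.L.toLeftChain.mir
  R' := by
    have h1 : mτ (mτ τ) = τ := by funext i; simp [mτ]
    have h2 : mV (mV V) = V := by ext v; rw [mem_mV, mem_mV, mir_mir]
    have h3 : mE (mE E) = E := by funext a b; simp [mE]
    rw [h1, h2, h3, mir_mir, neg_neg, neg_neg]; exact C.L
  hbc := by have := C.hbc; omega
  hkb := by have := C.hce; omega
  hce := by have := C.hkb; omega
  tr := C.tr'
  r1 := C.r1'
  tr' := C.tr
  r1' := C.r1
  hX := by
    rw [C.hX', mir_pt]; simp only [mτ, neg_neg, show -(-b + 1) = b - 1 by ring]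
  hX' := by
    rw [C.hX, mir_pt]; simp only [mτ, neg_neg, show -(-c - 1) = c + 1 by ring]
  clear := by have := C.clear'.mir; simpa only [mτ, neg_neg] using this
  clear' := by have := C.clear.mir; simpa only [mτ, neg_neg] using this

lemma fanL (C : Crossing o s V E τ k c b e t ρ t' ρ' r r' X) {i : ℤ} (h1 : k ≤ i) (h2 : i < c) :
    FanAt V E τ k c t X i := by
  have := C.L.fan C.tr C.r1.le (by rw [← C.hX]; exact C.clear) h1 h2
  rwa [← C.hX] at this

lemma fanR (C : Crossing o s V E τ k c b e t ρ t' ρ' r r' X) {i : ℤ} (h1 : b ≤ i) (h2 : i < e) :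
    0 < orient X (τ (i + 1)) (τ i) ∧
      ∀ v ∈ V, v ∈ Tri X (τ (i + 1)) (τ i) → v = τ (b - 1) ∨ v = τ (i + 1) ∨ v = τ i := by
  have := C.mir.fanL (i := -(i + 1)) (by omega) (by omega)
  have e1 : mτ τ (-(i + 1)) = GridMWT.mir (τ (i + 1)) := by simp only [mτ, neg_neg]
  have e2 : mτ τ (-(i + 1) + 1) = GridMWT.mir (τ i) := by
    simp only [mτ, show -(-(i + 1) + 1) = i by ring]
  have e3 : mτ τ (-b + 1) = GridMWT.mir (τ (b - 1)) := by
    simp only [mτ, show -(-b + 1) = b - 1 by ring]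
  have hp := this.pos
  have he := this.empty
  rw [e1, e2] at hp he
  rw [orient_mir, orient_swap'] at hp
  refine ⟨by linarith, fun v hv hT => ?_⟩
  have := he (GridMWT.mir v) (mem_mV.2 (by simpa using hv)) (Tri_mir (Tri_swap' hT))
  rw [e3, mir_inj, mir_inj, mir_inj] at this
  tauto

/-- The fan at the crossing point contains no vertices outside the chain. -/
lemma fan (C : Crossing o s V E τ k c b e t ρ t' ρ' r r' X) {i : ℤ} (h1 : k ≤ i) (h2 : i < e) :
    0 < orient X (τ (i + 1)) (τ i) ∧
      ∀ v ∈ V, v ∈ Tri X (τ (i + 1)) (τ i) → ∃ j, k ≤ j ∧ j ≤ e ∧ v = τ j := by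
  have hbc := C.hbc; have hkb := C.hkb; have hce := C.hce
  by_cases hc : i < c
  · have := C.fanL h1 hc
    refine ⟨this.pos, fun v hv hT => ?_⟩
    rcases this.empty v hv hT with h | h | h
    · exact ⟨_, by omega, by omega, h⟩
    · exact ⟨_, by omega, by omega, h⟩
    · exact ⟨_, by omega, by omega, h⟩
  by_cases hb : b ≤ i
  · have := C.fanR hb h2
    refine ⟨this.1, fun v hv hT => ?_⟩
    rcases this.2 v hv hT with h | h | h
    · exact ⟨_, by omega, by omega, h⟩
    · exact ⟨_, by omega, by omega, h⟩
    · exact ⟨_, by omega, by omega, h⟩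
  have hic : i = c := by omega
  subst hic
  have L := C.L
  have t0 := L.t0; have r1 := C.r1; have tr := C.tr; have pos := L.pos
  refine ⟨?_, fun v hv hT => ?_⟩
  · have : orient X (τ (i + 1)) (τ i) = (1 - r) * orient (τ k) (τ (i + 1)) (τ i) := by
      rw [C.hX]; unfold orient; simp only [pt_re, pt_im]; ring
    rw [this]; have := sub_pos.2 r1; positivity
  · have hXT : X ∈ Tri (τ (i + 1)) (pt (τ k) (τ (i + 1)) t) (τ i) := by
      refine seg_sub_Tri (left_mem_Tri _ _ _) (mid_mem_Tri _ _ _) (mem_seg.2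
        ⟨(1 - r) / (1 - t), div_nonneg (by linarith) (by linarith),
        by rw [div_le_one] <;> linarith, ?_⟩)
      have : 1 - t ≠ 0 := by linarith
      rw [C.hX]
      apply Complex.ext <;> simp only [pt_re, pt_im] <;> field_simp <;> ring
    rcases L.empty v hv (Tri_subset hXT (left_mem_Tri _ _ _) (right_mem_Tri _ _ _) hT) with
      h | h | h
    · exact ⟨_, by omega, by omega, h⟩
    · exact ⟨_, by omega, by omega, h⟩
    · exact ⟨_, by omega, by omega, h⟩

/-- The start of the base of the right chain lies above the base of the left chain. -/
lemma orient_left_end (C : Crossing o s V E τ k c b e t ρ t' ρ' r r' X) :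
    0 < orient (τ k) (τ (c + 1)) (τ (b - 1)) := by
  have L := C.L
  rcases C.hbc with rfl | rfl
  · have hne : τ (b - 1) ≠ τ k := L.fan_ne C.tr (by have := C.hkb; omega) le_rfl
      (by rw [← C.hX]; exact C.fanL (by have := C.hkb; omega) (by omega))
    have : orient (τ k) (τ (b + 1)) (τ (b - 1)) = ρ * orient (τ k) (τ (b + 1)) (τ b) := by
      rw [L.pred]; unfold orient; simp only [pt_re, pt_im]; ring
    rw [this]; exact mul_pos (L.ρ_pos hne) L.pos
  · rw [add_sub_cancel_right]; exact L.pos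

lemma r0 (C : Crossing o s V E τ k c b e t ρ t' ρ' r r' X) : 0 < r :=
  lt_of_le_of_lt C.L.t0 C.tr
lemma r0' (C : Crossing o s V E τ k c b e t ρ t' ρ' r r' X) : 0 < r' :=
  lt_of_le_of_lt C.R'.t0 C.tr'

/-- The end of the chain lies below the base of the left chain. -/
lemma orient_right_end (C : Crossing o s V E τ k c b e t ρ t' ρ' r r' X) :
    orient (τ k) (τ (c + 1)) (τ e) < 0 := by
  have h1 := C.orient_left_end
  have h2 : orient (τ k) (τ (c + 1)) X = 0 := by
    rw [C.hX]; unfold orient; simp only [pt_re, pt_im]; ring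
  rw [C.hX', (Aff.orient_right _ _).pt] at h2
  have := C.r0'; have := C.r1'
  by_contra hc
  push Not at hc
  nlinarith [mul_nonneg (sub_pos.2 C.r1').le hc, mul_pos C.r0' h1]

lemma orient_base (C : Crossing o s V E τ k c b e t ρ t' ρ' r r' X) :
    0 < orient X (τ k) (τ e) := by
  have h1 := C.orient_right_end
  have : orient X (τ k) (τ e) = -(r * orient (τ k) (τ (c + 1)) (τ e)) := by
    rw [C.hX]; unfold orient; simp only [pt_re, pt_im]; ring
  rw [this]; nlinarith [mul_pos C.r0 (neg_pos.2 h1)]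

/-- If the triangle below the crossing point contains no further vertices, then the region of the
chain is covered. -/
lemma covered (C : Crossing o s V E τ k c b e t ρ t' ρ' r r' X)
    (hT : ∀ v ∈ V, v ∈ Tri X (τ k) (τ e) → v = τ k ∨ v = τ e) : Covered V τ k e := by
  have H := C.L.cfg
  have W := C.L.walk
  have hkb := C.hkb; have hbc := C.hbc; have hce := C.hce
  have hXp : X ∈ segment ℝ (τ (c + 1)) (τ k) := seg_comm (by
    rw [C.hX]; exact pt_mem_seg C.r0.le C.r1.le)
  have hXe : X ∈ segment ℝ (τ (b - 1)) (τ e) := seg_comm (by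
    rw [C.hX']; exact pt_mem_seg C.r0'.le C.r1'.le)
  -- the fan at the crossing point together with the triangle over the base
  refine ⟨X, Fan X τ k e ∪ Tri X (τ k) (τ e), .inr (left_mem_Tri _ _ _), ?_, ?_, ?_, ?_⟩
  · rintro y (hy | hy)
    · exact (Fan_star hy).trans subset_union_left
    · exact fun x hx => .inr (seg_sub_Tri (left_mem_Tri _ _ _) hy hx)
  · exact fun x hx => .inr (seg_sub_Tri (mid_mem_Tri _ _ _) (right_mem_Tri _ _ _) hx)
  · exact fun i h1 h2 => (Fan_path h1 h2).trans subset_union_left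
  · intro u hu v hv hout
    have nv : ∀ w ∈ segment ℝ u v, ∀ i, k ≤ i → i ≤ e → w ≠ τ i := by
      intro w hw i h1 h2 he
      rcases h2.lt_or_eq with h | h
      · exact hout i h1 h w hw (he ▸ left_mem_segment _ _ _)
      · refine hout (e - 1) (by omega) (by omega) w hw ?_
        rw [he, h, sub_add_cancel]; exact right_mem_segment _ _ _
    have hg := fun x hx => (C.L.toLeftChain.avoid hu hv
      (fun i h1 h2 => hout i h1 (by omega)) x hx).2
    have hg' := C.R.avoid hu hv (fun i h1 h2 => hout i (by omega) h2)
    have hsub : segment ℝ X (τ k) ⊆ segment ℝ (τ (c + 1)) (τ k) :=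
      (convex_segment _ _).segment_subset hXp (right_mem_segment _ _ _)
    have hsub' : segment ℝ X (τ e) ⊆ segment ℝ (τ (b - 1)) (τ e) :=
      (convex_segment _ _).segment_subset hXe (right_mem_segment _ _ _)
    -- the spokes at both ends of the fan lie on the bases of the two chains, which the segment
    -- misses
    have hF : ∀ x ∈ segment ℝ u v, x ∉ Fan X τ k e := by
      intro x hx hxF
      obtain ⟨i, h1, h2, hiT⟩ : u ∈ Fan X τ k e := by
        have sub : ∀ y ∈ segment ℝ x u, y ∈ segment ℝ u v := fun y hy =>
          (convex_segment _ _).segment_subset hx (left_mem_segment _ _ _) hy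
        exact fan_exit (fun i h1 h2 => (C.fan h1 h2).1) hxF
          (fun i h1 h2 y hy => hout i h1 h2 y (sub y hy))
          (fun y hy h => hg y (sub y hy) (hsub h)) (fun y hy h => hg' y (sub y hy) (hsub' h))
      obtain ⟨j, h3, h4, h5⟩ := (C.fan h1 h2).2 u hu hiT
      exact nv u (left_mem_segment _ _ _) j h3 h4 h5
    have hke : τ k ≠ τ e := by
      intro h; have := C.orient_base; rw [h] at this; simp at this
    have no : ∀ w ∈ V, w ∈ segment ℝ u v → orient (τ k) (τ e) w ≠ 0 := by
      intro w hwV hw h0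
      rcases H.eq_of_orient (W.mem H _) (W.mem H _) hwV hke h0 with h | h
      · exact nv w hw _ le_rfl (by omega) h
      · exact nv w hw _ (by omega) le_rfl h
    have nT : ∀ w ∈ V, w ∈ segment ℝ u v → w ∉ Tri X (τ k) (τ e) := by
      intro w hwV hw h
      rcases hT w hwV h with h | h
      · exact nv w hw _ le_rfl (by omega) h
      · exact nv w hw _ (by omega) le_rfl h
    -- the triangle as a fan with a single triangle
    set θ : ℤ → ℂ := fun i => if i = 0 then τ k else X with hθ
    have hθ0 : θ 0 = τ k := by simp [hθ]
    have hθ1 : θ 1 = X := by simp [hθ]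
    have hfan : ∀ w, w ∈ Fan (τ e) θ 0 1 → w ∈ Tri X (τ k) (τ e) := by
      rintro w ⟨i, h1, h2, h⟩
      have : i = 0 := by omega
      rw [this, zero_add, hθ0, hθ1] at h
      exact Tri_rot h
    have hfan' : ∀ w, w ∈ Tri X (τ k) (τ e) → w ∈ Fan (τ e) θ 0 1 := by
      intro w h
      refine ⟨0, le_rfl, by norm_num, ?_⟩
      rw [zero_add, hθ0, hθ1]; exact Tri_rot (Tri_rot h)
    have key := fan_avoid (O := τ e) (τ := θ) (a := 0) (b := 1) (u := u) (v := v) (by norm_num)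
      (fun i h1 h2 => by
        have : i = 0 := by omega
        rw [this, zero_add, hθ0, hθ1, orient_rot']; exact C.orient_base)
      (fun i h1 h2 x hx h => by
        have : i = 0 := by omega
        rw [this, zero_add, hθ0, hθ1] at h
        exact hg x hx (hsub (seg_comm h)))
      (fun x hx h => hg' x hx (hsub' (seg_comm (by rwa [hθ1] at h))))
      (fun h => nT u hu (left_mem_segment _ _ _) (hfan _ h))
      (fun h => nT v hv (right_mem_segment _ _ _) (hfan _ h))
      (by rw [hθ0]; exact no u hu (left_mem_segment _ _ _))
      (by rw [hθ0]; exact no v hv (right_mem_segment _ _ _))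
    rintro x hx (h | h)
    · exact hF x hx h
    · exact (key x hx).1 (hfan' x h)

end Crossing
end

/-! ### The crossing of the two bases -/

section
variable {o : ℂ} {s : ℝ} {V : Finset ℂ} {E : ℂ → ℂ → Prop} {τ : ℤ → ℂ} {k c b e : ℤ}

lemma RightChain.exists_frame (R : RightChain o s V E τ b e) :
    ∃ t ρ, Frame (GridMWT.mir o) s (mV V) (mE E) (mτ τ) (-e) (-b) t ρ := R.mir.exists_frame'

/-- The predecessor of the apex is a different point than the start of the chain, unless it is the
start. -/
lemma Frame.pred_ne {t ρ : ℝ} (F : Frame o s V E τ k c t ρ) (h : k < c - 1) : τ (c - 1) ≠ τ k := by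
  have hcl : Clear E (pt (τ k) (τ (c + 1)) 1) (τ c) := by
    rw [pt_one]; exact (F.cfg.clear_edge (F.walk.adj c)).symm
  exact F.fan_ne F.t1 h le_rfl (F.fan_start F.t1 le_rfl hcl)

/-- An inner point of the base sees the apex if it lies beyond the end of the frame. -/
lemma Frame.clear_apex {t ρ : ℝ} (F : Frame o s V E τ k c t ρ) {r : ℝ} (hr : t < r) (hr1 : r < 1) :
    Clear E (pt (τ k) (τ (c + 1)) r) (τ c) := by
  have H := F.cfg; have W := F.walk
  have t0 := F.t0; have t1 := F.t1; have pos := F.pos; have ρ1 := F.ρ1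
  have e0 : orient (pt (τ k) (τ (c + 1)) r) (τ c) (τ (c + 1)) =
      -((1 - r) * orient (τ k) (τ (c + 1)) (τ c)) := by
    unfold orient; simp only [pt_re, pt_im]; ring
  have p0 : 0 < (1 - r) * orient (τ k) (τ (c + 1)) (τ c) := mul_pos (by linarith) pos
  have hcq : Clear E (τ (c + 1)) (τ c) := (H.clear_edge (W.adj c)).symm
  -- the third side of a subtriangle of the frame
  refine clear_of_empty H (c := τ (c + 1)) (by rw [e0]; linarith) ?_ hcq ?_ ?_
  · have := F.center_clear (r := r) (r' := 1) (by linarith) hr1.le zero_le_one le_rfl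
    rwa [pt_one] at this
  · intro v hv hvT
    have hX : pt (τ k) (τ (c + 1)) r ∈ Tri (τ (c + 1)) (pt (τ k) (τ (c + 1)) t) (τ c) := by
      refine seg_sub_Tri (left_mem_Tri _ _ _) (mid_mem_Tri _ _ _) (mem_seg.2
        ⟨(1 - r) / (1 - t), div_nonneg (by linarith) (by linarith),
        by rw [div_le_one] <;> linarith, ?_⟩)
      have : 1 - t ≠ 0 := by linarith
      apply Complex.ext <;> simp only [pt_re, pt_im] <;> field_simp <;> ring
    rcases F.empty v hv (Tri_subset hX (right_mem_Tri _ _ _) (left_mem_Tri _ _ _) hvT) with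
      h | h | h
    · exact .inl h
    · right; rw [h]; simp
    · exfalso
      have h1 := ((Aff.orient_right (pt (τ k) (τ (c + 1)) r) (τ c)).neg).nonneg_tri hvT
        (by simp) (by simp) (by rw [e0]; linarith)
      have h2 : orient (pt (τ k) (τ (c + 1)) r) (τ c) v =
          (1 - ρ) * ((r - t) * orient (τ k) (τ (c + 1)) (τ c)) := by
        rw [h, F.pred]; unfold orient; simp only [pt_re, pt_im]; ring
      have h3 : 0 < (1 - ρ) * ((r - t) * orient (τ k) (τ (c + 1)) (τ c)) :=
        mul_pos (by linarith) (mul_pos (by linarith) pos)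
      linarith
  · intro g h hgh hq z hz hz'
    have hp : 0 < orient (τ (c + 1)) (τ c) (τ k) := by rw [orient_rot]; exact pos
    have e1 : orient (τ (c + 1)) (τ c) (pt (τ k) (τ (c + 1)) r) =
        (1 - r) * orient (τ (c + 1)) (τ c) (τ k) := by
      unfold orient; simp only [pt_re, pt_im]; ring
    have e2 : orient (τ (c + 1)) (pt (τ k) (τ (c + 1)) r) (τ k) = 0 := by
      unfold orient; simp only [pt_re, pt_im]; ring
    have p1 : 0 < orient (τ (c + 1)) (τ c) (pt (τ k) (τ (c + 1)) r) := by
      rw [e1]; exact mul_pos (by linarith) hp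
    refine F.center_edge t1 le_rfl hgh (by rwa [pt_one]) hz' ?_ ?_
    · exact (Aff.orient_right _ _).pos_open hz p1.le (by simp) (.inl p1.ne')
    · exact (Aff.orient_mid _ _).pos_open hz e2.ge hp.le (.inr hp.ne')

/-- A segment that leaves the apex inside the frame crosses the base. -/
lemma Frame.exists_cross {t ρ : ℝ} (F : Frame o s V E τ k c t ρ) {x : ℂ} (hx : x ∈ V)
    (h1 : 0 < orient (τ c) (τ (c - 1)) x) (h2 : 0 < orient (τ c) x (τ (c + 1))) :
    ∃ r r', t < r ∧ r < 1 ∧ 0 < r' ∧ r' < 1 ∧ pt (τ k) (τ (c + 1)) r = pt x (τ c) r' := by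
  have ρ1 := F.ρ1; have t1 := F.t1
  have e1 : ∀ z, orient (τ c) (τ (c - 1)) z =
      (1 - ρ) * orient (τ c) (pt (τ k) (τ (c + 1)) t) z := by
    intro z; rw [F.pred]; unfold orient; simp only [pt_re, pt_im]; ring
  have hc := F.conv
  rw [e1] at h1 hc
  have h1' := pos_of_mul_pos_right h1 (by linarith)
  have hc' := pos_of_mul_pos_right hc (by linarith)
  rcases wedge_exit hc' h1' h2 with h | ⟨z, hz, hz'⟩
  · exfalso
    rcases F.empty x hx (Tri_swap (Tri_rot h)) with rfl | rfl | rfl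
    · simp at h2
    · simp at h2
    · rw [← e1] at h1; simp at h1
  · obtain ⟨a, a0, a1, rfl⟩ := mem_open.1 (open_comm hz)
    obtain ⟨d, d0, d1, hd⟩ := mem_open.1 hz'
    refine ⟨t + d * (1 - t), a, by nlinarith, by nlinarith, a0, a1, ?_⟩
    rw [hd]; apply Complex.ext <;> simp only [pt_re, pt_im] <;> ring

/-- The bases of a left chain and of an overlapping right chain cross. -/
lemma exists_crossing (L : LeftChain o s V E τ k c) (R : RightChain o s V E τ b e)
    (hbc : b = c ∨ b = c + 1) (hkb : k < b - 1) (hce : c + 1 < e) :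
    ∃ t ρ t' ρ' r r' X, Crossing o s V E τ k c b e t ρ t' ρ' r r' X := by
  obtain ⟨t, ρ, F⟩ := L.exists_frame'
  obtain ⟨t', ρ', F'⟩ := R.exists_frame
  have t1 := F.t1; have t1' := F'.t1; have ρ1 := F.ρ1; have ρ1' := F'.ρ1
  have m1 : mτ τ (-b + 1) = mir (τ (b - 1)) := by
    simp only [mτ, show -(-b + 1) = b - 1 by ring]
  have m2 : mτ τ (-b - 1) = mir (τ (b + 1)) := by
    simp only [mτ, show -(-b - 1) = b + 1 by ring]
  have m3 : mτ τ (-b) = mir (τ b) := by simp only [mτ, neg_neg]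
  have m4 : mτ τ (-e) = mir (τ e) := by simp only [mτ, neg_neg]
  have pred' : τ (b + 1) = pt (pt (τ e) (τ (b - 1)) t') (τ b) ρ' := by
    have := F'.pred
    rwa [m1, m2, m3, m4, ← mir_pt, ← mir_pt, mir_inj] at this
  have apex' : ∀ r', t' < r' → r' < 1 → Clear E (pt (τ e) (τ (b - 1)) r') (τ b) := by
    intro r' h1 h2
    have := (F'.clear_apex h1 h2).mir
    simp only [m1, m3, m4, ← mir_pt, mir_mir] at this
    exact this
  rcases hbc with rfl | rfl
  -- with a common apex `τ b`, the bases are two cevians of the triangle spanned by the apex and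
  -- the points of the frames; their intersection is computed explicitly
  · have hρ := F.ρ_pos (F.pred_ne hkb)
    have hρ' := F'.ρ_pos (F'.pred_ne (by omega))
    have pred := F.pred
    set κ := 1 - ρ with hκ
    set κ' := 1 - ρ' with hκ'
    have k0 : 0 < κ := by linarith
    have k1 : κ < 1 := by linarith
    have k0' : 0 < κ' := by linarith
    have k1' : κ' < 1 := by linarith
    have hd : 0 < 1 - κ * κ' := by nlinarith
    have hx0 : 0 < κ * (1 - κ') / (1 - κ * κ') := div_pos (mul_pos k0 (by linarith)) hd
    have hx1 : κ * (1 - κ') / (1 - κ * κ') < 1 := by rw [div_lt_one hd]; nlinarith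
    have hy0 : 0 < κ' * (1 - κ) / (1 - κ * κ') := div_pos (mul_pos k0' (by linarith)) hd
    have hy1 : κ' * (1 - κ) / (1 - κ * κ') < 1 := by rw [div_lt_one hd]; nlinarith
    have hxe : κ * (1 - κ') / (1 - κ * κ') * (1 - κ * κ') = κ * (1 - κ') :=
      div_mul_cancel₀ _ hd.ne'
    have hye : κ' * (1 - κ) / (1 - κ * κ') * (1 - κ * κ') = κ' * (1 - κ) :=
      div_mul_cancel₀ _ hd.ne'
    set x := κ * (1 - κ') / (1 - κ * κ')
    set y := κ' * (1 - κ) / (1 - κ * κ')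
    have r1 : t < 1 - x * (1 - t) := by nlinarith
    have r2 : 1 - x * (1 - t) < 1 := by nlinarith
    have r1' : t' < 1 - y * (1 - t') := by nlinarith
    have r2' : 1 - y * (1 - t') < 1 := by nlinarith
    have hX : pt (τ k) (τ (b + 1)) (1 - x * (1 - t)) = pt (τ e) (τ (b - 1)) (1 - y * (1 - t')) := by
      have hρe : ρ = 1 - κ := by linarith
      have hρe' : ρ' = 1 - κ' := by linarith
      have xe : x = κ * (1 - y) := by
        have : (x - κ * (1 - y)) * (1 - κ * κ') = 0 := by linear_combination hxe + κ * hye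
        rcases mul_eq_zero.1 this with h | h
        · linarith
        · linarith
      have ye : y = κ' * (1 - x) := by
        have : (y - κ' * (1 - x)) * (1 - κ * κ') = 0 := by linear_combination hye + κ' * hxe
        rcases mul_eq_zero.1 this with h | h
        · linarith
        · linarith
      have a1 := congrArg Complex.re pred
      have a2 := congrArg Complex.im pred
      have a3 := congrArg Complex.re pred'
      have a4 := congrArg Complex.im pred'
      simp only [pt_re, pt_im] at a1 a2 a3 a4
      rw [hρe] at a1 a2
      rw [hρe'] at a3 a4
      apply Complex.ext
      · simp only [pt_re]
        linear_combination (1 - x) * a3 - (1 - y) * a1 +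
            ((τ k).re + t * ((τ (b + 1)).re - (τ k).re) - (τ b).re) * xe -
            ((τ e).re + t' * ((τ (b - 1)).re - (τ e).re) - (τ b).re) * ye
      · simp only [pt_im]
        linear_combination (1 - x) * a4 - (1 - y) * a2 +
            ((τ k).im + t * ((τ (b + 1)).im - (τ k).im) - (τ b).im) * xe -
            ((τ e).im + t' * ((τ (b - 1)).im - (τ e).im) - (τ b).im) * ye
    exact ⟨t, ρ, t', ρ', _, _, _, ⟨F, R, F', .inl rfl, hkb, hce, r1, r2, r1', r2', rfl, hX,
      F.clear_apex r1 r2, by rw [hX]; exact apex' _ r1' r2'⟩⟩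
  · rw [add_sub_cancel_right] at *
    -- with adjacent apexes, either base crosses the segment between the apex of its chain and the
    -- other end, and the crossing points agree
    have Re : 0 < orient (τ c) (τ (c - 1)) (τ e) := by
      have h := R.left
      rw [show c + 1 - 2 = c - 1 by ring, add_sub_cancel_right] at h
      exact ((h _ (F.walk.adj c)).1 F.conv).1
    have Rpos := R.pos
    rw [add_sub_cancel_right] at Rpos
    obtain ⟨r, r', h1, h2, h3, h4, h5⟩ := F.exists_cross (F.walk.mem F.cfg e) Re Rpos
    have Lp : 0 < orient (τ (c + 1)) (τ k) (τ (c + 2)) := by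
      have hc := R.conv
      rw [add_sub_cancel_right, add_assoc] at hc
      exact ((F.right _ (F.cfg.symm (F.walk.adj c))).2 hc).1
    obtain ⟨a, a', g1, g2, g3, g4, g5⟩ := F'.exists_cross (x := mir (τ k))
      (mem_mV.2 (by simpa using F.walk.mem F.cfg k))
      (by rw [m3, m2, orient_mir, orient_swap']; rw [add_assoc]; simpa using Lp)
      (by rw [m3, m1, orient_mir, orient_swap', neg_neg, orient_rot, ]; exact F.pos)
    rw [m1, m3, m4, ← mir_pt, ← mir_pt, mir_inj] at g5
    have hr : a = r' := by
      have z1 : orient (τ k) (τ (c + 1)) (pt (τ e) (τ c) r') = 0 := by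
        rw [← h5]; unfold orient; simp only [pt_re, pt_im]; ring
      have z2 : orient (τ k) (τ (c + 1)) (pt (τ e) (τ c) a) = 0 := by
        rw [g5]; unfold orient; simp only [pt_re, pt_im]; ring
      rw [(Aff.orient_right _ _).pt] at z1 z2
      have pos := F.pos
      by_contra hne
      have hd : (a - r') * (orient (τ k) (τ (c + 1)) (τ c) - orient (τ k) (τ (c + 1)) (τ e)) = 0 := by
        linear_combination z2 - z1
      rcases mul_eq_zero.1 hd with h | h
      · exact hne (by linarith)
      · rw [h] at z1; linarith
    subst hr
    have X0 : 0 < r := lt_of_le_of_lt F.t0 h1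
    refine ⟨t, ρ, t', ρ', r, a, _, ⟨F, R, F', .inr rfl, by omega, hce, h1, h2, g1, h4, rfl, ?_,
      F.clear_apex h1 h2, ?_⟩⟩
    · rw [add_sub_cancel_right]; exact h5
    · rw [h5]; exact apex' _ g1 h4

end

/-! ### Gaps -/

section
variable {o : ℂ} {s : ℝ} {V : Finset ℂ} {E : ℂ → ℂ → Prop}

/-- A segment that leaves a triangle meets one of its sides; the triangle is a fan over a single
edge. -/
lemma tri_exit {a b c z u : ℂ} (h : 0 < orient a b c) (hz : z ∈ Tri a b c) (hu : u ∉ Tri a b c) :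
    ∃ w ∈ segment ℝ z u, w ∈ segment ℝ a b ∨ w ∈ segment ℝ b c ∨ w ∈ segment ℝ c a := by
  by_contra hc
  push Not at hc
  set θ : ℤ → ℂ := fun i => if i = 0 then c else b with hθ
  have hθ0 : θ 0 = c := by simp [hθ]
  have hθ1 : θ 1 = b := by simp [hθ]
  obtain ⟨i, h1, h2, h3⟩ := fan_exit (O := a) (τ := θ) (a := 0) (b := 1) (z := z) (u := u)
    (fun i h1 h2 => by
      have : i = 0 := by omega
      rw [this, zero_add, hθ0, hθ1]; exact h)
    ⟨0, le_rfl, by norm_num, by rw [zero_add, hθ0, hθ1]; exact hz⟩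
    (fun i h1 h2 x hx hx' => by
      have : i = 0 := by omega
      rw [this, zero_add, hθ0, hθ1] at hx'
      exact (hc x hx).2.1 (seg_comm hx'))
    (fun x hx hx' => (hc x hx).2.2 (seg_comm (by rwa [hθ0] at hx')))
    (fun x hx hx' => (hc x hx).1 (by rwa [hθ1] at hx'))
  have : i = 0 := by omega
  rw [this, zero_add, hθ0, hθ1] at h3
  exact hu h3

/-- A cevian from the vertex `b` splits a triangle. -/
lemma Tri_split {a b c y z : ℂ} (hy : y ∈ segment ℝ a c) (hz : z ∈ Tri a b c) :
    z ∈ Tri a b y ∨ z ∈ Tri y b c := by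
  obtain ⟨u, u0, u1, rfl⟩ := mem_seg.1 hy
  obtain ⟨α, β, γ, hα, hβ, hγ, e, rfl⟩ := hz
  rcases u0.eq_or_lt with rfl | u0
  · right; rw [pt_zero]; exact ⟨α, β, γ, hα, hβ, hγ, e, rfl⟩
  rcases u1.eq_or_lt with rfl | u1
  · left; rw [pt_one]; exact ⟨α, β, γ, hα, hβ, hγ, e, rfl⟩
  have u2 : 0 < 1 - u := by linarith
  rcases le_total (γ * (1 - u)) (α * u) with h | h
  · left
    refine ⟨α - γ * (1 - u) / u, β, γ / u, ?_, hβ, by positivity, ?_, ?_⟩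
    · rw [sub_nonneg, div_le_iff₀ u0]; exact h
    · field_simp; linear_combination u * e
    · apply Complex.ext <;> simp [pt_re, pt_im] <;> field_simp <;> ring
  · right
    obtain ⟨q, hq⟩ : ∃ q : ℝ, α = q * (1 - u) := ⟨α / (1 - u), by field_simp⟩
    subst hq
    have q0 : 0 ≤ q := by by_contra hc; push Not at hc; nlinarith
    refine ⟨q, β, γ - q * u, q0, hβ, by nlinarith, by linear_combination e, ?_⟩
    apply Complex.ext <;> simp [pt_re, pt_im] <;> ring

/-- A triangle `X p e` that is open towards the drawing only along its base `p e`: the two sides at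
`X` are free. -/
structure Gap (V : Finset ℂ) (E : ℂ → ℂ → Prop) (X p e : ℂ) : Prop where
  pos : 0 < orient X p e
  hp : p ∈ V
  he : e ∈ V
  left : ∀ z ∈ segment ℝ X p, z ≠ p → z ∉ V ∧ ∀ a b, E a b → z ∉ segment ℝ a b
  right : ∀ z ∈ segment ℝ X e, z ≠ e → z ∉ V ∧ ∀ a b, E a b → z ∉ segment ℝ a b

/-- A vertex `m` in a gap that is extremal with respect to the linear functional `h`, which is
positive at the top of the gap. -/
structure Top (V : Finset ℂ) (X p e m : ℂ) (h : ℂ → ℝ) : Prop where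
  mem : m ∈ V
  tri : m ∈ Tri X p e
  nep : m ≠ p
  nee : m ≠ e
  aff : Aff h
  zero : h m = 0
  pos : 0 < h X
  le : ∀ v ∈ V, v ∈ Tri X p e → h v ≤ 0

variable {X p e m : ℂ} {h : ℂ → ℝ}

lemma Gap.ne_left (G : Gap V E X p e) : X ≠ p := fun h => by have := G.pos; simp [h] at this
lemma Gap.ne_right (G : Gap V E X p e) : X ≠ e := fun h => by have := G.pos; simp [h] at this
lemma Gap.ne_base (G : Gap V E X p e) : p ≠ e := fun h => by have := G.pos; simp [h] at this

lemma Gap.mir (G : Gap V E X p e) : Gap (mV V) (mE E) (mir X) (mir e) (mir p) where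
  pos := by rw [orient_mir, orient_swap', neg_neg]; exact G.pos
  hp := mem_mV.2 (by simpa using G.he)
  he := mem_mV.2 (by simpa using G.hp)
  left z hz hne := by
    have h1 : GridMWT.mir z ∈ segment ℝ X e := by rw [← seg_mir]; simpa using hz
    have := G.right _ h1 (fun h => hne (by rw [← h]; simp))
    exact ⟨fun h => this.1 (mem_mV.1 h), fun a b hab hz' => this.2 _ _ hab (seg_mir.2 hz')⟩
  right z hz hne := by
    have h1 : GridMWT.mir z ∈ segment ℝ X p := by rw [← seg_mir]; simpa using hz
    have := G.left _ h1 (fun h => hne (by rw [← h]; simp))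
    exact ⟨fun h => this.1 (mem_mV.1 h), fun a b hab hz' => this.2 _ _ hab (seg_mir.2 hz')⟩

lemma Aff.mir (hh : Aff h) : Aff (fun z => h (GridMWT.mir z)) := by
  obtain ⟨α, β, γ, hz⟩ := hh
  exact ⟨β, α, γ, fun z => by
    simp only [hz, GridMWT.mir]; ring⟩

lemma Top.mir (T : Top V X p e m h) :
    Top (mV V) (mir X) (mir e) (mir p) (mir m) (fun z => h (GridMWT.mir z)) where
  mem := mem_mV.2 (by simpa using T.mem)
  tri := Tri_mir (Tri_swap' T.tri)
  nep := mt mir_inj.1 T.nee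
  nee := mt mir_inj.1 T.nep
  aff := T.aff.mir
  zero := by simpa using T.zero
  pos := by simpa using T.pos
  le v hv hT := T.le _ (mem_mV.1 hv) (by have := Tri_mir (Tri_swap' hT); simpa using this)

lemma Top.left_nonpos (T : Top V X p e m h) (G : Gap V E X p e) : h p ≤ 0 :=
  T.le p G.hp (mid_mem_Tri _ _ _)
lemma Top.right_nonpos (T : Top V X p e m h) (G : Gap V E X p e) : h e ≤ 0 :=
  T.le e G.he (right_mem_Tri _ _ _)

/-- The part of a gap above an extremal vertex is disjoint from the drawing. -/
lemma Top.no_drawing (T : Top V X p e m h) (H : Cfg o s V E) (G : Gap V E X p e) {z : ℂ}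
    (hz : z ∈ Tri X p e) (h0 : 0 < h z) {a b : ℂ} (hab : E a b) : z ∉ segment ℝ a b := by
  -- an edge with an end above the extremal vertex would have to leave the gap through one of its
  -- free sides
  have key : ∀ u ∈ V, 0 < h u → segment ℝ z u ⊆ segment ℝ a b → False := by
    intro u hu hhu hsub
    have huT : u ∉ Tri X p e := fun hT => absurd (T.le u hu hT) (not_le.2 hhu)
    obtain ⟨w, hw, hw'⟩ := tri_exit G.pos hz huT
    have hw0 : 0 < h w := by
      obtain ⟨t, t0, t1, rfl⟩ := mem_seg.1 hw
      rw [T.aff.pt]; rcases t1.eq_or_lt with rfl | t1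
      · linarith
      · nlinarith [mul_pos (sub_pos.2 t1) h0, mul_nonneg t0 hhu.le]
    have hp := T.left_nonpos G
    have he := T.right_nonpos G
    rcases hw' with hw' | hw' | hw'
    · exact (G.left w hw' (by rintro rfl; linarith)).2 a b hab (hsub hw)
    · have := T.aff.neg.nonneg_seg hw' (by simpa using hp) (by simpa using he)
      linarith
    · exact (G.right w (seg_comm hw') (by rintro rfl; linarith)).2 a b hab (hsub hw)
  intro hzs
  by_cases ha : 0 < h a
  · exact key a (H.mem hab) ha ((convex_segment a b).segment_subset hzs (left_mem_segment _ _ _))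
  by_cases hb : 0 < h b
  · exact key b (H.mem' hab) hb ((convex_segment a b).segment_subset hzs (right_mem_segment _ _ _))
  have := T.aff.neg.nonneg_seg hzs (by linarith) (by linarith)
  linarith

lemma Top.not_side (T : Top V X p e m h) (H : Cfg o s V E) (G : Gap V E X p e) :
    m ∉ segment ℝ X p ∧ m ∉ segment ℝ p e ∧ m ∉ segment ℝ e X := by
  refine ⟨fun hs => (G.left m hs T.nep).1 T.mem, fun hs => ?_,
    fun hs => (G.right m (seg_comm hs) T.nee).1 T.mem⟩
  rcases H.eq_of_orient G.hp G.he T.mem G.ne_base (orient_open hs) with h | h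
  · exact T.nep h
  · exact T.nee h

/-- The neighbours of an extremal vertex lie below it. -/
lemma Top.no_up (T : Top V X p e m h) (H : Cfg o s V E) (G : Gap V E X p e) {x : ℂ} (hx : E m x) :
    h x ≤ 0 := by
  by_contra hc
  push Not at hc
  have hxT : x ∉ Tri X p e := fun hT => absurd (T.le x (H.mem' hx) hT) (not_le.2 hc)
  obtain ⟨w, hw, hw'⟩ := tri_exit G.pos T.tri hxT
  have hwm : w ≠ m := by
    rintro rfl
    have := T.not_side H G
    tauto
  have hwT : w ∈ Tri X p e := by
    rcases hw' with h | h | h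
    · exact seg_sub_Tri (left_mem_Tri _ _ _) (mid_mem_Tri _ _ _) h
    · exact seg_sub_Tri (mid_mem_Tri _ _ _) (right_mem_Tri _ _ _) h
    · exact seg_sub_Tri (right_mem_Tri _ _ _) (left_mem_Tri _ _ _) h
  refine T.no_drawing H G hwT ?_ hx hw
  obtain ⟨t, t0, t1, rfl⟩ := mem_seg.1 hw
  rcases t0.eq_or_lt with rfl | t0
  · simp at hwm
  · rw [T.aff.pt, T.zero]; nlinarith

lemma Top.above (T : Top V X p e m h) {z : ℂ} (hz : z ∈ openSegment ℝ X m) :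
    z ∈ Tri X p e ∧ 0 < h z := by
  refine ⟨seg_sub_Tri (left_mem_Tri _ _ _) T.tri (open_sub_seg hz), ?_⟩
  exact T.aff.pos_open hz T.pos.le T.zero.ge (.inl T.pos.ne')

lemma Top.clear (T : Top V X p e m h) (H : Cfg o s V E) (G : Gap V E X p e) : Clear E X m :=
  fun _ _ hcd _ hz hz' => absurd (open_sub_seg hz')
    (T.no_drawing H G (T.above hz).1 (T.above hz).2 hcd)

lemma Top.side_pos (T : Top V X p e m h) (H : Cfg o s V E) (G : Gap V E X p e) :
    0 < orient X p m ∧ 0 < orient p e m ∧ 0 < orient e X m := by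
  obtain ⟨h1, h2, h3⟩ := (mem_Tri_iff G.pos).1 T.tri
  have hpos := G.pos
  have hpos' : orient p e X ≠ 0 := by rw [orient_rot]; exact hpos.ne'
  have hpos'' : orient e X p ≠ 0 := by rw [orient_rot']; exact hpos.ne'
  obtain ⟨n1, n2, n3⟩ := T.not_side H G
  exact ⟨lt_of_le_of_ne h1 fun h => n1 (mem_seg_of_Tri hpos.ne' T.tri h.symm),
    lt_of_le_of_ne h2 fun h => n2 (mem_seg_of_Tri hpos' (Tri_rot T.tri) h.symm),
    lt_of_le_of_ne h3 fun h => n3 (mem_seg_of_Tri hpos'' (Tri_rot (Tri_rot T.tri)) h.symm)⟩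

lemma Gap.clear_right (G : Gap V E X p e) : Clear E e X := fun c d hcd z hz hz' => by
  have hz := open_comm hz
  exact absurd (open_sub_seg hz')
    ((G.right z (open_sub_seg hz) (ne_of_open hz G.ne_right).2).2 c d hcd)

lemma Gap.not_edge (G : Gap V E X p e) {a b : ℂ} (hab : E a b) : X ∉ segment ℝ a b :=
  (G.left X (left_mem_segment _ _ _) G.ne_left).2 a b hab

/-- Turning a ray about the right end of the base downwards, the first vertex of the gap. -/
lemma Gap.exists_top_right (G : Gap V E X p e) (H : Cfg o s V E)
    (hM : ∃ v ∈ V, v ∈ Tri X p e ∧ v ≠ p ∧ v ≠ e) :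
    ∃ m, Top V X p e m (fun z => orient m e z) := by
  obtain ⟨v, hv, hvT, hvp, hve⟩ := hM
  have pos := G.pos
  set S : Set ℂ := {v | v ∈ V ∧ v ∈ Tri X p e ∧ v ≠ e} with hS
  have hSf : S.Finite := (V.finite_toSet).subset fun v hv => hv.1
  obtain ⟨m, hm, w, hw, hmw, hmax⟩ := exists_first_ray (l := p) (x := X) (y := e) hSf
    ⟨G.hp, mid_mem_Tri _ _ _, G.ne_base⟩ (fun v hv => Tri_swap hv.2.1) (fun h => h.2.2 rfl)
  have e1 : orient p X e = -orient X p e := orient_swap _ _ _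
  have hmax' : ∀ v ∈ V, v ∈ Tri X p e → orient m e v ≤ 0 := by
    intro v hv hvT
    by_cases h : v = e
    · simp [h]
    · have := hmax v ⟨hv, hvT, h⟩
      rw [e1, orient_swap m e v] at this
      nlinarith
  have hvpos : 0 < orient p e v := lt_of_le_of_ne ((mem_Tri_iff pos).1 hvT).2.1 fun h => by
    rcases H.eq_of_orient G.hp G.he hv G.ne_base h.symm with h | h
    · exact hvp h
    · exact hve h
  have hmp : m ≠ p := by
    rintro rfl
    have := hmax' v hv hvT
    linarith
  refine ⟨m, hm.1, hm.2.1, hmp, hm.2.2, Aff.orient_right _ _, by simp, ?_, hmax'⟩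
  have h3 := ((mem_Tri_iff pos).1 hm.2.1).2.2
  have : orient m e X = orient e X m := (orient_rot m e X).symm
  rw [this]
  refine lt_of_le_of_ne h3 fun h => (G.right m (seg_comm ?_) hm.2.2).1 hm.1
  exact mem_seg_of_Tri (by rw [orient_rot']; exact pos.ne') (Tri_rot (Tri_rot hm.2.1)) h.symm

/-- The mirror image of `Gap.exists_top_right`: turning a ray about the left end of the base. -/
lemma Gap.exists_top_left (G : Gap V E X p e) (H : Cfg o s V E)
    (hM : ∃ v ∈ V, v ∈ Tri X p e ∧ v ≠ p ∧ v ≠ e) :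
    ∃ m, Top V X p e m (fun z => orient p m z) := by
  obtain ⟨v, hv, hvT, hvp, hve⟩ := hM
  obtain ⟨m, T⟩ := G.mir.exists_top_right H.mir
    ⟨GridMWT.mir v, mem_mV.2 (by simpa using hv), Tri_mir (Tri_swap' hvT), mt mir_inj.1 hve,
      mt mir_inj.1 hvp⟩
  refine ⟨GridMWT.mir m, ?_⟩
  have := T.mir
  have h2 : mV (mV V) = V := by ext v; rw [mem_mV, mem_mV, mir_mir]
  have h3 : (fun z => orient m (GridMWT.mir p) (GridMWT.mir z)) =
      fun z => orient p (GridMWT.mir m) z := by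
    funext z; unfold orient GridMWT.mir; simp only; ring
  rwa [h2, mir_mir, mir_mir, mir_mir, h3] at this

lemma Top.clear_right (T : Top V X p e m (fun z => orient m e z)) (H : Cfg o s V E)
    (G : Gap V E X p e) : Clear E e m := by
  have h0 : 0 < orient m e X := T.pos
  refine clear_of_empty H (c := X) ?_ G.clear_right (T.clear H G) ?_ ?_
  · rw [orient_swap]; linarith
  · intro v hv hvT
    right
    have h1 := T.le v hv (Tri_subset (right_mem_Tri _ _ _) T.tri (left_mem_Tri _ _ _) hvT)
    have h2 := (Aff.orient_right m e).nonneg_tri hvT (by simp) (by simp) h0.le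
    rw [orient_swap]; linarith
  · intro g k hgk hX
    exact absurd hX (G.not_edge hgk)

lemma Top.clear_left (T : Top V X p e m (fun z => orient p m z)) (H : Cfg o s V E)
    (G : Gap V E X p e) : Clear E p m := by
  have h0 : 0 < orient p m X := T.pos
  have hpX : Clear E p X := fun c d hcd z hz hz' => by
    have hz := open_comm hz
    exact absurd (open_sub_seg hz')
      ((G.left z (open_sub_seg hz) (ne_of_open hz G.ne_left).2).2 c d hcd)
  refine clear_of_empty H (c := X) h0.ne' hpX (T.clear H G) ?_ ?_
  · intro v hv hvT
    right
    have h1 := T.le v hv (Tri_subset (mid_mem_Tri _ _ _) T.tri (left_mem_Tri _ _ _) hvT)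
    have h2 := (Aff.orient_right p m).nonneg_tri hvT (by simp) (by simp) h0.le
    linarith
  · intro g k hgk hX
    exact absurd hX (G.not_edge hgk)

/-- An extremal vertex `m` sees a vertex beyond the gap, which is too far away to be joined to
`m`. -/
lemma Top.exists_far (T : Top V X p e m h) (H : Cfg o s V E) (G : Gap V E X p e) {a : ℂ}
    (ha : a ∈ V) (hX : X ∈ openSegment ℝ e a) (hcl : Clear E X a) :
    ∃ z ∈ V, ∃ y ∈ segment ℝ X p, y ≠ p ∧ z ∈ Tri a X y ∧ z ∈ Tri a X m ∧ ¬ Near o s z m := by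
  have hp := T.left_nonpos G
  have he := T.right_nonpos G
  have hX0 := T.pos
  obtain ⟨r, r0, r1, hXr⟩ := mem_open.1 hX
  -- `a` lies beyond `X` on the ray from `e`, hence above the extremal vertex
  have hha : 0 < h a := by
    have := T.aff.pt e a r
    rw [← hXr] at this
    by_contra hc
    push Not at hc
    nlinarith [mul_nonneg (sub_pos.2 r1).le (neg_nonneg.2 he), mul_nonneg r0.le (neg_nonneg.2 hc)]
  have haT : a ∉ Tri X p e := fun hT => absurd (T.le a ha hT) (not_le.2 hha)
  have ham : a ≠ m := fun h => haT (h ▸ T.tri)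
  have hsid := T.side_pos H G
  have eX : ∀ z, orient e X z = r * orient e a z := by
    intro z; rw [hXr]; unfold orient; simp only [pt_re, pt_im]; ring
  have hD : 0 < -orient a X m := by
    have e1 : orient a X m = -((1 - r) * orient e a m) := by
      rw [hXr]; unfold orient; simp only [pt_re, pt_im]; ring
    have := hsid.2.2
    rw [eX] at this
    have := pos_of_mul_pos_right this r0.le
    rw [e1]; nlinarith [mul_pos (sub_pos.2 r1) this]
  -- the point where the segment from `m` to `a` leaves the gap
  obtain ⟨y, hy, hy'⟩ := tri_exit G.pos T.tri haT
  have hym : y ≠ m := by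
    rintro rfl
    have := T.not_side H G
    tauto
  obtain ⟨t, t0, t1, hyt⟩ := mem_seg.1 hy
  have t0 : 0 < t := lt_of_le_of_ne t0 (by rintro rfl; rw [pt_zero] at hyt; exact hym hyt)
  have hhy : 0 < h y := by rw [hyt, T.aff.pt, T.zero]; nlinarith
  have hyX : y ∈ segment ℝ X p := by
    rcases hy' with h | h | h
    · exact h
    · have := T.aff.neg.nonneg_seg h (by linarith) (by linarith)
      linarith
    · exfalso
      have h1 : orient e X y = 0 := orient_open h
      have h2 : orient e X a = 0 := by rw [eX]; simp
      rw [hyt, (Aff.orient_right e X).pt, h2] at h1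
      have : t = 1 := by
        by_contra hne
        have := mul_pos (sub_pos.2 (lt_of_le_of_ne t1 hne)) hsid.2.2
        nlinarith
      rw [this, pt_one] at hyt
      exact haT (seg_sub_Tri (right_mem_Tri _ _ _) (left_mem_Tri _ _ _) (hyt ▸ h))
  -- the first vertex seen from `m` when turning from `X` towards `a`
  set S : Set ℂ := {v | v ∈ V ∧ v ∈ Tri a X m ∧ v ≠ m} with hS
  have hSf : S.Finite := (V.finite_toSet).subset fun v hv => hv.1
  obtain ⟨z, hz, w, hw, hzw, hmax⟩ := exists_first_ray (l := a) (x := X) (y := m) hSf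
    ⟨ha, left_mem_Tri _ _ _, ham⟩ (fun v hv => hv.2.1) (fun h => h.2.2 rfl)
  obtain ⟨ρ, ρ0, ρ1, hzρ⟩ := mem_seg.1 hzw
  have ρ1 : ρ < 1 := lt_of_le_of_ne ρ1 (by rintro rfl; rw [pt_one] at hzρ; exact hz.2.2 hzρ)
  obtain ⟨l, l0, l1, hwl⟩ := mem_seg.1 hw
  have hhw : 0 < h w := by
    rw [hwl, T.aff.pt]
    rcases l1.eq_or_lt with rfl | l1
    · linarith
    · nlinarith [mul_pos (sub_pos.2 l1) hX0, mul_nonneg l0 hha.le]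
  have hhz : 0 < h z := by
    rw [hzρ, T.aff.pt, T.zero]; nlinarith
  have hzT : z ∉ Tri X p e := fun hT => absurd (T.le z hz.1 hT) (not_le.2 hhz)
  have hl0 : 0 < l := by
    refine lt_of_le_of_ne l0 ?_
    rintro rfl
    rw [pt_zero] at hwl
    exact hzT (seg_sub_Tri (left_mem_Tri _ _ _) T.tri (hwl ▸ hzw))
  -- the swept triangle `w`, `m`, `X` contains only vertices on its side `w m`
  have hclw : Clear E w m := by
    have e1 : orient w m X = l * -orient a X m := by
      rw [hwl]; unfold orient; simp only [pt_re, pt_im]; ring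
    have e2 : ∀ v, orient m z v = -((1 - ρ) * orient w m v) := by
      intro v; rw [hzρ]; unfold orient; simp only [pt_re, pt_im]; ring
    have hlD := mul_pos hl0 hD
    refine clear_of_empty H (c := X) (by rw [e1]; exact hlD.ne')
      (hcl.sub hw (left_mem_segment _ _ _)) (T.clear H G) ?_
      fun g k hgk hX => absurd hX (G.not_edge hgk)
    intro v hv hvT
    right
    by_cases hvm : v = m
    · simp [hvm]
    have h1 := hmax v ⟨hv, Tri_subset (seg_sub_Tri (mid_mem_Tri _ _ _) (left_mem_Tri _ _ _) hw)
      (right_mem_Tri _ _ _) (mid_mem_Tri _ _ _) hvT, hvm⟩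
    have h2 := (Aff.orient_right w m).nonneg_tri hvT (by simp) (by simp) (by rw [e1]; exact hlD.le)
    rw [e2] at h1
    have h4 := mul_pos hD (sub_pos.2 ρ1)
    by_contra hne
    have : 0 < orient w m v := lt_of_le_of_ne h2 (Ne.symm hne)
    nlinarith [mul_pos h4 this]
  have hclz : Clear E z m := hclw.sub hzw (right_mem_segment _ _ _)
  refine ⟨z, hz.1, y, hyX, by rintro rfl; linarith, ?_, hz.2.1, fun hn => ?_⟩
  · rcases Tri_split (seg_comm hy) hz.2.1 with h | h
    · exact h
    · exact absurd (Tri_subset (seg_sub_Tri (left_mem_Tri _ _ _) (mid_mem_Tri _ _ _) hyX)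
        (left_mem_Tri _ _ _) T.tri h) hzT
  · have := T.no_up H G (H.symm (H.edge_of_clear hz.1 T.mem hz.2.2 hn hclz))
    linarith

end

/-! ### Cell coordinates -/

section
variable {o : ℂ} {s : ℝ}

/-- `N` is an integer coordinate that is a monotone function of the affine coordinate `G`. -/
structure Coord (G : ℂ → ℝ) (N : ℂ → ℤ) : Prop where
  aff : Aff G
  mono : ∀ a b, G a ≤ G b → N a ≤ N b

/-- A pair of cell coordinates, up to reflections and the exchange of the two axes. -/
structure Coords (o : ℂ) (s : ℝ) (G : ℂ → ℝ) (N : ℂ → ℤ) (G' : ℂ → ℝ) (N' : ℂ → ℤ) : Prop where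
  fst : Coord G N
  snd : Coord G' N'
  near : ∀ a b, Near o s a b ↔
    (N a ≤ N b + 1 ∧ N b ≤ N a + 1) ∧ (N' a ≤ N' b + 1 ∧ N' b ≤ N' a + 1)
  sum : ∀ a b c z, z ∈ Tri a b c → ∀ n, (n ≤ N a + N' a → n ≤ N b + N' b → n ≤ N c + N' c →
      n ≤ N z + N' z + 1) ∧ (N a + N' a ≤ n → N b + N' b ≤ n → N c + N' c ≤ n → N z + N' z ≤ n + 1)
  diff : ∀ a b c z, z ∈ Tri a b c → ∀ n, (n ≤ N a - N' a → n ≤ N b - N' b → n ≤ N c - N' c →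
      n ≤ N z - N' z + 1) ∧ (N a - N' a ≤ n → N b - N' b ≤ n → N c - N' c ≤ n → N z - N' z ≤ n + 1)

variable {G G' : ℂ → ℝ} {N N' : ℂ → ℤ}

lemma Coord.lt (h : Coord G N) {a b : ℂ} (hab : N a < N b) : G a < G b := by
  by_contra hc
  exact absurd (h.mono b a (not_lt.1 hc)) (not_le.2 hab)

lemma Coord.neg (h : Coord G N) : Coord (fun z => -G z) (fun z => -N z) :=
  ⟨h.aff.neg, fun a b hab => by have := h.mono b a (by linarith); linarith⟩

lemma Coord.le_tri (h : Coord G N) {a b c z : ℂ} (hz : z ∈ Tri a b c) {n : ℤ} (ha : N a ≤ n)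
    (hb : N b ≤ n) (hc : N c ≤ n) : N z ≤ n := by
  by_contra hn
  push Not at hn
  have h1 := h.lt (ha.trans_lt hn)
  have h2 := h.lt (hb.trans_lt hn)
  have h3 := h.lt (hc.trans_lt hn)
  have := (h.aff.neg.add_const (G z)).pos_tri hz (by linarith) (by linarith) (by linarith)
  linarith

lemma Coord.ge_tri (h : Coord G N) {a b c z : ℂ} (hz : z ∈ Tri a b c) {n : ℤ} (ha : n ≤ N a)
    (hb : n ≤ N b) (hc : n ≤ N c) : n ≤ N z := by
  have := h.neg.le_tri hz (n := -n) (by linarith) (by linarith) (by linarith)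
  linarith

lemma coords_base (o : ℂ) (s : ℝ) :
    Coords o s (gx o s) (fun z => ⌊gx o s z⌋) (gy o s) (fun z => ⌊gy o s z⌋) where
  fst := ⟨Aff.gx o s, fun _ _ h => Int.floor_mono h⟩
  snd := ⟨Aff.gy o s, fun _ _ h => Int.floor_mono h⟩
  near _ _ := near_int
  sum a b c z hz n := by
    have h := (cell_tri_diag (o := o) (s := s) hz).1
    exact ⟨fun ha hb hc => (le_min (le_min ha hb) hc).trans h.1,
      fun ha hb hc => h.2.trans (by have := max_le (max_le ha hb) hc; linarith)⟩
  diff a b c z hz n := by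
    have h := (cell_tri_diag (o := o) (s := s) hz).2
    exact ⟨fun ha hb hc => (le_min (le_min ha hb) hc).trans h.1,
      fun ha hb hc => h.2.trans (by have := max_le (max_le ha hb) hc; linarith)⟩

lemma Coords.swap (h : Coords o s G N G' N') : Coords o s G' N' G N where
  fst := h.snd
  snd := h.fst
  near a b := by rw [h.near]; exact and_comm
  sum a b c z hz n := by
    have := h.sum a b c z hz n
    constructor
    · intro ha hb hc; linarith [this.1 (by linarith) (by linarith) (by linarith)]
    · intro ha hb hc; linarith [this.2 (by linarith) (by linarith) (by linarith)]
  diff a b c z hz n := by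
    have := h.diff a b c z hz (-n)
    constructor
    · intro ha hb hc; linarith [this.2 (by linarith) (by linarith) (by linarith)]
    · intro ha hb hc; linarith [this.1 (by linarith) (by linarith) (by linarith)]

lemma Coords.neg (h : Coords o s G N G' N') :
    Coords o s (fun z => -G z) (fun z => -N z) G' N' where
  fst := h.fst.neg
  snd := h.snd
  near a b := by rw [h.near]; constructor <;> intro h <;> omega
  sum a b c z hz n := by
    have := h.diff a b c z hz (-n)
    constructor
    · intro ha hb hc; linarith [this.2 (by linarith) (by linarith) (by linarith)]
    · intro ha hb hc; linarith [this.1 (by linarith) (by linarith) (by linarith)]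
  diff a b c z hz n := by
    have := h.sum a b c z hz (-n)
    constructor
    · intro ha hb hc; linarith [this.2 (by linarith) (by linarith) (by linarith)]
    · intro ha hb hc; linarith [this.1 (by linarith) (by linarith) (by linarith)]

lemma exists_coords {a b : ℂ} (h : ¬ Near o s a b) :
    ∃ G N G' N', Coords o s G N G' N' ∧ N b + 1 < N a := by
  have hb := coords_base o s
  rcases not_near_iff.1 h with (h | h) | (h | h)
  · exact ⟨_, _, _, _, hb.neg, by omega⟩
  · exact ⟨_, _, _, _, hb, h⟩
  · exact ⟨_, _, _, _, hb.swap.neg, by omega⟩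
  · exact ⟨_, _, _, _, hb.swap, h⟩

end

/-! ### Vertices in the gap of an extended chain -/

section
variable {o : ℂ} {s : ℝ} {V : Finset ℂ} {E : ℂ → ℂ → Prop} {τ : ℤ → ℂ} {k c b e : ℤ}
variable {t ρ t' ρ' r r' : ℝ} {X m : ℂ} {h : ℂ → ℝ}

namespace Crossing

/-- The triangle below the crossing point is a gap: its sides at `X` lie on the two free bases. -/
lemma gap (C : Crossing o s V E τ k c b e t ρ t' ρ' r r' X) : Gap V E X (τ k) (τ e) where
  pos := C.orient_base
  hp := C.L.walk.mem C.L.cfg _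
  he := C.L.walk.mem C.L.cfg _
  left z hz hne := by
    have r0 := C.r0; have r1 := C.r1
    obtain ⟨u, u0, u1, hu⟩ := mem_seg.1 hz
    have u1 : u < 1 := lt_of_le_of_ne u1 (by rintro rfl; rw [pt_one] at hu; exact hne hu)
    have : z ∈ openSegment ℝ (τ k) (τ (c + 1)) := by
      refine mem_open.2 ⟨r * (1 - u), mul_pos r0 (by linarith), by nlinarith, ?_⟩
      rw [hu, C.hX]; apply Complex.ext <;> simp only [pt_re, pt_im] <;> ring
    exact ⟨fun hV => C.L.free.1 z hV this, fun a b hab => C.L.free.2 a b hab z this⟩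
  right z hz hne := by
    have r0 := C.r0'; have r1 := C.r1'
    obtain ⟨u, u0, u1, hu⟩ := mem_seg.1 hz
    have u1 : u < 1 := lt_of_le_of_ne u1 (by rintro rfl; rw [pt_one] at hu; exact hne hu)
    have : z ∈ openSegment ℝ (τ (b - 1)) (τ e) := by
      refine open_comm (mem_open.2 ⟨r' * (1 - u), mul_pos r0 (by linarith), by nlinarith, ?_⟩)
      rw [hu, C.hX']; apply Complex.ext <;> simp only [pt_re, pt_im] <;> ring
    exact ⟨fun hV => C.R.free.1 z hV this, fun a b hab => C.R.free.2 a b hab z this⟩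

lemma cross_left (C : Crossing o s V E τ k c b e t ρ t' ρ' r r' X) :
    X ∈ openSegment ℝ (τ k) (τ (c + 1)) := by rw [C.hX]; exact pt_mem_open C.r0 C.r1
lemma cross_right (C : Crossing o s V E τ k c b e t ρ t' ρ' r r' X) :
    X ∈ openSegment ℝ (τ e) (τ (b - 1)) := by rw [C.hX']; exact pt_mem_open C.r0' C.r1'

lemma ρ_pos (C : Crossing o s V E τ k c b e t ρ t' ρ' r r' X) (h : k < c - 1) : 0 < ρ :=
  C.L.ρ_pos (C.L.pred_ne h)

lemma left_mem (C : Crossing o s V E τ k c b e t ρ t' ρ' r r' X) (hk : k < c - 1) :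
    τ (k + 1) ∈ Tri (τ k) (pt (τ k) (τ (c + 1)) t) (τ (c - 1)) :=
  (C.fanL (i := k + 1) (by omega) (by omega)).mem

lemma fan_first (C : Crossing o s V E τ k c b e t ρ t' ρ' r r' X) :
    0 < orient X (τ (k + 1)) (τ k) :=
  (C.fan le_rfl (by have := C.hkb; have := C.hbc; have := C.hce; omega)).1

lemma orient_base_apex (C : Crossing o s V E τ k c b e t ρ t' ρ' r r' X) :
    0 < orient (τ k) (τ e) (τ (b - 1)) := by
  have h := C.orient_base
  have : orient X (τ k) (τ e) = r' * orient (τ k) (τ e) (τ (b - 1)) := by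
    rw [C.hX']; unfold orient; simp only [pt_re, pt_im]; ring
  rw [this] at h
  exact pos_of_mul_pos_right h C.r0'.le

lemma orient_base_pred (C : Crossing o s V E τ k c b e t ρ t' ρ' r r' X) (hk : k < c - 1) :
    0 < orient (τ k) (τ e) (τ (c - 1)) := by
  have h1 := C.orient_base_apex
  have hρ := C.ρ_pos hk
  rcases C.hbc with rfl | rfl
  · exact h1
  · rw [add_sub_cancel_right] at h1
    have h2 := C.orient_right_end
    have e1 : orient (τ k) (τ e) (τ (c - 1)) =
        (1 - ρ) * (t * -orient (τ k) (τ (c + 1)) (τ e)) + ρ * orient (τ k) (τ e) (τ c) := by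
      rw [C.L.pred]; unfold orient; simp only [pt_re, pt_im]; ring
    rw [e1]
    have := mul_nonneg (sub_pos.2 C.L.ρ1).le (mul_nonneg C.L.t0 (neg_pos.2 h2).le)
    have := mul_pos hρ h1
    linarith

/-- The second vertex of the chain lies above the line through its ends. -/
lemma orient_base_next (C : Crossing o s V E τ k c b e t ρ t' ρ' r r' X) :
    0 < orient (τ k) (τ e) (τ (k + 1)) := by
  have h1 := C.orient_base_apex
  have hkb := C.hkb; have hbc := C.hbc
  by_cases hk : k < c - 1
  · have hf := C.fan_first
    have hρ := C.ρ_pos hk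
    have f1 := C.orient_base_pred hk
    have g1 : 0 < orient X (τ (c - 1)) (τ k) := by
      have : orient X (τ (c - 1)) (τ k) = r * (ρ * orient (τ k) (τ (c + 1)) (τ c)) := by
        rw [C.hX, C.L.pred]; unfold orient; simp only [pt_re, pt_im]; ring
      rw [this]; exact mul_pos C.r0 (mul_pos hρ C.L.pos)
    set f := orient (τ k) (τ e) (τ (c - 1)) with hfd
    set g := orient X (τ (c - 1)) (τ k) with hgd
    -- compare the slopes of the rays from `τ k` to `τ (c - 1)` and to `τ (k + 1)`, which lies in
    -- the triangle of the frame
    have A := ((Aff.orient_right (τ k) (τ e)).mul_const g).add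
      ((Aff.orient_mid X (τ k)).mul_const f).neg
    have e2 : orient (τ k) (τ e) (pt (τ k) (τ (c + 1)) t) =
        t * -orient (τ k) (τ (c + 1)) (τ e) := by
      unfold orient; simp only [pt_re, pt_im]; ring
    have e3 : orient X (pt (τ k) (τ (c + 1)) t) (τ k) = 0 := by
      rw [C.hX]; unfold orient; simp only [pt_re, pt_im]; ring
    have := A.nonneg_tri (C.left_mem hk) (by simp)
      (by
        simp only [e2, e3, mul_zero, neg_zero, add_zero]
        exact mul_nonneg g1.le (mul_nonneg C.L.t0 (neg_pos.2 C.orient_right_end).le))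
      (by simp only [← hfd, ← hgd]; linarith [mul_comm f g])
    have h3 : 0 < g * orient (τ k) (τ e) (τ (k + 1)) := by
      have := mul_pos f1 hf
      linarith
    exact pos_of_mul_pos_right h3 g1.le
  · have : k + 1 = b - 1 := by omega
    rw [this]; exact h1

/-- The second vertex of the chain lies on the left of the other base. -/
lemma next_side (C : Crossing o s V E τ k c b e t ρ t' ρ' r r' X) :
    0 ≤ orient (τ e) X (τ (k + 1)) := by
  have hkb := C.hkb; have hbc := C.hbc
  have eX : ∀ z, orient (τ e) X z = r' * orient (τ e) (τ (b - 1)) z := by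
    intro z; rw [C.hX']; unfold orient; simp only [pt_re, pt_im]; ring
  have fa : orient (τ e) X (τ (b - 1)) = 0 := by rw [eX]; simp
  by_cases hk : k < c - 1
  · have fp : 0 < orient (τ e) X (τ k) := by rw [orient_rot']; exact C.orient_base
    have fw : 0 < orient (τ e) X (pt (τ k) (τ (c + 1)) t) := by
      have e1 : r * orient (τ e) X (pt (τ k) (τ (c + 1)) t) = (r - t) * orient (τ e) X (τ k) := by
        rw [C.hX]; unfold orient; simp only [pt_re, pt_im]; ring
      have : 0 < r * orient (τ e) X (pt (τ k) (τ (c + 1)) t) := by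
        rw [e1]; exact mul_pos (sub_pos.2 C.tr) fp
      exact pos_of_mul_pos_right this C.r0.le
    have fr : 0 ≤ orient (τ e) X (τ (c - 1)) := by
      rcases hbc with rfl | rfl
      · exact fa.ge
      · rw [add_sub_cancel_right] at fa
        rw [C.L.pred, (Aff.orient_right _ _).pt, fa]
        nlinarith [mul_nonneg (sub_pos.2 C.L.ρ1).le fw.le]
    exact (Aff.orient_right _ _).nonneg_tri (C.left_mem hk) fp.le fw.le fr
  · have : k + 1 = b - 1 := by omega
    rw [this]; exact fa.ge

/-- Seen from the left end, the points of the gap precede the second vertex of the chain. -/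
lemma orient_next (C : Crossing o s V E τ k c b e t ρ t' ρ' r r' X) {x : ℂ}
    (hx : x ∈ Tri X (τ k) (τ e)) (hne : x ≠ τ k) : 0 < orient (τ k) x (τ (k + 1)) := by
  have h1 : 0 < orient (τ k) X (τ (k + 1)) := by rw [orient_rot']; exact C.fan_first
  have h2 := C.orient_base_next
  obtain ⟨α, β, γ, hα, hβ, hγ, e1, rfl⟩ := hx
  rw [(Aff.orient_mid (τ k) (τ (k + 1))).comb3 _ _ _ e1]
  simp only [orient_self_left, mul_zero, add_zero]
  rcases hα.eq_or_lt with rfl | hα'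
  · rcases hγ.eq_or_lt with rfl | hγ'
    · have : β = 1 := by linarith
      subst this; simp at hne
    · rw [zero_mul, zero_add]; positivity
  · have := mul_pos hα' h1
    have := mul_nonneg hγ h2.le
    linarith

/-- If the left end of the chain is reflex, then it has no neighbours in the gap. -/
lemma no_edge_left (C : Crossing o s V E τ k c b e t ρ t' ρ' r r' X)
    (hr : orient (τ k) (τ (k - 1)) (τ (k + 1)) ≤ 0) {x : ℂ} (hx : x ∈ Tri X (τ k) (τ e)) :
    ¬ E (τ k) x := fun hE => by
  have := (Corner.of_reflex (C.L.walk.corner' k) hr hE).2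
  linarith [C.orient_next hx (C.L.cfg.ne hE).symm]

/-- The mirror image of `Crossing.no_edge_left`. -/
lemma no_edge_right (C : Crossing o s V E τ k c b e t ρ t' ρ' r r' X)
    (hr : orient (τ e) (τ (e - 1)) (τ (e + 1)) ≤ 0) {x : ℂ} (hx : x ∈ Tri X (τ k) (τ e)) :
    ¬ E (τ e) x := fun hE => by
  refine C.mir.no_edge_left (x := GridMWT.mir x) ?_ ?_ ?_
  · simp only [mτ, orient_mir, neg_neg, show -(-e - 1) = e + 1 by ring,
      show -(-e + 1) = e - 1 by ring]
    rw [orient_swap']; linarith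
  · simp only [mτ, neg_neg]; exact Tri_mir (Tri_swap' hx)
  · simpa only [mE, mτ, neg_neg, mir_mir] using hE

lemma apex_mem (C : Crossing o s V E τ k c b e t ρ t' ρ' r r' X) :
    τ (b - 1) ∈ Tri (τ k) (τ (c + 1)) (τ c) := by
  rcases C.hbc with rfl | rfl
  · rw [C.L.pred]
    exact seg_sub_Tri (seg_sub_Tri (left_mem_Tri _ _ _) (mid_mem_Tri _ _ _)
      (pt_mem_seg C.L.t0 C.L.t1.le)) (right_mem_Tri _ _ _) (pt_mem_seg C.L.ρ0 C.L.ρ1.le)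
  · rw [add_sub_cancel_right]; exact right_mem_Tri _ _ _

/-- An extremal vertex of the gap is far from some vertex in the small triangle of the frame. -/
lemma exists_far (C : Crossing o s V E τ k c b e t ρ t' ρ' r r' X)
    (T : Top V X (τ k) (τ e) m h) :
    ∃ z ∈ V, z ∈ Tri (τ k) (τ c) (pt (τ k) (τ (c + 1)) t) ∧ z ∈ Tri (τ (b - 1)) X m ∧
      Near o s z (τ k) ∧ Near o s z (τ c) ∧ ¬ Near o s z m := by
  have H := C.L.cfg; have W := C.L.walk
  have hXo := open_sub_seg C.cross_left
  have hcl : Clear E X (τ (b - 1)) := C.R.free.clear.sub (seg_comm (open_sub_seg C.cross_right))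
    (left_mem_segment _ _ _)
  obtain ⟨z, hz, y, hy, hyp, hzT, hzm, hfar⟩ := T.exists_far H C.gap (W.mem H (b - 1))
    C.cross_right hcl
  have hyo : y ∈ segment ℝ (τ k) (τ (c + 1)) :=
    (convex_segment _ _).segment_subset hXo (left_mem_segment _ _ _) hy
  have hsub : z ∈ Tri (τ k) (τ c) (τ (c + 1)) := Tri_swap' (Tri_subset C.apex_mem
    (seg_sub_Tri (left_mem_Tri _ _ _) (mid_mem_Tri _ _ _) hXo)
    (seg_sub_Tri (left_mem_Tri _ _ _) (mid_mem_Tri _ _ _) hyo) hzT)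
  have hw : pt (τ k) (τ (c + 1)) t ∈ segment ℝ (τ k) (τ (c + 1)) := pt_mem_seg C.L.t0 C.L.t1.le
  -- the end of the base cannot lie in the triangle in which `z` was found
  have hzq : z ≠ τ (c + 1) := by
    rintro rfl
    have hpos := C.L.pos
    have A := (Aff.orient_right (τ k) (τ (c + 1))).add (Aff.orient_right (τ (c + 1)) (τ c))
    have hp : 0 < orient (τ (c + 1)) (τ c) (τ k) := by rw [orient_rot]; exact hpos
    have hX1 : 0 < orient (τ (c + 1)) (τ c) X := by
      have : orient (τ (c + 1)) (τ c) X = (1 - r) * orient (τ (c + 1)) (τ c) (τ k) := by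
        rw [C.hX]; unfold orient; simp only [pt_re, pt_im]; ring
      rw [this]; exact mul_pos (sub_pos.2 C.r1) hp
    have on : ∀ x ∈ segment ℝ (τ k) (τ (c + 1)), orient (τ k) (τ (c + 1)) x = 0 :=
      fun x hx => orient_open hx
    have := A.pos_tri hzT
      (add_pos_of_pos_of_nonneg C.orient_left_end
        ((Aff.orient_right _ _).nonneg_tri C.apex_mem hp.le (by simp) (by simp)))
      (by simp only [on X hXo, zero_add]; exact hX1)
      (by
        simp only [on y hyo, zero_add]
        obtain ⟨u, u0, u1, rfl⟩ := mem_seg.1 hy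
        rw [(Aff.orient_right _ _).pt]
        rcases u1.eq_or_lt with rfl | u1
        · linarith
        · nlinarith [mul_pos (sub_pos.2 u1) hX1, mul_nonneg u0 hp.le])
    simp at this
  -- above the ray of the frame there are no vertices besides the apex and its predecessor
  have hzs : z ∈ Tri (τ k) (τ c) (pt (τ k) (τ (c + 1)) t) := by
    rcases Tri_split hw hsub with h | h
    · exact h
    · rcases C.L.empty z hz (Tri_rot (Tri_rot (h))) with h | h | h
      · exact absurd h hzq
      · rw [h]; exact mid_mem_Tri _ _ _
      · rw [h, C.L.pred]
        exact seg_sub_Tri (right_mem_Tri _ _ _) (mid_mem_Tri _ _ _) (pt_mem_seg C.L.ρ0 C.L.ρ1.le)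
  have n1 : Near o s (τ k) (τ c) := C.L.near.symm
  have n2 : Near o s (τ c) (pt (τ k) (τ (c + 1)) t) := near_seg hw C.L.near (H.near (W.adj c))
  have n3 : Near o s (pt (τ k) (τ (c + 1)) t) (τ k) := C.L.small.1.symm
  exact ⟨z, hz, hzs, hzm, near_hull hzs (left_mem_Tri _ _ _) n1 n2 n3,
    near_hull hzs (mid_mem_Tri _ _ _) n1 n2 n3, hfar⟩

end Crossing
end

section
variable {o : ℂ} {s : ℝ} {V : Finset ℂ} {E : ℂ → ℂ → Prop} {τ : ℤ → ℂ} {k c b e : ℤ}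
variable {t ρ t' ρ' r r' : ℝ} {X m m' : ℂ} {h h' : ℂ → ℝ}

namespace Crossing

/-- If both chains have the same apex, then an extremal vertex of the gap cannot be far from the
right end of the chain. -/
lemma near_right_of_eq (C : Crossing o s V E τ k c c e t ρ t' ρ' r r' X)
    (T : Top V X (τ k) (τ e) m h) : Near o s m (τ e) := by
  have H := C.L.cfg; have W := C.L.walk
  by_contra hme
  have hkb := C.hkb
  have t0 := C.L.t0; have t1 := C.L.t1; have tr := C.tr; have r1 := C.r1; have r0 := C.r0
  have ρ1 := C.L.ρ1; have ρ0 := C.L.ρ0; have r1' := C.r1'; have r0' := C.r0'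
  -- the crossing point lies in the triangle of the ends and the apex
  have hXT : X ∈ Tri (τ k) (τ c) (τ e) := by
    have hd : 0 < r - r' * (1 - ρ) * t := by
      have : r' * (1 - ρ) ≤ 1 := by nlinarith
      nlinarith [mul_nonneg t0 (sub_nonneg.2 this)]
    refine ⟨r' * (1 - ρ) * (r - t) / (r - r' * (1 - ρ) * t), r' * ρ * r / (r - r' * (1 - ρ) * t),
      (1 - r') * r / (r - r' * (1 - ρ) * t), ?_, ?_, ?_, ?_, ?_⟩
    · exact div_nonneg (mul_nonneg (mul_nonneg r0'.le (by linarith)) (by linarith)) hd.le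
    · positivity
    · exact div_nonneg (mul_nonneg (by linarith) r0.le) hd.le
    · field_simp; ring
    · have hX := C.hX
      have hX' := C.hX'
      rw [C.L.pred] at hX'
      have a1 := congrArg Complex.re hX
      have a2 := congrArg Complex.im hX
      have a3 := congrArg Complex.re hX'
      have a4 := congrArg Complex.im hX'
      simp only [pt_re, pt_im] at a1 a2 a3 a4
      apply Complex.ext
      · simp only [Complex.add_re, Complex.re_ofReal_mul]
        field_simp
        linear_combination r * a3 - r' * (1 - ρ) * t * a1
      · simp only [Complex.add_im, Complex.im_ofReal_mul]
        field_simp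
        linear_combination r * a4 - r' * (1 - ρ) * t * a2
  have hce : Near o s (τ c) (τ e) := C.R.near
  have hm : m ∈ Tri (τ k) (τ c) (τ e) :=
    Tri_subset hXT (left_mem_Tri _ _ _) (right_mem_Tri _ _ _) T.tri
  have hmc : Near o s (τ c) m := near_tri hm C.L.near (near_refl _) hce
  have hmp : Near o s m (τ k) := (near_or_near C.L.near hce hm).resolve_right hme
  obtain ⟨z, hz, hzT, -, hzp, hzc, hzm⟩ := C.exists_far T
  -- choose a coordinate in which `z` lies beyond the cells adjacent to that of `m`: the apex and
  -- its predecessor have smaller values of it than `X`, and so has the right end, although `X`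
  -- lies between the predecessor and the right end
  obtain ⟨G, N, G', N', K, hN⟩ := exists_coords hzm
  have h1 := ((K.near _ _).1 hzp).1
  have h2 := ((K.near _ _).1 hzc).1
  have h3 := ((K.near _ _).1 hmc).1
  have h4 := ((K.near _ _).1 hmp).1
  have F := K.fst
  have A := F.aff
  set w := pt (τ k) (τ (c + 1)) t with hw
  have hNw : N (τ k) < N w := by
    by_contra hc
    have := F.le_tri hzT (n := N (τ k)) le_rfl (by omega) (by omega)
    omega
  have hGw := F.lt hNw
  have hGX : G w ≤ G X := by
    rw [C.hX, hw, A.pt, A.pt]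
    rw [hw, A.pt] at hGw
    have : 0 < G (τ (c + 1)) - G (τ k) := by
      by_contra hc; push Not at hc; nlinarith
    nlinarith
  have hNX := F.mono _ _ hGX
  have hNe : N (τ e) < N X := by
    by_contra hc
    have := F.ge_tri T.tri (n := N (τ k)) (by omega) le_rfl (by omega)
    omega
  have hGe := F.lt hNe
  have hGc : G (τ c) < G w := F.lt (by omega)
  have hGr : G (τ (c - 1)) ≤ G w := by
    rw [C.L.pred, A.pt]; nlinarith
  have hlt : G (τ (c - 1)) < G X := by
    refine lt_of_le_of_ne (hGr.trans hGX) fun h => ?_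
    have h5 := A.pt (τ e) (τ (c - 1)) r'
    rw [← C.hX', h] at h5
    nlinarith [mul_pos (sub_pos.2 r1') (sub_pos.2 hGe)]
  have h5 := A.pt (τ e) (τ (c - 1)) r'
  rw [← C.hX'] at h5
  nlinarith [mul_pos (sub_pos.2 r1') (sub_pos.2 hGe), mul_pos r0' (sub_pos.2 hlt)]

/-- If the two apexes are adjacent, then the extremal vertices of the gap are far from the first
apex. -/
lemma far_left_of_succ (C : Crossing o s V E τ k c (c + 1) e t ρ t' ρ' r r' X)
    (T : Top V X (τ k) (τ e) m h) : ¬ Near o s (τ c) m := by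
  intro hcm
  obtain ⟨z, hz, hzT, hzm, hzp, hzc, hfar⟩ := C.exists_far T
  rw [add_sub_cancel_right] at hzm
  -- in a coordinate in which `z` lies beyond the cells adjacent to that of `m`, the left end
  -- and the apex lie strictly beyond `m`, and so do `X` and the right end: then `m` is not in
  -- their triangle
  obtain ⟨G, N, G', N', K, hN⟩ := exists_coords hfar
  have h1 := ((K.near _ _).1 hzp).1
  have h2 := ((K.near _ _).1 hzc).1
  have h3 := ((K.near _ _).1 hcm).1
  have F := K.fst
  have hNX : N (τ c) < N X := by
    by_contra hc
    have := F.le_tri hzm (n := N (τ c)) le_rfl (by omega) (by omega)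
    omega
  have hXs := open_sub_seg C.cross_right
  rw [add_sub_cancel_right] at hXs
  have hNe : N (τ c) < N (τ e) := by
    by_contra hc
    have := F.le_tri (Tri_of_seg (τ c) hXs) (n := N (τ c)) (by omega) le_rfl le_rfl
    omega
  have := F.ge_tri T.tri (n := N (τ c)) (by omega) (by omega) (by omega)
  omega

/-- The mirror image of `Crossing.far_left_of_succ`. -/
lemma far_right_of_succ (C : Crossing o s V E τ k c (c + 1) e t ρ t' ρ' r r' X)
    (T : Top V X (τ k) (τ e) m h) : ¬ Near o s (τ (c + 1)) m := by
  intro hn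
  have C' := C.mir
  rw [show -c = -(c + 1) + 1 by ring] at C'
  have T' := T.mir
  refine C'.far_left_of_succ (m := GridMWT.mir m) (h := fun z => h (GridMWT.mir z)) ?_ ?_
  · simpa only [mτ, neg_neg] using T'
  · simp only [mτ, neg_neg]; exact near_mir.2 hn

/-- If the two apexes are adjacent and an extremal vertex of the gap is far from the right end of
the chain, then all extremal vertices are close to the left end. -/
lemma near_left_of_succ (C : Crossing o s V E τ k c (c + 1) e t ρ t' ρ' r r' X)
    (T : Top V X (τ k) (τ e) m h) (T' : Top V X (τ k) (τ e) m' h') (hme : ¬ Near o s (τ e) m) :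
    Near o s (τ k) m' := by
  have H := C.L.cfg; have W := C.L.walk
  have n1 := C.far_left_of_succ T
  have n2 := C.far_right_of_succ T
  have n1' := C.far_left_of_succ T'
  have n2' := C.far_right_of_succ T'
  have hcp := C.L.near
  have hcq : Near o s (τ c) (τ (c + 1)) := H.near (W.adj c)
  have hqe : Near o s (τ (c + 1)) (τ e) := C.R.near
  have hX1 := open_sub_seg C.cross_left
  have hX2 := open_sub_seg C.cross_right
  rw [add_sub_cancel_right] at hX2
  have inT : ∀ x ∈ Tri X (τ k) (τ e), x ∈ Tri (τ k) (τ c) (τ e) ∧ x ∈ Tri (τ k) (τ (c + 1)) (τ e) :=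
    fun x hx => ⟨Tri_subset (seg_sub_Tri (right_mem_Tri _ _ _) (mid_mem_Tri _ _ _) hX2)
      (left_mem_Tri _ _ _) (right_mem_Tri _ _ _) hx,
      Tri_subset (seg_sub_Tri (left_mem_Tri _ _ _) (mid_mem_Tri _ _ _) hX1)
      (left_mem_Tri _ _ _) (right_mem_Tri _ _ _) hx⟩
  obtain ⟨i1, i2⟩ := inT m T.tri
  obtain ⟨j1, j2⟩ := inT m' T'.tri
  -- `G₂` is the coordinate in which `m` is far from the first apex; then the other coordinate
  -- separates `m` from the second apex, and its sign can be chosen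
  obtain ⟨G₂, N₂, G₁, N₁, K, hN⟩ := exists_coords n1
  have key : ∀ G N, Coords o s G N G₂ N₂ → N m + 1 < N (τ (c + 1)) → Near o s (τ k) m' := by
    intro G N K hN₁
    rw [K.near] at hcp hcq hqe hme n1' n2' ⊢
    have F := K.fst; have F₂ := K.snd
    have a1 : N₂ (τ e) ≤ N₂ m := by
      by_contra hc
      have := F₂.ge_tri i1 (n := N₂ m + 1) (by omega) (by omega) (by omega)
      omega
    have a2 : N (τ k) ≤ N m := by
      by_contra hc
      have := F.ge_tri i2 (n := N m + 1) (by omega) (by omega) (by omega)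
      omega
    have b1 : N (τ c) + 1 ≤ N (τ e) := by
      by_contra hc
      apply hme
      constructor <;> omega
    have b2 : N₂ (τ k) < N₂ (τ c) := by
      by_contra hc
      have := (K.sum _ _ _ _ i1 (N (τ c) + N₂ (τ c) - 1)).1 (by omega) (by omega) (by omega)
      omega
    have c1 := F₂.le_tri j2 (n := N₂ (τ c) - 1) (by omega) (by omega) (by omega)
    have c2 := F₂.ge_tri j2 (n := N₂ (τ c) - 2) (by omega) (by omega) (by omega)
    have c3 := F.ge_tri j2 (n := N (τ c) - 1) (by omega) (by omega) (by omega)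
    have c4 : N m' ≤ N (τ c) - 1 := by
      by_contra hc
      have c5 := F.le_tri j2 (n := N (τ c) + 2) (by omega) (by omega) (by omega)
      apply n2'
      constructor <;> omega
    have c6 : N₂ m' ≤ N₂ (τ c) - 2 := by
      by_contra hc
      apply n1'
      constructor <;> omega
    constructor <;> omega
  have hq : N₂ (τ (c + 1)) ≤ N₂ m + 1 ∧ N₂ m ≤ N₂ (τ (c + 1)) + 1 := by
    have := (K.near _ _).1 hcp
    have := (K.near _ _).1 hcq
    have := (K.near _ _).1 hqe
    have a1 : N₂ (τ e) ≤ N₂ m := by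
      by_contra hc
      have := K.fst.ge_tri i1 (n := N₂ m + 1) (by omega) (by omega) (by omega)
      omega
    have a2 := K.fst.ge_tri i1 (n := N₂ (τ c) - 2) (by omega) (by omega) (by omega)
    omega
  have n2s := n2
  rw [K.near] at n2s
  by_cases hlt : N₁ m + 1 < N₁ (τ (c + 1))
  · exact key _ _ K.swap hlt
  · refine key _ _ K.swap.neg ?_
    have : ¬ (N₁ (τ (c + 1)) ≤ N₁ m + 1 ∧ N₁ m ≤ N₁ (τ (c + 1)) + 1) := fun h => n2s ⟨hq, h⟩
    omega

/-- If the left end `τ k` of the chain is joined to the first vertex of the gap, then the walk comes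
from there, `τ k` is convex and its predecessor is reflex. -/
lemma pred_of_edge (C : Crossing o s V E τ k c b e t ρ t' ρ' r r' X)
    (T : Top V X (τ k) (τ e) m (fun z => orient (τ k) m z)) (hE : E (τ k) m) :
    τ (k - 1) = m ∧ 0 < orient (τ k) (τ (k - 1)) (τ (k + 1)) ∧
      orient (τ (k - 1)) (τ (k - 2)) (τ k) ≤ 0 := by
  have H := C.L.cfg; have W := C.L.walk; have G := C.gap
  have hw := C.orient_next T.tri T.nep
  have hc := (W.corner' k m hE).2 hw
  have hu : E (τ k) (τ (k - 1)) := H.symm (W.adj' k)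
  -- otherwise the edge to the predecessor enters the part of the gap above `m`, which is free
  have hum : τ (k - 1) = m := by
    by_contra hne
    have h0 : 0 < orient (τ k) m (τ (k - 1)) := by
      refine lt_of_le_of_ne (by rw [orient_swap']; linarith [hc.2]) fun h0 => ?_
      rcases H.eq_of_orient G.hp T.mem (W.mem H _) T.nep.symm h0.symm with h | h
      · exact H.ne hu h.symm
      · exact hne h
    have hq : orient (τ k) (τ (c + 1)) (τ (k - 1)) < 0 := by
      have h1 := (C.L.left (τ (k - 1)) hu).1
      have h2 : orient (τ k) (τ (c + 1)) (τ (k - 1)) ≤ 0 := by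
        by_contra hcon
        linarith [(h1 (not_le.1 hcon)).2, hc.1]
      refine lt_of_le_of_ne h2 fun h3 => ?_
      rcases H.eq_of_orient G.hp (W.mem H _) (W.mem H _) C.L.base_ne h3 with h | h
      · exact H.ne hu h.symm
      · rw [h] at hu
        exact C.L.free.2 _ _ hu X C.cross_left (open_sub_seg C.cross_left)
    have hX : 0 < orient (τ k) (τ (k - 1)) X := by
      have : orient (τ k) (τ (k - 1)) X = -(r * orient (τ k) (τ (c + 1)) (τ (k - 1))) := by
        rw [C.hX]; unfold orient; simp only [pt_re, pt_im]; ring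
      rw [this]; nlinarith [C.r0]
    rcases wedge_exit T.pos h0 hX with h | ⟨z, hz, hz'⟩
    · have := T.le _ (W.mem H (k - 1)) (Tri_subset (mid_mem_Tri _ _ _) T.tri (left_mem_Tri _ _ _) h)
      linarith
    · have := T.above (open_comm hz')
      exact T.no_drawing H G this.1 this.2 hu (open_sub_seg hz)
  refine ⟨hum, hc.1, ?_⟩
  have := T.no_up H G (x := τ (k - 2)) (by
    have := H.symm (W.adj (k - 2))
    rwa [show k - 2 + 1 = k - 1 by ring, hum] at this)
  rw [hum, orient_rot]
  exact this

/-- If both chains have the same apex and the right end of the chain is reflex, then the gap is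
empty. -/
lemma empty_of_eq (C : Crossing o s V E τ k c c e t ρ t' ρ' r r' X)
    (hr : orient (τ e) (τ (e - 1)) (τ (e + 1)) ≤ 0) :
    ∀ v ∈ V, v ∈ Tri X (τ k) (τ e) → v = τ k ∨ v = τ e := by
  intro v hv hvT
  by_contra hc
  push Not at hc
  obtain ⟨m, T⟩ := C.gap.exists_top_right C.L.cfg ⟨v, hv, hvT, hc.1, hc.2⟩
  have hn := C.near_right_of_eq T
  exact C.no_edge_right hr T.tri
    (C.L.cfg.edge_of_clear C.gap.he T.mem T.nee.symm hn.symm (T.clear_right C.L.cfg C.gap))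

/-- If the two apexes are adjacent, then a vertex in the gap yields an edge from one of the two
ends of the chain to an extremal vertex of the gap. -/
lemma edge_of_succ (C : Crossing o s V E τ k c (c + 1) e t ρ t' ρ' r r' X)
    (hM : ∃ v ∈ V, v ∈ Tri X (τ k) (τ e) ∧ v ≠ τ k ∧ v ≠ τ e) :
    (∃ m, Top V X (τ k) (τ e) m (fun z => orient (τ k) m z) ∧ E (τ k) m) ∨
      ∃ m, Top V X (τ k) (τ e) m (fun z => orient m (τ e) z) ∧ E (τ e) m := by
  have H := C.L.cfg; have G := C.gap
  obtain ⟨m, T⟩ := G.exists_top_right H hM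
  obtain ⟨m', T'⟩ := G.exists_top_left H hM
  by_cases hn : Near o s (τ e) m
  · exact .inr ⟨m, T, H.edge_of_clear G.he T.mem T.nee.symm hn (T.clear_right H G)⟩
  · exact .inl ⟨m', T', H.edge_of_clear G.hp T'.mem T'.nep.symm (C.near_left_of_succ T T' hn)
      (T'.clear_left H G)⟩

/-- The part of the mirror image of `Crossing.pred_of_edge` that concerns the successor of the
right end. -/
lemma succ_of_edge (C : Crossing o s V E τ k c b e t ρ t' ρ' r r' X)
    (T : Top V X (τ k) (τ e) m (fun z => orient m (τ e) z)) (hE : E (τ e) m) :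
    orient (τ (e + 1)) (τ e) (τ (e + 2)) ≤ 0 := by
  have T' := T.mir
  have h3 : (fun z => orient m (τ e) (GridMWT.mir z)) =
      fun z => orient (GridMWT.mir (τ e)) (GridMWT.mir m) z := by
    funext z; unfold orient GridMWT.mir; simp only; ring
  rw [h3] at T'
  have := (C.mir.pred_of_edge (m := GridMWT.mir m)
    (by simpa only [mτ, neg_neg] using T')
    (by simpa only [mE, mτ, neg_neg, mir_mir] using hE)).2.2
  simp only [mτ, orient_mir, neg_neg, show -(-e - 1) = e + 1 by ring,
    show -(-e - 2) = e + 2 by ring] at this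
  rw [orient_swap']; linarith

end Crossing
end

section
variable {o : ℂ} {s : ℝ} {V : Finset ℂ} {E : ℂ → ℂ → Prop} {τ : ℤ → ℂ} {k c b e : ℤ}
variable {t ρ t' ρ' r r' : ℝ} {X m : ℂ}

/-- The convex vertex `τ k` with a reflex predecessor can be cut off by a free segment from
`τ (k - 1)` to `τ (k + 1)` that crosses the segment from `τ k` to `q`. -/
structure Shortcut (V : Finset ℂ) (E : ℂ → ℂ → Prop) (τ : ℤ → ℂ) (k : ℤ) (q : ℂ) : Prop where
  conv : 0 < orient (τ k) (τ (k - 1)) (τ (k + 1))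
  refl : orient (τ (k - 1)) (τ (k - 2)) (τ k) ≤ 0
  free : Free V E (τ (k - 1)) (τ (k + 1))
  cross : ∃ y ∈ openSegment ℝ (τ (k - 1)) (τ (k + 1)), y ∈ openSegment ℝ (τ k) q
  below : ∀ x, E (τ (k - 1)) x → orient (τ k) (τ (k - 1)) x ≤ 0
  wedge : ∀ x, E (τ (k + 1)) x → 0 < orient (τ (k + 1)) (τ k) x →
    orient (τ (k + 1)) x (τ (k - 1)) < 0

namespace Crossing

/-- The segment from the first vertex of the gap to the second vertex of the chain leaves the gap
through the base of the left chain. -/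
lemma exists_exit (C : Crossing o s V E τ k c b e t ρ t' ρ' r r' X)
    (T : Top V X (τ k) (τ e) m (fun z => orient (τ k) m z)) :
    ∃ u, 0 < u ∧ u < 1 ∧ pt m (τ (k + 1)) u ∈ segment ℝ X (τ k) ∧ pt m (τ (k + 1)) u ≠ τ k := by
  have H := C.L.cfg; have W := C.L.walk; have G := C.gap
  have hw := C.orient_next T.tri T.nep
  have hwT : τ (k + 1) ∉ Tri X (τ k) (τ e) := fun hT => by
    have := T.le _ (W.mem H _) hT; linarith
  obtain ⟨y, hy, hy'⟩ := tri_exit G.pos T.tri hwT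
  have hym : y ≠ m := by
    rintro rfl
    have := T.not_side H G
    tauto
  obtain ⟨u, u0, u1, rfl⟩ := mem_seg.1 hy
  have u0 : 0 < u := lt_of_le_of_ne u0 (by rintro rfl; simp at hym)
  have hhy : 0 < orient (τ k) m (pt m (τ (k + 1)) u) := by
    rw [(Aff.orient_right _ _).pt]; simp only [orient_self_right]; nlinarith
  have hp := T.left_nonpos G
  have he := T.right_nonpos G
  have hwe : τ (k + 1) ∉ segment ℝ X (τ e) := fun hs => by
    by_cases h : τ (k + 1) = τ e
    · rw [h] at hw; linarith
    · exact (G.right _ hs h).1 (W.mem H _)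
  have hwp : τ (k + 1) ∉ segment ℝ X (τ k) := fun hs =>
    (G.left _ hs (H.ne (W.adj k)).symm).1 (W.mem H _)
  have hys : pt m (τ (k + 1)) u ∈ segment ℝ X (τ k) := by
    rcases hy' with h | h | h
    · exact h
    · have := (Aff.orient_right (τ k) m).neg.nonneg_seg h (by linarith) (by linarith)
      linarith
    · exfalso
      have h1 : orient (τ e) X (pt m (τ (k + 1)) u) = 0 := orient_open h
      rw [(Aff.orient_right _ _).pt] at h1
      have h2 := (T.side_pos H G).2.2
      have h3 := C.next_side
      rcases u1.eq_or_lt with rfl | u1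
      · rw [pt_one] at h
        exact hwe (seg_comm h)
      · nlinarith [mul_pos (sub_pos.2 u1) h2, mul_nonneg u0.le h3]
  refine ⟨u, u0, lt_of_le_of_ne u1 ?_, hys, ?_⟩
  · rintro rfl; rw [pt_one] at hys; exact hwp hys
  · intro h; rw [h] at hhy; simp at hhy

lemma orient_above_next (C : Crossing o s V E τ k c b e t ρ t' ρ' r r' X) :
    0 < orient (τ k) (τ (c + 1)) (τ (k + 1)) := by
  have h := C.fan_first
  have : orient X (τ (k + 1)) (τ k) = r * orient (τ k) (τ (c + 1)) (τ (k + 1)) := by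
    rw [C.hX]; unfold orient; simp only [pt_re, pt_im]; ring
  rw [this] at h
  exact pos_of_mul_pos_right h C.r0.le

/-- The first triangle of the fan contains no vertices besides its corners. -/
lemma first_empty (C : Crossing o s V E τ k c b e t ρ t' ρ' r r' X) {y : ℂ}
    (hy : y ∈ segment ℝ X (τ k)) :
    ∀ v ∈ V, v ∈ Tri y (τ (k + 1)) (τ k) → v = τ (k + 1) ∨ v = τ k := by
  intro v hv hvT
  have hf := C.fan_first
  have hyf : 0 ≤ orient X (τ (k + 1)) y :=
    (Aff.orient_right X (τ (k + 1))).nonneg_seg hy (by simp) hf.le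
  rcases (C.fanL le_rfl C.L.lt).empty v hv (Tri_subset (seg_sub_Tri (left_mem_Tri _ _ _)
    (right_mem_Tri _ _ _) hy) (mid_mem_Tri _ _ _) (right_mem_Tri _ _ _) hvT) with h | h | h
  · exfalso
    have h1 := (Aff.orient_right X (τ (k + 1))).nonneg_tri hvT hyf (by simp) hf.le
    have h2 : r * orient X (τ (k + 1)) (τ (c + 1)) = -((1 - r) * orient X (τ (k + 1)) (τ k)) := by
      rw [C.hX]; unfold orient; simp only [pt_re, pt_im]; ring
    rw [h] at h1
    nlinarith [mul_pos (sub_pos.2 C.r1) hf, mul_nonneg C.r0.le h1]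
  · exact .inl h
  · exact .inr h

/-- An edge from the left end to the first vertex of the gap leads to a shortcut. -/
lemma shortcut (C : Crossing o s V E τ k c b e t ρ t' ρ' r r' X)
    (T : Top V X (τ k) (τ e) m (fun z => orient (τ k) m z)) (hE : E (τ k) m) :
    Shortcut V E τ k (τ (c + 1)) := by
  have H := C.L.cfg; have W := C.L.walk; have G := C.gap
  obtain ⟨hm, hconv, hrefl⟩ := C.pred_of_edge T hE
  obtain ⟨u, u0, u1, hy, hyp⟩ := C.exists_exit T
  have hw := C.orient_next T.tri T.nep
  set w := τ (k + 1) with hwdef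
  set y := pt m w u with hydef
  have hhy : 0 < orient (τ k) m y := by
    rw [hydef, (Aff.orient_right _ _).pt]; simp only [orient_self_right]; nlinarith
  have hyT : y ∈ Tri X (τ k) (τ e) := seg_sub_Tri (left_mem_Tri _ _ _) (mid_mem_Tri _ _ _) hy
  have hyq : y ∈ openSegment ℝ (τ k) (τ (c + 1)) := by
    obtain ⟨a, a0, a1, ha⟩ := mem_seg.1 hy
    have a1 : a < 1 := lt_of_le_of_ne a1 (by rintro rfl; rw [pt_one] at ha; exact hyp ha)
    have := C.r0; have := C.r1
    refine mem_open.2 ⟨r * (1 - a), mul_pos C.r0 (by linarith), by nlinarith, ?_⟩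
    rw [ha, C.hX]; apply Complex.ext <;> simp only [pt_re, pt_im] <;> ring
  have hpw := W.adj k
  have hwV : w ∈ V := W.mem H _
  have habove := C.orient_above_next
  have hywp : 0 < orient (τ k) y w := by
    have : orient (τ k) y w = (1 - u) * orient (τ k) m w := by
      rw [hydef]; unfold orient; simp only [pt_re, pt_im]; ring
    rw [this]; exact mul_pos (by linarith) hw
  have nomw : ¬ E m w := fun h => by have := T.no_up H G h; linarith
  have hmw : m ≠ w := by rintro h; rw [h] at hw; simp at hw
  have hempty := C.first_empty hy
  rw [← hwdef] at hempty
  -- the part of the shortcut above the base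
  have hclear : Clear E y w := by
    refine clear_of_empty H (c := τ k) (by rw [← orient_rot']; exact hywp.ne') ?_
      (H.clear_edge hpw) ?_ ?_
    · exact C.L.free.clear.sub (open_sub_seg hyq) (left_mem_segment _ _ _)
    · intro v hv hvT
      rcases hempty v hv hvT with h | h
      · right; rw [h]; simp
      · exact .inl h
    · have key : ∀ x, E (τ k) x → ∀ z ∈ openSegment ℝ y w, z ∉ openSegment ℝ (τ k) x := by
        intro x hx z hz hz'
        obtain ⟨a, a0, a1, rfl⟩ := mem_open.1 hz'
        have h1 := (Aff.orient_right (τ k) (τ (c + 1))).pos_open hz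
          (orient_open (open_sub_seg hyq)).ge habove.le (.inr habove.ne')
        have h2 := (Aff.orient_mid (τ k) w).pos_open hz hywp.le (by simp) (.inl hywp.ne')
        rw [(Aff.orient_right (τ k) (τ (c + 1))).pt] at h1
        rw [(Aff.orient_mid (τ k) w).pt] at h2
        simp only [orient_self_out, orient_self_left, zero_add, sub_zero] at h1 h2
        have h3 := pos_of_mul_pos_right h1 a0.le
        have h4 := pos_of_mul_pos_right h2 a0.le
        linarith [((C.L.left x hx).1 h3).2]
      intro g g' hg hp z hz hz'
      by_cases h1 : τ k = g
      · exact key g' (h1 ▸ hg) z hz (h1 ▸ hz')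
      by_cases h2 : τ k = g'
      · exact key g (h2 ▸ H.symm hg) z hz (h2 ▸ open_comm hz')
      exact H.not_mem_open hg G.hp (open_of_seg hp h1 h2)
  have hnv : ∀ z ∈ openSegment ℝ y w, z ∉ V := by
    intro z hz hzV
    have hzT : z ∈ Tri y w (τ k) :=
      seg_sub_Tri (left_mem_Tri _ _ _) (mid_mem_Tri _ _ _) (open_sub_seg hz)
    have h2 := (Aff.orient_mid (τ k) w).pos_open hz hywp.le (by simp) (.inl hywp.ne')
    rcases hempty z hzV hzT with rfl | rfl
    · simp at h2
    · simp at h2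
  have line : ∀ x ∈ V, orient y w x = 0 → x = m ∨ x = w := by
    intro x hx h0
    refine H.eq_of_orient T.mem hwV hx hmw ?_
    have : orient y w x = (1 - u) * orient m w x := by
      rw [hydef]; unfold orient; simp only [pt_re, pt_im]; ring
    rw [this] at h0
    rcases mul_eq_zero.1 h0 with h | h
    · linarith
    · exact h
  have hup : ∀ z ∈ openSegment ℝ y w, ∀ g g', E g g' → z ∉ segment ℝ g g' := by
    intro z hz g g' hg hzg
    have hzo : z ∈ openSegment ℝ g g' := open_of_seg hzg
      (fun h => hnv z hz (h ▸ H.mem hg)) (fun h => hnv z hz (h ▸ H.mem' hg))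
    have h1 := line g (H.mem hg) (hclear g g' hg z hz hzo)
    have h2 := line g' (H.mem' hg) (hclear g' g (H.symm hg) z hz (open_comm hzo))
    have hne := H.ne hg
    rcases h1 with rfl | rfl <;> rcases h2 with rfl | rfl
    · exact hne rfl
    · exact nomw hg
    · exact nomw (H.symm hg)
    · exact hne rfl
  -- the shortcut runs first in the part of the gap above `m` and then above the base of the left
  -- chain
  have hsplit : ∀ z ∈ openSegment ℝ m w, (z ∈ Tri X (τ k) (τ e) ∧ 0 < orient (τ k) m z) ∨
      z ∈ openSegment ℝ y w := by
    intro z hz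
    obtain ⟨a, a0, a1, rfl⟩ := mem_open.1 hz
    rcases le_or_gt a u with hau | hau
    · left
      refine ⟨seg_sub_Tri T.tri hyT (mem_seg.2 ⟨a / u, by positivity, by rwa [div_le_one u0], ?_⟩),
        ?_⟩
      · have := u0.ne'
        rw [hydef]; apply Complex.ext <;> simp only [pt_re, pt_im] <;> field_simp <;> ring
      · rw [(Aff.orient_right _ _).pt]; simp only [orient_self_right]; nlinarith
    · right
      have h1 : 0 < 1 - u := by linarith
      refine mem_open.2 ⟨(a - u) / (1 - u), div_pos (by linarith) h1, by rw [div_lt_one h1]; linarith,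
        ?_⟩
      have := h1.ne'
      rw [hydef]; apply Complex.ext <;> simp only [pt_re, pt_im] <;> field_simp <;> ring
  have hfree : Free V E m w := by
    refine ⟨fun v hv hz => ?_, fun g g' hg z hz => ?_⟩
    · rcases hsplit v hz with ⟨h1, h2⟩ | h
      · linarith [T.le v hv h1]
      · exact hnv v h hv
    · rcases hsplit z hz with ⟨h1, h2⟩ | h
      · exact T.no_drawing H G h1 h2 hg
      · exact hup z h g g' hg
  refine ⟨hconv, hrefl, hm ▸ hfree, ⟨y, ?_, hyq⟩, ?_, ?_⟩
  · rw [hm]; exact pt_mem_open u0 u1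
  · rw [hm]; exact fun x hx => T.no_up H G hx
  · rw [hm]
    intro x hx h1
    by_contra hc
    push Not at hc
    have hwx := H.ne hx
    have h2 : 0 < orient w x m := by
      refine lt_of_le_of_ne hc fun h0 => ?_
      rcases H.eq_of_orient hwV T.mem (H.mem' hx) hmw.symm (c := x)
        (by rw [orient_swap']; linarith) with h | h
      · exact hwx h.symm
      · exact nomw (H.symm (h ▸ hx))
    -- an edge from `w` between the directions of `τ k` and `m` cannot end in the triangle of
    -- `m`, `τ k` and `w`, nor leave it through the edge from `τ k` to `m`
    have h3 : 0 < orient w (τ k) m := by rw [orient_rot']; exact hw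
    rcases wedge_exit h3 h1 h2 with h | ⟨z, hz, hz'⟩
    · rcases Tri_split (seg_comm (pt_mem_seg u0.le u1.le : y ∈ segment ℝ m w)) h with h | h
      · rcases hempty x (H.mem' hx) (Tri_rot (Tri_rot (h))) with h | h
        · exact hwx h.symm
        · rw [h] at h1; simp at h1
      · have h4 := T.le x (H.mem' hx) (Tri_subset hyT (mid_mem_Tri _ _ _) T.tri h)
        have h5 := (Aff.orient_right (τ k) m).nonneg_tri h hhy.le (by simp) (by simp)
        rcases H.eq_of_orient G.hp T.mem (H.mem' hx) T.nep.symm (le_antisymm h4 h5) with h | h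
        · rw [h] at h1; simp at h1
        · rw [h] at h2; simp at h2
    · rcases H.planar hx hE hz hz' with ⟨h, -⟩ | ⟨h, -⟩
      · rw [h] at h1; simp at h1
      · exact hmw h.symm

end Crossing

/-- The chain of a left chain extended by a right chain is covered, unless it could have been
preceded or followed by a shortcut. -/
theorem extended_covered (L : LeftChain o s V E τ k c) (R : RightChain o s V E τ b e)
    (hbc : b = c ∨ b = c + 1)
    (hr : b = c → orient (τ e) (τ (e - 1)) (τ (e + 1)) ≤ 0)
    (hL : b = c + 1 → ¬ Shortcut V E τ k (τ (c + 1)))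
    (hR : b = c + 1 → orient (τ e) (τ (e - 1)) (τ (e + 1)) ≤ 0 ∨
      0 < orient (τ (e + 1)) (τ e) (τ (e + 2))) : Covered V τ k e := by
  have l1 := L.lt; have l2 := R.lt
  by_cases hkb : k < b - 1
  · by_cases hce : c + 1 < e
    · obtain ⟨t, ρ, t', ρ', r, r', X, C⟩ := exists_crossing L R hbc hkb hce
      refine C.covered ?_
      rcases hbc with rfl | rfl
      · exact C.empty_of_eq (hr rfl)
      · intro v hv hvT
        by_contra hc
        push Not at hc
        rcases C.edge_of_succ ⟨v, hv, hvT, hc.1, hc.2⟩ with ⟨m, T, hE⟩ | ⟨m, T, hE⟩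
        · exact hL rfl (C.shortcut T hE)
        · rcases hR rfl with h | h
          · exact C.no_edge_right h T.tri hE
          · linarith [C.succ_of_edge T hE]
    -- the left chain is the whole chain
    · have : e = c + 1 := by omega
      rw [this]; exact L.covered
  -- the right chain is the whole chain
  · have : k = b - 1 := by omega
    rw [this]; exact R.covered

end

/-! ### Rotation angles and orientations -/

section

lemma turn_pos (u v w : ℂ) : 0 < turn u v w := by
  unfold turn
  split_ifs with h
  · exact h
  · linarith [Complex.neg_pi_lt_arg ((w - v) / (u - v)), Real.pi_pos]

lemma turn_le (u v w : ℂ) : turn u v w ≤ 2 * Real.pi := by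
  unfold turn
  split_ifs with h
  · linarith [Complex.arg_le_pi ((w - v) / (u - v)), Real.pi_pos]
  · linarith

lemma im_div_orient {u v : ℂ} (h : u ≠ v) (w : ℂ) :
    ((w - v) / (u - v)).im = orient v u w / Complex.normSq (u - v) := by
  have : Complex.normSq (u - v) ≠ 0 := by rwa [Ne, Complex.normSq_eq_zero, sub_eq_zero]
  rw [Complex.div_im, orient]
  simp only [Complex.sub_re, Complex.sub_im]
  field_simp

lemma turn_lt_pi {u v w : ℂ} (hu : u ≠ v) : turn u v w < Real.pi ↔ 0 < orient v u w := by
  have hn : 0 < Complex.normSq (u - v) := by rwa [Complex.normSq_pos, sub_ne_zero]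
  have h1 : 0 < orient v u w ↔ 0 < ((w - v) / (u - v)).im := by
    rw [im_div_orient hu, div_pos_iff_of_pos_right hn]
  rw [h1]
  unfold turn
  set z := (w - v) / (u - v)
  have hpi := Real.pi_pos
  constructor
  · intro h
    split_ifs at h with h0
    · by_contra hc
      push Not at hc
      rcases hc.lt_or_eq with hc | hc
      · linarith [Complex.arg_neg_iff.2 hc]
      · rcases le_or_gt 0 z.re with hr | hr
        · linarith [Complex.arg_eq_zero_iff.2 ⟨hr, hc⟩]
        · linarith [Complex.arg_eq_pi_iff.2 ⟨hr, hc⟩]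
    · linarith [Complex.neg_pi_lt_arg z]
  · intro h
    have h2 : 0 ≤ z.arg := Complex.arg_nonneg_iff.2 h.le
    have h3 : z.arg ≠ 0 := fun h3 => by
      have := (Complex.arg_eq_zero_iff.1 h3).2; linarith
    have h4 : z.arg ≠ Real.pi := fun h3 => by
      have := (Complex.arg_eq_pi_iff.1 h3).2; linarith
    have h5 : 0 < z.arg := lt_of_le_of_ne h2 h3.symm
    rw [if_pos h5]
    exact lt_of_le_of_ne (Complex.arg_le_pi z) h4

lemma turn_coe (u v w : ℂ) :
    (turn u v w : Real.Angle) = (Complex.arg ((w - v) / (u - v)) : Real.Angle) := by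
  unfold turn
  split_ifs with h
  · rfl
  · rw [Real.Angle.coe_add, Real.Angle.coe_two_pi, add_zero]

/-- Rotation angles about a point add up, possibly after discarding a full turn. -/
lemma turn_add {u v m x : ℂ} (hu : u ≠ v) (hm : m ≠ v) (hx : x ≠ v) :
    turn u v m + turn m v x = turn u v x ∨ turn u v m + turn m v x = turn u v x + 2 * Real.pi := by
  have hu' := sub_ne_zero.2 hu
  have hm' := sub_ne_zero.2 hm
  have hx' := sub_ne_zero.2 hx
  have h : ((turn u v m + turn m v x : ℝ) : Real.Angle) = (turn u v x : Real.Angle) := by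
    rw [Real.Angle.coe_add, turn_coe, turn_coe, turn_coe,
      ← Complex.arg_mul_coe_angle (div_ne_zero hm' hu') (div_ne_zero hx' hm')]
    congr 2
    field_simp
  obtain ⟨n, hn⟩ := Real.Angle.angle_eq_iff_two_pi_dvd_sub.1 h
  have hpi := Real.pi_pos
  have a1 := turn_pos u v m; have a2 := turn_pos m v x; have a3 := turn_pos u v x
  have b1 := turn_le u v m; have b2 := turn_le m v x; have b3 := turn_le u v x
  have n1 : -1 < n := by
    by_contra hc
    have : (n : ℝ) ≤ -1 := by exact_mod_cast not_lt.1 hc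
    nlinarith
  have n2 : n < 2 := by
    by_contra hc
    have : (2 : ℝ) ≤ n := by exact_mod_cast not_lt.1 hc
    nlinarith
  have : n = 0 ∨ n = 1 := by omega
  rcases this with rfl | rfl
  · left; push_cast at hn; linarith
  · right; push_cast at hn; linarith

lemma turn_self {u v : ℂ} (hu : u ≠ v) : turn u v u = 2 * Real.pi := by
  unfold turn
  rw [div_self (sub_ne_zero.2 hu), Complex.arg_one]
  simp

lemma orient_eq_zero_of_turn {u v w : ℂ} (hu : u ≠ v) (h : turn u v w = 2 * Real.pi) :
    orient v u w = 0 := by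
  have hn : 0 < Complex.normSq (u - v) := by rwa [Complex.normSq_pos, sub_ne_zero]
  have hpi := Real.pi_pos
  unfold turn at h
  have h0 : Complex.arg ((w - v) / (u - v)) = 0 := by
    split_ifs at h
    · linarith [Complex.arg_le_pi ((w - v) / (u - v))]
    · linarith
  have := (Complex.arg_eq_zero_iff.1 h0).2
  rw [im_div_orient hu, div_eq_zero_iff] at this
  exact this.resolve_right hn.ne'

variable {E : ℂ → ℂ → Prop} {u v w a : ℂ}

/-- If no edge at `v` is met before the direction of `w`, then the corner of `u`, `v`, `w` contains
no edges. -/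
lemma corner_of_turn (hu : u ≠ v) (hw : w ≠ v) (hne : ∀ x, E v x → x ≠ v)
    (h : ∀ x, E v x → turn u v w ≤ turn u v x) : Corner E u v w := by
  intro x hx
  have hxv := hne x hx
  have hle := h x hx
  have hpi := Real.pi_pos
  have p1 := turn_pos u v w; have p2 := turn_pos x v w; have p3 := turn_le u v x
  have hadd := turn_add hu hxv hw
  constructor
  · intro h1
    have t1 := (turn_lt_pi hu).2 h1
    refine ⟨(turn_lt_pi hu).1 (by linarith), ?_⟩
    by_contra hc
    have t2 := (turn_lt_pi hxv).2 (not_le.1 hc)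
    rcases hadd with h | h <;> linarith
  · intro h1
    have t1 := (turn_lt_pi hxv).2 h1
    rcases hadd with h | h
    · linarith
    · refine ⟨(turn_lt_pi hu).1 (by linarith), ?_⟩
      by_contra hc
      have t2 := (turn_lt_pi hu).2 (not_le.1 hc)
      linarith

/-- A segment that leaves `v` into the corner of `u`, `v`, `w` splits this corner. -/
lemma corner_of_between (hu : u ≠ v) (hw : w ≠ v) (ha : a ≠ v) (hne : ∀ x, E v x → x ≠ v)
    (huv : E v u) (h : ∀ x, E v x → turn u v w ≤ turn u v x)
    (h' : ∀ x, E v x → turn a v w ≤ turn a v x) (h0 : orient v u a ≠ 0) : Corner E u v a := by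
  refine corner_of_turn hu ha hne fun x hx => ?_
  have h1 := h x hx
  have h2 := h' u huv
  have hpi := Real.pi_pos
  have p1 := turn_pos u v w; have p2 := turn_pos a v w
  have q1 := turn_le u v a; have q2 := turn_le a v u
  have hself := turn_self hu
  have hlt : turn u v a ≠ 2 * Real.pi := fun h => h0 (orient_eq_zero_of_turn hu h)
  rcases turn_add hu ha hw with h3 | h3
  · linarith
  · exfalso
    rcases turn_add hu ha hu with h4 | h4
    · linarith
    · exact hlt (by linarith)

/-- If the corner of `u`, `v`, `w` is less than `π` and contains no edges, then `w` is the next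
neighbour of `v`. -/
lemma turn_le_of_wedge (hu : u ≠ v) (hw : w ≠ v) (hne : ∀ x, E v x → x ≠ v)
    (h0 : 0 < orient v u w) (h : ∀ x, E v x → 0 < orient v u x → ¬ 0 < orient v x w) :
    ∀ x, E v x → turn u v w ≤ turn u v x := by
  intro x hx
  by_contra hc
  push Not at hc
  have t0 := (turn_lt_pi hu).2 h0
  have p2 := turn_pos x v w
  have h1 := (turn_lt_pi (w := x) hu).1 (by linarith)
  have q := turn_le x v w
  have p := turn_pos u v x
  rcases turn_add hu (hne x hx) hw with h3 | h3
  · exact h x hx h1 ((turn_lt_pi (hne x hx)).1 (by linarith))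
  · linarith

/-- If `w` is the next neighbour of `v` after the direction of `u`, and the corner from `u` to `a`
contains no edges, then `w` is the next neighbour after the direction of `a`. -/
lemma turn_le_of_sub (hu : u ≠ v) (hw : E v w) (ha : a ≠ v) (hne : ∀ x, E v x → x ≠ v)
    (h : ∀ x, E v x → turn u v w ≤ turn u v x) (h0 : 0 < orient v u a)
    (h' : ∀ x, E v x → 0 < orient v u x → orient v x a < 0) :
    ∀ x, E v x → turn a v w ≤ turn a v x := by
  have t0 := (turn_lt_pi hu).2 h0
  have hpi := Real.pi_pos
  have key : ∀ x, E v x → turn u v a + turn a v x = turn u v x := by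
    intro x hx
    refine (turn_add hu ha (hne x hx)).resolve_right fun h1 => ?_
    have p1 := turn_pos u v x; have p2 := turn_pos x v a
    have q := turn_le a v x
    have h2 := (turn_lt_pi (w := x) hu).1 (by linarith)
    have h3 := h' x hx h2
    -- the directions of `u`, `x`, `a` are met in this order
    rcases turn_add hu (hne x hx) ha with h4 | h4
    · have := (turn_lt_pi (w := a) (hne x hx)).1 (by linarith)
      linarith
    · have h5 : turn x v a = 2 * Real.pi := le_antisymm (turn_le x v a) (by linarith)
      exact h3.ne (orient_eq_zero_of_turn (hne x hx) h5)
  intro x hx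
  linarith [key x hx, key w hw, h x hx]

end

/-! ### Free diagonals -/

section
variable {o : ℂ} {s : ℝ} {V : Finset ℂ} {E : ℂ → ℂ → Prop} {τ : ℤ → ℂ} {k c : ℤ} {t ρ : ℝ}

lemma exists_pt_of_orient {a b z : ℂ} (hab : a ≠ b) (h : orient a b z = 0) : ∃ t, z = pt a b t := by
  have hn : (b.re - a.re) ^ 2 + (b.im - a.im) ^ 2 ≠ 0 := by
    intro h0
    apply hab
    apply Complex.ext <;> nlinarith [sq_nonneg (b.re - a.re), sq_nonneg (b.im - a.im)]
  unfold orient at h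
  refine ⟨((b.re - a.re) * (z.re - a.re) + (b.im - a.im) * (z.im - a.im)) /
    ((b.re - a.re) ^ 2 + (b.im - a.im) ^ 2), ?_⟩
  apply Complex.ext
  · rw [pt_re]; field_simp; linear_combination -(b.im - a.im) * h
  · rw [pt_im]; field_simp; linear_combination (b.re - a.re) * h

/-- A clear segment without vertices is free if no edge contains one of its endpoints: an edge
meeting it would lie on its line. -/
lemma free_of_clear (H : Cfg o s V E) {x y : ℂ} (hxy : x ≠ y) (hc : Clear E x y)
    (hV : ∀ v ∈ V, v ∉ openSegment ℝ x y) (hx : ∀ g h, E g h → x ∉ segment ℝ g h)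
    (hy : ∀ g h, E g h → y ∉ segment ℝ g h) : Free V E x y := by
  refine ⟨hV, fun g h hgh z hz hzs => ?_⟩
  have hzo : z ∈ openSegment ℝ g h := open_of_seg hzs
    (fun e => hV g (H.mem hgh) (e ▸ hz)) (fun e => hV h (H.mem' hgh) (e ▸ hz))
  obtain ⟨a, ha⟩ := exists_pt_of_orient hxy (hc g h hgh z hz hzo)
  have hsub : segment ℝ z g ⊆ segment ℝ g h :=
    (convex_segment g h).segment_subset hzs (left_mem_segment _ _ _)
  obtain ⟨d, d0, d1, rfl⟩ := mem_open.1 hz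
  rcases le_or_gt a 0 with h0 | h0
  · refine hx g h hgh (hsub (mem_seg.2 ⟨d / (d - a), div_nonneg d0.le (by linarith),
      by rw [div_le_one] <;> linarith, ?_⟩))
    have : d - a ≠ 0 := by linarith
    rw [ha]; apply Complex.ext <;> simp only [pt_re, pt_im] <;> field_simp <;> ring
  rcases le_or_gt 1 a with h1 | h1
  · refine hy g h hgh (hsub (mem_seg.2 ⟨(1 - d) / (a - d), div_nonneg (by linarith) (by linarith),
      by rw [div_le_one] <;> linarith, ?_⟩))
    have : a - d ≠ 0 := by linarith
    rw [ha]; apply Complex.ext <;> simp only [pt_re, pt_im] <;> field_simp <;> ring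
  · exact hV g (H.mem hgh) (ha ▸ pt_mem_open h0 h1)

/-- In general position the only edge on the line of `x` and `y` is the one between them. -/
lemma free_of_clear_of_not_edge (H : Cfg o s V E) {x y : ℂ} (hx : x ∈ V) (hy : y ∈ V) (hxy : x ≠ y)
    (hc : Clear E x y) (hE : ¬ E x y) : Free V E x y := by
  have hV : ∀ v ∈ V, v ∉ openSegment ℝ x y := fun v hv hz => by
    have := ne_of_open hz hxy
    rcases H.eq_of_orient hx hy hv hxy (orient_open (open_sub_seg hz)) with h | h
    · exact this.1 h
    · exact this.2 h
  refine ⟨hV, fun g h hgh z hz hzs => ?_⟩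
  have hzo : z ∈ openSegment ℝ g h := open_of_seg hzs
    (fun e => hV g (H.mem hgh) (e ▸ hz)) (fun e => hV h (H.mem' hgh) (e ▸ hz))
  have hne := H.ne hgh
  rcases H.eq_of_orient hx hy (H.mem hgh) hxy (hc g h hgh z hz hzo) with rfl | rfl <;>
    rcases H.eq_of_orient hx hy (H.mem' hgh) hxy (hc h g (H.symm hgh) z hz (open_comm hzo)) with
      rfl | rfl
  · exact hne rfl
  · exact hE hgh
  · exact hE (H.symm hgh)
  · exact hne rfl

/-- The convex vertex `τ j` can be cut off by a free segment, which contains the point `y` or is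
joined to it by another free segment; `fst` and `snd` say that this segment leaves both neighbours
of `τ j` inside the corners of the walk. -/
structure Cut (V : Finset ℂ) (E : ℂ → ℂ → Prop) (τ : ℤ → ℂ) (j : ℤ) (y : ℂ) : Prop where
  conv : 0 < orient (τ j) (τ (j - 1)) (τ (j + 1))
  free : Free V E (τ (j - 1)) (τ (j + 1))
  link : ∃ z ∈ openSegment ℝ (τ (j - 1)) (τ (j + 1)), z = y ∨ Free V E y z
  fst : ∀ x, E (τ (j - 1)) x → 0 < orient (τ (j - 1)) (τ (j + 1)) x →
    ¬ 0 < orient (τ (j - 1)) x (τ j)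
  snd : ∀ x, E (τ (j + 1)) x → 0 < orient (τ (j + 1)) (τ j) x →
    orient (τ (j + 1)) x (τ (j - 1)) < 0

lemma Shortcut.cut {q : ℂ} (S : Shortcut V E τ k q) :
    ∃ y ∈ openSegment ℝ (τ k) q, Cut V E τ k y := by
  obtain ⟨y, hy, hyq⟩ := S.cross
  refine ⟨y, hyq, S.conv, S.free, ⟨y, hy, .inl rfl⟩, fun x hx _ h => ?_, S.wedge⟩
  have := S.below x hx
  rw [orient_rot] at h
  linarith

/-- The apex of a chain that does not start next to it can be cut off by the diagonal between its
two neighbours. -/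
lemma Frame.cut (F : Frame o s V E τ k c t ρ) (hk : k < c - 1) :
    ∃ y ∈ openSegment ℝ (τ k) (τ (c + 1)), Cut V E τ c y := by
  have H := F.cfg; have W := F.walk
  have hne := F.pred_ne hk
  have t0 := F.t_pos hne
  have t1 := F.t1
  have hrq := F.pred_ne_right
  have hnE := F.pred_not_edge hne
  have hrV := W.mem H (c - 1)
  have hqV := W.mem H (c + 1)
  have hrT := F.pred_mem
  have hop := F.orient_pred
  have hconv := F.conv
  have hfree : Free V E (τ (c - 1)) (τ (c + 1)) := free_of_clear_of_not_edge H hrV hqV hrq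
    F.clear_right.symm (fun h => hnE (H.symm h))
  set w := pt (τ k) (τ (c + 1)) t with hw
  have hwo : w ∈ openSegment ℝ (τ k) (τ (c + 1)) := pt_mem_open t0 t1
  have hpos := F.pos
  -- no edge enters the triangle of the apex and its neighbours
  have hwedge : ∀ v v', (v = τ (c - 1) ∧ v' = τ (c + 1) ∨ v = τ (c + 1) ∧ v' = τ (c - 1)) →
      ∀ x, E v x → x ≠ v' → x ≠ τ c → ¬ x ∈ Tri v v' (τ c) ∧
        ∀ z ∈ openSegment ℝ v x, z ∉ openSegment ℝ v' (τ c) := by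
    intro v v' hv x hx hxv' hxc
    have hvx := H.ne hx
    refine ⟨fun hT => ?_, fun z hz hz' => ?_⟩
    · have hT' : x ∈ Tri (τ (c + 1)) w (τ c) := by
        rcases hv with ⟨rfl, rfl⟩ | ⟨rfl, rfl⟩
        · exact Tri_subset hrT (left_mem_Tri _ _ _) (right_mem_Tri _ _ _) hT
        · exact Tri_subset (left_mem_Tri _ _ _) hrT (right_mem_Tri _ _ _) hT
      rcases F.empty x (H.mem' hx) hT' with h | h | h <;> rcases hv with ⟨h1, h2⟩ | ⟨h1, h2⟩
      · exact hxv' (h.trans h2.symm)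
      · exact hvx (h1.trans h.symm)
      · exact hxc h
      · exact hxc h
      · exact hvx (h1.trans h.symm)
      · exact hxv' (h.trans h2.symm)
    · have hE' : E v' (τ c) := by
        rcases hv with ⟨-, rfl⟩ | ⟨-, rfl⟩
        · exact H.symm (W.adj c)
        · exact W.adj' c
      rcases H.planar hx hE' hz hz' with ⟨h, -⟩ | ⟨-, h⟩
      · rcases hv with ⟨h1, h2⟩ | ⟨h1, h2⟩
        · exact hrq (h1.symm.trans (h.trans h2))
        · exact hrq (h2.symm.trans (h.symm.trans h1))
      · exact hxv' h
  -- the midpoint `Y` of the shortcut sees the point `w` of the base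
  set Y := pt (τ (c - 1)) (τ (c + 1)) (1 / 2) with hY
  have hYo : Y ∈ openSegment ℝ (τ (c - 1)) (τ (c + 1)) := pt_mem_open (by norm_num) (by norm_num)
  have hYT : Y ∈ Tri (τ (c + 1)) w (τ c) := seg_sub_Tri hrT (left_mem_Tri _ _ _) (open_sub_seg hYo)
  have hρ := F.ρ_pos hne
  have eY : orient w Y (τ (c + 1)) = -(1 / 2 * ρ * (1 - t) * orient (τ k) (τ (c + 1)) (τ c)) := by
    rw [hY, F.pred, hw]; unfold orient; simp only [pt_re, pt_im]; ring
  have pY : 0 < 1 / 2 * ρ * (1 - t) * orient (τ k) (τ (c + 1)) (τ c) := by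
    have := sub_pos.2 t1; positivity
  have hwY : w ≠ Y := by
    intro h; rw [h] at eY; simp only [orient_self_left] at eY; linarith
  have hqc : 0 < orient (τ (c + 1)) (τ c) (τ k) := by rw [orient_rot]; exact hpos
  have q1w : 0 < orient (τ (c + 1)) (τ c) w := by
    rw [hw, (Aff.orient_right _ _).pt]; simp only [orient_self_out]; nlinarith
  have q2w : orient (τ (c + 1)) w (τ k) = 0 := by
    rw [hw]; unfold orient; simp only [pt_re, pt_im]; ring
  have q1Y : 0 < orient (τ (c + 1)) (τ c) Y :=
    (Aff.orient_right _ _).pos_open hYo hop.le (by simp) (.inl hop.ne')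
  have q2r : 0 < orient (τ (c + 1)) (τ (c - 1)) (τ k) := by
    have : orient (τ (c + 1)) (τ (c - 1)) (τ k) = ρ * orient (τ k) (τ (c + 1)) (τ c) := by
      rw [F.pred]; unfold orient; simp only [pt_re, pt_im]; ring
    rw [this]; positivity
  have q2Y : 0 < orient (τ (c + 1)) Y (τ k) :=
    (Aff.orient_mid (τ (c + 1)) (τ k)).pos_open hYo q2r.le (by simp) (.inl q2r.ne')
  have hempty : ∀ v ∈ V, v ∈ Tri w Y (τ (c + 1)) → v = τ (c + 1) := by
    intro v hv hvT
    rcases F.empty v hv (Tri_subset (mid_mem_Tri _ _ _) hYT (left_mem_Tri _ _ _) hvT) with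
      h | h | h
    · exact h
    · exfalso
      have h1 := (Aff.orient_right (τ (c - 1)) (τ (c + 1))).neg.nonneg_tri hvT
        (by
          have : orient (τ (c - 1)) (τ (c + 1)) w =
              -(ρ * (1 - t) * orient (τ k) (τ (c + 1)) (τ c)) := by
            rw [F.pred, hw]; unfold orient; simp only [pt_re, pt_im]; ring
          rw [this]
          have : 0 < ρ * (1 - t) * orient (τ k) (τ (c + 1)) (τ c) := by linarith
          linarith)
        (by rw [orient_open (open_sub_seg hYo)]; simp) (by simp)
      rw [h, orient_rot'] at h1
      linarith
    · exfalso
      have h1 := (Aff.orient_right w Y).neg.nonneg_tri hvT (by simp) (by simp) (by linarith)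
      have h2 : orient w Y (τ (c + 1)) + orient w Y (τ (c - 1)) = 0 := by
        rw [hY]; unfold orient; simp only [pt_re, pt_im]; ring
      rw [h] at h1
      linarith
  have hcl : Clear E w Y := by
    refine clear_of_empty H (c := τ (c + 1)) (by rw [eY]; linarith)
      (F.free.clear.sub (open_sub_seg hwo) (right_mem_segment _ _ _))
      (F.clear_right.sub (left_mem_segment _ _ _) (seg_comm (open_sub_seg hYo)))
      (fun v hv hvT => .inl (hempty v hv hvT)) ?_
    intro g h hgh hq z hz hz'
    refine F.center_edge t1 le_rfl hgh (by rwa [pt_one]) hz' ?_ ?_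
    · exact (Aff.orient_right _ _).pos_open hz q1w.le q1Y.le (.inl q1w.ne')
    · exact (Aff.orient_mid (τ (c + 1)) (τ k)).pos_open hz q2w.ge q2Y.le (.inr q2Y.ne')
  have hwYf : Free V E w Y := by
    refine free_of_clear H hwY hcl (fun v hv hz => ?_)
      (fun g h hgh => F.free.2 g h hgh w hwo) (fun g h hgh => hfree.2 g h hgh Y hYo)
    have hz' := hempty v hv (seg_sub_Tri (left_mem_Tri _ _ _) (mid_mem_Tri _ _ _) (open_sub_seg hz))
    have := orient_open (open_sub_seg hz)
    rw [hz'] at this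
    linarith
  refine ⟨w, hwo, hconv, hfree, ⟨Y, hYo, .inr hwYf⟩, ?_, ?_⟩
  · intro x hx h1 h2
    have hxq : x ≠ τ (c + 1) := by rintro rfl; simp at h1
    have hxc : x ≠ τ c := by rintro rfl; simp at h2
    have := hwedge _ _ (.inl ⟨rfl, rfl⟩) x hx hxq hxc
    rcases wedge_exit (a := τ (c + 1)) (b := τ c) (by rw [orient_rot]; exact hconv) h1 h2 with
      h | ⟨z, hz, hz'⟩
    · exact this.1 h
    · exact this.2 z hz hz'
  · intro x hx h1
    by_contra hc
    push Not at hc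
    have hxr : x ≠ τ (c - 1) := by rintro rfl; exact hnE hx
    have hxc : x ≠ τ c := by rintro rfl; simp at h1
    have h2 : 0 < orient (τ (c + 1)) x (τ (c - 1)) := by
      refine lt_of_le_of_ne hc fun h0 => ?_
      rcases H.eq_of_orient hqV hrV (H.mem' hx) hrq.symm (c := x)
        (by rw [orient_swap']; linarith) with h | h
      · exact H.ne hx h.symm
      · exact hxr h
    have := hwedge _ _ (.inr ⟨rfl, rfl⟩) x hx hxr hxc
    rcases wedge_exit (a := τ c) (b := τ (c - 1)) hop h1 h2 with h | ⟨z, hz, hz'⟩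
    · exact this.1 (Tri_swap' h)
    · exact this.2 z hz (open_comm hz')

end

/-! ### Faces, walks and chains of a maximal graph -/

section
variable {P : Finset ℂ} {o : ℂ} {s : ℝ} {A : SimpleGraph P} {f : Set ℂ} {σ : ℤ → P}

/-- Adjacency in `A` as a relation between points of the plane. -/
def gE (A : SimpleGraph P) (a b : ℂ) : Prop := ∃ (ha : a ∈ P) (hb : b ∈ P), A.Adj ⟨a, ha⟩ ⟨b, hb⟩

lemma gE_coe {u v : P} : gE A u v ↔ A.Adj u v := ⟨fun ⟨_, _, h⟩ => h, fun h => ⟨u.2, v.2, h⟩⟩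

lemma collinear_of_orient {a b c : ℂ} (hab : a ≠ b) (h : orient a b c = 0) :
    Collinear ℝ ({a, b, c} : Set ℂ) := by
  obtain ⟨t, rfl⟩ := exists_pt_of_orient hab h
  rw [collinear_iff_of_mem (p₀ := a) (by simp)]
  refine ⟨b - a, ?_⟩
  intro p hp
  rcases hp with rfl | rfl | rfl
  · exact ⟨0, by simp⟩
  · exact ⟨1, by simp⟩
  · exact ⟨t, by rw [GridMWT.pt, vadd_eq_add, add_comm]⟩

/-- A maximal plane graph in the graph of pairs from adjacent cells is a configuration; maximality
becomes the rule that two vertices in adjacent cells whose open segment meets no open edge are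
joined by an edge. -/
lemma cfg_of_maximal (hP : GeneralPosition P) (hs : 0 < s)
    (hA : IsMaximalPSLG (adjGraph P o s) A) : Cfg o s P (gE A) where
  hs := hs
  gp a ha b hb c hc hab hac hbc h := hP a ha b hb c hc hab hac hbc (collinear_of_orient hab h)
  symm := fun ⟨ha, hb, h⟩ => ⟨hb, ha, h.symm⟩
  mem := fun ⟨ha, _, _⟩ => ha
  ne := fun ⟨_, _, h⟩ e => h.ne (Subtype.ext e)
  near := fun ⟨_, _, h⟩ => (hA.prop.2 h).2
  planar := by
    rintro a b c d z ⟨ha, hb, h⟩ ⟨hc, hd, h'⟩ hz hz'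
    by_contra hne
    refine Set.disjoint_left.1 (hA.prop.1.1 s(⟨a, ha⟩, ⟨b, hb⟩) h s(⟨c, hc⟩, ⟨d, hd⟩) h' ?_) hz hz'
    simpa [Sym2.eq_iff, Subtype.ext_iff] using hne
  maxl := by
    intro a b ha hb hab hn hfree
    have hab' : (⟨a, ha⟩ : P) ≠ ⟨b, hb⟩ := fun e => hab (congrArg Subtype.val e)
    have hE : ∀ e ∈ (A ⊔ SimpleGraph.edge (⟨a, ha⟩ : P) ⟨b, hb⟩).edgeSet,
        e ∈ A.edgeSet ∨ e = s(⟨a, ha⟩, ⟨b, hb⟩) := by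
      intro e he
      rw [SimpleGraph.edgeSet_sup, SimpleGraph.edgeSet_edge_of_ne hab'] at he
      exact he
    have hdis : ∀ e ∈ A.edgeSet, Disjoint (openSeg (s(⟨a, ha⟩, ⟨b, hb⟩) : Sym2 P)) (openSeg e) := by
      intro e
      induction e with
      | _ c d =>
        intro he
        exact Set.disjoint_left.2 fun z hz hz' => hfree c d (gE_coe.2 he) z hz hz'
    have hle : A ⊔ SimpleGraph.edge (⟨a, ha⟩ : P) ⟨b, hb⟩ ≤ A := by
      refine hA.le_of_ge ⟨⟨?_, ?_⟩, ?_⟩ le_sup_left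
      · intro e he e' he' hne
        rcases hE e he with h | rfl <;> rcases hE e' he' with h' | rfl
        · exact hA.prop.1.1 e h e' h' hne
        · exact (hdis e h).symm
        · exact hdis e' h'
        · exact absurd rfl hne
      · intro e he p
        rcases hE e he with h | rfl
        · exact hA.prop.1.2 e h p
        · intro hp
          have hp' : (p : ℂ) ∈ openSegment ℝ a b := hp
          have := ne_of_open hp' hab
          exact hP a ha b hb p p.2 hab this.1.symm this.2.symm
            (collinear_of_orient hab (orient_open (open_sub_seg hp')))
      · refine sup_le hA.prop.2 ?_
        rw [SimpleGraph.edge_le_iff]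
        exact .inr ⟨hab', hn⟩
    refine ⟨ha, hb, hle ?_⟩
    rw [SimpleGraph.sup_adj]
    exact .inr (by rw [SimpleGraph.edge_adj]; exact ⟨.inl ⟨rfl, rfl⟩, hab'⟩)

lemma mem_drawing {z : ℂ} : z ∈ drawing A ↔ z ∈ P ∨ ∃ a b, gE A a b ∧ z ∈ segment ℝ a b := by
  unfold drawing
  simp only [Set.mem_union, Finset.mem_coe, Set.mem_iUnion, exists_prop]
  constructor
  · rintro (h | ⟨e, he, hz⟩)
    · exact .inl h
    · right
      induction e with
      | _ c d => exact ⟨c, d, gE_coe.2 he, hz⟩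
  · rintro (h | ⟨a, b, ⟨ha, hb, h⟩, hz⟩)
    · exact .inl h
    · exact .inr ⟨s(⟨a, ha⟩, ⟨b, hb⟩), h, hz⟩

lemma IsFace.subset (hf : IsFace A f) : f ⊆ (drawing A)ᶜ := by
  obtain ⟨z, -, rfl⟩ := hf
  exact connectedComponentIn_subset _ _

lemma IsFace.free (hf : IsFace A f) {a b : ℂ} (h : openSegment ℝ a b ⊆ f) : Free P (gE A) a b :=
  ⟨fun _ hv hz => hf.subset (h hz) (mem_drawing.2 (.inl hv)),
    fun a b hab _ hz hz' => hf.subset (h hz) (mem_drawing.2 (.inr ⟨a, b, hab, hz'⟩))⟩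

lemma IsFace.subset_of_connected (hf : IsFace A f) {S : Set ℂ} (hS : IsPreconnected S)
    (hd : S ⊆ (drawing A)ᶜ) {z : ℂ} (hz : z ∈ S) (hzf : z ∈ f) : S ⊆ f := by
  obtain ⟨w, hw, rfl⟩ := hf
  rw [connectedComponentIn_eq hzf]
  exact hS.subset_connectedComponentIn hz hd

lemma Free.subset_compl {a b : ℂ} (h : Free P (gE A) a b) :
    openSegment ℝ a b ⊆ (drawing A)ᶜ := fun z hz hd => by
  rcases mem_drawing.1 hd with hd | ⟨c, d, hcd, hzs⟩
  · exact h.1 z hd hz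
  · exact h.2 c d hcd z hz hzs

lemma walk_ne (H : Cfg o s P (gE A)) (hσ : IsBoundaryWalk A f σ) (k : ℤ) :
    (σ k : ℂ) ≠ σ (k + 1) :=
  H.ne (gE_coe.2 (hσ k).1)

lemma walk_next (hσ : IsBoundaryWalk A f σ) (k : ℤ) : IsNext A (σ (k - 1)) (σ k) (σ (k + 1)) := by
  have := (hσ (k - 1)).2.2
  rwa [sub_add_cancel, show k - 1 + 2 = k + 1 by ring] at this

lemma walk_adj' (hσ : IsBoundaryWalk A f σ) (k : ℤ) : gE A (σ k) (σ (k - 1)) := by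
  have := (hσ (k - 1)).1
  rw [sub_add_cancel] at this
  exact gE_coe.2 this.symm

/-- Consecutive edges of a boundary walk bound an empty corner, expressed by orientations instead
of angles. -/
lemma IsNext.corner (H : Cfg o s P (gE A)) {u v w : P} (h : IsNext A u v w) (hu : (u : ℂ) ≠ v) :
    Corner (gE A) (u : ℂ) v w :=
  corner_of_turn hu (fun e => h.1.ne (Subtype.ext e.symm)) (fun _ hx => (H.ne hx).symm)
    fun x hx => h.2 ⟨x, H.mem' hx⟩ (gE_coe.1 (by exact hx))

lemma isWalk (H : Cfg o s P (gE A)) (hσ : IsBoundaryWalk A f σ) :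
    IsWalk (gE A) (fun i => (σ i : ℂ)) where
  adj i := gE_coe.2 (hσ i).1
  corner i := (hσ i).2.2.corner H (walk_ne H hσ i)

lemma convexAt_iff (H : Cfg o s P (gE A)) (hσ : IsBoundaryWalk A f σ) (k : ℤ) :
    ConvexAt σ k ↔ 0 < orient (σ k : ℂ) (σ (k - 1)) (σ (k + 1)) :=
  turn_lt_pi (H.ne (walk_adj' hσ k)).symm

lemma not_convexAt_iff (H : Cfg o s P (gE A)) (hσ : IsBoundaryWalk A f σ) (k : ℤ) :
    ¬ ConvexAt σ k ↔ orient (σ k : ℂ) (σ (k - 1)) (σ (k + 1)) ≤ 0 := by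
  rw [convexAt_iff H hσ, not_lt]

lemma Visible.ne (hf : IsFace A f) {k l : ℤ} (h : Visible A f σ k l) :
    (σ k : ℂ) ≠ σ l := fun e => by
  have h1 : (σ l : ℂ) ∈ f := h.1 (by rw [e, openSegment_same]; rfl)
  exact hf.subset h1 (mem_drawing.2 (.inl (σ l).2))

lemma Visible.not_adj (hf : IsFace A f) {k l : ℤ} (h : Visible A f σ k l) :
    ¬ gE A (σ k) (σ l) := fun hE =>
  (hf.free h.1).2 _ _ hE _ (pt_mem_open (t := 1 / 2) (by norm_num) (by norm_num))
    (pt_mem_seg (by norm_num) (by norm_num))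

/-- A visible vertex splits the corners at both ends of the line of sight. -/
lemma Visible.corners (H : Cfg o s P (gE A)) (hf : IsFace A f) (hσ : IsBoundaryWalk A f σ)
    {k l : ℤ} (h : Visible A f σ k l) :
    Corner (gE A) (σ (k - 1) : ℂ) (σ k) (σ l) ∧ Corner (gE A) (σ (l - 1) : ℂ) (σ l) (σ k) := by
  have hne := h.ne hf
  have hnE := h.not_adj hf
  have W := isWalk H hσ
  have key : ∀ i (a : P), (a : ℂ) ≠ σ i → ¬ gE A (σ i) a → IsNext A a (σ i) (σ (i + 1)) →
      Corner (gE A) (σ (i - 1) : ℂ) (σ i) a := by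
    intro i a ha hE hn
    have hu := walk_adj' hσ i
    refine corner_of_between (H.ne hu).symm (walk_ne H hσ i).symm ha
      (fun _ hx => (H.ne hx).symm) hu
      (fun x hx => (walk_next hσ i).2 ⟨x, H.mem' hx⟩ (gE_coe.1 (by exact hx)))
      (fun x hx => hn.2 ⟨x, H.mem' hx⟩ (gE_coe.1 (by exact hx))) fun h0 => ?_
    rcases H.eq_of_orient (σ i).2 (σ (i - 1)).2 a.2 (H.ne hu) h0 with h1 | h1
    · exact ha h1
    · rw [h1] at hE; exact hE hu
  exact ⟨key k (σ l) hne.symm hnE h.2.1, key l (σ k) hne (fun h => hnE (H.symm h)) h.2.2⟩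

/-- The conditions of step 1 provide a left chain from the processed vertex to its forward support
vertex. -/
lemma StepOne.leftChain (H : Cfg o s P (gE A)) (hf : IsFace A f) (hσ : IsBoundaryWalk A f σ)
    {k c : ℤ} (h : StepOne (Near o s) A f σ k c) :
    LeftChain o s P (gE A) (fun i => (σ i : ℂ)) k c where
  cfg := H
  walk := isWalk H hσ
  lt := h.1.1
  conv := (convexAt_iff H hσ c).1 h.1.2.1
  refl i h1 h2 := (not_convexAt_iff H hσ i).1 (h.1.2.2 i h1 h2)
  pos := by
    have := (turn_lt_pi (walk_ne H hσ c)).1 h.2.2.2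
    rwa [orient_rot] at this
  near := h.2.1
  free := hf.free h.2.2.1.1
  left := h.2.2.1.2.1.corner H (h.2.2.1.ne hf).symm
  right := by
    have := h.2.2.1.2.2.corner H (h.2.2.1.ne hf)
    rwa [add_assoc] at this

/-- The conditions for extending the chain provide a right chain from the backward support vertex
to the last vertex of the chain. -/
lemma rightChain_of (H : Cfg o s P (gE A)) (hf : IsFace A f) (hσ : IsBoundaryWalk A f σ)
    {b e : ℤ} (hbe : b < e) (hb : ConvexAt σ b)
    (hr : ∀ i, b < i → i < e → ¬ ConvexAt σ i) (hn : Near o s (σ e : ℂ) (σ b))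
    (hv : Visible A f σ (b - 1) e)
    (ht : turn (σ e : ℂ) (σ (b - 1) : ℂ) (σ b : ℂ) < Real.pi) :
    RightChain o s P (gE A) (fun i => (σ i : ℂ)) b e where
  cfg := H
  walk := isWalk H hσ
  lt := hbe
  conv := (convexAt_iff H hσ b).1 hb
  refl i h1 h2 := (not_convexAt_iff H hσ i).1 (hr i h1 h2)
  pos := (turn_lt_pi (hv.ne hf).symm).1 ht
  near := hn.symm
  free := hf.free hv.1
  right := (hv.corners H hf hσ).2
  left := by
    have := (hv.corners H hf hσ).1
    rwa [sub_sub] at this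

/-- A convex vertex that can be cut off inside the face leads to an execution of step 1. -/
lemma Cut.stepOne (H : Cfg o s P (gE A)) (hf : IsFace A f) (hσ : IsBoundaryWalk A f σ)
    {j : ℤ} {y : ℂ} (C : Cut P (gE A) (fun i => (σ i : ℂ)) j y) (hy : y ∈ f) :
    StepOne (Near o s) A f σ (j - 1) j := by
  have hne : (σ (j - 1) : ℂ) ≠ σ (j + 1) := by
    intro h; have := C.conv; simp [h] at this
  have hj1 : gE A (σ (j - 1)) (σ j) := H.symm (walk_adj' hσ j)
  have hj2 : gE A (σ j) (σ (j + 1)) := gE_coe.2 (hσ j).1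
  have hd := C.free.subset_compl
  -- the face is connected, and the segment can be reached from `y` without meeting the graph
  have hsub : openSegment ℝ (σ (j - 1) : ℂ) (σ (j + 1)) ⊆ f := by
    obtain ⟨z, hz, hzy⟩ := C.link
    refine hf.subset_of_connected (convex_openSegment _ _).isPreconnected hd hz ?_
    rcases hzy with rfl | hfree
    · exact hy
    · have hs : segment ℝ y z ⊆ (drawing A)ᶜ := by
        intro x hx
        by_cases h1 : x = y
        · rw [h1]; exact hf.subset hy
        by_cases h2 : x = z
        · rw [h2]; exact hd hz
        exact hfree.subset_compl (open_of_seg hx h1 h2)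
      exact hf.subset_of_connected (convex_segment _ _).isPreconnected hs
        (left_mem_segment _ _ _) hy (right_mem_segment _ _ _)
  refine ⟨⟨by omega, (convexAt_iff H hσ j).2 C.conv, fun x h1 h2 => by omega⟩, ?_,
    ⟨hsub, ⟨?_, ?_⟩, ?_, ?_⟩, ?_⟩
  · exact H.near (H.symm hj1)
  · rw [sub_add_cancel]; exact gE_coe.1 hj1
  · rw [sub_add_cancel]
    intro x hx
    refine turn_le_of_wedge hne.symm (H.ne hj1).symm (fun _ h => (H.ne h).symm) ?_ C.fst x
      (gE_coe.2 hx)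
    rw [orient_rot]; exact C.conv
  · exact (hσ (j + 1)).1
  · intro x hx
    refine turn_le_of_sub (H.ne hj2) (gE_coe.2 (hσ (j + 1)).1) hne (fun _ h => (H.ne h).symm)
      (fun x hx => ?_) ?_ C.snd x (gE_coe.2 hx)
    · have := (hσ j).2.2.2 ⟨x, H.mem' hx⟩ (gE_coe.1 (by exact hx))
      rwa [show j + 2 = j + 1 + 1 by ring] at this
    · rw [orient_rot']; exact C.conv
  · rw [turn_lt_pi (H.ne hj2), orient_rot']; exact C.conv

end

/-! ### The chains of Phase 1 are covered -/

section
variable {P : Finset ℂ} {o : ℂ} {s : ℝ} {A : SimpleGraph P} {f : Set ℂ} {σ : ℤ → P}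
  {near : ℂ → ℂ → Prop} {k l c b e m j p : ℤ}

lemma ConvexAt.shift (hp : Function.Periodic σ p) (h : ConvexAt σ k) : ConvexAt σ (k + p) := by
  unfold ConvexAt at h ⊢
  rwa [show k + p - 1 = k - 1 + p by ring, show k + p + 1 = k + 1 + p by ring, hp, hp, hp]

lemma convexAt_shift (hp : Function.Periodic σ p) : ConvexAt σ (k + p) ↔ ConvexAt σ k :=
  ⟨fun h => by simpa using h.shift hp.neg, fun h => h.shift hp⟩

lemma Visible.shift (hp : Function.Periodic σ p) (h : Visible A f σ k l) :
    Visible A f σ (k + p) (l + p) := by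
  unfold Visible at h ⊢
  rwa [show k + p + 1 = k + 1 + p by ring, show l + p + 1 = l + 1 + p by ring, hp, hp, hp, hp]

lemma reflex_shift (hp : Function.Periodic σ p) {x : ℤ} (h : ¬ ConvexAt σ (x - p)) :
    ¬ ConvexAt σ x := by
  rwa [← convexAt_shift hp, sub_add_cancel] at h

lemma BackwardConvex.shift (hp : Function.Periodic σ p) (h : BackwardConvex σ k b) :
    BackwardConvex σ (k + p) (b + p) :=
  ⟨(convexAt_shift hp).not.2 h.1, by linarith [h.2.1], h.2.2.1.shift hp,
    fun x h1 h2 => reflex_shift hp (h.2.2.2 _ (by linarith) (by linarith))⟩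

lemma StepOne.shift (hp : Function.Periodic σ p) (h : StepOne near A f σ k c) :
    StepOne near A f σ (k + p) (c + p) := by
  obtain ⟨⟨h1, h2, h3⟩, h4, h5, h6⟩ := h
  have h5' := h5.shift hp
  have e : c + 1 + p = c + p + 1 := by ring
  refine ⟨⟨by linarith, h2.shift hp,
    fun x hx hx' => reflex_shift hp (h3 _ (by linarith) (by linarith))⟩, ?_, e ▸ h5', ?_⟩
  · rwa [hp, hp]
  · rwa [← e, hp, hp, hp]

lemma Extends.shift (hp : Function.Periodic σ p) (h : Extends near A f σ l b e) :
    Extends near A f σ (l + p) (b + p) (e + p) := by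
  obtain ⟨h1, h2, h3, h4, h5⟩ := h
  have h4' := h4.shift hp
  have e : b - 1 + p = b + p - 1 := by ring
  refine ⟨by linarith, fun x hx hx' => reflex_shift hp (h2 _ (by linarith) (by linarith)), ?_,
    e ▸ h4', ?_⟩
  · rwa [hp, hp]
  · rwa [← e, hp, hp, hp]

lemma ForwardConvex.unique (h : ForwardConvex σ k c) (h' : ForwardConvex σ k l) : c = l := by
  rcases lt_trichotomy c l with h1 | h1 | h1
  · exact absurd h.2.1 (h'.2.2 _ h.1 h1)
  · exact h1
  · exact absurd h'.2.1 (h.2.2 _ h'.1 h1)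

lemma ForwardConvex.le (h : ForwardConvex σ k c) (hl : k < l) (hc : ConvexAt σ l) : c ≤ l := by
  by_contra h1
  exact h.2.2 l hl (by omega) hc

lemma BackwardConvex.le (h : BackwardConvex σ k b) (hl : l < k) (hc : ConvexAt σ l) : l ≤ b := by
  by_contra h1
  exact h.2.2.2 l (by omega) hl hc

/-- The backward convex vertex of `v_{c+2}` is `v_c` or `v_{c+1}`. -/
lemma CanExtend.cases (h : CanExtend near A f σ (c + 1) b) (hc : ConvexAt σ c) :
    b = c ∨ b = c + 1 := by
  have h1 := h.1.le (by omega) hc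
  have h2 := h.1.2.1
  omega

lemma Extends.not_convexAt (h : Extends near A f σ l b e) : ¬ ConvexAt σ e := h.2.1 e h.1 le_rfl

lemma Extends.rightChain (H : Cfg o s P (gE A)) (hf : IsFace A f) (hσ : IsBoundaryWalk A f σ)
    (h : Extends (Near o s) A f σ l b e) (hb : BackwardConvex σ (l + 1) b) :
    RightChain o s P (gE A) (fun i => (σ i : ℂ)) b e := by
  have h1 := hb.2.1; have h2 := h.1
  refine rightChain_of H hf hσ (by omega) hb.2.2.1 (fun i hi hi' => ?_) h.2.2.1 h.2.2.2.1 h.2.2.2.2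
  rcases lt_or_ge l i with h3 | h3
  · exact h.2.1 i h3 hi'.le
  · exact hb.2.2.2 i hi (by omega)

/-- A left chain with a single edge before its apex is a right chain, too. -/
lemma StepOne.rightChain (H : Cfg o s P (gE A)) (hf : IsFace A f) (hσ : IsBoundaryWalk A f σ)
    (h : StepOne (Near o s) A f σ (b - 1) b) :
    RightChain o s P (gE A) (fun i => (σ i : ℂ)) b (b + 1) := by
  refine rightChain_of H hf hσ (by omega) h.1.2.1 (fun i hi hi' => by omega)
    (H.near (gE_coe.2 (hσ b).1.symm)) h.2.2.1 ?_
  rw [turn_lt_pi (h.2.2.1.ne hf).symm]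
  exact (h.leftChain H hf hσ).pos

lemma Shortcut.stepOne (H : Cfg o s P (gE A)) (hf : IsFace A f) (hσ : IsBoundaryWalk A f σ)
    (h : StepOne (Near o s) A f σ k c)
    (S : Shortcut P (gE A) (fun i => (σ i : ℂ)) k (σ (c + 1))) :
    StepOne (Near o s) A f σ (k - 1) k ∧ ¬ ConvexAt σ (k - 1) := by
  obtain ⟨y, hy, C⟩ := S.cut
  refine ⟨C.stepOne H hf hσ (h.2.2.1.1 hy), (not_convexAt_iff H hσ _).2 ?_⟩
  rw [sub_add_cancel]
  have := S.refl
  rwa [show k - 2 = k - 1 - 1 by ring] at this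

/-- Step 1 does not apply to the reflex predecessor of a convex vertex at which a chain starts: the
chain before would have ended differently. -/
lemma Processed.not_stepOne (hk : Processed near A f σ m k) (h0 : k ≠ 0)
    (hr : ¬ ConvexAt σ (k - 1)) : ¬ StepOne near A f σ (k - 1) k := by
  intro h
  cases hk with
  | start => exact h0 rfl
  | next hk' hend hlt =>
    rcases hend with ⟨c, -, hc, ⟨b, -, he⟩ | ⟨-, rfl⟩⟩ | ⟨h2, rfl⟩
    · exact he.1.not_convexAt h.1.2.1
    · rw [add_sub_cancel_right] at hr
      exact hr hc.1.2.1
    · rw [add_sub_cancel_right] at h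
      exact h2 ⟨_, h⟩

lemma Processed.lt (hm : 0 < m) (hk : Processed near A f σ m k) : k < m := by
  cases hk with
  | start => exact hm
  | next _ _ h => exact h

/-- If the start vertex is a backward support vertex, then `v₁` is convex and `v₂` is reflex. -/
lemma start_of_backwardConvex (h : BackwardConvex σ p 1) : ConvexAt σ 1 ∧ ¬ ConvexAt σ 2 := by
  refine ⟨h.2.2.1, ?_⟩
  have := h.2.1
  rcases eq_or_ne p 2 with rfl | hp
  · exact h.1
  · exact h.2.2.2 2 (by omega) (by omega)

lemma all_convex (hm : 0 < m) (hp : Function.Periodic σ m) (h : ¬ ∃ p b, BackwardConvex σ p b)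
    (hc : ConvexAt σ c) (k : ℤ) : ConvexAt σ k := by
  by_contra hk
  have hlow : ∃ x, x < k ∧ ConvexAt σ x := by
    refine ⟨c + -(|c - k| + 1) * m, ?_, hc.shift (hp.int_mul _)⟩
    have h1 := le_abs_self (c - k)
    nlinarith [abs_nonneg (c - k)]
  obtain ⟨b, ⟨hb, hb'⟩, hmax⟩ := Int.exists_greatest_of_bdd (P := fun x => x < k ∧ ConvexAt σ x)
    ⟨k, fun z hz => hz.1.le⟩ hlow
  exact h ⟨k, b, hk, hb, hb', fun x h1 h2 h3 => absurd (hmax x ⟨h2, h3⟩) (by omega)⟩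

lemma StepOne.exists_end (hm : 0 < m) (hp : Function.Periodic σ m)
    (h : StepOne near A f σ k c) (hc : c < m) : ∃ e, StepOneEnd near A f σ m k e := by
  by_cases hx : ∃ b, CanExtend near A f σ (c + 1) b
  · obtain ⟨b, hb⟩ := hx
    have hbd : ∀ z, Extends near A f σ (c + 1) b z → z ≤ c + 2 * m := fun z hz => by
      by_contra hlt
      exact hz.2.1 (c + 2 * m) (by omega) (by omega) (h.1.2.1.shift (hp.int_mul 2))
    obtain ⟨e, he, hmax⟩ := Int.exists_greatest_of_bdd (P := fun x => Extends near A f σ (c + 1) b x)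
      ⟨_, hbd⟩ ⟨_, hb.2⟩
    exact ⟨e, c, hc, h, .inl ⟨b, hb, he, fun x hx => hmax x hx⟩⟩
  · exact ⟨c + 1, c, hc, h, .inr ⟨hx, rfl⟩⟩

/-- The chain of a vertex at which step 1 is executed, unless the walk is closed by it. -/
lemma StepOneEnd.covered (H : Cfg o s P (gE A)) (hf : IsFace A f) (hσ : IsBoundaryWalk A f σ)
    (hst : IsStart σ) (hk : Processed (Near o s) A f σ m k)
    (h : StepOneEnd (Near o s) A f σ m k e) : Covered P (fun i => (σ i : ℂ)) k e := by
  obtain ⟨c, hcm, h1, ⟨b, hb, he⟩ | ⟨-, rfl⟩⟩ := h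
  · have hre := (not_convexAt_iff H hσ e).1 he.1.not_convexAt
    refine extended_covered (h1.leftChain H hf hσ) (he.1.rightChain H hf hσ hb.1)
      (hb.cases h1.1.2.1) (fun _ => hre) (fun hbc S => ?_) fun _ => .inl hre
    obtain ⟨hS, hS'⟩ := S.stepOne H hf hσ h1
    refine hk.not_stepOne ?_ hS' hS
    -- at the start vertex, the backward convex vertex of the extension would be the reflex vertex
    -- `v₂`
    rintro rfl
    rcases hst with ⟨p, hp⟩ | hno
    · obtain ⟨h2, h3⟩ := start_of_backwardConvex hp
      have := h1.1.le (by omega) h2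
      have := h1.1.1
      obtain rfl : c = 1 := by omega
      rw [hbc] at hb
      exact h3 hb.1.2.2.1
    · exact hno ⟨_, _, hb.1⟩
  · exact (h1.leftChain H hf hσ).covered

/-- The chain that closes the walk. -/
lemma Closing.covered (H : Cfg o s P (gE A)) (hf : IsFace A f) (hσ : IsBoundaryWalk A f σ)
    (hst : IsStart σ) (hm : 0 < m) (hp : Function.Periodic σ m)
    (hk : Processed (Near o s) A f σ m k) (hj : ChainEnd (Near o s) A f σ m 0 j)
    (h : Closing (Near o s) A f σ m k) : Covered P (fun i => (σ i : ℂ)) k (m + j) := by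
  obtain ⟨c, hmc, h1⟩ := h
  have hk0 : k ≠ 0 := by
    rintro rfl
    rcases hj with ⟨c', hc', h2, -⟩ | ⟨h2, -⟩
    · have := h1.1.unique h2.1
      omega
    · exact h2 ⟨_, h1⟩
  have hkm := hk.lt hm
  have hL : ¬ Shortcut P (gE A) (fun i => (σ i : ℂ)) k (σ (c + 1)) := fun S => by
    obtain ⟨hS, hS'⟩ := S.stepOne H hf hσ h1
    exact hk.not_stepOne hk0 hS' hS
  have L := h1.leftChain H hf hσ
  rcases hst with ⟨p, hp1⟩ | hno
  · obtain ⟨h2, h3⟩ := start_of_backwardConvex hp1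
    have hm1 : ConvexAt σ (m + 1) := by rw [add_comm]; exact h2.shift hp
    have hm2 : ¬ ConvexAt σ (m + 2) := by rw [add_comm, convexAt_shift hp]; exact h3
    have hc := h1.1.le (by omega) hm1
    -- the chain of `v₀`, shifted by the period, ends in a right chain with apex `v_{m+1}`
    have key : StepTwo (Near o s) A f σ 0 ∧ j = 1 ∨ StepOne (Near o s) A f σ 0 1 ∧ j = 2 ∨
        RightChain o s P (gE A) (fun i => (σ i : ℂ)) (m + 1) (m + j) ∧ ¬ ConvexAt σ (m + j) := by
      rcases hj with ⟨c', hc', h4, h5⟩ | ⟨h4, h5⟩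
      · obtain rfl : c' = 1 := by
          have := h4.1.le (by omega) h2
          have := h4.1.1
          omega
        rcases h5 with ⟨b, hb, he⟩ | ⟨-, h5⟩
        · obtain rfl : b = 1 := by
            rcases hb.cases h2 with hb1 | hb1
            · exact hb1
            · rw [hb1] at hb
              exact absurd hb.1.2.2.1 h3
          have hE := he.1.shift hp
          have hB := hb.1.shift hp
          refine .inr (.inr ?_)
          rw [add_comm m, add_comm m]
          refine ⟨hE.rightChain H hf hσ ?_, hE.not_convexAt⟩
          rwa [show (1 : ℤ) + 1 + m + 1 = 1 + 1 + 1 + m by ring]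
        · exact .inr (.inl ⟨h4, h5⟩)
      · exact .inl ⟨h4, h5⟩
    rcases (show c = m ∨ c = m + 1 by omega) with rfl | rfl
    · rcases key with ⟨-, rfl⟩ | ⟨h4, rfl⟩ | ⟨R, hre⟩
      · exact L.covered
      · have h4' := h4.shift hp
        rw [zero_add, add_comm] at h4'
        have R := StepOne.rightChain H hf hσ (b := c + 1) (by rwa [add_sub_cancel_right])
        rw [add_assoc, one_add_one_eq_two] at R
        exact extended_covered L R (.inr rfl) (fun h => by omega) (fun _ => hL)
          fun _ => .inl ((not_convexAt_iff H hσ _).1 hm2)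
      · have hre := (not_convexAt_iff H hσ _).1 hre
        exact extended_covered L R (.inr rfl) (fun _ => hre) (fun _ => hL) fun _ => .inl hre
    · -- the apex can be cut off, hence step 1 is executed at `v₀`
      obtain ⟨t, ρ, F⟩ := L.exists_frame'
      obtain ⟨y, hy, C⟩ := F.cut (by omega)
      have hS := (C.stepOne H hf hσ (h1.2.2.1.1 hy)).shift hp.neg
      rw [show m + 1 - 1 + -m = 0 by ring, show m + 1 + -m = 1 by ring] at hS
      rcases key with ⟨h4, -⟩ | ⟨-, rfl⟩ | ⟨R, hre⟩
      · exact absurd ⟨_, hS⟩ h4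
      · have := L.covered
        rwa [add_assoc, one_add_one_eq_two] at this
      · have hre := (not_convexAt_iff H hσ _).1 hre
        exact extended_covered L R (.inl rfl) (fun _ => hre) (fun h => by omega) fun _ => .inl hre
  · have hall := all_convex hm hp hno h1.1.2.1
    obtain rfl : c = k + 1 := by
      have := h1.1.le (show k < k + 1 by omega) (hall _)
      have := h1.1.1
      omega
    obtain rfl : m = k + 1 := by omega
    rcases hj with ⟨c', hc', h4, ⟨b, hb, -⟩ | ⟨-, rfl⟩⟩ | ⟨-, rfl⟩
    · exact absurd ⟨_, _, hb.1⟩ hno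
    · obtain rfl : c' = 1 := by
        have := h4.1.le (show (0 : ℤ) < 1 by omega) (hall _)
        have := h4.1.1
        omega
      have h4' := h4.shift hp
      rw [zero_add, add_comm 1] at h4'
      have R := StepOne.rightChain H hf hσ (b := k + 1 + 1) (by rwa [add_sub_cancel_right])
      rw [add_assoc (k + 1)] at R
      refine extended_covered L R (.inr rfl) (fun h => by omega) (fun _ => hL) fun _ => .inr ?_
      have := (convexAt_iff H hσ _).1 (hall (k + 1 + (1 + 1) + 1))
      rwa [add_sub_cancel_right, add_assoc (k + 1 + (1 + 1)), one_add_one_eq_two] at this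
    · exact L.covered

end

/-! ### Edges touched by short segments -/

section
variable {P : Finset ℂ} {o : ℂ} {s : ℝ} {A : SimpleGraph P} {f : Set ℂ} {σ : ℤ → P}
  {k a b e m j : ℤ}

/-- Whenever a short segment between two input points touches the pair `e`, its first endpoint is
connected in `A` with both points of `e`. -/
def Good (A : SimpleGraph P) (s : ℝ) (e : Sym2 P) : Prop :=
  ∀ u v : P, dist (u : ℂ) v ≤ s / √2 → ∀ z ∈ segment ℝ (u : ℂ) v, z ∈ seg e →
    ∀ x ∈ e, Reach (gE A) (u : ℂ) (x : ℂ)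

lemma good_of_mem (H : Cfg o s P (gE A)) {e : Sym2 P} (he : e ∈ A.edgeSet) : Good A s e := by
  intro u v huv z hz hze x hx
  induction e with
  | _ c d =>
    have hE : gE A (c : ℂ) d := gE_coe.2 he
    have hc := reach_of_touch H u.2 huv c.2 d.2 (.inr hE) hze hz
    rcases Sym2.mem_iff.1 hx with rfl | rfl
    · exact hc
    · exact hc.tail hE

lemma reach_walk (H : Cfg o s P (gE A)) (hσ : IsBoundaryWalk A f σ) (i j : ℤ) :
    Reach (gE A) (σ i : ℂ) (σ j) := by
  have key : ∀ (n : ℕ) (i : ℤ), Reach (gE A) (σ i : ℂ) (σ (i + n)) := by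
    intro n
    induction n with
    | zero => intro i; simpa using Relation.ReflTransGen.refl
    | succ n ih =>
      intro i
      refine (ih i).tail ?_
      rw [Nat.cast_succ, ← add_assoc]
      exact gE_coe.2 (hσ _).1
  rcases le_total i j with h | h
  · have := key (j - i).toNat i
    rwa [Int.toNat_of_nonneg (by omega), add_sub_cancel] at this
  · have := key (i - j).toNat j
    rw [Int.toNat_of_nonneg (by omega), add_sub_cancel] at this
    exact H.reach_symm this

/-- A short segment that touches an added edge has to cross the chain on its way. -/
lemma IsChainTriangulation.good (H : Cfg o s P (gE A)) (hσ : IsBoundaryWalk A f σ)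
    (hc : Covered P (fun i => (σ i : ℂ)) a b) {D₀ D : Set (Sym2 P)}
    (hD : IsChainTriangulation σ a b D₀ D) (h0 : ∀ e ∈ D₀, Good A s e) : ∀ e ∈ D, Good A s e := by
  obtain ⟨O, F, hO, hstar, hbase, hedge, hmiss⟩ := hc
  have hcurve : chainCurve σ a b ⊆ F := by
    refine union_subset hbase (iUnion₂_subset fun i hi => hedge i hi.1 hi.2)
  -- otherwise the short segment meets no edge of the chain, hence misses the star-shaped set
  have main : ∀ p q, seg s(σ p, σ q) ⊆ F → Good A s s(σ p, σ q) := by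
    intro p q hF u v huv z hz hze x hx
    have hx' : ∃ i, x = σ i := by
      rcases Sym2.mem_iff.1 hx with rfl | rfl
      · exact ⟨p, rfl⟩
      · exact ⟨q, rfl⟩
    obtain ⟨i, rfl⟩ := hx'
    by_contra hn
    refine hmiss u u.2 v v.2 (fun l _ _ y hy hyl => hn ?_) z hz (hF hze)
    exact (reach_of_touch H u.2 huv (σ l).2 (σ (l + 1)).2 (.inr (gE_coe.2 (hσ l).1)) hyl hy).trans
      (reach_walk H hσ l i)
  have hvert : ∀ i, a ≤ i → i ≤ b → a < b → (σ i : ℂ) ∈ F := by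
    intro i h1 h2 h3
    rcases h2.lt_or_eq with h | rfl
    · exact hedge i h1 h (left_mem_segment _ _ _)
    · exact hbase (right_mem_segment _ _ _)
  intro e he
  by_cases hbe : e = s(σ a, σ b)
  · rw [hbe]; exact main a b hbase
  by_cases he0 : e ∈ D₀
  · exact h0 e he0
  obtain ⟨⟨p, q, h1, h2, h3, rfl⟩, hreg, -⟩ := hD.prop.2 e he (by simp [hbe, he0])
  refine main p q fun z hz => ?_
  by_cases hzp : z = σ p
  · rw [hzp]; exact hvert p h1 (by omega) (by omega)
  by_cases hzq : z = σ q
  · rw [hzq]; exact hvert q (by omega) h3 (by omega)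
  exact mem_of_bounded_component hO hstar hcurve (hreg (open_of_seg hz hzp hzq)).2

/-- All edges added by a run of Phase 1 are good. -/
lemma IsRun.good (H : Cfg o s P (gE A)) (hf : IsFace A f) (hσ : IsBoundaryWalk A f σ)
    {D : Set (Sym2 P)} (h : IsRun (Near o s) A f σ D) : ∀ e ∈ D, Good A s e := by
  obtain ⟨hst, m, j, T, hm, hj, hT, rfl⟩ := h
  obtain ⟨hm0, hper⟩ := hm.1
  have hper : Function.Periodic σ m := hper
  have hend : ∀ k, Processed (Near o s) A f σ m k → ∀ l, StepOneEnd (Near o s) A f σ m k l →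
      ∀ e ∈ T k, Good A s e := fun k hk l hl =>
    ((hT k hk).1 l hl).good H hσ (hl.covered H hf hσ hst hk) (by simp)
  have h0 : ∀ e ∈ T 0, Good A s e := by
    rcases hj with hj | ⟨hj, -⟩
    · exact hend 0 .start j hj
    · rw [(hT 0 .start).2.2 hj]; simp
  intro e he
  obtain ⟨k, hk, hek⟩ := mem_iUnion₂.1 he
  by_cases h2 : StepTwo (Near o s) A f σ k
  · rw [(hT k hk).2.2 h2] at hek
    exact absurd hek (by simp)
  obtain ⟨c, hc⟩ := not_not.1 h2
  rcases lt_or_ge c m with hcm | hcm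
  · obtain ⟨l, hl⟩ := hc.exists_end hm0 hper hcm
    exact hend k hk l hl e hek
  · have hcl : Closing (Near o s) A f σ m k := ⟨c, hcm, hc⟩
    exact ((hT k hk).2.1 hcl).good H hσ (hcl.covered H hf hσ hst hm0 hper hk hj) h0 e hek

lemma reachable_of_reach {u : P} {z : ℂ} (h : Reach (gE A) (u : ℂ) z) :
    ∃ hz : z ∈ P, A.Reachable u ⟨z, hz⟩ := by
  induction h with
  | refl => exact ⟨u.2, .refl _⟩
  | tail _ hbc ih =>
    obtain ⟨hb, hr⟩ := ih
    obtain ⟨_, hc, hadj⟩ := hbc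
    exact ⟨hc, hr.trans hadj.reachable⟩

end

end GridMWT

theorem mainTheorem6 (P : Finset ℂ) (hP : GridMWT.GeneralPosition P)
    (o : ℂ) (γ : ℝ) (hγ : 0 < γ) (i : ℤ)
    (A Ahat Tstar : SimpleGraph P)
    (hA : GridMWT.IsMaximalPSLG (GridMWT.adjGraph P o (GridMWT.side γ i)) A)
    (hAhat : GridMWT.IsPhaseOne (GridMWT.Near o (GridMWT.side γ i)) A Ahat)
    (hT : GridMWT.IsMWT Tstar) :
    (∀ f' : Set ℂ, GridMWT.IsNonTriangulatedFace Ahat f' →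
      ∀ u v : P, (GridMWT.shortEdges Tstar (GridMWT.side γ i / √2)).Adj u v →
      ∀ e₁ e₂ : Sym2 P, GridMWT.IsBoundaryEdge Ahat f' e₁ → GridMWT.IsBoundaryEdge Ahat f' e₂ →
      (segment ℝ (u : ℂ) (v : ℂ) ∩ GridMWT.seg e₁).Nonempty →
      (segment ℝ (u : ℂ) (v : ℂ) ∩ GridMWT.seg e₂).Nonempty →
      ∃ K : Ahat.ConnectedComponent, (∀ x ∈ e₁, x ∈ K.supp) ∧ (∀ x ∈ e₂, x ∈ K.supp)) ∧
    (∀ K L : Ahat.ConnectedComponent, K ≠ L →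
      ∀ u ∈ K.supp, ∀ v ∈ L.supp,
        ¬ (GridMWT.shortEdges Tstar (GridMWT.side γ i / √2)).Adj u v) := by
  have hs : 0 < GridMWT.side γ i := mul_pos hγ (zpow_pos (by norm_num) _)
  have H := GridMWT.cfg_of_maximal hP hs hA
  obtain ⟨W, D, hW, -, hadj⟩ := hAhat
  have hle : A ≤ Ahat := fun u v h => (hadj u v).2 (.inl h)
  have hgood : ∀ e ∈ Ahat.edgeSet, GridMWT.Good A (GridMWT.side γ i) e := by
    intro e he
    induction e with
    | _ c d =>
      rcases (hadj c d).1 he with h | ⟨-, σ, hσ, h⟩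
      · exact GridMWT.good_of_mem H h
      · obtain ⟨f, hf, hw, hrun⟩ := hW σ hσ
        exact hrun.good H hf.1 hw _ h
  have hcomp : ∀ u x : P, GridMWT.Reach (GridMWT.gE A) (u : ℂ) (x : ℂ) →
      x ∈ (Ahat.connectedComponentMk u).supp := fun u x h => by
    obtain ⟨_, hr⟩ := GridMWT.reachable_of_reach h
    exact SimpleGraph.ConnectedComponent.eq.2 (hr.mono hle).symm
  constructor
  · rintro f' - u v huv e₁ e₂ h₁ h₂ ⟨z₁, hz₁, hz₁'⟩ ⟨z₂, hz₂, hz₂'⟩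
    exact ⟨Ahat.connectedComponentMk u,
      fun x hx => hcomp u x (hgood e₁ h₁.1 u v huv.2 z₁ hz₁ hz₁' x hx),
      fun x hx => hcomp u x (hgood e₂ h₂.1 u v huv.2 z₂ hz₂ hz₂' x hx)⟩
  · intro K L hKL u hu v hv huv
    -- the point `v` is a degenerate edge touched by the segment
    have hr := GridMWT.reach_of_touch H u.2 huv.2 v.2 v.2 (.inl rfl)
      (left_mem_segment ℝ (v : ℂ) v) (right_mem_segment ℝ (u : ℂ) v)
    have h := hcomp u v hr
    rw [SimpleGraph.ConnectedComponent.mem_supp_iff] at hu hv h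
    exact hKL (by rw [← hu, ← hv, h])
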